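/- Let $\mathcal M$ be an $n$-dimensional smooth (Hausdorff, second countable) manifold with a smooth torsion-free connection $\nabla$, let $\Phi$ be a smooth real function on an open set $U\subseteq\mathcal M$, and let $p\in U$ be a nondegenerate critical point of $\Phi$. Write $\nabla^2 f(X,Y)=YXf-(\nabla_YX)f$. Call a pair of open neighborhoods $\Omega_0,\Omega_1\subseteq U$ of $p$ *admissible* if: $\overline{\Omega_0}$ is compact and contained in $\Omega_1$; $p$ is the only critical point of $\Phi$ in $\Omega_1$; any two points $p',q'\in\overline{\Omega_0}$ are joined by a unique geodesic $\gamma:[0,1]\to\Omega_1$ with $\gamma(0)=p'$, $\gamma(1)=q'$; this geodesic depends smoothly on $(p',q')\in\Omega_0\times\Omega_0$; the geodesics from $p$ to points of $\Omega_0$ stay in $\Omega_0$; and $\nabla^2_1\Phi$ is nondegenerate on $\overline{\Omega_0}$. Here, for $\sigma>0$ and $q\in\overline{\Omega_0}$, the weighted Hessian at $q$ is $$\nabla^2_\sigma\Phi(X,Y)=\sigma\int_0^1(1-s)^{\sigma-1}\,\nabla^2\Phi|_{\gamma(s)}(X|_{\gamma(s)},Y|_{\gamma(s)})\,ds,$$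 where $\gamma$ is the geodesic in $\Omega_1$ from $p$ to $q$ and $X,Y\in T_q\mathcal M$ are extended along $\gamma$ by parallel transport. On $\Omega_0$ define $$Z_\psi f=(\nabla_1^2\Phi)^{-1}(d\psi,df),\qquad \square_0f=\mathrm{tr}\big((\nabla_1^2\Phi)^{-1}\,\nabla_2^2\Phi\,(\nabla_1^2\Phi)^{-1}\,\nabla^2f\big),$$ $$\eta(q)=\int_0^1\big[n-\square_0\Phi(\gamma(s))\big]\frac{ds}{s},\qquad \square f=\square_0f+Z_\eta f .$$ (1) For every admissible pair, the integral defining $\eta$ converges on $\Omega_0$, $\eta$ is smooth on $\Omega_0$, $\square$ maps smooth complex functions on $\Omega_0$ to smooth functions on $\Omega_0$, and on $\Omega_0$, for all $t>0$, $$\Big(\frac{\partial}{\partial t}-\frac i2\square\Big)\Big[t^{-n/2}e^{it^{-1}(\Phi-\Phi(p))}\Big]=0 .$$ (2) $\square$ varies smoothly under small perturbations of $\Phi$ and $\nabla$. Let $(\nabla^\tau,\Phi^\tau)$, $\tau\in\mathbb R^m$, be any family of torsion-free connections on $\mathcal M$ and real functions on $U$, jointly smooth in $\tau$ and the point, equal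 to $(\nabla,\Phi)$ at $\tau=0$. Let $(\Omega_0,\Omega_1)$ be admissible for $(\nabla,\Phi)$ and such that, for all small $\tau$, any two points of $\overline{\Omega_0}$ are still joined by a unique $\nabla^\tau$-geodesic in $\Omega_1$. Then for every open $\Omega$ with $\overline\Omega\subseteq\Omega_0$ there is an open neighborhood $N$ of $0$ in $\mathbb R^m$ such that, for each $\tau\in N$: $\Phi^\tau$ has exactly one critical point $p_\tau$ in $\Omega_0$, it is nondegenerate, and it depends smoothly on $\tau$ with $p_0=p$; the $\nabla^\tau$-geodesics in $\Omega_1$ from $p_\tau$ to the points of $\Omega$ lie in $\Omega_0$, and the perturbed form $\nabla_1^2\Phi$ is nondegenerate along them; the integral defining the perturbed function $\eta^\tau$ converges on $\Omega$; and the operator $\square^\tau$ built by the same formulas from $\nabla^\tau,\Phi^\tau,p_\tau$ (with the same $\Omega_1$) satisfies the Schrödinger identity, with $\Phi^\tau$ and $p_\tau$ in place of $\Phi$ and $p$, on $\Omega$ for all $t>0$. Moreover $\eta^\tau(x)$ is jointly smooth in $(\tau,x)\in N\times\Omega$, and so is $(\square^\tau f_\tau)(x)$ for every complex function $f_\tau(x)$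 jointly smooth on $N\times\Omega$. (3) Every neighborhood of $p$ contains $\Omega_1$ for some admissible pair $(\Omega_0,\Omega_1)$ with the following property: for every family as in (2), for all small $\tau$, any two points of $\overline{\Omega_0}$ are joined by a unique $\nabla^\tau$-geodesic in $\Omega_1$, and $\Phi^\tau$ has exactly one critical point in $\Omega_1$, which lies in $\Omega_0$. -/

import Mathlib

open Set Filter
open scoped Manifold ContDiff Topology

noncomputable section

namespace OscGeom

variable {n : ℕ} {M : Type*} [TopologicalSpace M] [ChartedSpace (EuclideanSpace ℝ (Fin n)) M]

/-- Affine connections on `M`: for a vector field `Y` and `v ∈ T_x M`, `cov Y x v` is `∇_v Y`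
at `x`. -/
abbrev Conn (n : ℕ) (M : Type*) [TopologicalSpace M]
    [ChartedSpace (EuclideanSpace ℝ (Fin n)) M] [IsManifold (𝓡 n) ∞ M] :=
  CovariantDerivative (𝓡 n) (EuclideanSpace ℝ (Fin n)) (TangentSpace (𝓡 n) : M → Type _)

/-- The `i`-th vector of a basis of `T_x M` (all traces and inverses below are independent of the
choice of the basis). -/
def basisVec (x : M) (i : Fin n) : TangentSpace (𝓡 n) x :=
  (EuclideanSpace.single i (1 : ℝ) : EuclideanSpace ℝ (Fin n))

/-- `x` is a critical point of the real function `Φ`: `dΦ` vanishes at `x`. -/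
def IsCrit (n : ℕ) {M : Type*} [TopologicalSpace M]
    [ChartedSpace (EuclideanSpace ℝ (Fin n)) M] (Φ : M → ℝ) (x : M) : Prop := mvfderiv (𝓡 n) Φ x = 0

/-- The velocity at time `t` of a curve `γ` defined on `[0,1]` (one-sided at the end points). -/
def velocity (γ : ℝ → M) (t : ℝ) : TangentSpace (𝓡 n) (γ t) :=
  mfderivWithin 𝓘(ℝ, ℝ) (𝓡 n) γ (Icc 0 1) t (1 : ℝ)

variable [IsManifold (𝓡 n) ∞ M]

/-- The covariant derivative `∇_{γ'} V` at time `t` of a vector field `V` along a curve `γ` defined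
on `[0,1]`. In the local frame `(e_k)` around `γ t` given by the trivialization of the tangent
bundle, if `V = ∑ V^k e_k` then this is `∑ (V^k)'(t) e_k + ∑ V^k(t) ∇_{γ'(t)} e_k`; here
`FiberBundle.extend` is the extension with constant coefficients in that frame. -/
def covDerivAlong (cov : Conn n M) (γ : ℝ → M) (V : ∀ t, TangentSpace (𝓡 n) (γ t)) (t : ℝ) :
    TangentSpace (𝓡 n) (γ t) :=
  (trivializationAt (EuclideanSpace ℝ (Fin n)) (TangentSpace (𝓡 n) : M → Type _) (γ t)).symm (γ t)
    (derivWithin (fun s : ℝ =>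
      (trivializationAt (EuclideanSpace ℝ (Fin n)) (TangentSpace (𝓡 n) : M → Type _) (γ t)
        ⟨γ s, V s⟩).2) (Icc 0 1) t) +
  cov (FiberBundle.extend (EuclideanSpace ℝ (Fin n)) (V t)) (γ t) (velocity γ t)

/-- `γ : [0,1] → Ω₁` is a geodesic from `p` to `q`: it is smooth and `∇_{γ'} γ' = 0`. -/
structure IsGeodesicIn (cov : Conn n M) (Ω₁ : Set M) (p q : M) (γ : ℝ → M) : Prop where
  smooth : ContMDiffOn 𝓘(ℝ, ℝ) (𝓡 n) ∞ γ (Icc 0 1)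
  geodesic : ∀ t ∈ Icc (0 : ℝ) 1, covDerivAlong cov γ (velocity γ) t = 0
  mapsTo : MapsTo γ (Icc 0 1) Ω₁
  source : γ 0 = p
  target : γ 1 = q

/-- Any two points of the closure of `Ω₀` are joined by one and only one geodesic
`[0,1] → Ω₁`. -/
def GeodesicallyConnected (cov : Conn n M) (Ω₀ Ω₁ : Set M) : Prop :=
  ∀ p ∈ closure Ω₀, ∀ q ∈ closure Ω₀,
    (∃ γ, IsGeodesicIn cov Ω₁ p q γ) ∧
    ∀ γ₁ γ₂, IsGeodesicIn cov Ω₁ p q γ₁ → IsGeodesicIn cov Ω₁ p q γ₂ → EqOn γ₁ γ₂ (Icc 0 1)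

open Classical in
/-- The geodesic `[0,1] → Ω₁` from `p` to `q` (a constant curve if there is none). -/
def geod (cov : Conn n M) (Ω₁ : Set M) (p q : M) : ℝ → M :=
  if h : ∃ γ, IsGeodesicIn cov Ω₁ p q γ then h.choose else fun _ => q

/-- `V` is a smooth parallel vector field along the curve `γ` on `[0,1]`. -/
structure IsParallel (cov : Conn n M) (γ : ℝ → M) (V : ∀ t, TangentSpace (𝓡 n) (γ t)) :
    Prop where
  smooth : ContMDiffOn 𝓘(ℝ, ℝ) (𝓡 n).tangent ∞
    (fun t => (⟨γ t, V t⟩ : TangentBundle (𝓡 n) M)) (Icc 0 1)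
  parallel : ∀ t ∈ Icc (0 : ℝ) 1, covDerivAlong cov γ V t = 0

open Classical in
/-- Reverse parallel transport of `v ∈ T_q M` along a curve `γ` with `γ 1 = q`: the parallel
field `V` along `γ` with `V 1 = v` (zero if there is none). -/
def transport (cov : Conn n M) (γ : ℝ → M) (q : M) (v : TangentSpace (𝓡 n) q) :
    ∀ t, TangentSpace (𝓡 n) (γ t) :=
  if h : ∃ V : ∀ t, TangentSpace (𝓡 n) (γ t), IsParallel cov γ V ∧
      (⟨γ 1, V 1⟩ : TangentBundle (𝓡 n) M) = ⟨q, v⟩ then h.choose else fun _ => 0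

section Hessian

variable {F : Type*} [NormedAddCommGroup F] [NormedSpace ℝ F]

/-- The Hessian `∇²f(X, Y) = Y X f - (∇_Y X) f` at `x`, where `v = X(x)`, `w = Y(x)`; the value does
not depend on the extension `X` of `v`. -/
def hess (cov : Conn n M) (f : M → F) (x : M) (v w : TangentSpace (𝓡 n) x) : F :=
  mvfderiv (𝓡 n) (fun y => mvfderiv (𝓡 n) f y
    (FiberBundle.extend (EuclideanSpace ℝ (Fin n)) v y)) x w -
  mvfderiv (𝓡 n) f x (cov (FiberBundle.extend (EuclideanSpace ℝ (Fin n)) v) x w)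

end Hessian

/-- The matrix of the quadratic form `∇²Φ` at `x`. -/
def hessMatrix (cov : Conn n M) (Φ : M → ℝ) (x : M) : Matrix (Fin n) (Fin n) ℝ :=
  Matrix.of fun i j => hess cov Φ x (basisVec x i) (basisVec x j)

/-- The weighted Hessian `∇²_σ Φ(v, w) = σ ∫₀¹ (1-s)^(σ-1) ∇²Φ|_{γ(s)} (V(s), W(s)) ds` at `q`,
with `γ` the geodesic in `Ω₁` from `p` to `q` and `V`, `W` the parallel fields along `γ` that end in
`v`, `w`. -/
def weightedHess (cov : Conn n M) (Ω₁ : Set M) (Φ : M → ℝ) (p : M) (σ : ℝ) (q : M)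
    (v w : TangentSpace (𝓡 n) q) : ℝ :=
  σ * ∫ s in (0 : ℝ)..1, (1 - s) ^ (σ - 1) *
    hess cov Φ (geod cov Ω₁ p q s)
      (transport cov (geod cov Ω₁ p q) q v s) (transport cov (geod cov Ω₁ p q) q w s)

/-- The matrix of the quadratic form `∇²_σ Φ` at `q`. -/
def weightedMatrix (cov : Conn n M) (Ω₁ : Set M) (Φ : M → ℝ) (p : M) (σ : ℝ) (q : M) :
    Matrix (Fin n) (Fin n) ℝ :=
  Matrix.of fun i j => weightedHess cov Ω₁ Φ p σ q (basisVec q i) (basisVec q j)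

/-- The matrix of `(∇²_1 Φ)⁻¹ ∇²_2 Φ (∇²_1 Φ)⁻¹` at `q`. -/
def symbolMatrix (cov : Conn n M) (Ω₁ : Set M) (Φ : M → ℝ) (p q : M) :
    Matrix (Fin n) (Fin n) ℝ :=
  (weightedMatrix cov Ω₁ Φ p 1 q)⁻¹ * weightedMatrix cov Ω₁ Φ p 2 q *
    (weightedMatrix cov Ω₁ Φ p 1 q)⁻¹

section Operators

variable {F : Type*} [NormedAddCommGroup F] [NormedSpace ℝ F]

/-- `□₀ f = tr((∇²_1 Φ)⁻¹ ∇²_2 Φ (∇²_1 Φ)⁻¹ ∇²f)`, for real, complex or vector valued `f`. -/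
def box₀ (cov : Conn n M) (Ω₁ : Set M) (Φ : M → ℝ) (p : M) (f : M → F) (q : M) : F :=
  ∑ i, ∑ j, symbolMatrix cov Ω₁ Φ p q i j • hess cov f q (basisVec q j) (basisVec q i)

/-- `Z_ψ f = (∇²_1 Φ)⁻¹(dψ, df)`. -/
def zField (cov : Conn n M) (Ω₁ : Set M) (Φ : M → ℝ) (p : M) (ψ : M → ℝ) (f : M → F) (q : M) : F :=
  ∑ i, ∑ j, ((weightedMatrix cov Ω₁ Φ p 1 q)⁻¹ i j * mvfderiv (𝓡 n) ψ q (basisVec q i)) •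
    mvfderiv (𝓡 n) f q (basisVec q j)

/-- The integrand `(n - □₀Φ(γ(s))) / s` in the definition of `η(q)`. -/
def etaIntegrand (cov : Conn n M) (Ω₁ : Set M) (Φ : M → ℝ) (p q : M) (s : ℝ) : ℝ :=
  ((n : ℝ) - box₀ cov Ω₁ Φ p Φ (geod cov Ω₁ p q s)) / s

/-- `η(q) = ∫₀¹ (n - □₀Φ(γ(s))) ds/s`. -/
def eta (cov : Conn n M) (Ω₁ : Set M) (Φ : M → ℝ) (p q : M) : ℝ :=
  ∫ s in (0 : ℝ)..1, etaIntegrand cov Ω₁ Φ p q s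

/-- `□ f = □₀ f + Z_η f`. -/
def box (cov : Conn n M) (Ω₁ : Set M) (Φ : M → ℝ) (p : M) (f : M → F) (q : M) : F :=
  box₀ cov Ω₁ Φ p f q + zField cov Ω₁ Φ p (eta cov Ω₁ Φ p) f q

end Operators

/-- For real functions, `□₀ f` is literally the trace of a product of matrices. -/
theorem box₀_eq_trace (cov : Conn n M) (Ω₁ : Set M) (Φ : M → ℝ) (p : M) (f : M → ℝ) (q : M) :
    box₀ cov Ω₁ Φ p f q = Matrix.trace ((weightedMatrix cov Ω₁ Φ p 1 q)⁻¹ *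
      weightedMatrix cov Ω₁ Φ p 2 q * (weightedMatrix cov Ω₁ Φ p 1 q)⁻¹ * hessMatrix cov f q) := by
  simp [box₀, symbolMatrix, Matrix.trace, Matrix.mul_apply, hessMatrix]

/-- The function `t^(-n/2) exp(i t⁻¹ (Φ - Φ(p)))`. -/
def oscKernel (n : ℕ) (Φ : M → ℝ) (p : M) (t : ℝ) (x : M) : ℂ :=
  ((t ^ (-(n : ℝ) / 2) : ℝ) : ℂ) * Complex.exp (Complex.I * (((Φ x - Φ p) / t : ℝ) : ℂ))

/-- `(∂/∂t - (i/2) □) [t^(-n/2) exp(i t⁻¹ (Φ - Φ(p)))] = 0` on `Ω` for all `t > 0`, including that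
the `t`-derivative exists. -/
def SchrodingerOn (n : ℕ) (L : (M → ℂ) → M → ℂ) (Φ : M → ℝ) (p : M) (Ω : Set M) : Prop :=
  ∀ x ∈ Ω, ∀ t : ℝ, 0 < t →
    HasDerivAt (fun s => oscKernel n Φ p s x) (Complex.I / 2 * L (oscKernel n Φ p t) x) t

/-- The neighbourhoods `Ω₀`, `Ω₁` of the critical point `p` of `Φ : U → ℝ` on which the operator is
built. -/
structure IsAdmissible (cov : Conn n M) (U : Set M) (Φ : M → ℝ) (p : M) (Ω₀ Ω₁ : Set M) :
    Prop where
  isOpen₀ : IsOpen Ω₀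
  isOpen₁ : IsOpen Ω₁
  mem : p ∈ Ω₀
  isCompact_closure : IsCompact (closure Ω₀)
  closure_subset : closure Ω₀ ⊆ Ω₁
  subset : Ω₁ ⊆ U
  /-- `p` is the only critical point of `Φ` in `Ω₁`. -/
  crit : ∀ x ∈ Ω₁, IsCrit n Φ x ↔ x = p
  connected : GeodesicallyConnected cov Ω₀ Ω₁
  /-- The geodesics depend smoothly on their end points. -/
  smooth : ContMDiffOn (((𝓡 n).prod (𝓡 n)).prod 𝓘(ℝ, ℝ)) (𝓡 n) ∞
    (fun z : (M × M) × ℝ => geod cov Ω₁ z.1.1 z.1.2 z.2) ((Ω₀ ×ˢ Ω₀) ×ˢ Icc 0 1)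
  /-- The geodesics from `p` to the points of `Ω₀` do not leave `Ω₀`. -/
  star : ∀ q ∈ Ω₀, ∀ s ∈ Icc (0 : ℝ) 1, geod cov Ω₁ p q s ∈ Ω₀
  /-- `∇²_1 Φ` is nondegenerate on the closure of `Ω₀`. -/
  nondegenerate : ∀ q ∈ closure Ω₀, (weightedMatrix cov Ω₁ Φ p 1 q).det ≠ 0

/-- A smooth perturbation of `(∇, Φ)` with `m` real parameters: torsion-free connections `covF τ`
and phases `ΦF τ` on `U`, jointly smooth in the parameter `τ` and the point, with value `(∇, Φ)` at
`τ = 0`. -/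
structure IsPerturbation (cov : Conn n M) (U : Set M) (Φ : M → ℝ) {m : ℕ}
    (covF : EuclideanSpace ℝ (Fin m) → Conn n M)
    (ΦF : EuclideanSpace ℝ (Fin m) → M → ℝ) : Prop where
  cov_zero : covF 0 = cov
  phase_zero : ΦF 0 = Φ
  torsion_free : ∀ τ, (covF τ).torsion = 0
  cov_smooth : ∀ Y : (x : M) → TangentSpace (𝓡 n) x,
    ContMDiff (𝓡 n) (𝓡 n).tangent ∞ (fun x => (⟨x, Y x⟩ : TangentBundle (𝓡 n) M)) →
    ContMDiff ((𝓡 m).prod (𝓡 n))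
      ((𝓡 n).prod 𝓘(ℝ, EuclideanSpace ℝ (Fin n) →L[ℝ] EuclideanSpace ℝ (Fin n))) ∞
      (fun z : EuclideanSpace ℝ (Fin m) × M =>
        (⟨z.2, covF z.1 Y z.2⟩ : Bundle.TotalSpace
          (EuclideanSpace ℝ (Fin n) →L[ℝ] EuclideanSpace ℝ (Fin n))
          (fun x : M => TangentSpace (𝓡 n) x →L[ℝ] TangentSpace (𝓡 n) x)))
  phase_smooth : ContMDiffOn ((𝓡 m).prod (𝓡 n)) 𝓘(ℝ, ℝ) ∞
    (fun z : EuclideanSpace ℝ (Fin m) × M => ΦF z.1 z.2) (univ ×ˢ U)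

end OscGeom

end

/-! The identity rests on two integrations along the geodesic `γ` from `p` to `q`. Let `u = γ'(1)`.
If `V` is parallel along `γ`, then `d/ds dΦ(V) = ∇²Φ(V, γ')`. Since `dΦ` vanishes at `p` and the
velocity of a geodesic is parallel, this gives `dΦ_q = ∇²₁Φ(·, u)`
(`RegPt.mvfderiv_eq_weightedHess`), and Taylor's formula gives `2(Φ(q) - Φ(p)) = ∇²₂Φ(u, u)`
(`RegPt.sub_eq_weightedHess`). So `(∇²₁Φ)⁻¹` turns `dΦ` into `u`, and for a function `g` of one
variable the Hessian `g' ∇²Φ + g'' dΦ ⊗ dΦ` of `g ∘ Φ` yields `□₀(g ∘ Φ) = g' □₀Φ + 2(Φ - Φ(p)) g''`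
(`RegPt.box₀_eq`), while `Z_η(g ∘ Φ) = g' dη(u)` (`RegPt.zField_eq`). The function `η` is built so
that `dη(u) = n - □₀Φ(q)`. The terms with `□₀Φ` cancel, and `□(g ∘ Φ) = n g' + 2(Φ - Φ(p)) g''`. For
the Gaussian kernel this is the time derivative up to the factor `i/2`
(`RegPt.hasDerivAt_oscKernel`).

At `p` all weighted Hessians equal `∇²Φ`, so `□₀Φ(p) = n`. The numerator `n - □₀Φ(γ(s))` is
therefore `s` times a smooth function of the parameters and `s`; this gives the convergence and the
smoothness of `η`. Its derivative along `γ` is read off from `η(γ(r)) = ∫₀^r (n - □₀Φ(γ(s))) ds/s`,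
because the geodesic from `p` to `γ(r)` is a reparametrized piece of `γ` (`NiceAt.eta_spec`).

The rest is smooth dependence. Geodesics with a transported vector solve an ODE on states (point,
velocity, vector). Its flow is smooth in data and parameters by the implicit function theorem in a
space of continuous curves (`exists_local_flow`), and it extends along a whole geodesic
(`exists_flow_along`). Data are prescribed at time 1, since the vectors in the weighted Hessian are
given at `q`. To pass from final velocities to end points, the map from final velocity to starting
point needs an invertible derivative. Admissibility supplies this: the smooth dependence of
geodesics on end points gives a differentiable right inverse
(`IsGeoFlow.isInvertible_of_differentiableAt`). Hence the geodesics of nearby connections also form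
smooth families (`exists_geoFamily_of_smooth`). Uniqueness in `Ω₁` identifies them with the curves
chosen by `geod`.

For perturbations, critical points are continued by the implicit function theorem, with compactness
excluding new ones (`exists_crit_family`). "The geodesic from `p_τ` to `q` runs through points of
`Ω₀` where `∇²₁Φ` is nondegenerate and everything is smooth" is an open condition on `(τ, q)`
(`NiceAt.eventually`). It holds at `τ = 0` on the compact set `closure Ω`, hence for all small `τ`.

Admissible pairs are coordinate balls. In a ball of small radius `R` a geodesic has velocity at most
`8R`, and a contraction estimate makes it determined by its end points (`IsCoordGeodesic.eqOn`).
Existence comes from the implicit function theorem at the constant geodesic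
(`IsGeoFlow.isInvertible_const`). The distance from the centre is monotone along geodesics that
start there (`IsCoordGeodesic.norm_sub_le`). The estimates are strict on a compact ball, so they
survive perturbation. -/

noncomputable section

namespace OscGeom

section Analysis

universe u

/-! ### Smoothness of composition operators on continuous maps. -/

section Nemytskii

variable {K : Type*} [TopologicalSpace K]

/-- The operator `X ↦ f ∘ X` on continuous maps. -/
def postcomp (K : Type*) [TopologicalSpace K] {G F : Type*} [TopologicalSpace G]
    [TopologicalSpace F] (f : G → F) (hf : Continuous f) (X : C(K, G)) : C(K, F) :=
  (⟨f, hf⟩ : C(G, F)).comp X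

@[simp] theorem postcomp_apply {G F : Type*} [TopologicalSpace G]
    [TopologicalSpace F] (f : G → F) (hf : Continuous f) (X : C(K, G)) (t : K) :
    postcomp K f hf X t = f (X t) := rfl

theorem continuous_postcomp {G F : Type*} [TopologicalSpace G]
    [TopologicalSpace F] (f : G → F) (hf : Continuous f) : Continuous (postcomp K f hf) :=
  ContinuousMap.continuous_postcomp _

variable [CompactSpace K]

/-- Pointwise application of continuous families of linear maps. -/
def pointwiseApply (K : Type*) [TopologicalSpace K] [CompactSpace K] (G F : Type*)
    [NormedAddCommGroup G] [NormedSpace ℝ G]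
    [NormedAddCommGroup F] [NormedSpace ℝ F] : C(K, G →L[ℝ] F) →L[ℝ] C(K, G) →L[ℝ] C(K, F) :=
  LinearMap.mkContinuous₂
    (LinearMap.mk₂ ℝ (fun (A : C(K, G →L[ℝ] F)) (X : C(K, G)) =>
      (⟨fun t => A t (X t), A.continuous.clm_apply X.continuous⟩ : C(K, F)))
      (fun _ _ _ => by ext; simp) (fun _ _ _ => by ext; simp)
      (fun _ _ _ => by ext; simp) (fun _ _ _ => by ext; simp)) 1
    (fun A X => by
      rw [one_mul, ContinuousMap.norm_le _ (by positivity)]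
      intro t
      exact ((A t).le_opNorm _).trans (by
        gcongr
        exacts [A.norm_coe_le_norm t, X.norm_coe_le_norm t]))

@[simp] theorem pointwiseApply_apply {G F : Type*}
    [NormedAddCommGroup G] [NormedSpace ℝ G]
    [NormedAddCommGroup F] [NormedSpace ℝ F] (A : C(K, G →L[ℝ] F)) (X : C(K, G)) (t : K) :
    pointwiseApply K G F A X t = A t (X t) := rfl

/-- The mean value inequality on the segment from `X t` to `X t + H t` gives the remainder, provided
the derivative of `f` oscillates little on balls around `X t`, uniformly in `t`. The uniformity is
the continuity at `X` of composition with the derivative, in the supremum norm. -/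
theorem hasFDerivAt_postcomp {G F : Type*} [NormedAddCommGroup G] [NormedSpace ℝ G]
    [NormedAddCommGroup F] [NormedSpace ℝ F] {f : G → F} (hf : ContDiff ℝ 1 f) (X : C(K, G)) :
    HasFDerivAt (postcomp K f hf.continuous)
      (pointwiseApply K G F (postcomp K (fderiv ℝ f) (hf.continuous_fderiv one_ne_zero) X)) X := by
  rw [hasFDerivAt_iff_isLittleO_nhds_zero, Asymptotics.isLittleO_iff]
  intro c hc
  have hcont := continuous_postcomp (K := K) (fderiv ℝ f) (hf.continuous_fderiv one_ne_zero)
  obtain ⟨δ, hδ, hball⟩ := (Metric.continuousAt_iff (α := C(K, G)) (β := C(K, G →L[ℝ] F))).1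
    (hcont.continuousAt (x := X)) c hc
  -- the derivative at all points of the ball of radius `δ` around `X t`
  have key : ∀ t : K, ∀ y ∈ Metric.ball (X t) δ, ‖fderiv ℝ f y - fderiv ℝ f (X t)‖ ≤ c := by
    intro t y hy
    -- Shifting `X` by a constant produces a map close to `X` whose value at `t` is any prescribed
    -- point near `X t`.
    have h1 : dist (X + ContinuousMap.const K (y - X t)) X < δ := by
      rw [dist_eq_norm, add_sub_cancel_left]
      refine lt_of_le_of_lt (b := ‖y - X t‖) ?_ (by rwa [← dist_eq_norm])
      exact (ContinuousMap.norm_le _ (norm_nonneg _)).2 fun _ => le_rfl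
    have h2 := hball h1
    have h3 := ContinuousMap.dist_apply_le_dist
      (f := postcomp K (fderiv ℝ f) (hf.continuous_fderiv one_ne_zero)
        (X + ContinuousMap.const K (y - X t)))
      (g := postcomp K (fderiv ℝ f) (hf.continuous_fderiv one_ne_zero) X) t
    simp only [postcomp_apply, ContinuousMap.add_apply, ContinuousMap.const_apply,
      add_sub_cancel] at h3
    rw [← dist_eq_norm]
    exact (h3.trans_lt h2).le
  filter_upwards [Metric.ball_mem_nhds (0 : C(K, G)) hδ] with H hH
  rw [ContinuousMap.norm_le _ (by positivity)]
  intro t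
  have hHt : ‖H t‖ ≤ ‖H‖ := H.norm_coe_le_norm t
  have hH' : ‖H‖ < δ := by simpa using hH
  have := (convex_ball (X t) δ).norm_image_sub_le_of_norm_hasFDerivWithin_le'
    (f := f) (f' := fderiv ℝ f) (φ := fderiv ℝ f (X t)) (C := c)
    (fun y _ => ((hf.differentiable one_ne_zero) y).hasFDerivAt.hasFDerivWithinAt)
    (fun y hy => key t y hy) (Metric.mem_ball_self hδ)
    (show X t + H t ∈ Metric.ball (X t) δ by simpa using hHt.trans_lt hH')
  simp only [add_sub_cancel_left] at this
  simpa using this.trans (mul_le_mul_of_nonneg_left hHt hc.le)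

/-- Induction on `m`: the derivative is composition with `fderiv ℝ f` followed by a continuous
linear map. Both spaces lie in one universe because the induction replaces `F` by `G →L[ℝ] F`. -/
theorem contDiff_postcomp_nat {G : Type u} [NormedAddCommGroup G] [NormedSpace ℝ G] (m : ℕ) :
    ∀ {F : Type u} [NormedAddCommGroup F] [NormedSpace ℝ F] {f : G → F} (hf : ContDiff ℝ m f),
      ContDiff ℝ m (postcomp K f hf.continuous) := by
  induction m with
  | zero =>
    intro F _ _ f hf
    exact contDiff_zero.2 (continuous_postcomp f hf.continuous)
  | succ m ih =>
    intro F _ _ f hf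
    have hf1 : ContDiff ℝ 1 f := hf.of_le (by simp)
    have hf' : ContDiff ℝ m (fderiv ℝ f) := hf.fderiv_right (by simp)
    have h := ih hf'
    refine (contDiff_succ_iff_hasFDerivAt (n := m)).2 ⟨fun X => pointwiseApply K G F
      (postcomp K (fderiv ℝ f) hf'.continuous X), ?_, fun X => hasFDerivAt_postcomp hf1 X⟩
    · exact (pointwiseApply K G F).contDiff.comp h

end Nemytskii

/-! ### Integrals with parameters and division by the time variable. -/

section ParametricIntegral

/-- Multiplication by a cutoff function. It makes `contDiff_postcomp_nat`, which needs a globally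
defined function, available for local ones. -/
theorem exists_contDiff_eq_near_compact {G F : Type*} [NormedAddCommGroup G] [NormedSpace ℝ G]
    [FiniteDimensional ℝ G] [NormedAddCommGroup F] [NormedSpace ℝ F] {m : ℕ∞} {f : G → F}
    {D K : Set G} (hD : IsOpen D) (hf : ContDiffOn ℝ m f D) (hK : IsCompact K) (hKD : K ⊆ D) :
    ∃ g : G → F, ContDiff ℝ m g ∧ ∀ᶠ y in 𝓝ˢ K, g y = f y := by
  obtain ⟨t, ht, hKt, htD⟩ := exists_compact_between hK hD hKD
  obtain ⟨ρ, h1, h0, -⟩ := exists_contMDiffMap_one_nhds_of_subset_interior (n := m)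
    (modelWithCornersSelf ℝ G) hK.isClosed hKt
  refine ⟨fun y => ρ y • f y, ?_, ?_⟩
  · rw [contDiff_iff_contDiffAt]
    intro y
    by_cases hy : y ∈ t
    · exact (ρ.contMDiff.contDiff.contDiffAt).smul (hf.contDiffAt (hD.mem_nhds (htD hy)))
    · refine (contDiffAt_const (c := (0 : F))).congr_of_eventuallyEq ?_
      filter_upwards [ht.isClosed.isOpen_compl.mem_nhds hy] with z hz
      simp [h0 z hz]
  · filter_upwards [h1] with y hy
    simp [hy]

/-- Integration as a continuous linear map on `C([0,1], F)`. -/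
def integralCLM (F : Type*) [NormedAddCommGroup F] [NormedSpace ℝ F] [CompleteSpace F] :
    C(Icc (0 : ℝ) 1, F) →L[ℝ] F :=
  LinearMap.mkContinuous
    { toFun := fun X => ∫ s in (0 : ℝ)..1, X (projIcc 0 1 zero_le_one s)
      map_add' := fun X Y => by
        simp only [ContinuousMap.add_apply]
        exact intervalIntegral.integral_add
          ((X.continuous.comp continuous_projIcc).intervalIntegrable _ _)
          ((Y.continuous.comp continuous_projIcc).intervalIntegrable _ _)
      map_smul' := fun c X => by simp } 1
    (fun X => by
      have := intervalIntegral.norm_integral_le_of_norm_le_const (a := (0 : ℝ)) (b := 1)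
        (f := fun s => X (projIcc 0 1 zero_le_one s)) (C := ‖X‖)
        (fun s _ => X.norm_coe_le_norm _)
      simpa using this)

/-- The map `z ↦ (s ↦ (z, s))`. -/
theorem contDiff_curryPair {Z : Type*} [NormedAddCommGroup Z] [NormedSpace ℝ Z] {m : ℕ∞ω} :
    ContDiff ℝ m (fun z : Z => (⟨fun s => (z, (s : ℝ)), by fun_prop⟩ : C(Icc (0 : ℝ) 1, Z × ℝ))) := by
  let L : Z →L[ℝ] C(Icc (0 : ℝ) 1, Z × ℝ) := LinearMap.mkContinuous
    { toFun := fun z => (⟨fun _ => (z, 0), by fun_prop⟩ : C(Icc (0 : ℝ) 1, Z × ℝ))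
      map_add' := fun _ _ => by ext <;> simp
      map_smul' := fun _ _ => by ext <;> simp } 1
    (fun z => by
      rw [one_mul, ContinuousMap.norm_le _ (norm_nonneg _)]
      intro t
      simp [Prod.norm_def])
  have : (fun z : Z => (⟨fun s => (z, (s : ℝ)), by fun_prop⟩ : C(Icc (0 : ℝ) 1, Z × ℝ))) =
      fun z => L z + ⟨fun s => (0, (s : ℝ)), by fun_prop⟩ := by
    funext z
    ext s <;> simp [L]
  rw [this]
  exact L.contDiff.add contDiff_const

/-- The integral factors through `C([0,1], F)`: an affine map `z ↦ (s ↦ (z, s))`, a composition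
operator, and the continuous linear integral. No differentiation under the integral sign is needed.
-/
theorem contDiffAt_parametric_intervalIntegral {Z F : Type} [NormedAddCommGroup Z]
    [NormedSpace ℝ Z] [FiniteDimensional ℝ Z] [NormedAddCommGroup F] [NormedSpace ℝ F]
    [CompleteSpace F] {h : Z × ℝ → F} {z₀ : Z}
    (H : ∀ s ∈ Icc (0 : ℝ) 1, ContDiffAt ℝ ∞ h (z₀, s)) :
    ContDiffAt ℝ ∞ (fun z => ∫ s in (0 : ℝ)..1, h (z, s)) z₀ := by
  -- Being `C^m` at a point is an open condition for finite `m`, but not for `m = ∞`.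
  rw [contDiffAt_infty]
  intro m
  have hopen : IsOpen (interior {y | ContDiffAt ℝ m h y}) := isOpen_interior
  have hon : ContDiffOn ℝ (m : ℕ∞) h (interior {y | ContDiffAt ℝ m h y}) := fun y hy =>
    (show ContDiffAt ℝ m h y from interior_subset hy).contDiffWithinAt
  have hK : IsCompact (({z₀} : Set Z) ×ˢ Icc (0 : ℝ) 1) := isCompact_singleton.prod isCompact_Icc
  have hKD : ({z₀} : Set Z) ×ˢ Icc (0 : ℝ) 1 ⊆ interior {y | ContDiffAt ℝ m h y} := by
    rintro ⟨z, s⟩ ⟨hz, hs⟩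
    obtain rfl : z = z₀ := hz
    rw [mem_interior_iff_mem_nhds]
    exact ((H s hs).of_le (by exact_mod_cast le_top : (m : ℕ∞ω) ≤ ∞)).eventually (by simp)
  obtain ⟨g, hg, hgh⟩ := exists_contDiff_eq_near_compact hopen hon hK hKD
  obtain ⟨u, v, hu, -, hzu, hIv, huv⟩ := generalized_tube_lemma isCompact_singleton isCompact_Icc
    isOpen_interior (subset_interior_iff_mem_nhdsSet.2 hgh)
  have hev : (fun z => ∫ s in (0 : ℝ)..1, h (z, s)) =ᶠ[𝓝 z₀] fun z =>
      integralCLM F (postcomp _ g hg.continuous ⟨fun s => (z, (s : ℝ)), by fun_prop⟩) := by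
    filter_upwards [hu.mem_nhds (singleton_subset_iff.1 hzu)] with z hz
    refine intervalIntegral.integral_congr fun s hs => ?_
    rw [uIcc_of_le zero_le_one] at hs
    have : (z, s) ∈ {y | g y = h y} := interior_subset (huv (mk_mem_prod hz (hIv hs)))
    have : g (z, s) = h (z, s) := this
    simp [projIcc_of_mem zero_le_one hs, this]
  refine ContDiffAt.congr_of_eventuallyEq (ContDiff.contDiffAt ?_) hev
  exact (integralCLM F).contDiff.comp ((contDiff_postcomp_nat m hg).comp contDiff_curryPair)

/-- Division by the time variable of a smooth function vanishing at time zero. -/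
theorem exists_contDiffAt_div {Z F : Type} [NormedAddCommGroup Z]
    [NormedSpace ℝ Z] [FiniteDimensional ℝ Z] [NormedAddCommGroup F] [NormedSpace ℝ F]
    [CompleteSpace F] (k : Z × ℝ → F) :
    ∃ κ : Z × ℝ → F, (∀ z₀, (∀ s ∈ Icc (0 : ℝ) 1, ContDiffAt ℝ ∞ k (z₀, s)) → k (z₀, 0) = 0 →
      (∀ s ∈ Icc (0 : ℝ) 1, ContDiffAt ℝ ∞ κ (z₀, s) ∧ k (z₀, s) = s • κ (z₀, s))) := by
  -- Hadamard's quotient. It does not depend on `z₀`, so one function `κ` serves all parameters at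
  -- once.
  refine ⟨fun y => ∫ r in (0 : ℝ)..1, fderiv ℝ k (y.1, r * y.2) (0, 1), fun z₀ hk h0 s hs => ?_⟩
  have hmem : ∀ r ∈ Icc (0 : ℝ) 1, r * s ∈ Icc (0 : ℝ) 1 := fun r hr =>
    ⟨mul_nonneg hr.1 hs.1, mul_le_one₀ hr.2 hs.1 hs.2⟩
  constructor
  · refine contDiffAt_parametric_intervalIntegral
      (h := fun w : (Z × ℝ) × ℝ => fderiv ℝ k (w.1.1, w.2 * w.1.2) (0, 1)) fun r hr => ?_
    have h1 : ContDiffAt ℝ ∞ (fderiv ℝ k) (z₀, r * s) :=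
      (hk _ (hmem r hr)).fderiv_right (by simp)
    have h2 : ContDiffAt ℝ ∞ (fun w : (Z × ℝ) × ℝ => (w.1.1, w.2 * w.1.2)) ((z₀, s), r) := by
      fun_prop
    exact (ContDiffAt.comp ((z₀, s), r) (f := fun w : (Z × ℝ) × ℝ => (w.1.1, w.2 * w.1.2)) h1 h2).clm_apply contDiffAt_const
  · have hd : ∀ r ∈ uIcc (0 : ℝ) 1,
        HasDerivAt (fun r => k (z₀, r * s)) (s • fderiv ℝ k (z₀, r * s) (0, 1)) r := by
      intro r hr
      rw [uIcc_of_le zero_le_one] at hr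
      have h1 := ((hk _ (hmem r hr)).differentiableAt (by simp)).hasFDerivAt
      have h2 : HasDerivAt (fun r : ℝ => (z₀, r * s)) (0, s) r :=
        (hasDerivAt_const r z₀).prodMk (by simpa using (hasDerivAt_id r).mul_const s)
      have h3 := h1.comp_hasDerivAt r h2
      have h4 : ((0 : Z), s) = s • ((0 : Z), (1 : ℝ)) := by simp
      rw [h4, map_smul] at h3
      exact h3
    have hc : ContinuousOn (fun r => s • fderiv ℝ k (z₀, r * s) (0, 1)) (uIcc (0 : ℝ) 1) := by
      intro r hr
      rw [uIcc_of_le zero_le_one] at hr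
      have h1 : ContDiffAt ℝ 0 (fderiv ℝ k) (z₀, r * s) :=
        (hk _ (hmem r hr)).fderiv_right (by simp)
      have h2 : ContinuousAt (fun r => fderiv ℝ k (z₀, r * s)) r :=
        ContinuousAt.comp (f := fun r : ℝ => (z₀, r * s)) h1.continuousAt (by fun_prop)
      exact ((h2.clm_apply continuousAt_const).const_smul s).continuousWithinAt
    have := intervalIntegral.integral_eq_sub_of_hasDerivAt hd (hc.intervalIntegrable)
    simp only [one_mul, zero_mul, h0, sub_zero, intervalIntegral.integral_smul] at this
    exact this.symm

end ParametricIntegral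

end Analysis
end OscGeom

end

noncomputable section

namespace OscGeom

/-! ### Implicit functions, smooth flows, and uniqueness for ordinary differential equations. -/

section ODE

/-- A version of the implicit function theorem with a uniform neighbourhood. -/
theorem exists_implicit_contDiffOn {A B C : Type*} [NormedAddCommGroup A] [NormedSpace ℝ A]
    [CompleteSpace A] [NormedAddCommGroup B] [NormedSpace ℝ B] [CompleteSpace B]
    [NormedAddCommGroup C] [NormedSpace ℝ C] [CompleteSpace C] {f : A × B → C} {D : Set (A × B)}
    (hD : IsOpen D) (hf : ContDiffOn ℝ ∞ f D) {u : A × B} (hu : u ∈ D)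
    (hinv : (fderiv ℝ f u ∘L .inr ℝ A B).IsInvertible) :
    ∃ (O : Set A) (V : Set B) (g : A → B), IsOpen O ∧ IsOpen V ∧ u.1 ∈ O ∧ u.2 ∈ V ∧
      ContDiffOn ℝ ∞ g O ∧ g u.1 = u.2 ∧ O ×ˢ V ⊆ D ∧
      ∀ a ∈ O, g a ∈ V ∧ ∀ b ∈ V, f (a, b) = f u ↔ b = g a := by
  have hfu : ContDiffAt ℝ ∞ f u := hf.contDiffAt (hD.mem_nhds hu)
  set g := hfu.implicitFunction (by simp) hinv with hg
  have hgu : g u.1 = u.2 := hfu.implicitFunction_apply_self (by simp) hinv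
  have hiff : ∀ᶠ v in 𝓝 u, f v = f u ↔ g v.1 = v.2 :=
    hfu.eventually_apply_eq_iff_implicitFunction (by simp) hinv
  have hgc : ContDiffAt ℝ ∞ g u.1 := hfu.contDiffAt_implicitFunction (by simp) hinv
  have hgraph : Tendsto (fun a => (a, g a)) (𝓝 u.1) (𝓝 u) := by
    have : ContinuousAt (fun a => (a, g a)) u.1 := continuousAt_id.prodMk hgc.continuousAt
    rwa [ContinuousAt, hgu] at this
  have hinv' : ∀ᶠ v in 𝓝 u, (fderiv ℝ f v ∘L .inr ℝ A B).IsInvertible := by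
    have hcont : ContinuousAt (fun v => fderiv ℝ f v ∘L .inr ℝ A B) u := by
      have : ContDiffAt ℝ 0 (fderiv ℝ f) u := hfu.fderiv_right (by simp)
      exact this.continuousAt.clm_comp continuousAt_const
    obtain ⟨e, he⟩ := hinv
    have hn : range ((↑) : (B ≃L[ℝ] C) → B →L[ℝ] C) ∈ 𝓝 (fderiv ℝ f u ∘L .inr ℝ A B) :=
      he ▸ ContinuousLinearEquiv.nhds e
    filter_upwards [hcont.preimage_mem_nhds hn] with v hv
    exact hv
  have hc1 : ∀ᶠ a in 𝓝 u.1, ContinuousAt g a :=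
    ((hgc.of_le (by simp : (1 : ℕ∞ω) ≤ ∞)).eventually (by simp)).mono fun a h => h.continuousAt
  -- Smoothness at `u.1` alone does not spread to a neighbourhood. At a nearby `a`, the implicit
  -- function based at `(a, g a)` is smooth at `a` and coincides with `g` by local uniqueness.
  have hsmooth : ∀ᶠ a in 𝓝 u.1, ContDiffAt ℝ ∞ g a := by
    filter_upwards [hc1, hgraph.eventually (hD.mem_nhds hu), hgraph.eventually hinv',
      hgraph.eventually hiff.eventually_nhds] with a ha haD hai haiff
    have hfa : ContDiffAt ℝ ∞ f (a, g a) := hf.contDiffAt (hD.mem_nhds haD)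
    have hval : f (a, g a) = f u := (haiff.self_of_nhds).2 rfl
    have h2c := hfa.contDiffAt_implicitFunction (by simp) hai
    refine h2c.congr_of_eventuallyEq ?_
    have h2g : Tendsto (fun a' => (a', hfa.implicitFunction (by simp) hai a')) (𝓝 a)
        (𝓝 (a, g a)) := by
      have : ContinuousAt (fun a' => (a', hfa.implicitFunction (by simp) hai a')) a :=
        continuousAt_id.prodMk h2c.continuousAt
      have h3 := hfa.implicitFunction_apply_self (by simp) hai
      rwa [ContinuousAt, h3] at this
    filter_upwards [h2g.eventually haiff,
      hfa.eventually_apply_implicitFunction (by simp) hai] with a' h1 h2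
    exact h1.1 (h2.trans hval)
  have hnhds : ∀ᶠ v in 𝓝 u, (f v = f u ↔ g v.1 = v.2) ∧ v ∈ D := hiff.and (hD.mem_nhds hu)
  rw [show u = (u.1, u.2) from rfl, nhds_prod_eq] at hnhds
  obtain ⟨O₁, hO₁, V₁, hV₁, hOV⟩ := mem_prod_iff.1 hnhds
  obtain ⟨V, hVV, hV, huV⟩ := mem_nhds_iff.1 hV₁
  have hO₂ : ∀ᶠ a in 𝓝 u.1, ContDiffAt ℝ ∞ g a ∧ g a ∈ V ∧ a ∈ O₁ :=
    hsmooth.and ((hgc.continuousAt.eventually (by rw [hgu]; exact hV.mem_nhds huV)).and hO₁)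
  obtain ⟨O, hOO, hO, huO⟩ := mem_nhds_iff.1 hO₂
  refine ⟨O, V, g, hO, hV, huO, huV, fun a ha => (hOO ha).1.contDiffWithinAt, hgu,
    fun v hv => (hOV (mk_mem_prod (hOO hv.1).2.2 (hVV hv.2))).2,
    fun a ha => ⟨(hOO ha).2.1, fun b hb => ?_⟩⟩
  have := (hOV (mk_mem_prod (hOO ha).2.2 (hVV hb))).1
  exact this.trans eq_comm

/-- The Volterra operator `X ↦ ∫₀^t X` on `C([-1,1], F)`. -/
def volterra (F : Type*) [NormedAddCommGroup F] [NormedSpace ℝ F] [CompleteSpace F] :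
    C(Icc (-1 : ℝ) 1, F) →L[ℝ] C(Icc (-1 : ℝ) 1, F) :=
  LinearMap.mkContinuous
    { toFun := fun X => ⟨fun t => ∫ s in (0 : ℝ)..t, X (projIcc (-1) 1 (by norm_num) s),
        (intervalIntegral.continuous_primitive (fun _ _ =>
          (X.continuous.comp continuous_projIcc).intervalIntegrable _ _) 0).comp
          continuous_subtype_val⟩
      map_add' := fun X Y => by
        ext t
        simp only [ContinuousMap.add_apply, ContinuousMap.coe_mk]
        exact intervalIntegral.integral_add
          ((X.continuous.comp continuous_projIcc).intervalIntegrable _ _)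
          ((Y.continuous.comp continuous_projIcc).intervalIntegrable _ _)
      map_smul' := fun c X => by ext t; simp } 1
    (fun X => by
      rw [one_mul, ContinuousMap.norm_le _ (norm_nonneg _)]
      intro t
      have := intervalIntegral.norm_integral_le_of_norm_le_const (a := (0 : ℝ)) (b := t)
        (f := fun s => X (projIcc (-1) 1 (by norm_num) s)) (C := ‖X‖)
        (fun s _ => X.norm_coe_le_norm _)
      refine this.trans ?_
      rw [sub_zero]
      exact mul_le_of_le_one_right (norm_nonneg _) (abs_le.2 t.2))

theorem volterra_apply {F : Type*} [NormedAddCommGroup F] [NormedSpace ℝ F] [CompleteSpace F]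
    (X : C(Icc (-1 : ℝ) 1, F)) (t : Icc (-1 : ℝ) 1) :
    volterra F X t = ∫ s in (0 : ℝ)..t, X (projIcc (-1) 1 (by norm_num) s) := rfl

/-- Constant maps as elements of `C(K, G)`. -/
def constCLM (K G : Type*) [TopologicalSpace K] [CompactSpace K] [NormedAddCommGroup G]
    [NormedSpace ℝ G] : G →L[ℝ] C(K, G) :=
  LinearMap.mkContinuous
    { toFun := fun y => ContinuousMap.const K y
      map_add' := fun _ _ => rfl
      map_smul' := fun _ _ => rfl } 1
    (fun y => by
      rw [one_mul, ContinuousMap.norm_le _ (norm_nonneg _)]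
      exact fun _ => le_rfl)

@[simp] theorem constCLM_apply {K G : Type*} [TopologicalSpace K] [CompactSpace K]
    [NormedAddCommGroup G] [NormedSpace ℝ G] (y : G) (t : K) : constCLM K G y t = y := rfl

/-- Smooth local flow of a smooth vector field. -/
theorem exists_local_flow {G : Type} [NormedAddCommGroup G] [NormedSpace ℝ G]
    [FiniteDimensional ℝ G] {X : G → G} {D : Set G} (hD : IsOpen D) (hX : ContDiffOn ℝ ∞ X D)
    {y₀ : G} (hy₀ : y₀ ∈ D) :
    ∃ ε > 0, ∃ φ : G × ℝ → G, ContDiffOn ℝ ∞ φ (Metric.ball y₀ ε ×ˢ Ioo (-ε) ε) ∧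
      ∀ y ∈ Metric.ball y₀ ε, φ (y, 0) = y ∧ ∀ t ∈ Ioo (-ε) ε, φ (y, t) ∈ D ∧
        HasDerivAt (fun t => φ (y, t)) (X (φ (y, t))) t := by
  have : CompleteSpace G := FiniteDimensional.complete ℝ G
  obtain ⟨Y, hY, hYX⟩ := exists_contDiff_eq_near_compact (m := ⊤) hD hX isCompact_singleton
    (singleton_subset_iff.2 hy₀)
  rw [nhdsSet_singleton] at hYX
  obtain ⟨r, hr, hball⟩ := Metric.eventually_nhds_iff_ball.1 (hYX.and (hD.mem_nhds hy₀))
  -- Zeros of `f` are the solutions on `[-1,1]` of the equation sped up by the factor `h`, that is,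
  -- `Z = y + h ∫ Y(Z)`. At `h = 0` the derivative in `Z` is the identity, so the implicit function
  -- theorem applies without a contraction argument.
  let f : (ℝ × G) × C(Icc (-1 : ℝ) 1, G) → C(Icc (-1 : ℝ) 1, G) := fun w =>
    w.2 - constCLM (Icc (-1 : ℝ) 1) G w.1.2 - w.1.1 • volterra G (postcomp (Icc (-1 : ℝ) 1) Y hY.continuous w.2)
  have hpost : ContDiff ℝ ∞ (postcomp (Icc (-1 : ℝ) 1) Y hY.continuous) :=
    contDiff_infty.2 fun m => contDiff_postcomp_nat m (hY.of_le (by exact_mod_cast le_top))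
  have hf : ContDiff ℝ ∞ f := by
    refine (contDiff_snd.sub ?_).sub ?_
    · exact (constCLM (Icc (-1 : ℝ) 1) G).contDiff.comp (contDiff_snd.comp contDiff_fst)
    · exact (contDiff_fst.comp contDiff_fst).smul
        ((volterra G).contDiff.comp (hpost.comp contDiff_snd))
  let u : (ℝ × G) × C(Icc (-1 : ℝ) 1, G) := ((0, y₀), constCLM (Icc (-1 : ℝ) 1) G y₀)
  have hfu : f u = 0 := by simp [f, u]
  have hinv : (fderiv ℝ f u ∘L .inr ℝ (ℝ × G) C(Icc (-1 : ℝ) 1, G)).IsInvertible := by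
    have h1 : HasFDerivAt (fun Z => f (u.1, Z)) (fderiv ℝ f u ∘L .inr ℝ (ℝ × G) C(Icc (-1 : ℝ) 1, G)) u.2 := by
      have h2 : HasFDerivAt f (fderiv ℝ f u) (u.1, u.2) :=
        ((hf.differentiable (by simp)) u).hasFDerivAt
      exact h2.comp u.2 (hasFDerivAt_prodMk_right u.1 u.2)
    have h3 : HasFDerivAt (fun Z => f (u.1, Z)) (ContinuousLinearMap.id ℝ C(Icc (-1 : ℝ) 1, G)) u.2 := by
      have : (fun Z => f (u.1, Z)) = fun Z => Z - constCLM (Icc (-1 : ℝ) 1) G y₀ := by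
        funext Z; simp [f, u]
      rw [this]
      exact (hasFDerivAt_id _).sub_const _
    rw [h1.unique h3]
    exact ⟨ContinuousLinearEquiv.refl ℝ _, rfl⟩
  obtain ⟨O, V, g, hO, hV, huO, huV, hg, hgu, -, hgV⟩ :=
    exists_implicit_contDiffOn isOpen_univ hf.contDiffOn (mem_univ u) hinv
  rw [hfu] at hgV
  -- restrict to curves which stay in a ball
  obtain ⟨ρ, hρ, hρV⟩ := Metric.isOpen_iff.1 (hV.inter (Metric.isOpen_ball (x := u.2) (ε := r)))
    u.2 ⟨huV, Metric.mem_ball_self hr⟩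
  have hgρ : ∀ᶠ a in 𝓝 u.1, g a ∈ Metric.ball u.2 ρ ∧ a ∈ O :=
    ((hg.contDiffAt (hO.mem_nhds huO)).continuousAt.eventually
      (by rw [hgu]; exact Metric.ball_mem_nhds _ hρ)).and (hO.mem_nhds huO)
  obtain ⟨ε₀, hε₀, hball₀⟩ := Metric.eventually_nhds_iff_ball.1 hgρ
  -- The inequality is strict so that the speed `h = ε` itself is admitted; the solution of that
  -- speed is compared with all the others.
  obtain ⟨ε, hε, hεε⟩ : ∃ ε, 0 < ε ∧ ε < ε₀ := ⟨ε₀ / 2, by linarith, by linarith⟩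
  have hmem : ∀ h : ℝ, |h| ≤ ε → ∀ y ∈ Metric.ball y₀ ε, ((h, y) : ℝ × G) ∈ Metric.ball u.1 ε₀ := by
    intro h hh y hy
    rw [Metric.mem_ball, Prod.dist_eq]
    refine max_lt ?_ ?_
    · simpa [u] using hh.trans_lt hεε
    · exact lt_trans (Metric.mem_ball.1 hy) hεε
  let one : Icc (-1 : ℝ) 1 := ⟨1, by norm_num, le_rfl⟩
  have hsol : ∀ h : ℝ, |h| ≤ ε → ∀ y ∈ Metric.ball y₀ ε, ∀ t : Icc (-1 : ℝ) 1,
      g (h, y) t = y + h • ∫ s in (0 : ℝ)..t, Y (g (h, y) (projIcc (-1) 1 (by norm_num) s)) := by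
    intro h hh y hy t
    have hb := hball₀ _ (hmem h hh y hy)
    have h1 := ((hgV _ hb.2).2 _ (hgV _ hb.2).1).2 rfl
    have h2 := congrArg (fun Z : C(Icc (-1 : ℝ) 1, G) => Z t) h1
    simp only [f, ContinuousMap.sub_apply, ContinuousMap.smul_apply, volterra_apply,
      ContinuousMap.zero_apply, postcomp_apply, constCLM_apply] at h2
    rw [sub_sub, sub_eq_zero] at h2
    exact h2
  have hgball : ∀ h : ℝ, |h| ≤ ε → ∀ y ∈ Metric.ball y₀ ε, ∀ t : Icc (-1 : ℝ) 1,
      g (h, y) t ∈ Metric.ball y₀ r := by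
    intro h hh y hy t
    have hb := (hρV (hball₀ _ (hmem h hh y hy)).1).2
    exact ((ContinuousMap.dist_apply_le_dist t).trans_lt hb)
  -- reparametrization
  have hrep : ∀ h : ℝ, |h| ≤ ε → ∀ y ∈ Metric.ball y₀ ε,
      g (h, y) one = g (ε, y) (projIcc (-1) 1 (by norm_num) (h / ε)) := by
    intro h hh y hy
    have hcm : ∀ s ∈ Icc (-1 : ℝ) 1, h / ε * s ∈ Icc (-1 : ℝ) 1 := by
      intro s hs
      have h1 : |h / ε * s| ≤ 1 := by
        rw [abs_mul, abs_div, abs_of_pos hε]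
        exact mul_le_one₀ ((div_le_one hε).2 hh) (abs_nonneg _) (abs_le.2 hs)
      exact abs_le.1 h1
    -- The solution of speed `ε`, slowed down to speed `h`. Slowing down does not increase the
    -- distance to a constant curve, so `Z` stays in `V`, where zeros of `f` are unique.
    let Z : C(Icc (-1 : ℝ) 1, G) := (g (ε, y)).comp ⟨fun s => ⟨h / ε * s, hcm s s.2⟩, by fun_prop⟩
    have hbε := hball₀ _ (hmem ε (abs_of_pos hε).le y hy)
    have hb := hball₀ _ (hmem h hh y hy)
    have hZV : Z ∈ V := by
      refine (hρV ?_).1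
      rw [Metric.mem_ball]
      refine lt_of_le_of_lt ?_ (Metric.mem_ball.1 hbε.1)
      rw [ContinuousMap.dist_le dist_nonneg]
      intro s
      exact ContinuousMap.dist_apply_le_dist (f := g (ε, y)) (g := u.2) _
    have hZ : Z = g (h, y) := by
      refine ((hgV _ hb.2).2 _ hZV).1 ?_
      ext t
      simp only [f, ContinuousMap.sub_apply, ContinuousMap.smul_apply, volterra_apply,
        ContinuousMap.zero_apply, postcomp_apply, constCLM_apply, Z, ContinuousMap.comp_apply, ContinuousMap.coe_mk]
      rw [hsol ε (abs_of_pos hε).le y hy]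
      have hint : ∫ s in (0 : ℝ)..t, Y (g (ε, y) ⟨h / ε * (projIcc (-1) 1 (by norm_num) s : Icc (-1 : ℝ) 1),
            hcm _ (Subtype.coe_prop _)⟩) =
          ∫ s in (0 : ℝ)..t, Y (g (ε, y) (projIcc (-1) 1 (by norm_num) (h / ε * s))) := by
        refine intervalIntegral.integral_congr fun s hs => ?_
        have hs' : s ∈ Icc (-1 : ℝ) 1 := (convex_Icc (-1 : ℝ) 1).ordConnected.uIcc_subset
          (by constructor <;> norm_num) t.2 hs
        congr 2
        rw [projIcc_of_mem _ (hcm s hs')]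
        simp [projIcc_of_mem _ hs']
      rw [hint]
      by_cases h0 : h = 0
      · subst h0; simp
      · have := intervalIntegral.smul_integral_comp_mul_left (a := 0) (b := (t : ℝ))
          (fun s => Y (g (ε, y) (projIcc (-1) 1 (by norm_num) s))) (h / ε)
        rw [mul_zero] at this
        rw [← this, smul_smul, mul_div_cancel₀ _ hε.ne']
        simp
    rw [← hZ]
    simp only [Z, ContinuousMap.comp_apply, ContinuousMap.coe_mk]
    congr 1
    have hhε : h / ε ∈ Icc (-1 : ℝ) 1 := by simpa [one] using hcm 1 one.2
    rw [projIcc_of_mem _ hhε]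
    simp [one]
  -- The flow at time `t` is the value at time 1 of the solution of speed `t`. Time has become a
  -- parameter of the implicit function, which gives joint smoothness.
  refine ⟨ε, hε, fun w => g (w.2, w.1) one, ?_, fun y hy => ⟨?_, fun t ht => ?_⟩⟩
  · have h1 : ContDiffOn ℝ ∞ (fun w : G × ℝ => g (w.2, w.1)) (Metric.ball y₀ ε ×ˢ Ioo (-ε) ε) :=
      hg.comp (contDiff_snd.prodMk contDiff_fst).contDiffOn fun w hw =>
        (hball₀ _ (hmem _ (abs_le.2 ⟨hw.2.1.le, hw.2.2.le⟩) _ hw.1)).2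
    exact (ContinuousMap.evalCLM ℝ one).contDiff.comp_contDiffOn h1
  · simp only
    rw [hsol 0 (by simpa using hε.le) y hy, zero_smul, add_zero]
  · have hta : |t| ≤ ε := abs_le.2 ⟨ht.1.le, ht.2.le⟩
    have hrD := hball _ (hgball t hta y hy one)
    refine ⟨hrD.2, ?_⟩
    simp only
    rw [← hrD.1]
    have hev : (fun t => g (t, y) one) =ᶠ[𝓝 t] fun t => y + ε • ∫ s in (0 : ℝ)..(t / ε),
        Y (g (ε, y) (projIcc (-1) 1 (by norm_num) s)) := by
      filter_upwards [isOpen_Ioo.mem_nhds ht] with s hs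
      have hsa : |s| ≤ ε := abs_le.2 ⟨hs.1.le, hs.2.le⟩
      rw [hrep s hsa y hy, hsol ε (abs_of_pos hε).le y hy]
      have hsε : s / ε ∈ Icc (-1 : ℝ) 1 := by
        refine abs_le.1 ?_
        rw [abs_div, abs_of_pos hε]
        exact (div_le_one hε).2 hsa
      rw [projIcc_of_mem _ hsε]
    refine HasDerivAt.congr_of_eventuallyEq ?_ hev
    have hcont : Continuous (fun s => Y (g (ε, y) (projIcc (-1) 1 (by norm_num) s))) :=
      hY.continuous.comp ((g (ε, y)).continuous.comp continuous_projIcc)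
    have h1 := intervalIntegral.integral_hasDerivAt_right (hcont.intervalIntegrable 0 (t / ε))
      (hcont.stronglyMeasurableAtFilter _ _) hcont.continuousAt
    have h2 := ((h1.scomp t ((hasDerivAt_id t).div_const ε)).const_smul ε).const_add y
    rw [hrep t hta y hy]
    simpa [smul_smul, hε.ne'] using h2

/-- Propagation of a property along an order-connected set. -/
theorem interval_propagation {C : ℝ → Prop} {S : Set ℝ} (hS : S.OrdConnected) {a b : ℝ}
    (ha : a ∈ S) (hb : b ∈ S) (hC : C a)
    (hloc : ∀ t ∈ S, ∃ ε > 0, ∀ t₁ ∈ S, ∀ t₂ ∈ S,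
      |t₁ - t| < ε → |t₂ - t| < ε → C t₁ → C t₂) : C b := by
  let A : Set S := {t | C t}
  have hA : IsClopen A := by
    have key : ∀ t : S, (∀ᶠ s : S in 𝓝 t, s ∈ A) ∨ (∀ᶠ s : S in 𝓝 t, s ∉ A) := by
      intro t
      obtain ⟨ε, hε, h⟩ := hloc t t.2
      have hev : ∀ᶠ s : S in 𝓝 t, |(s : ℝ) - t| < ε := by
        filter_upwards [Metric.ball_mem_nhds t hε] with s hs
        simpa [Real.dist_eq, Subtype.dist_eq] using hs
      by_cases ht : t ∈ A
      · left
        filter_upwards [hev] with s hs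
        exact h t t.2 s s.2 (by simpa using hε) hs ht
      · right
        filter_upwards [hev] with s hs hsS
        exact ht (h s s.2 t t.2 hs (by simpa using hε) hsS)
    constructor
    · rw [← isOpen_compl_iff, isOpen_iff_mem_nhds]
      intro t ht
      exact (key t).resolve_left fun h => ht h.self_of_nhds
    · rw [isOpen_iff_mem_nhds]
      intro t ht
      exact (key t).resolve_right fun h => h.self_of_nhds ht
  have hconn : PreconnectedSpace S := Subtype.preconnectedSpace hS.isPreconnected
  have huniv : A = univ := hA.eq_univ ⟨⟨a, ha⟩, hC⟩
  exact (huniv ▸ mem_univ _ : (⟨b, hb⟩ : S) ∈ A)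

/-- Local uniqueness of integral curves on an order-connected set. -/
theorem ode_unique_local {G : Type*} [NormedAddCommGroup G] [NormedSpace ℝ G] {X : G → G}
    {y₀ : G} (hX : ContDiffAt ℝ 1 X y₀) {S : Set ℝ} (hS : S.OrdConnected) {t₀ : ℝ}
    {α β : ℝ → G} (hα0 : α t₀ = y₀) (hβ0 : β t₀ = y₀)
    (hαc : ContinuousWithinAt α S t₀) (hβc : ContinuousWithinAt β S t₀)
    (hα : ∀ᶠ t in 𝓝[S] t₀, HasDerivWithinAt α (X (α t)) S t)
    (hβ : ∀ᶠ t in 𝓝[S] t₀, HasDerivWithinAt β (X (β t)) S t) :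
    ∃ ε > 0, ∀ t₁ ∈ S, ∀ t₂ ∈ S, |t₁ - t₀| < ε → |t₂ - t₀| < ε → α t₁ = β t₁ → α t₂ = β t₂ := by
  obtain ⟨K, s, hs, hK⟩ := hX.exists_lipschitzOnWith
  have hev : ∀ᶠ t in 𝓝[S] t₀, α t ∈ s ∧ β t ∈ s ∧ HasDerivWithinAt α (X (α t)) S t ∧
      HasDerivWithinAt β (X (β t)) S t :=
    (hαc.eventually (by rwa [hα0])).and ((hβc.eventually (by rwa [hβ0])).and (hα.and hβ))
  obtain ⟨ε, hε, h⟩ := Metric.mem_nhdsWithin_iff.1 hev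
  have h' : ∀ t ∈ S, |t - t₀| < ε → α t ∈ s ∧ β t ∈ s ∧ HasDerivWithinAt α (X (α t)) S t ∧
      HasDerivWithinAt β (X (β t)) S t := fun t ht htε => h ⟨by simpa [Real.dist_eq] using htε, ht⟩
  refine ⟨ε, hε, fun t₁ h₁ t₂ h₂ h₁ε h₂ε heq => ?_⟩
  have hmid : ∀ a ∈ S, ∀ b ∈ S, |a - t₀| < ε → |b - t₀| < ε → ∀ t ∈ Icc a b,
      t ∈ S ∧ |t - t₀| < ε := by
    intro a ha b hb haε hbε t ht
    refine ⟨hS.out ha hb ht, abs_lt.2 ⟨?_, ?_⟩⟩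
    · linarith [(abs_lt.1 haε).1, ht.1]
    · linarith [(abs_lt.1 hbε).2, ht.2]
  rcases le_total t₁ t₂ with hle | hle
  · have hm := hmid t₁ h₁ t₂ h₂ h₁ε h₂ε
    have hsub : Icc t₁ t₂ ⊆ S := fun t ht => (hm t ht).1
    have hder : ∀ (γ : ℝ → G), (∀ t ∈ Icc t₁ t₂, HasDerivWithinAt γ (X (γ t)) S t) →
        ContinuousOn γ (Icc t₁ t₂) ∧
        ∀ t ∈ Ico t₁ t₂, HasDerivWithinAt γ (X (γ t)) (Ici t) t := by
      intro γ hγ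
      refine ⟨fun t ht => ((hγ t ht).continuousWithinAt).mono hsub, fun t ht => ?_⟩
      refine ((hγ t ⟨ht.1, ht.2.le⟩).mono hsub).mono_of_mem_nhdsWithin ?_
      exact mem_of_superset (Icc_mem_nhdsGE ht.2) (Icc_subset_Icc_left ht.1)
    obtain ⟨hac, had⟩ := hder α fun t ht => (h' t (hm t ht).1 (hm t ht).2).2.2.1
    obtain ⟨hbc, hbd⟩ := hder β fun t ht => (h' t (hm t ht).1 (hm t ht).2).2.2.2
    exact ODE_solution_unique_of_mem_Icc_right (v := fun _ => X) (s := fun _ => s) (K := K)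
      (fun _ _ => hK) hac had
      (fun t ht => (h' t (hm t ⟨ht.1, ht.2.le⟩).1 (hm t ⟨ht.1, ht.2.le⟩).2).1)
      hbc hbd (fun t ht => (h' t (hm t ⟨ht.1, ht.2.le⟩).1 (hm t ⟨ht.1, ht.2.le⟩).2).2.1)
      heq ⟨hle, le_rfl⟩
  · have hm := hmid t₂ h₂ t₁ h₁ h₂ε h₁ε
    have hsub : Icc t₂ t₁ ⊆ S := fun t ht => (hm t ht).1
    have hder : ∀ (γ : ℝ → G), (∀ t ∈ Icc t₂ t₁, HasDerivWithinAt γ (X (γ t)) S t) →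
        ContinuousOn γ (Icc t₂ t₁) ∧
        ∀ t ∈ Ioc t₂ t₁, HasDerivWithinAt γ (X (γ t)) (Iic t) t := by
      intro γ hγ
      refine ⟨fun t ht => ((hγ t ht).continuousWithinAt).mono hsub, fun t ht => ?_⟩
      refine ((hγ t ⟨ht.1.le, ht.2⟩).mono hsub).mono_of_mem_nhdsWithin ?_
      exact mem_of_superset (Icc_mem_nhdsLE ht.1) (Icc_subset_Icc_right ht.2)
    obtain ⟨hac, had⟩ := hder α fun t ht => (h' t (hm t ht).1 (hm t ht).2).2.2.1
    obtain ⟨hbc, hbd⟩ := hder β fun t ht => (h' t (hm t ht).1 (hm t ht).2).2.2.2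
    exact ODE_solution_unique_of_mem_Icc_left (v := fun _ => X) (s := fun _ => s) (K := K)
      (fun _ _ => hK) hac had
      (fun t ht => (h' t (hm t ⟨ht.1.le, ht.2⟩).1 (hm t ⟨ht.1.le, ht.2⟩).2).1)
      hbc hbd (fun t ht => (h' t (hm t ⟨ht.1.le, ht.2⟩).1 (hm t ⟨ht.1.le, ht.2⟩).2).2.1)
      heq ⟨le_rfl, hle⟩

/-- Smooth local flow of a smooth vector field with parameters. -/
theorem exists_local_flow_param {P G : Type} [NormedAddCommGroup P] [NormedSpace ℝ P]
    [FiniteDimensional ℝ P] [NormedAddCommGroup G] [NormedSpace ℝ G]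
    [FiniteDimensional ℝ G] {X : P × G → G} {D : Set (P × G)} (hD : IsOpen D)
    (hX : ContDiffOn ℝ ∞ X D) {z₀ : P × G} (hz₀ : z₀ ∈ D) :
    ∃ ε > 0, ∃ φ : (P × G) × ℝ → G, ContDiffOn ℝ ∞ φ (Metric.ball z₀ ε ×ˢ Ioo (-ε) ε) ∧
      ∀ z ∈ Metric.ball z₀ ε, φ (z, 0) = z.2 ∧ ∀ t ∈ Ioo (-ε) ε, (z.1, φ (z, t)) ∈ D ∧
        HasDerivAt (fun t => φ (z, t)) (X (z.1, φ (z, t))) t := by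
  -- Parameters are extra coordinates that do not move.
  obtain ⟨ε, hε, φ, hφ, h⟩ := exists_local_flow (X := fun z : P × G => ((0 : P), X z)) hD
    (contDiffOn_const.prodMk hX) hz₀
  have hfst : ∀ z ∈ Metric.ball z₀ ε, ∀ t ∈ Ioo (-ε) ε, (φ (z, t)).1 = z.1 := by
    intro z hz t ht
    have h1 : ∀ s ∈ Ioo (-ε) ε, HasDerivAt (fun s => (φ (z, s)).1) 0 s := fun s hs =>
      (ContinuousLinearMap.fst ℝ P G).hasFDerivAt.comp_hasDerivAt s ((h z hz).2 s hs).2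
    have := isOpen_Ioo.is_const_of_deriv_eq_zero isPreconnected_Ioo
      (fun s hs => (h1 s hs).differentiableAt.differentiableWithinAt)
      (fun s hs => (h1 s hs).deriv) ht (show (0 : ℝ) ∈ Ioo (-ε) ε by simpa using hε)
    rw [this, (h z hz).1]
  refine ⟨ε, hε, fun w => (φ w).2, contDiff_snd.comp_contDiffOn hφ, fun z hz => ⟨?_, ?_⟩⟩
  · simp only [(h z hz).1]
  · intro t ht
    have h1 := (h z hz).2 t ht
    have h2 : (z.1, (φ (z, t)).2) = φ (z, t) := Prod.ext (hfst z hz t ht).symm rfl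
    rw [h2]
    exact ⟨h1.1, (ContinuousLinearMap.snd ℝ P G).hasFDerivAt.comp_hasDerivAt t h1.2⟩

end ODE
end OscGeom

end

noncomputable section

namespace OscGeom

/-! ### Tangent vectors and connections in a fixed chart. -/

section Charts

variable {n : ℕ} {M : Type*} [TopologicalSpace M] [ChartedSpace (EuclideanSpace ℝ (Fin n)) M]

local notation "E" => EuclideanSpace ℝ (Fin n)

/-- The domain of the preferred chart at `x₀`. -/
abbrev chartDom (n : ℕ) {M : Type*} [TopologicalSpace M]
    [ChartedSpace (EuclideanSpace ℝ (Fin n)) M] (x₀ : M) : Set M := (chartAt (EuclideanSpace ℝ (Fin n)) x₀).source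

/-- The preferred chart at `x₀`, with values in the model vector space. -/
abbrev cc (n : ℕ) {M : Type*} [TopologicalSpace M]
    [ChartedSpace (EuclideanSpace ℝ (Fin n)) M] (x₀ : M) : PartialEquiv M (EuclideanSpace ℝ (Fin n)) :=
  extChartAt (𝓡 n) x₀

theorem mem_cc_source {x₀ x : M} : x ∈ (cc n x₀).source ↔ x ∈ chartDom n x₀ := by
  rw [extChartAt_source]

theorem cc_symm_mem {x₀ : M} {y : E} (hy : y ∈ (cc n x₀).target) :
    (cc n x₀).symm y ∈ chartDom n x₀ :=
  mem_cc_source.1 ((cc n x₀).map_target hy)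

theorem cc_mem_target {x₀ x : M} (hx : x ∈ chartDom n x₀) : cc n x₀ x ∈ (cc n x₀).target :=
  (cc n x₀).map_source (mem_cc_source.2 hx)

theorem cc_left_inv {x₀ x : M} (hx : x ∈ chartDom n x₀) : (cc n x₀).symm (cc n x₀ x) = x :=
  (cc n x₀).left_inv (mem_cc_source.2 hx)

theorem isOpen_cc_target (x₀ : M) : IsOpen (cc n x₀).target := isOpen_extChartAt_target x₀

theorem isOpen_chartDom (x₀ : M) : IsOpen (chartDom n x₀) := (chartAt _ x₀).open_source

variable [IsManifold (𝓡 n) ∞ M]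

/-- The trivialization of the tangent bundle over the chart at `x₀`. -/
abbrev tt (n : ℕ) {M : Type*} [TopologicalSpace M]
    [ChartedSpace (EuclideanSpace ℝ (Fin n)) M] [IsManifold (𝓡 n) ∞ M] (x₀ : M) :=
  trivializationAt (EuclideanSpace ℝ (Fin n)) (TangentSpace (𝓡 n) : M → Type _) x₀

/-- Coordinates of tangent vectors in the chart at `x₀`. -/
def tc (x₀ x : M) : TangentSpace (𝓡 n) x →L[ℝ] E := (tt n x₀).continuousLinearMapAt ℝ x

/-- The tangent vector with given coordinates in the chart at `x₀`. -/
def ts (x₀ x : M) : E →L[ℝ] TangentSpace (𝓡 n) x := (tt n x₀).symmL ℝ x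

theorem mem_tt_baseSet {x₀ x : M} : x ∈ (tt n x₀).baseSet ↔ x ∈ chartDom n x₀ := Iff.rfl

theorem tc_eq {x₀ x : M} (hx : x ∈ chartDom n x₀) (v : TangentSpace (𝓡 n) x) :
    tc x₀ x v = (tt n x₀ ⟨x, v⟩).2 := by
  rw [tc, Bundle.Trivialization.continuousLinearMapAt_apply,
    Bundle.Trivialization.coe_linearMapAt_of_mem _ (mem_tt_baseSet.2 hx)]

theorem ts_eq {x₀ x : M} (hx : x ∈ chartDom n x₀) (v : E) : ts x₀ x v = (tt n x₀).symm x v :=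
  (tt n x₀).symmL_apply (mem_tt_baseSet.2 hx) v

theorem tc_ts {x₀ x : M} (hx : x ∈ chartDom n x₀) (a : E) : tc x₀ x (ts x₀ x a) = a :=
  (tt n x₀).continuousLinearMapAt_symmL (mem_tt_baseSet.2 hx) a

theorem ts_tc {x₀ x : M} (hx : x ∈ chartDom n x₀) (v : TangentSpace (𝓡 n) x) :
    ts x₀ x (tc x₀ x v) = v :=
  (tt n x₀).symmL_continuousLinearMapAt (mem_tt_baseSet.2 hx) v

theorem tc_injective {x₀ x : M} (hx : x ∈ chartDom n x₀) {v w : TangentSpace (𝓡 n) x}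
    (h : tc x₀ x v = tc x₀ x w) : v = w := by
  rw [← ts_tc hx v, h, ts_tc hx]

theorem hasMFDerivAt_cc {x₀ x : M} (hx : x ∈ chartDom n x₀) :
    HasMFDerivAt (𝓡 n) 𝓘(ℝ, E) (cc n x₀) x (tc x₀ x) := by
  rw [tc, TangentBundle.continuousLinearMapAt_trivializationAt hx]
  exact (mdifferentiableAt_extChartAt hx).hasMFDerivAt

theorem hasMFDerivAt_cc_symm {x₀ : M} {y : E} (hy : y ∈ (cc n x₀).target) :
    HasMFDerivAt 𝓘(ℝ, E) (𝓡 n) (cc n x₀).symm y (ts x₀ ((cc n x₀).symm y)) := by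
  rw [ts, TangentBundle.symmL_trivializationAt (cc_symm_mem hy), (cc n x₀).right_inv hy]
  have := (mdifferentiableWithinAt_extChartAt_symm (I := 𝓡 n) hy).hasMFDerivWithinAt
  rw [ModelWithCorners.range_eq_univ, hasMFDerivWithinAt_univ] at this
  rwa [ModelWithCorners.range_eq_univ]

section

variable {F : Type*} [NormedAddCommGroup F] [NormedSpace ℝ F]

theorem hasFDerivAt_comp_cc_symm {f : M → F} {x₀ x : M} (hx : x ∈ chartDom n x₀)
    (hf : MDifferentiableAt (𝓡 n) 𝓘(ℝ, F) f x) :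
    HasFDerivAt (fun y => f ((cc n x₀).symm y)) (mvfderiv (𝓡 n) f x ∘L ts x₀ x) (cc n x₀ x) := by
  have h1 := hasMFDerivAt_cc_symm (cc_mem_target hx)
  rw [cc_left_inv hx] at h1
  have h2 : HasMFDerivAt (𝓡 n) 𝓘(ℝ, F) f ((cc n x₀).symm (cc n x₀ x)) (mvfderiv (𝓡 n) f x) := by
    rw [cc_left_inv hx]
    exact hf.hasMFDerivAt
  exact (HasMFDerivAt.comp (cc n x₀ x) h2 h1).hasFDerivAt

theorem mvfderiv_eq {f : M → F} {x₀ x : M} (hx : x ∈ chartDom n x₀)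
    (hf : MDifferentiableAt (𝓡 n) 𝓘(ℝ, F) f x) (v : TangentSpace (𝓡 n) x) :
    mvfderiv (𝓡 n) f x v = fderiv ℝ (fun y => f ((cc n x₀).symm y)) (cc n x₀ x) (tc x₀ x v) := by
  rw [(hasFDerivAt_comp_cc_symm hx hf).fderiv, ContinuousLinearMap.comp_apply, ts_tc hx]

end

theorem mdifferentiableAt_ts (x₀ : M) {x : M} (hx : x ∈ chartDom n x₀) (a : E) :
    MDifferentiableAt (𝓡 n) (𝓡 n).tangent
      (fun y => (⟨y, ts x₀ y a⟩ : TangentBundle (𝓡 n) M)) x := by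
  refine ((tt n x₀).mdifferentiableAt_section_iff (𝓡 n) (fun y => ts x₀ y a)
    (mem_tt_baseSet.2 hx)).2 ?_
  refine (mdifferentiableAt_const (c := a)).congr_of_eventuallyEq ?_
  filter_upwards [(isOpen_chartDom x₀).mem_nhds hx] with y hy
  rw [← tc_eq hy, tc_ts hy]

theorem extend_eq {x : M} (v : TangentSpace (𝓡 n) x) {y : M} (hy : y ∈ chartDom n x) :
    FiberBundle.extend E v y = ts x y (tc x x v) := by
  rw [tc_eq (mem_chart_source _ x), ts_eq hy]
  rfl

/-- The Christoffel symbols in the chart at `x₀`: the coordinates of `∇_b e_a` where `e_a` has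
constant coordinates `a`. -/
def christ (cov : Conn n M) (x₀ : M) (y : E) : E →L[ℝ] E →L[ℝ] E :=
  ∑ i, (EuclideanSpace.proj i : E →L[ℝ] ℝ).smulRight
    (tc x₀ ((cc n x₀).symm y) ∘L
      cov (fun z => ts x₀ z (EuclideanSpace.single i 1)) ((cc n x₀).symm y) ∘L
        ts x₀ ((cc n x₀).symm y))

theorem cov_sum (cov : Conn n M) {ι : Type*} (s : Finset ι)
    (σ : ι → ∀ x : M, TangentSpace (𝓡 n) x) {x : M}
    (hσ : ∀ i ∈ s, MDifferentiableAt (𝓡 n) (𝓡 n).tangent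
      (fun y => (⟨y, σ i y⟩ : TangentBundle (𝓡 n) M)) x) :
    MDifferentiableAt (𝓡 n) (𝓡 n).tangent
      (fun y => (⟨y, (∑ i ∈ s, σ i) y⟩ : TangentBundle (𝓡 n) M)) x ∧
    cov (∑ i ∈ s, σ i) x = ∑ i ∈ s, cov (σ i) x := by
  classical
  induction s using Finset.induction_on with
  | empty =>
    refine ⟨?_, by simp⟩
    simp only [Finset.sum_empty]
    exact Bundle.mdifferentiableAt_zeroSection ℝ (TangentSpace (𝓡 n) : M → Type _)
  | insert i s hi ih =>
    obtain ⟨h1, h2⟩ := ih fun j hj => hσ j (Finset.mem_insert_of_mem hj)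
    have h3 := hσ i (Finset.mem_insert_self i s)
    rw [Finset.sum_insert hi, Finset.sum_insert hi]
    exact ⟨mdifferentiableAt_add_section h3 h1,
      (cov.isCovariantDerivativeOnUniv.add h3 h1).trans (by rw [h2])⟩

/-- A covariant derivative in coordinates. -/
theorem tc_cov (cov : Conn n M) {x₀ x : M} (hx : x ∈ chartDom n x₀)
    {σ : ∀ x : M, TangentSpace (𝓡 n) x}
    (hσ : MDifferentiableAt (𝓡 n) (𝓡 n).tangent
      (fun y => (⟨y, σ y⟩ : TangentBundle (𝓡 n) M)) x) (w : TangentSpace (𝓡 n) x) :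
    tc x₀ x (cov σ x w) = mvfderiv (𝓡 n) (fun y => tc x₀ y (σ y)) x w +
      christ cov x₀ (cc n x₀ x) (tc x₀ x (σ x)) (tc x₀ x w) := by
  have hcoord : MDifferentiableAt (𝓡 n) 𝓘(ℝ, E) (fun y => tc x₀ y (σ y)) x := by
    have := ((tt n x₀).mdifferentiableAt_section_iff (𝓡 n) σ (mem_tt_baseSet.2 hx)).1 hσ
    refine this.congr_of_eventuallyEq ?_
    filter_upwards [(isOpen_chartDom x₀).mem_nhds hx] with y hy
    rw [tc_eq hy]
  have hcomp : ∀ i, MDifferentiableAt (𝓡 n) 𝓘(ℝ, ℝ) (fun y => tc x₀ y (σ y) i) x := fun i =>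
    ((EuclideanSpace.proj i : E →L[ℝ] ℝ).mdifferentiableAt).comp x hcoord
  have hfr := fun i : Fin n => mdifferentiableAt_ts x₀ hx (EuclideanSpace.single i (1 : ℝ))
  have hterm : ∀ i ∈ (Finset.univ : Finset (Fin n)), MDifferentiableAt (𝓡 n) (𝓡 n).tangent
      (fun y => (⟨y, ((fun y => tc x₀ y (σ y) i) •
        (fun y => ts x₀ y (EuclideanSpace.single i (1 : ℝ)) : ∀ y, TangentSpace (𝓡 n) y)) y⟩ :
        TangentBundle (𝓡 n) M)) x := fun i _ =>
    (hcomp i).smul_section (hfr i)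
  obtain ⟨h1, h2⟩ := cov_sum cov Finset.univ (fun i => (fun y => tc x₀ y (σ y) i) •
        (fun y => ts x₀ y (EuclideanSpace.single i (1 : ℝ)) : ∀ y, TangentSpace (𝓡 n) y)) hterm
  have hdecomp : ∀ a : E, a = ∑ i, a i • EuclideanSpace.single i (1 : ℝ) := by
    intro a
    ext j
    simp [Finset.sum_apply, Pi.single_apply]
  -- The frame expansion of `σ` is valid only over the chart domain. Locality of the covariant
  -- derivative allows replacing `σ` by it before the Leibniz rule is applied.
  have hσ' : ∀ᶠ y in 𝓝 x, σ y = (∑ i, (fun y => tc x₀ y (σ y) i) •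
        (fun y => ts x₀ y (EuclideanSpace.single i (1 : ℝ)) : ∀ y, TangentSpace (𝓡 n) y)) y := by
    filter_upwards [(isOpen_chartDom x₀).mem_nhds hx] with y hy
    conv_lhs => rw [← ts_tc hy (σ y), hdecomp (tc x₀ y (σ y)), map_sum]
    simp only [map_smul, Finset.sum_apply]
    rfl
  have h3 := cov.isCovariantDerivativeOnUniv.congr_of_eventuallyEq hσ h1 univ_mem hσ'
  have h4 : ∀ i, tc x₀ x (cov ((fun y => tc x₀ y (σ y) i) •
        (fun y => ts x₀ y (EuclideanSpace.single i (1 : ℝ)) : ∀ y, TangentSpace (𝓡 n) y)) x w) =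
      tc x₀ x (σ x) i • tc x₀ x (cov (fun z => ts x₀ z (EuclideanSpace.single i 1)) x w) +
      mvfderiv (𝓡 n) (fun y => tc x₀ y (σ y) i) x w • EuclideanSpace.single i (1 : ℝ) := by
    intro i
    have := cov.isCovariantDerivativeOnUniv.leibniz (hfr i) (hcomp i)
    have h5 := congrArg (fun L => tc x₀ x (L w)) this
    refine h5.trans ?_
    simp only [_root_.add_apply, _root_.smul_apply,
      ContinuousLinearMap.smulRight_apply, map_add, map_smul]
    rw [tc_ts hx]
  have h5 : ∀ i, mvfderiv (𝓡 n) (fun y => tc x₀ y (σ y) i) x w =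
      mvfderiv (𝓡 n) (fun y => tc x₀ y (σ y)) x w i := by
    intro i
    have := (((EuclideanSpace.proj i : E →L[ℝ] ℝ).hasMFDerivAt).comp x
      hcoord.hasMFDerivAt).mfderiv
    exact congrArg (fun L => L w) this
  have h6 : cov σ x w = ∑ i, cov ((fun y => tc x₀ y (σ y) i) •
        (fun y => ts x₀ y (EuclideanSpace.single i (1 : ℝ)) : ∀ y, TangentSpace (𝓡 n) y)) x w := by
    have := congrArg (fun L => L w) (h3.trans h2)
    simpa using this
  rw [h6, map_sum]
  simp only [h4, h5, Finset.sum_add_distrib]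
  rw [← hdecomp, add_comm]
  congr 1
  simp only [christ, _root_.sum_apply, ContinuousLinearMap.smulRight_apply, _root_.smul_apply,
    ContinuousLinearMap.comp_apply]
  rw [cc_left_inv hx, ts_tc hx]
  rfl

end Charts
end OscGeom

end

noncomputable section

namespace OscGeom

/-! ### Changes of charts, covariant derivatives along curves, and Hessians. -/

section ChartChange

variable {n : ℕ} {M : Type*} [TopologicalSpace M] [ChartedSpace (EuclideanSpace ℝ (Fin n)) M]
  [IsManifold (𝓡 n) ∞ M]

local notation "E" => EuclideanSpace ℝ (Fin n)

/-- The change of coordinates of tangent vectors from the chart at `x₁` to the chart at `x₀`. -/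
def tch (x₁ x₀ x : M) : E →L[ℝ] E := tc x₀ x ∘L ts x₁ x

theorem tch_tc {x₁ x₀ x : M} (h₁ : x ∈ chartDom n x₁) (v : TangentSpace (𝓡 n) x) :
    tch x₁ x₀ x (tc x₁ x v) = tc x₀ x v := by
  rw [tch, ContinuousLinearMap.comp_apply, ts_tc h₁]

theorem contMDiffAt_tch {x₁ x₀ x : M} (h₁ : x ∈ chartDom n x₁) (h₀ : x ∈ chartDom n x₀) :
    ContMDiffAt (𝓡 n) 𝓘(ℝ, E →L[ℝ] E) ∞ (tch (n := n) x₁ x₀) x := by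
  refine (contMDiffAt_coordChangeL (n := ∞) (IB := 𝓡 n) (e := tt n x₁) (e' := tt n x₀)
    (mem_tt_baseSet.2 h₁) (mem_tt_baseSet.2 h₀)).congr_of_eventuallyEq ?_
  filter_upwards [(isOpen_chartDom x₁).mem_nhds h₁, (isOpen_chartDom x₀).mem_nhds h₀] with y hy₁ hy₀
  ext1 a
  rw [ContinuousLinearEquiv.coe_coe, Bundle.Trivialization.coordChangeL_apply _ _
    ⟨mem_tt_baseSet.2 hy₁, mem_tt_baseSet.2 hy₀⟩, tch, ContinuousLinearMap.comp_apply, tc_eq hy₀,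
    ts_eq hy₁]

theorem mdifferentiableAt_tch {x₁ x₀ x : M} (h₁ : x ∈ chartDom n x₁) (h₀ : x ∈ chartDom n x₀) :
    MDifferentiableAt (𝓡 n) 𝓘(ℝ, E →L[ℝ] E) (tch (n := n) x₁ x₀) x :=
  (contMDiffAt_tch h₁ h₀).mdifferentiableAt (by simp)

theorem mvfderiv_tch_apply {x₁ x₀ x : M} (h₁ : x ∈ chartDom n x₁) (h₀ : x ∈ chartDom n x₀)
    (a : E) (w : TangentSpace (𝓡 n) x) :
    mvfderiv (𝓡 n) (fun y => tch (n := n) x₁ x₀ y a) x w =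
      mvfderiv (𝓡 n) (tch (n := n) x₁ x₀) x w a := by
  have := ((ContinuousLinearMap.apply ℝ E a).hasMFDerivAt.comp x
    (mdifferentiableAt_tch h₁ h₀).hasMFDerivAt).mfderiv
  exact congrArg (fun L => L w) this

/-- Transformation law of the Christoffel symbols. -/
theorem christ_change (cov : Conn n M) {x₁ x₀ x : M} (h₁ : x ∈ chartDom n x₁)
    (h₀ : x ∈ chartDom n x₀) (a b : E) :
    christ cov x₀ (cc n x₀ x) (tch x₁ x₀ x a) (tch x₁ x₀ x b) =
      tch x₁ x₀ x (christ cov x₁ (cc n x₁ x) a b) -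
        mvfderiv (𝓡 n) (tch (n := n) x₁ x₀) x (ts x₁ x b) a := by
  have hσ := mdifferentiableAt_ts x₁ h₁ a
  have e0 := tc_cov cov h₀ hσ (ts x₁ x b)
  have e1 := tc_cov cov h₁ hσ (ts x₁ x b)
  have hconst : mvfderiv (𝓡 n) (fun y => tc x₁ y (ts x₁ y a)) x = 0 := by
    have : (fun y => tc x₁ y (ts x₁ y a)) =ᶠ[𝓝 x] fun _ => a := by
      filter_upwards [(isOpen_chartDom x₁).mem_nhds h₁] with y hy
      exact tc_ts hy a
    rw [mvfderiv, this.mfderiv_eq, mfderiv_const]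
    rfl
  rw [hconst, tc_ts h₁, tc_ts h₁, _root_.zero_apply, zero_add] at e1
  have e2 := mvfderiv_tch_apply h₁ h₀ a (ts x₁ x b)
  rw [← e1, tch_tc h₁, e0]
  change _ = mvfderiv (𝓡 n) (fun y => tch (n := n) x₁ x₀ y a) x (ts x₁ x b) +
    christ cov x₀ (cc n x₀ x) (tch x₁ x₀ x a) (tch x₁ x₀ x b) - _
  rw [e2]
  abel

section Curves

theorem hasDerivWithinAt_cc {γ : ℝ → M} {S : Set ℝ} {t : ℝ} {x₀ : M}
    (hx : γ t ∈ chartDom n x₀) (hγ : MDifferentiableWithinAt 𝓘(ℝ, ℝ) (𝓡 n) γ S t) :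
    HasDerivWithinAt (fun s => cc n x₀ (γ s))
      (tc x₀ (γ t) (mfderivWithin 𝓘(ℝ, ℝ) (𝓡 n) γ S t (1 : ℝ))) S t := by
  have h := (hasMFDerivAt_cc hx).comp_hasMFDerivWithinAt t hγ.hasMFDerivWithinAt
  have h' : HasFDerivWithinAt (fun s => cc n x₀ (γ s))
      (tc x₀ (γ t) ∘L mfderivWithin 𝓘(ℝ, ℝ) (𝓡 n) γ S t : ℝ →L[ℝ] E) S t := h.hasFDerivWithinAt
  exact h'.hasDerivWithinAt

theorem hasDerivWithinAt_comp_mvfderiv {F : Type*} [NormedAddCommGroup F] [NormedSpace ℝ F]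
    {f : M → F} {γ : ℝ → M} {S : Set ℝ} {t : ℝ}
    (hf : MDifferentiableAt (𝓡 n) 𝓘(ℝ, F) f (γ t))
    (hγ : MDifferentiableWithinAt 𝓘(ℝ, ℝ) (𝓡 n) γ S t) :
    HasDerivWithinAt (fun s => f (γ s))
      (mvfderiv (𝓡 n) f (γ t) (mfderivWithin 𝓘(ℝ, ℝ) (𝓡 n) γ S t (1 : ℝ))) S t := by
  have h := hf.hasMFDerivAt.comp_hasMFDerivWithinAt t hγ.hasMFDerivWithinAt
  have h' : HasFDerivWithinAt (fun s => f (γ s))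
      (mvfderiv (𝓡 n) f (γ t) ∘L mfderivWithin 𝓘(ℝ, ℝ) (𝓡 n) γ S t : ℝ →L[ℝ] F) S t :=
    h.hasFDerivWithinAt
  exact h'.hasDerivWithinAt

theorem uniqueDiffWithinAt_unitInterval {t : ℝ} (ht : t ∈ Icc (0 : ℝ) 1) :
    UniqueDiffWithinAt ℝ (Icc (0 : ℝ) 1) t := uniqueDiffOn_Icc zero_lt_one t ht

/-- The covariant derivative along a curve in coordinates. -/
theorem tc_covDerivAlong (cov : Conn n M) {γ : ℝ → M} {V : ∀ t, TangentSpace (𝓡 n) (γ t)} {t : ℝ}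
    (ht : t ∈ Icc (0 : ℝ) 1) {x₀ : M} (hx : γ t ∈ chartDom n x₀)
    (hV : MDifferentiableWithinAt 𝓘(ℝ, ℝ) (𝓡 n).tangent
      (fun s => (⟨γ s, V s⟩ : TangentBundle (𝓡 n) M)) (Icc 0 1) t) :
    DifferentiableWithinAt ℝ (fun s => tc x₀ (γ s) (V s)) (Icc 0 1) t ∧
    tc x₀ (γ t) (covDerivAlong cov γ V t) =
      derivWithin (fun s => tc x₀ (γ s) (V s)) (Icc 0 1) t +
        christ cov x₀ (cc n x₀ (γ t)) (tc x₀ (γ t) (V t)) (tc x₀ (γ t) (velocity γ t)) := by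
  set x₁ := γ t with hx₁
  have h₁ : γ t ∈ chartDom n x₁ := mem_chart_source _ _
  have hγ : MDifferentiableWithinAt 𝓘(ℝ, ℝ) (𝓡 n) γ (Icc 0 1) t :=
    (Bundle.mdifferentiableAt_proj (TangentSpace (𝓡 n) : M → Type _)).comp_mdifferentiableWithinAt t hV
  have hdom : ∀ x₂ : M, γ t ∈ chartDom n x₂ → ∀ᶠ s in 𝓝[Icc 0 1] t, γ s ∈ chartDom n x₂ :=
    fun x₂ h => hγ.continuousWithinAt.eventually ((isOpen_chartDom x₂).mem_nhds h)
  have hd : ∀ x₂ : M, γ t ∈ chartDom n x₂ →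
      DifferentiableWithinAt ℝ (fun s => tc x₂ (γ s) (V s)) (Icc 0 1) t := by
    intro x₂ h₂
    have := (((tt n x₂).mdifferentiableWithinAt_totalSpace_iff (𝓡 n)
      (fun s => (⟨γ s, V s⟩ : TangentBundle (𝓡 n) M)) h₂).1 hV).2
    refine this.differentiableWithinAt.congr_of_eventuallyEq ?_ (tc_eq h₂ _)
    filter_upwards [hdom x₂ h₂] with s hs
    exact tc_eq hs _
  refine ⟨hd x₀ hx, ?_⟩
  have hfirst : (tt n x₁).symm (γ t)
      (derivWithin (fun s : ℝ => (tt n x₁ ⟨γ s, V s⟩).2) (Icc 0 1) t) =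
      ts x₁ (γ t) (derivWithin (fun s => tc x₁ (γ s) (V s)) (Icc 0 1) t) := by
    rw [ts_eq h₁]
    congr 1
    refine Filter.EventuallyEq.derivWithin_eq_of_mem ?_ ht
    filter_upwards [hdom x₁ h₁] with s hs
    exact (tc_eq hs _).symm
  have hext : MDifferentiableAt (𝓡 n) (𝓡 n).tangent
      (fun y => (⟨y, FiberBundle.extend E (V t) y⟩ : TangentBundle (𝓡 n) M)) (γ t) := by
    apply FiberBundle.mdifferentiableAt_extend
  have hextev : (fun y => tc x₀ y (FiberBundle.extend E (V t) y)) =ᶠ[𝓝 (γ t)]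
      fun y => tch x₁ x₀ y (tc x₁ (γ t) (V t)) := by
    filter_upwards [(isOpen_chartDom x₁).mem_nhds h₁] with y hy
    rw [extend_eq _ hy]
    rfl
  -- `covDerivAlong` is defined in the chart at `γ t`. In another chart, the derivative of the
  -- transition map in this product rule equals the derivative of the coordinates of the constant
  -- extension, which enters through `tc_cov`.
  have hprod : HasDerivWithinAt (fun s => tc x₀ (γ s) (V s))
      (mvfderiv (𝓡 n) (tch (n := n) x₁ x₀) (γ t) (velocity γ t) (tc x₁ (γ t) (V t)) +
        tch x₁ x₀ (γ t) (derivWithin (fun s => tc x₁ (γ s) (V s)) (Icc 0 1) t)) (Icc 0 1) t := by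
    have h3 := (hasDerivWithinAt_comp_mvfderiv (mdifferentiableAt_tch h₁ hx) hγ).clm_apply
      (hd x₁ h₁).hasDerivWithinAt
    refine h3.congr_of_eventuallyEq ?_ (tch_tc h₁ _).symm
    filter_upwards [hdom x₁ h₁] with s hs
    exact (tch_tc hs _).symm
  rw [hprod.derivWithin (uniqueDiffWithinAt_unitInterval ht)]
  have hdef : covDerivAlong cov γ V t = ts x₁ (γ t)
      (derivWithin (fun s => tc x₁ (γ s) (V s)) (Icc 0 1) t) +
      cov (FiberBundle.extend E (V t)) (γ t) (velocity γ t) := by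
    rw [← hfirst]
    rfl
  rw [hdef, map_add, tc_cov cov hx hext, FiberBundle.extend_apply_self]
  have : mvfderiv (𝓡 n) (fun y => tc x₀ y (FiberBundle.extend E (V t) y)) (γ t) (velocity γ t) =
      mvfderiv (𝓡 n) (tch (n := n) x₁ x₀) (γ t) (velocity γ t) (tc x₁ (γ t) (V t)) := by
    rw [← mvfderiv_tch_apply h₁ hx, mvfderiv, hextev.mfderiv_eq]
    simp only [mvfderiv]
    rfl
  rw [this]
  change tch x₁ x₀ (γ t) _ + _ = _
  abel

end Curves

section Hess

variable {F : Type*} [NormedAddCommGroup F] [NormedSpace ℝ F]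

theorem contDiffAt_comp_cc_symm {f : M → F} {x₀ x : M} (hx : x ∈ chartDom n x₀) {m : ℕ∞}
    (hf : ContMDiffAt (𝓡 n) 𝓘(ℝ, F) m f x) :
    ContDiffAt ℝ m (fun y => f ((cc n x₀).symm y)) (cc n x₀ x) := by
  have h1 : ContMDiffAt 𝓘(ℝ, E) (𝓡 n) m (cc n x₀).symm (cc n x₀ x) :=
    ((contMDiffOn_extChartAt_symm (n := ∞) x₀).contMDiffAt
      ((isOpen_cc_target x₀).mem_nhds (cc_mem_target hx))).of_le (by exact_mod_cast le_top)
  have h2 : ContMDiffAt (𝓡 n) 𝓘(ℝ, F) m f ((cc n x₀).symm (cc n x₀ x)) := by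
    rwa [cc_left_inv hx]
  exact (h2.comp _ h1).contDiffAt

/-- The Hessian in coordinates. -/
theorem hess_eq (cov : Conn n M) {f : M → F} {x₀ x : M} (hx : x ∈ chartDom n x₀)
    (hf : ContMDiffAt (𝓡 n) 𝓘(ℝ, F) 2 f x) (v w : TangentSpace (𝓡 n) x) :
    hess cov f x v w =
      fderiv ℝ (fderiv ℝ (fun y => f ((cc n x₀).symm y))) (cc n x₀ x) (tc x₀ x w) (tc x₀ x v) -
      fderiv ℝ (fun y => f ((cc n x₀).symm y)) (cc n x₀ x)
        (christ cov x₀ (cc n x₀ x) (tc x₀ x v) (tc x₀ x w)) := by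
  have hext : MDifferentiableAt (𝓡 n) (𝓡 n).tangent
      (fun y => (⟨y, FiberBundle.extend E v y⟩ : TangentBundle (𝓡 n) M)) x := by
    apply FiberBundle.mdifferentiableAt_extend
  have hcoord : MDifferentiableAt (𝓡 n) 𝓘(ℝ, E) (fun y => tc x₀ y (FiberBundle.extend E v y)) x := by
    have := ((tt n x₀).mdifferentiableAt_section_iff (𝓡 n) (FiberBundle.extend E v)
      (mem_tt_baseSet.2 hx)).1 hext
    refine this.congr_of_eventuallyEq ?_
    filter_upwards [(isOpen_chartDom x₀).mem_nhds hx] with y hy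
    rw [tc_eq hy]
  have hfd : MDifferentiableAt (𝓡 n) 𝓘(ℝ, F) f x := hf.mdifferentiableAt (by simp)
  set G : E → F := fun y => f ((cc n x₀).symm y) with hG
  have hG2 : ContDiffAt ℝ 2 G (cc n x₀ x) := contDiffAt_comp_cc_symm (m := 2) hx hf
  have hG1 : DifferentiableAt ℝ (fderiv ℝ G) (cc n x₀ x) :=
    (hG2.fderiv_right (m := 1) (by norm_num)).differentiableAt (by simp)
  have hGM : MDifferentiableAt (𝓡 n) 𝓘(ℝ, E →L[ℝ] F) (fun y => fderiv ℝ G (cc n x₀ y)) x :=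
    hG1.mdifferentiableAt.comp x (hasMFDerivAt_cc hx).mdifferentiableAt
  have hev : (fun y => mvfderiv (𝓡 n) f y (FiberBundle.extend E v y)) =ᶠ[𝓝 x]
      fun y => fderiv ℝ G (cc n x₀ y) (tc x₀ y (FiberBundle.extend E v y)) := by
    have h1 : ∀ᶠ y in 𝓝 x, ContMDiffAt (𝓡 n) 𝓘(ℝ, F) 2 f y :=
      (contMDiffAt_iff_contMDiffAt_nhds (by simp)).1 hf
    filter_upwards [(isOpen_chartDom x₀).mem_nhds hx, h1] with y hy hfy
    exact mvfderiv_eq hy (hfy.mdifferentiableAt (by simp)) _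
  -- The second summand depends on the extension of `v`. The same term comes out of `tc_cov` for the
  -- covariant derivative of the extension, and the two cancel.
  have hder : mvfderiv (𝓡 n) (fun y => mvfderiv (𝓡 n) f y (FiberBundle.extend E v y)) x w =
      fderiv ℝ (fderiv ℝ G) (cc n x₀ x) (tc x₀ x w) (tc x₀ x v) +
      fderiv ℝ G (cc n x₀ x)
        (mvfderiv (𝓡 n) (fun y => tc x₀ y (FiberBundle.extend E v y)) x w) := by
    rw [mvfderiv, hev.mfderiv_eq]
    have hcx := cc_left_inv hx
    have hmd : MDifferentiableAt (𝓡 n) 𝓘(ℝ, F)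
        (fun y => fderiv ℝ G (cc n x₀ y) (tc x₀ y (FiberBundle.extend E v y))) x :=
      hGM.clm_apply hcoord
    change mvfderiv (𝓡 n) (fun y => fderiv ℝ G (cc n x₀ y) (tc x₀ y (FiberBundle.extend E v y)))
      x w = _
    rw [mvfderiv_eq hx hmd, mvfderiv_eq hx hcoord]
    have h5 : (fun y => fderiv ℝ G (cc n x₀ ((cc n x₀).symm y))
        (tc x₀ ((cc n x₀).symm y) (FiberBundle.extend E v ((cc n x₀).symm y)))) =ᶠ[𝓝 (cc n x₀ x)]
        fun y => fderiv ℝ G y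
          (tc x₀ ((cc n x₀).symm y) (FiberBundle.extend E v ((cc n x₀).symm y))) := by
      filter_upwards [(isOpen_cc_target x₀).mem_nhds (cc_mem_target hx)] with y hy
      rw [(cc n x₀).right_inv hy]
    rw [h5.fderiv_eq]
    have h6 := (hG1.hasFDerivAt).clm_apply (hasFDerivAt_comp_cc_symm hx hcoord).differentiableAt.hasFDerivAt
    rw [h6.fderiv]
    simp only [_root_.add_apply, ContinuousLinearMap.comp_apply, ContinuousLinearMap.flip_apply]
    rw [hcx, FiberBundle.extend_apply_self, add_comm]
  rw [hess, hder, mvfderiv_eq hx hfd, tc_cov cov hx hext, FiberBundle.extend_apply_self, map_add]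
  abel

/-- The Christoffel symbols of a torsion-free connection are symmetric at the centre of the
chart. -/
theorem christ_symm (cov : Conn n M) (htor : cov.torsion = 0) (x : M) (a b : E) :
    christ cov x (cc n x x) a b = christ cov x (cc n x x) b a := by
  have hx : x ∈ chartDom n x := mem_chart_source _ x
  have ha := mdifferentiableAt_ts x hx a
  have hb := mdifferentiableAt_ts x hx b
  have h := CovariantDerivative.torsion_eq_zero_iff cov |>.1 htor ha hb
  -- Coordinate fields commute: their pullbacks to the chart are constant.
  have hbr : VectorField.mlieBracket (𝓡 n) (fun y => ts x y a) (fun y => ts x y b) x = 0 := by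
    have hp : ∀ a : E, (VectorField.mpullbackWithin 𝓘(ℝ, E) (𝓡 n) (cc n x).symm
        (fun y => ts x y a) (range (𝓡 n))) =ᶠ[𝓝 (cc n x x)] fun _ => a := by
      intro a
      filter_upwards [(isOpen_cc_target x).mem_nhds (cc_mem_target hx)] with y hy
      rw [VectorField.mpullbackWithin_apply, ModelWithCorners.range_eq_univ, mfderivWithin_univ,
        (hasMFDerivAt_cc_symm hy).mfderiv]
      have hinv : ((ts x ((cc n x).symm y)) : E →L[ℝ] TangentSpace (𝓡 n) ((cc n x).symm y)).IsInvertible :=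
        ContinuousLinearMap.IsInvertible.of_inverse (g := tc x ((cc n x).symm y))
          (by ext1 v; exact ts_tc (cc_symm_mem hy) v) (by ext1 v; exact tc_ts (cc_symm_mem hy) v)
      exact hinv.inverse_apply_eq.2 rfl
    have hbr : ∀ V W : E → E, V =ᶠ[𝓝 (cc n x x)] (fun _ => a) → W =ᶠ[𝓝 (cc n x x)] (fun _ => b) →
        VectorField.lieBracketWithin ℝ V W (range (𝓡 n)) (cc n x x) = 0 := by
      intro V W hV hW
      rw [ModelWithCorners.range_eq_univ, VectorField.lieBracketWithin_univ,
        hV.lieBracket_vectorField_eq hW]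
      simp [VectorField.lieBracket]
    rw [← VectorField.mlieBracketWithin_univ, VectorField.mlieBracketWithin_apply, preimage_univ,
      univ_inter]
    exact (congrArg _ (hbr _ _ (hp a) (hp b))).trans (map_zero _)
  have key : ∀ a b : E, tc x x (cov (fun y => ts x y a) x (ts x x b)) =
      christ cov x (cc n x x) a b := by
    intro a b
    have e1 := tc_cov cov hx (mdifferentiableAt_ts x hx a) (ts x x b)
    have hconst : mvfderiv (𝓡 n) (fun y => tc x y (ts x y a)) x = 0 := by
      have : (fun y => tc x y (ts x y a)) =ᶠ[𝓝 x] fun _ => a := by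
        filter_upwards [(isOpen_chartDom x).mem_nhds hx] with y hy
        exact tc_ts hy a
      rw [mvfderiv, this.mfderiv_eq, mfderiv_const]
      rfl
    rwa [hconst, tc_ts hx, tc_ts hx, _root_.zero_apply, zero_add] at e1
  rw [hbr, sub_eq_zero] at h
  rw [← key, ← key, h]

/-- In the chart centred at `x`, both the second derivative and the Christoffel symbols are
symmetric. -/
theorem hess_symm (cov : Conn n M) (htor : cov.torsion = 0) {f : M → F} {x : M}
    (hf : ContMDiffAt (𝓡 n) 𝓘(ℝ, F) 2 f x) (v w : TangentSpace (𝓡 n) x) :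
    hess cov f x v w = hess cov f x w v := by
  have hx : x ∈ chartDom n x := mem_chart_source _ x
  rw [hess_eq cov hx hf, hess_eq cov hx hf, christ_symm cov htor]
  congr 1
  have hG2 : ContDiffAt ℝ 2 (fun y => f ((cc n x).symm y)) (cc n x x) :=
    contDiffAt_comp_cc_symm (m := 2) hx hf
  exact (hG2.isSymmSndFDerivAt (by simp)) _ _

end Hess

end ChartChange
end OscGeom

end

noncomputable section

namespace OscGeom

/-! ### The geodesic equation with a transported vector, as a first-order ODE on states. -/

section States

variable {n : ℕ} {M : Type*} [TopologicalSpace M] [ChartedSpace (EuclideanSpace ℝ (Fin n)) M]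

local notation "E" => EuclideanSpace ℝ (Fin n)

/-- A point of the manifold with two tangent vectors: the velocity of a geodesic and a vector that
is transported along it. -/
structure GState (n : ℕ) (M : Type*) [TopologicalSpace M]
    [ChartedSpace (EuclideanSpace ℝ (Fin n)) M] where
  pt : M
  vel : TangentSpace (𝓡 n) pt
  vec : TangentSpace (𝓡 n) pt

variable [IsManifold (𝓡 n) ∞ M]

/-- Coordinates of a state. -/
def rd (x₀ : M) (ξ : GState n M) : E × E × E :=
  (cc n x₀ ξ.pt, tc x₀ ξ.pt ξ.vel, tc x₀ ξ.pt ξ.vec)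

/-- The state with given coordinates. -/
def wr (x₀ : M) (y : E × E × E) : GState n M :=
  ⟨(cc n x₀).symm y.1, ts x₀ _ y.2.1, ts x₀ _ y.2.2⟩

theorem rd_wr {x₀ : M} {y : E × E × E} (hy : y.1 ∈ (cc n x₀).target) : rd x₀ (wr x₀ y) = y := by
  exact Prod.ext ((cc n x₀).right_inv hy)
    (Prod.ext (tc_ts (cc_symm_mem hy) _) (tc_ts (cc_symm_mem hy) _))

theorem wr_rd {x₀ : M} {ξ : GState n M} (h : ξ.pt ∈ chartDom n x₀) : wr x₀ (rd x₀ ξ) = ξ := by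
  obtain ⟨x, v, w⟩ := ξ
  simp only [rd, wr]
  have key : ∀ x', x' = x → (⟨x', ts x₀ x' (tc x₀ x v), ts x₀ x' (tc x₀ x w)⟩ : GState n M) =
      ⟨x, v, w⟩ := by
    rintro _ rfl
    rw [ts_tc h, ts_tc h]
  exact key _ (cc_left_inv h)

theorem wr_pt_mem {x₀ : M} {y : E × E × E} (hy : y.1 ∈ (cc n x₀).target) :
    (wr x₀ y).pt ∈ chartDom n x₀ := cc_symm_mem hy

/-- The geodesic field on states, with Christoffel symbols `Γ`. -/
def geoField (Γ : E → E →L[ℝ] E →L[ℝ] E) (y : E × E × E) : E × E × E :=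
  (y.2.1, -Γ y.1 y.2.1 y.2.1, -Γ y.1 y.2.2 y.2.1)

theorem contDiffAt_cc_cc_symm {x₀ x₁ x : M} (h₀ : x ∈ chartDom n x₀) (h₁ : x ∈ chartDom n x₁) :
    ContDiffAt ℝ ∞ (fun y => cc n x₁ ((cc n x₀).symm y)) (cc n x₀ x) :=
  contDiffAt_comp_cc_symm (m := ⊤) h₀ (contMDiffAt_extChartAt' h₁)

theorem contDiffAt_rd_wr {x₀ x₁ : M} {ξ : GState n M} (h₀ : ξ.pt ∈ chartDom n x₀)
    (h₁ : ξ.pt ∈ chartDom n x₁) :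
    ContDiffAt ℝ ∞ (fun y => rd x₁ (wr x₀ y)) (rd x₀ ξ) := by
  have h2 : ContDiffAt ℝ ∞ (fun y => tch (n := n) x₀ x₁ ((cc n x₀).symm y)) (cc n x₀ ξ.pt) :=
    contDiffAt_comp_cc_symm (m := ⊤) h₀ (contMDiffAt_tch h₀ h₁)
  have hf : ContDiffAt ℝ ∞ (fun y : E × E × E => y.1) (rd x₀ ξ) := contDiffAt_fst
  have hv : ContDiffAt ℝ ∞ (fun y : E × E × E => y.2.1) (rd x₀ ξ) := by fun_prop
  have hw : ContDiffAt ℝ ∞ (fun y : E × E × E => y.2.2) (rd x₀ ξ) := by fun_prop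
  have h3 : ContDiffAt ℝ ∞ (fun y : E × E × E => tch (n := n) x₀ x₁ ((cc n x₀).symm y.1)) (rd x₀ ξ) :=
    h2.comp (f := fun y : E × E × E => y.1) (rd x₀ ξ) hf
  exact ((contDiffAt_cc_cc_symm h₀ h₁).comp (f := fun y : E × E × E => y.1) (rd x₀ ξ) hf).prodMk
    ((h3.clm_apply hv).prodMk (h3.clm_apply hw))

/-- The derivative of the transition map produced by the chain rule cancels the inhomogeneous term
in `christ_change`. Thus the geodesic fields of different charts describe the same equation. -/
theorem fderiv_rd_wr_geoField (cov : Conn n M) {x₀ x₁ : M} {ξ : GState n M}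
    (h₀ : ξ.pt ∈ chartDom n x₀) (h₁ : ξ.pt ∈ chartDom n x₁) :
    fderiv ℝ (fun y => rd x₁ (wr x₀ y)) (rd x₀ ξ) (geoField (christ cov x₀) (rd x₀ ξ)) =
      geoField (christ cov x₁) (rd x₁ ξ) := by
  have hd1 : HasFDerivAt (fun y : E × E × E => cc n x₁ ((cc n x₀).symm y.1))
      ((tc x₁ ξ.pt ∘L ts x₀ ξ.pt) ∘L .fst ℝ E (E × E)) (rd x₀ ξ) := by
    have h := hasFDerivAt_comp_cc_symm h₀ (hasMFDerivAt_cc h₁).mdifferentiableAt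
    have e : mvfderiv (𝓡 n) (cc n x₁) ξ.pt = tc x₁ ξ.pt := (hasMFDerivAt_cc h₁).mfderiv
    rw [e] at h
    exact h.comp (f := fun y : E × E × E => y.1) (rd x₀ ξ) hasFDerivAt_fst
  have hd2 : HasFDerivAt (fun y : E × E × E => tch (n := n) x₀ x₁ ((cc n x₀).symm y.1))
      ((mvfderiv (𝓡 n) (tch (n := n) x₀ x₁) ξ.pt ∘L ts x₀ ξ.pt) ∘L .fst ℝ E (E × E)) (rd x₀ ξ) :=
    (hasFDerivAt_comp_cc_symm h₀ (mdifferentiableAt_tch h₀ h₁)).comp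
      (f := fun y : E × E × E => y.1) (rd x₀ ξ) hasFDerivAt_fst
  have hv : HasFDerivAt (fun y : E × E × E => y.2.1) (.fst ℝ E E ∘L .snd ℝ E (E × E)) (rd x₀ ξ) :=
    hasFDerivAt_fst.comp (rd x₀ ξ) hasFDerivAt_snd
  have hw : HasFDerivAt (fun y : E × E × E => y.2.2) (.snd ℝ E E ∘L .snd ℝ E (E × E)) (rd x₀ ξ) :=
    hasFDerivAt_snd.comp (rd x₀ ξ) hasFDerivAt_snd
  have h := hd1.prodMk ((hd2.clm_apply hv).prodMk (hd2.clm_apply hw))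
  have h' : HasFDerivAt (fun y => rd x₁ (wr x₀ y)) _ (rd x₀ ξ) := h
  rw [h'.fderiv]
  have hv' : ts x₀ ξ.pt (rd x₀ ξ).2.1 = ξ.vel := ts_tc h₀ _
  have hw' : ts x₀ ξ.pt (rd x₀ ξ).2.2 = ξ.vec := ts_tc h₀ _
  have c1 := christ_change cov h₀ h₁ (rd x₀ ξ).2.1 (rd x₀ ξ).2.1
  have c2 := christ_change cov h₀ h₁ (rd x₀ ξ).2.2 (rd x₀ ξ).2.1
  have hx : (cc n x₀).symm (rd x₀ ξ).1 = ξ.pt := cc_left_inv h₀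
  have tv : tch x₀ x₁ ξ.pt (rd x₀ ξ).2.1 = (rd x₁ ξ).2.1 := tch_tc h₀ _
  have tw : tch x₀ x₁ ξ.pt (rd x₀ ξ).2.2 = (rd x₁ ξ).2.2 := tch_tc h₀ _
  rw [tv] at c1
  rw [tv, tw] at c2
  have e1 : cc n x₁ ξ.pt = (rd x₁ ξ).1 := rfl
  have e0 : cc n x₀ ξ.pt = (rd x₀ ξ).1 := rfl
  rw [e1, e0] at c1 c2
  refine Prod.ext ?_ (Prod.ext ?_ ?_)
  · exact tv
  · change tch x₀ x₁ ((cc n x₀).symm (rd x₀ ξ).1) (-_) +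
      mvfderiv (𝓡 n) (tch (n := n) x₀ x₁) ξ.pt (ts x₀ ξ.pt (rd x₀ ξ).2.1) (rd x₀ ξ).2.1 = -_
    rw [hx, c1, map_neg]
    abel
  · change tch x₀ x₁ ((cc n x₀).symm (rd x₀ ξ).1) (-_) +
      mvfderiv (𝓡 n) (tch (n := n) x₀ x₁) ξ.pt (ts x₀ ξ.pt (rd x₀ ξ).2.1) (rd x₀ ξ).2.2 = -_
    rw [hx, c2, map_neg]
    abel

section Smooth

variable {Z : Type*} [NormedAddCommGroup Z] [NormedSpace ℝ Z]

/-- Smoothness of a map into states. -/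
def SmAt (φ : Z → GState n M) (z : Z) : Prop :=
  ContinuousAt (fun z => (φ z).pt) z ∧
    ∀ x₀, (φ z).pt ∈ chartDom n x₀ → ContDiffAt ℝ ∞ (fun z => rd x₀ (φ z)) z

theorem smAt_of_chart {φ : Z → GState n M} {z : Z} {x₀ : M}
    (hc : ContinuousAt (fun z => (φ z).pt) z) (h₀ : (φ z).pt ∈ chartDom n x₀)
    (h : ContDiffAt ℝ ∞ (fun z => rd x₀ (φ z)) z) : SmAt φ z := by
  refine ⟨hc, fun x₁ h₁ => ?_⟩
  refine ((contDiffAt_rd_wr h₀ h₁).comp (f := fun z => rd x₀ (φ z)) z h).congr_of_eventuallyEq ?_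
  filter_upwards [hc.eventually ((isOpen_chartDom x₀).mem_nhds h₀)] with z' hz'
  simp only [Function.comp, wr_rd hz']

theorem smAt_wr {x₀ : M} {y : Z → E × E × E} {z : Z} (hy : ContDiffAt ℝ ∞ y z)
    (h : (y z).1 ∈ (cc n x₀).target) : SmAt (fun z => wr x₀ (y z)) z := by
  have hev : ∀ᶠ z' in 𝓝 z, (y z').1 ∈ (cc n x₀).target :=
    hy.continuousAt.fst.eventually ((isOpen_cc_target x₀).mem_nhds h)
  refine smAt_of_chart (x₀ := x₀) ?_ (wr_pt_mem h) (hy.congr_of_eventuallyEq ?_)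
  · exact ((continuousOn_extChartAt_symm x₀).continuousAt ((isOpen_cc_target x₀).mem_nhds h)).comp
      (f := fun z => (y z).1) hy.continuousAt.fst
  · filter_upwards [hev] with z' hz'
    exact rd_wr hz'

theorem SmAt.congr {φ ψ : Z → GState n M} {z : Z} (h : SmAt φ z) (he : ψ =ᶠ[𝓝 z] φ) : SmAt ψ z := by
  refine ⟨h.1.congr (he.mono fun z' hz' => by simp only [hz']), fun x₀ hx => ?_⟩
  refine (h.2 x₀ (by rwa [← he.self_of_nhds])).congr_of_eventuallyEq ?_
  exact he.mono fun z' hz' => by simp only [hz']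

theorem SmAt.comp {Y : Type*} [NormedAddCommGroup Y] [NormedSpace ℝ Y] {φ : Z → GState n M}
    {g : Y → Z} {y : Y} (h : SmAt φ (g y)) (hg : ContDiffAt ℝ ∞ g y) : SmAt (fun y => φ (g y)) y :=
  ⟨ContinuousAt.comp (f := g) h.1 hg.continuousAt, fun x₀ hx => ContDiffAt.comp (f := g) y (h.2 x₀ hx) hg⟩

theorem SmAt.contMDiffAt_pt {φ : Z → GState n M} {z : Z} (h : SmAt φ z) :
    ContMDiffAt 𝓘(ℝ, Z) (𝓡 n) ∞ (fun z => (φ z).pt) z := by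
  have hx : (φ z).pt ∈ chartDom n (φ z).pt := mem_chart_source _ _
  have h2 := (h.2 _ hx).fst.contMDiffAt
  have h3 : ContMDiffAt 𝓘(ℝ, E) (𝓡 n) ∞ (cc n (φ z).pt).symm (cc n (φ z).pt (φ z).pt) :=
    (contMDiffOn_extChartAt_symm _).contMDiffAt ((isOpen_cc_target _).mem_nhds (cc_mem_target hx))
  refine (ContMDiffAt.comp (f := fun z' => cc n (φ z).pt (φ z').pt) z h3 h2).congr_of_eventuallyEq ?_
  filter_upwards [h.1.eventually ((isOpen_chartDom _).mem_nhds hx)] with z' hz'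
  exact (cc_left_inv hz').symm

theorem SmAt.scale {φ : Z → GState n M} {z : Z} (h : SmAt φ z) (c d : ℝ) :
    SmAt (fun z => (⟨(φ z).pt, c • (φ z).vel, d • (φ z).vec⟩ : GState n M)) z := by
  refine ⟨h.1, fun x₀ hx => ?_⟩
  have h2 := h.2 x₀ hx
  have e : (fun z => rd x₀ (⟨(φ z).pt, c • (φ z).vel, d • (φ z).vec⟩ : GState n M)) =
      fun z => ((rd x₀ (φ z)).1, c • (rd x₀ (φ z)).2.1, d • (rd x₀ (φ z)).2.2) := by
    funext z
    simp [rd]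
  rw [e]
  exact h2.fst.prodMk ((h2.snd.fst.const_smul c).prodMk (h2.snd.snd.const_smul d))

end Smooth

/-- At time `t` the curve of states `W` on `S` solves the geodesic equation, and its last vector is
parallel. -/
def IsSol (cov : Conn n M) (S : Set ℝ) (W : ℝ → GState n M) (t : ℝ) : Prop :=
  ContinuousWithinAt (fun s => (W s).pt) S t ∧ ∀ x₀, (W t).pt ∈ chartDom n x₀ →
    HasDerivWithinAt (fun s => rd x₀ (W s)) (geoField (christ cov x₀) (rd x₀ (W t))) S t

variable {cov : Conn n M} {S : Set ℝ} {W : ℝ → GState n M} {t : ℝ}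

/-- By `fderiv_rd_wr_geoField` and the chain rule, it suffices to check the equation in one chart.
-/
theorem isSol_of_chart {x₀ : M} (hc : ContinuousWithinAt (fun s => (W s).pt) S t)
    (h₀ : (W t).pt ∈ chartDom n x₀)
    (h : HasDerivWithinAt (fun s => rd x₀ (W s)) (geoField (christ cov x₀) (rd x₀ (W t))) S t) :
    IsSol cov S W t := by
  refine ⟨hc, fun x₁ h₁ => ?_⟩
  have h2 := ((contDiffAt_rd_wr h₀ h₁).differentiableAt (by simp)).hasFDerivAt.comp_hasDerivWithinAt t h
  rw [fderiv_rd_wr_geoField cov h₀ h₁] at h2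
  refine h2.congr_of_eventuallyEq ?_ (by simp only [Function.comp, wr_rd h₀])
  filter_upwards [hc.eventually ((isOpen_chartDom x₀).mem_nhds h₀)] with s hs
  simp only [Function.comp, wr_rd hs]

theorem isSol_wr {x₀ : M} {y : ℝ → E × E × E} (h : (y t).1 ∈ (cc n x₀).target)
    (hy : HasDerivWithinAt y (geoField (christ cov x₀) (y t)) S t) :
    IsSol cov S (fun s => wr x₀ (y s)) t := by
  have hev : ∀ᶠ s in 𝓝[S] t, (y s).1 ∈ (cc n x₀).target :=
    hy.continuousWithinAt.fst.eventually ((isOpen_cc_target x₀).mem_nhds h)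
  refine isSol_of_chart (x₀ := x₀) ?_ (wr_pt_mem h) ?_
  · exact ((continuousOn_extChartAt_symm x₀).continuousAt
      ((isOpen_cc_target x₀).mem_nhds h)).comp_continuousWithinAt
      (f := fun z => (y z).1) hy.continuousWithinAt.fst
  · rw [rd_wr h]
    exact hy.congr_of_eventuallyEq (hev.mono fun s hs => rd_wr hs) (rd_wr h)

theorem IsSol.mono {T : Set ℝ} (h : IsSol cov S W t) (hT : T ⊆ S) : IsSol cov T W t :=
  ⟨h.1.mono hT, fun x₀ hx => (h.2 x₀ hx).mono hT⟩

theorem IsSol.congr {W' : ℝ → GState n M} (h : IsSol cov S W t) (he : W' =ᶠ[𝓝[S] t] W)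
    (ht : W' t = W t) : IsSol cov S W' t := by
  refine ⟨h.1.congr_of_eventuallyEq (he.mono fun z' hz' => by simp only [hz']) (by simp only [ht]), fun x₀ hx => ?_⟩
  rw [ht]
  refine (h.2 x₀ (by rwa [← ht])).congr_of_eventuallyEq (he.mono fun z' hz' => by simp only [hz']) (by simp only [ht])

/-- Affine reparametrization. -/
theorem IsSol.affine {S' : Set ℝ} {c l : ℝ} (h : IsSol cov S W (c + l * t))
    (hm : MapsTo (fun s => c + l * s) S' S) :
    IsSol cov S' (fun s => ⟨(W (c + l * s)).pt, l • (W (c + l * s)).vel, (W (c + l * s)).vec⟩) t := by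
  have hd : HasDerivWithinAt (fun s : ℝ => c + l * s) l S' t := by
    simpa using ((hasDerivWithinAt_id t S').const_mul l).const_add c
  refine ⟨h.1.comp (f := fun s => c + l * s) hd.continuousWithinAt hm, fun x₀ hx => ?_⟩
  have h2 := (h.2 x₀ hx).scomp (h := fun s : ℝ => c + l * s) t hd hm
  let L : E × E × E →L[ℝ] E × E × E := (ContinuousLinearMap.id ℝ E).prodMap
    ((l • ContinuousLinearMap.id ℝ E).prodMap (ContinuousLinearMap.id ℝ E))
  have h3 := L.hasFDerivAt.comp_hasDerivWithinAt t h2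
  have e : L (l • geoField (christ cov x₀) (rd x₀ (W (c + l * t)))) =
      geoField (christ cov x₀) (rd x₀ ⟨(W (c + l * t)).pt, l • (W (c + l * t)).vel,
        (W (c + l * t)).vec⟩) := by
    simp [geoField, rd, L]
  rw [e] at h3
  refine h3.congr_of_eventuallyEq (Eventually.of_forall fun s => ?_) ?_ <;> simp [rd, L]

/-- The last vector of a solution enters linearly. -/
theorem IsSol.lincomb {γ : ℝ → M} {V A B : ∀ t, TangentSpace (𝓡 n) (γ t)} (c d : ℝ)
    (hA : IsSol cov S (fun s => ⟨γ s, V s, A s⟩) t) (hB : IsSol cov S (fun s => ⟨γ s, V s, B s⟩) t) :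
    IsSol cov S (fun s => ⟨γ s, V s, c • A s + d • B s⟩) t := by
  refine ⟨hA.1, fun x₀ hx => ?_⟩
  have h1 := hA.2 x₀ hx
  have h2 := hB.2 x₀ hx
  have h3 := h1.prodMk h2
  let L : (E × E × E) × (E × E × E) →L[ℝ] E × E × E :=
    (ContinuousLinearMap.fst ℝ E (E × E) ∘L .fst ℝ (E × E × E) (E × E × E)).prod
    ((ContinuousLinearMap.fst ℝ E E ∘L .snd ℝ E (E × E) ∘L .fst ℝ (E × E × E) (E × E × E)).prod
    (c • (ContinuousLinearMap.snd ℝ E E ∘L .snd ℝ E (E × E) ∘L .fst ℝ (E × E × E) (E × E × E)) +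
      d • (ContinuousLinearMap.snd ℝ E E ∘L .snd ℝ E (E × E) ∘L .snd ℝ (E × E × E) (E × E × E))))
  have h4 := L.hasFDerivAt.comp_hasDerivWithinAt t h3
  have e : L (geoField (christ cov x₀) (rd x₀ ⟨γ t, V t, A t⟩),
      geoField (christ cov x₀) (rd x₀ ⟨γ t, V t, B t⟩)) =
      geoField (christ cov x₀) (rd x₀ ⟨γ t, V t, c • A t + d • B t⟩) := by
    simp [geoField, rd, L]
    abel
  rw [e] at h4
  refine h4.congr_of_eventuallyEq (Eventually.of_forall fun s => ?_) ?_ <;> simp [rd, L]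

/-- The restriction on the Christoffel symbols that makes the geodesic field smooth. -/
def SmoothConn (cov : Conn n M) : Prop :=
  ∀ x₀, ContDiffOn ℝ ∞ (christ cov x₀) (cc n x₀).target

theorem contDiffOn_geoField {P : Type*} [NormedAddCommGroup P] [NormedSpace ℝ P]
    {Γ : P → E → E →L[ℝ] E →L[ℝ] E} {T : Set E}
    (h : ContDiffOn ℝ ∞ (fun z : P × E => Γ z.1 z.2) (univ ×ˢ T)) :
    ContDiffOn ℝ ∞ (fun z : P × (E × E × E) => geoField (Γ z.1) z.2) (univ ×ˢ (T ×ˢ univ)) := by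
  have h1 : ContDiffOn ℝ ∞ (fun z : P × (E × E × E) => Γ z.1 z.2.1) (univ ×ˢ (T ×ˢ univ)) :=
    h.comp (f := fun z : P × (E × E × E) => (z.1, z.2.1)) (by fun_prop)
      fun z hz => ⟨mem_univ _, hz.2.1⟩
  have h2 : ContDiffOn ℝ ∞ (fun z : P × (E × E × E) => z.2.2.1) (univ ×ˢ (T ×ˢ univ)) := by fun_prop
  have h3 : ContDiffOn ℝ ∞ (fun z : P × (E × E × E) => z.2.2.2) (univ ×ˢ (T ×ˢ univ)) := by fun_prop
  exact h2.prodMk (((h1.clm_apply h2).clm_apply h2).neg.prodMk ((h1.clm_apply h3).clm_apply h2).neg)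

theorem SmoothConn.contDiffAt_geoField (hcov : SmoothConn cov) {x₀ : M} {y : E × E × E}
    (hy : y.1 ∈ (cc n x₀).target) : ContDiffAt ℝ ∞ (geoField (christ cov x₀)) y := by
  have h1 : ContDiffOn ℝ ∞ (fun z : ℝ × E => christ cov x₀ z.2) (univ ×ˢ (cc n x₀).target) :=
    (hcov x₀).comp (f := Prod.snd) contDiffOn_snd fun z hz => hz.2
  have h2 := (contDiffOn_geoField (Γ := fun _ : ℝ => christ cov x₀) h1).contDiffAt (x := ((0 : ℝ), y))
    ((isOpen_univ.prod ((isOpen_cc_target x₀).prod isOpen_univ)).mem_nhds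
      ⟨mem_univ _, hy, mem_univ _⟩)
  exact h2.comp (f := fun y : E × E × E => ((0 : ℝ), y)) y (by fun_prop)

/-- Uniqueness of solutions. -/
theorem IsSol.unique [T2Space M] (hcov : SmoothConn cov) {W' : ℝ → GState n M}
    (hS : S.OrdConnected) (h : ∀ s ∈ S, IsSol cov S W s) (h' : ∀ s ∈ S, IsSol cov S W' s)
    {a : ℝ} (ha : a ∈ S) (he : W a = W' a) : EqOn W W' S := by
  intro b hb
  refine interval_propagation (C := fun t => W t = W' t) hS ha hb he ?_
  intro t ht
  -- The local propagation hypothesis, in terms of filters. It holds vacuously near a time at which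
  -- the solutions differ.
  suffices hs : ∀ᶠ q : ℝ × ℝ in 𝓝[S] t ×ˢ 𝓝[S] t, W q.1 = W' q.1 → W q.2 = W' q.2 by
    rw [← nhdsWithin_prod_eq, Metric.nhdsWithin_basis_ball.eventually_iff] at hs
    obtain ⟨ε, hε, hball⟩ := hs
    refine ⟨ε, hε, fun t₁ ht₁ t₂ ht₂ h1 h2 => hball (x := (t₁, t₂)) ⟨?_, ht₁, ht₂⟩⟩
    rw [Metric.mem_ball, Prod.dist_eq, Real.dist_eq, Real.dist_eq]
    exact max_lt h1 h2
  have hne : (∀ᶠ s in 𝓝[S] t, W s ≠ W' s) →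
      ∀ᶠ q : ℝ × ℝ in 𝓝[S] t ×ˢ 𝓝[S] t, W q.1 = W' q.1 → W q.2 = W' q.2 := fun hn =>
    (hn.prod_inl _).mono fun q hq he => absurd he hq
  -- States carry no topology, so separation is checked in two stages: first the base points, by the
  -- Hausdorff property, and then, over a common base point, the coordinates in one chart.
  by_cases hpt : (W t).pt = (W' t).pt
  · have hx : (W t).pt ∈ chartDom n (W t).pt := mem_chart_source _ _
    have hx' : (W' t).pt ∈ chartDom n (W t).pt := hpt ▸ hx
    have e1 := (h t ht).1.eventually ((isOpen_chartDom _).mem_nhds hx)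
    have e2 := (h' t ht).1.eventually ((isOpen_chartDom _).mem_nhds hx')
    have d1 := (h t ht).2 _ hx
    have d2 := (h' t ht).2 _ hx'
    by_cases hrd : rd (W t).pt (W t) = rd (W t).pt (W' t)
    · have hde : ∀ {V : ℝ → GState n M}, (∀ s ∈ S, IsSol cov S V s) →
          (∀ᶠ s in 𝓝[S] t, (V s).pt ∈ chartDom n (W t).pt) →
          ∀ᶠ s in 𝓝[S] t, HasDerivWithinAt (fun s => rd (W t).pt (V s))
            (geoField (christ cov (W t).pt) (rd (W t).pt (V s))) S s := by
        intro V hV hev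
        filter_upwards [hev, self_mem_nhdsWithin] with s hs hsS
        exact (hV s hsS).2 _ hs
      obtain ⟨ε, hε, huniq⟩ := ode_unique_local
        ((hcov.contDiffAt_geoField (y := rd (W t).pt (W t)) (cc_mem_target hx)).of_le
          (by exact_mod_cast le_top)) hS (t₀ := t) (α := fun s => rd (W t).pt (W s)) (β := fun s => rd (W t).pt (W' s)) rfl hrd.symm
        d1.continuousWithinAt d2.continuousWithinAt (hde h e1) (hde h' e2)
      have hb : ∀ᶠ s in 𝓝[S] t, s ∈ S ∧ |s - t| < ε ∧ (W s).pt ∈ chartDom n (W t).pt ∧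
          (W' s).pt ∈ chartDom n (W t).pt := by
        filter_upwards [self_mem_nhdsWithin, e1, e2,
          nhdsWithin_le_nhds (Metric.ball_mem_nhds t hε)] with s h1 h2 h3 h4
        exact ⟨h1, h4, h2, h3⟩
      filter_upwards [hb.prod_mk hb] with q ⟨⟨a1, a2, a3, a4⟩, b1, b2, b3, b4⟩ hq
      have := huniq q.1 a1 q.2 b1 a2 b2 (by simp only [hq])
      rw [← wr_rd b3, ← wr_rd b4]
      exact congrArg _ this
    · refine hne ?_
      have hopen := d1.continuousWithinAt.tendsto.prodMk_nhds d2.continuousWithinAt.tendsto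
      have : ∀ᶠ q : (E × E × E) × (E × E × E) in
          𝓝 (rd (W t).pt (W t), rd (W t).pt (W' t)), q.1 ≠ q.2 :=
        (isOpen_ne_fun continuous_fst continuous_snd).mem_nhds hrd
      filter_upwards [hopen.eventually this] with s hs hEq
      exact hs (by simp only [hEq])
  · refine hne ?_
    have hopen := (h t ht).1.tendsto.prodMk_nhds (h' t ht).1.tendsto
    have : ∀ᶠ q : M × M in 𝓝 ((W t).pt, (W' t).pt), q.1 ≠ q.2 :=
      (isOpen_ne_fun continuous_fst continuous_snd).mem_nhds hpt
    filter_upwards [hopen.eventually this] with s hs hEq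
    exact hs (by simp only [hEq])

end States
end OscGeom

end

noncomputable section

namespace OscGeom

/-! ### Smooth families of connections in coordinates. -/

section Families

variable {n : ℕ} {M : Type*} [TopologicalSpace M] [ChartedSpace (EuclideanSpace ℝ (Fin n)) M]
  [IsManifold (𝓡 n) ∞ M]

local notation "E" => EuclideanSpace ℝ (Fin n)

theorem contMDiffAt_ts (x₀ : M) {x : M} (hx : x ∈ chartDom n x₀) (a : E) :
    ContMDiffAt (𝓡 n) (𝓡 n).tangent ∞
      (fun y => (⟨y, ts x₀ y a⟩ : TangentBundle (𝓡 n) M)) x := by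
  refine ((tt n x₀).contMDiffAt_section_iff (IB := 𝓡 n) (s := fun y => ts x₀ y a)
    (mem_tt_baseSet.2 hx)).2 ?_
  refine (contMDiffAt_const (c := a)).congr_of_eventuallyEq ?_
  filter_upwards [(isOpen_chartDom x₀).mem_nhds hx] with y hy
  rw [← tc_eq hy, tc_ts hy]

/-- A smooth family of connections, in coordinates. -/
def SmoothFam {P : Type*} [NormedAddCommGroup P] [NormedSpace ℝ P] (covF : P → Conn n M) : Prop :=
  ∀ x₀, ContDiffOn ℝ ∞ (fun z : P × E => christ (covF z.1) x₀ z.2) (univ ×ˢ (cc n x₀).target)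

theorem SmoothFam.smoothConn {P : Type*} [NormedAddCommGroup P] [NormedSpace ℝ P]
    {covF : P → Conn n M} (h : SmoothFam covF) (τ : P) : SmoothConn (covF τ) := fun x₀ =>
  (h x₀).comp (f := fun y => (τ, y)) (by fun_prop) fun _ hy => ⟨mem_univ _, hy⟩

/-- Locally, a smooth vector field agrees with a globally smooth one. -/
theorem exists_contMDiff_eventuallyEq [T2Space M] (x₀ : M) {x : M} (hx : x ∈ chartDom n x₀) (a : E) :
    ∃ Y : (x : M) → TangentSpace (𝓡 n) x,
      ContMDiff (𝓡 n) (𝓡 n).tangent ∞ (fun x => (⟨x, Y x⟩ : TangentBundle (𝓡 n) M)) ∧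
      ∀ᶠ y in 𝓝 x, Y y = ts x₀ y a := by
  obtain ⟨f, hf, -⟩ := (SmoothBumpFunction.nhds_basis_support (I := 𝓡 n) (c := x)
    ((isOpen_chartDom x₀).mem_nhds hx)).mem_iff.1 univ_mem
  refine ⟨fun y => f y • ts x₀ y a, fun y => ?_, ?_⟩
  · by_cases hy : y ∈ tsupport f
    · exact (f.contMDiffAt (x := y)).smul_section (contMDiffAt_ts x₀ (hf hy) a)
    · have h0 : ContMDiff (𝓡 n) (𝓡 n).tangent ∞
          (fun y => (⟨y, (0 : TangentSpace (𝓡 n) y)⟩ : TangentBundle (𝓡 n) M)) :=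
        Bundle.contMDiff_zeroSection ℝ (TangentSpace (𝓡 n) : M → Type _)
      refine (h0 y).congr_of_eventuallyEq ?_
      filter_upwards [(isClosed_tsupport f).isOpen_compl.mem_nhds hy] with z hz
      rw [image_eq_zero_of_notMem_tsupport hz, zero_smul]
  · filter_upwards [f.eventuallyEq_one] with y hy
    simp only [hy, Pi.one_apply, one_smul]

/-- The hypothesis tests connections on globally smooth fields only, while Christoffel symbols are
values on local frames. A frame field is cut off to a global one, and locality shows that the
covariant derivative is unchanged near the point. -/
theorem IsPerturbation.smoothFam [T2Space M] {cov : Conn n M} {U : Set M} {Φ : M → ℝ} {m : ℕ}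
    {covF : EuclideanSpace ℝ (Fin m) → Conn n M} {ΦF : EuclideanSpace ℝ (Fin m) → M → ℝ}
    (h : IsPerturbation cov U Φ covF ΦF) : SmoothFam covF := by
  rintro x₀ ⟨τ, y⟩ ⟨-, hy⟩
  refine ContDiffAt.contDiffWithinAt ?_
  unfold christ
  refine ContDiffAt.sum fun i _ => ?_
  set e : E := EuclideanSpace.single i 1
  suffices hs : ContDiffAt ℝ ∞ (fun z : EuclideanSpace ℝ (Fin m) × E =>
      (tc x₀ ((cc n x₀).symm z.2) ∘L covF z.1 (fun z => ts x₀ z e) ((cc n x₀).symm z.2) ∘L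
        ts x₀ ((cc n x₀).symm z.2) : E →L[ℝ] E)) (τ, y) from
    contDiffAt_const.smulRight hs
  set x := (cc n x₀).symm y with hxdef
  have hx : x ∈ chartDom n x₀ := cc_symm_mem hy
  have hxx : x ∈ chartDom n x := mem_chart_source _ x
  obtain ⟨Y, hY, hYe⟩ := exists_contMDiff_eventuallyEq x₀ hx e
  have h1 := ((Bundle.contMDiffAt_totalSpace).1 (h.cov_smooth Y hY (τ, x))).2
  have h1' : ContMDiffAt ((𝓡 m).prod (𝓡 n)) 𝓘(ℝ, E →L[ℝ] E) ∞
      (fun z : EuclideanSpace ℝ (Fin m) × M => tc x z.2 ∘L covF z.1 Y z.2 ∘L ts x z.2) (τ, x) := h1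
  have h2 : ContMDiffAt ((𝓡 m).prod (𝓡 n)) 𝓘(ℝ, E →L[ℝ] E) ∞
      (fun z : EuclideanSpace ℝ (Fin m) × M => tch (n := n) x x₀ z.2) (τ, x) :=
    (contMDiffAt_tch hxx hx).comp (f := Prod.snd) (τ, x) contMDiffAt_snd
  have h3 : ContMDiffAt ((𝓡 m).prod (𝓡 n)) 𝓘(ℝ, E →L[ℝ] E) ∞
      (fun z : EuclideanSpace ℝ (Fin m) × M => tch (n := n) x₀ x z.2) (τ, x) :=
    (contMDiffAt_tch hx hxx).comp (f := Prod.snd) (τ, x) contMDiffAt_snd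
  have h4 := h2.clm_comp (h1'.clm_comp h3)
  have h5 : ContMDiffAt 𝓘(ℝ, EuclideanSpace ℝ (Fin m) × E) ((𝓡 m).prod (𝓡 n)) ∞
      (fun z : EuclideanSpace ℝ (Fin m) × E => (z.1, (cc n x₀).symm z.2)) (τ, y) := by
    have h6 : ContMDiffAt 𝓘(ℝ, E) (𝓡 n) ∞ (cc n x₀).symm y :=
      (contMDiffOn_extChartAt_symm x₀).contMDiffAt ((isOpen_cc_target x₀).mem_nhds hy)
    exact (contDiffAt_fst.contMDiffAt).prodMk
      (ContMDiffAt.comp (f := Prod.snd) (τ, y) h6 contDiffAt_snd.contMDiffAt)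
  have h6 := (ContMDiffAt.comp (τ, y) (f := fun z : EuclideanSpace ℝ (Fin m) × E =>
    (z.1, (cc n x₀).symm z.2)) h4 h5).contDiffAt
  refine h6.congr_of_eventuallyEq ?_
  have hev : ∀ᶠ x' in 𝓝 x, x' ∈ chartDom n x₀ ∧ x' ∈ chartDom n x ∧
      ∀ᶠ y' in 𝓝 x', Y y' = ts x₀ y' e := by
    filter_upwards [(isOpen_chartDom x₀).mem_nhds hx, (isOpen_chartDom x).mem_nhds hxx,
      hYe.eventually_nhds] with _ a b c using ⟨a, b, c⟩
  have hcont : ContinuousAt (fun z : EuclideanSpace ℝ (Fin m) × E => (cc n x₀).symm z.2) (τ, y) :=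
    h5.continuousAt.snd
  filter_upwards [hcont.eventually hev] with z ⟨hz1, hz2, hz3⟩
  have hcoveq : covF z.1 (fun z => ts x₀ z e) ((cc n x₀).symm z.2) = covF z.1 Y ((cc n x₀).symm z.2) :=
    (covF z.1).isCovariantDerivativeOnUniv.congr_of_eventuallyEq (mdifferentiableAt_ts x₀ hz1 e)
      ((hY _).mdifferentiableAt (by simp)) univ_mem (hz3.mono fun _ h => h.symm)
  ext1 v
  simp only [Function.comp, ContinuousLinearMap.comp_apply, hcoveq, tch]
  rw [ts_tc hz2, ts_tc hz2]

/-- A smooth connection gives a constant perturbation. -/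
theorem isPerturbation_const {cov : Conn n M} (hcov : cov.ContMDiffCovariantDerivative ∞)
    (htor : cov.torsion = 0) {U : Set M} {Φ : M → ℝ} (hΦ : ContMDiffOn (𝓡 n) 𝓘(ℝ, ℝ) ∞ Φ U)
    (m : ℕ) : IsPerturbation cov U Φ (fun _ : EuclideanSpace ℝ (Fin m) => cov) (fun _ => Φ) where
  cov_zero := rfl
  phase_zero := rfl
  torsion_free _ := htor
  cov_smooth Y hY := by
    have h1 := hcov.contMDiff.contMDiff (σ := Y) (contMDiffOn_univ.2 hY)
    exact (contMDiffOn_univ.1 h1).comp contMDiff_snd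
  phase_smooth := hΦ.comp (f := Prod.snd) contMDiffOn_snd fun _ hz => hz.2

end Families

/-! ### Geodesics and parallel fields versus solutions of the ODE. -/

section Conversion

variable {n : ℕ} {M : Type*} [TopologicalSpace M] [ChartedSpace (EuclideanSpace ℝ (Fin n)) M]
  [IsManifold (𝓡 n) ∞ M]

local notation "E" => EuclideanSpace ℝ (Fin n)

theorem IsSol.hasDerivWithinAt {cov : Conn n M} {S : Set ℝ} {W : ℝ → GState n M} {t : ℝ}
    (h : IsSol cov S W t) {x₀ : M} (hx : (W t).pt ∈ chartDom n x₀) :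
    HasDerivWithinAt (fun s => cc n x₀ (W s).pt) (tc x₀ (W t).pt (W t).vel) S t ∧
    HasDerivWithinAt (fun s => tc x₀ (W s).pt (W s).vel) (-christ cov x₀ (cc n x₀ (W t).pt)
      (tc x₀ (W t).pt (W t).vel) (tc x₀ (W t).pt (W t).vel)) S t ∧
    HasDerivWithinAt (fun s => tc x₀ (W s).pt (W s).vec) (-christ cov x₀ (cc n x₀ (W t).pt)
      (tc x₀ (W t).pt (W t).vec) (tc x₀ (W t).pt (W t).vel)) S t :=
  ⟨(ContinuousLinearMap.fst ℝ E (E × E)).hasFDerivAt.comp_hasDerivWithinAt t (h.2 x₀ hx),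
    (ContinuousLinearMap.fst ℝ E E ∘L .snd ℝ E (E × E)).hasFDerivAt.comp_hasDerivWithinAt t
      (h.2 x₀ hx),
    (ContinuousLinearMap.snd ℝ E E ∘L .snd ℝ E (E × E)).hasFDerivAt.comp_hasDerivWithinAt t
      (h.2 x₀ hx)⟩

theorem tc_velocity {γ : ℝ → M} {t : ℝ} (ht : t ∈ Icc (0 : ℝ) 1) {x₀ : M}
    (hx : γ t ∈ chartDom n x₀) (hγ : MDifferentiableWithinAt 𝓘(ℝ, ℝ) (𝓡 n) γ (Icc 0 1) t) :
    tc x₀ (γ t) (velocity γ t) = derivWithin (fun s => cc n x₀ (γ s)) (Icc 0 1) t :=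
  ((hasDerivWithinAt_cc hx hγ).derivWithin (uniqueDiffWithinAt_unitInterval ht)).symm

theorem contMDiffOn_velocity {γ : ℝ → M} (hγ : ContMDiffOn 𝓘(ℝ, ℝ) (𝓡 n) ∞ γ (Icc 0 1)) :
    ContMDiffOn 𝓘(ℝ, ℝ) (𝓡 n).tangent ∞
      (fun t => (⟨γ t, velocity γ t⟩ : TangentBundle (𝓡 n) M)) (Icc 0 1) := by
  intro t ht
  refine Bundle.contMDiffWithinAt_totalSpace.2 ⟨hγ t ht, ?_⟩
  have hx : γ t ∈ chartDom n (γ t) := mem_chart_source _ _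
  have h1 : ContMDiffWithinAt 𝓘(ℝ, ℝ) 𝓘(ℝ, E) ∞ (fun s => cc n (γ t) (γ s)) (Icc 0 1) t :=
    (contMDiffAt_extChartAt' hx).comp_contMDiffWithinAt t (hγ t ht)
  have h2 := (h1.contDiffWithinAt.fderivWithin_right (uniqueDiffOn_Icc zero_lt_one) (m := ∞)
    (by simp) ht).clm_apply (contDiffWithinAt_const (c := (1 : ℝ)))
  refine ContMDiffWithinAt.congr_of_eventuallyEq h2.contMDiffWithinAt ?_ ?_
  · filter_upwards [self_mem_nhdsWithin, (hγ t ht).continuousWithinAt.eventually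
      ((isOpen_chartDom (γ t)).mem_nhds hx)] with s hs hsx
    rw [← tc_eq hsx, tc_velocity hs hsx ((hγ s hs).mdifferentiableWithinAt (by simp))]
    rfl
  · rw [← tc_eq hx, tc_velocity ht hx ((hγ t ht).mdifferentiableWithinAt (by simp))]
    rfl

theorem isSol_of_covDerivAlong {cov : Conn n M} {γ : ℝ → M} {V : ∀ t, TangentSpace (𝓡 n) (γ t)}
    (hγ : ContMDiffOn 𝓘(ℝ, ℝ) (𝓡 n) ∞ γ (Icc 0 1))
    (hgeo : ∀ t ∈ Icc (0 : ℝ) 1, covDerivAlong cov γ (velocity γ) t = 0)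
    (hV : IsParallel cov γ V) {t : ℝ} (ht : t ∈ Icc (0 : ℝ) 1) :
    IsSol cov (Icc 0 1) (fun s => ⟨γ s, velocity γ s, V s⟩) t := by
  have hx : γ t ∈ chartDom n (γ t) := mem_chart_source _ _
  have hd : ∀ {V : ∀ t, TangentSpace (𝓡 n) (γ t)}, MDifferentiableWithinAt 𝓘(ℝ, ℝ) (𝓡 n).tangent
      (fun s => (⟨γ s, V s⟩ : TangentBundle (𝓡 n) M)) (Icc 0 1) t → covDerivAlong cov γ V t = 0 →
      HasDerivWithinAt (fun s => tc (γ t) (γ s) (V s))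
        (-christ cov (γ t) (cc n (γ t) (γ t)) (tc (γ t) (γ t) (V t))
          (tc (γ t) (γ t) (velocity γ t))) (Icc 0 1) t := by
    intro V h1 h2
    obtain ⟨h3, h4⟩ := tc_covDerivAlong cov ht hx h1
    rw [h2, map_zero] at h4
    rw [← eq_neg_of_add_eq_zero_left h4.symm]
    exact h3.hasDerivWithinAt
  have hγd := (hγ t ht).mdifferentiableWithinAt (by simp)
  exact isSol_of_chart (x₀ := γ t) (hγ t ht).continuousWithinAt hx
    ((hasDerivWithinAt_cc hx hγd).prodMk
      ((hd ((contMDiffOn_velocity hγ t ht).mdifferentiableWithinAt (by simp)) (hgeo t ht)).prodMk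
      (hd ((hV.smooth t ht).mdifferentiableWithinAt (by simp)) (hV.parallel t ht))))

theorem IsGeodesicIn.isParallel_velocity {cov : Conn n M} {Ω : Set M} {p q : M} {γ : ℝ → M}
    (h : IsGeodesicIn cov Ω p q γ) : IsParallel cov γ (velocity γ) :=
  ⟨contMDiffOn_velocity h.smooth, h.geodesic⟩

theorem IsGeodesicIn.isSol {cov : Conn n M} {Ω : Set M} {p q : M} {γ : ℝ → M}
    (h : IsGeodesicIn cov Ω p q γ) {V : ∀ t, TangentSpace (𝓡 n) (γ t)} (hV : IsParallel cov γ V)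
    {t : ℝ} (ht : t ∈ Icc (0 : ℝ) 1) :
    IsSol cov (Icc 0 1) (fun s => ⟨γ s, velocity γ s, V s⟩) t :=
  isSol_of_covDerivAlong h.smooth h.geodesic hV ht

/-- The zero field arises as a trivial linear combination of the velocity. It gives a solution over
a geodesic when no transported vector is of interest. -/
theorem IsGeodesicIn.isSol_zero {cov : Conn n M} {Ω : Set M} {p q : M} {γ : ℝ → M}
    (h : IsGeodesicIn cov Ω p q γ) {t : ℝ} (ht : t ∈ Icc (0 : ℝ) 1) :
    IsSol cov (Icc 0 1) (fun s => ⟨γ s, velocity γ s, 0⟩) t := by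
  have h1 := h.isSol h.isParallel_velocity ht
  simpa using h1.lincomb 0 0 h1

/-- The converse of `isSol_of_covDerivAlong`: the first component of the equation forces `A` to be
the velocity, and the last one is then the vanishing of the covariant derivative. -/
theorem isParallel_of_isSol {cov : Conn n M} {γ : ℝ → M} {A V : ∀ t, TangentSpace (𝓡 n) (γ t)}
    (hγ : ContMDiffOn 𝓘(ℝ, ℝ) (𝓡 n).tangent ∞
      (fun t => (⟨γ t, V t⟩ : TangentBundle (𝓡 n) M)) (Icc 0 1))
    (h : ∀ t ∈ Icc (0 : ℝ) 1, IsSol cov (Icc 0 1) (fun s => ⟨γ s, A s, V s⟩) t) :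
    IsParallel cov γ V ∧ ∀ t ∈ Icc (0 : ℝ) 1, velocity γ t = A t := by
  have hγ' : ∀ t ∈ Icc (0 : ℝ) 1, MDifferentiableWithinAt 𝓘(ℝ, ℝ) (𝓡 n) γ (Icc 0 1) t := fun t ht =>
    (Bundle.mdifferentiableAt_proj (TangentSpace (𝓡 n) : M → Type _)).comp_mdifferentiableWithinAt
      t ((hγ t ht).mdifferentiableWithinAt (by simp))
  have hvel : ∀ t ∈ Icc (0 : ℝ) 1, velocity γ t = A t := by
    intro t ht
    have hx : γ t ∈ chartDom n (γ t) := mem_chart_source _ _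
    refine tc_injective hx ?_
    rw [tc_velocity ht hx (hγ' t ht)]
    exact ((h t ht).hasDerivWithinAt hx).1.derivWithin (uniqueDiffWithinAt_unitInterval ht)
  refine ⟨⟨hγ, fun t ht => ?_⟩, hvel⟩
  have hx : γ t ∈ chartDom n (γ t) := mem_chart_source _ _
  refine tc_injective hx ?_
  rw [(tc_covDerivAlong cov ht hx ((hγ t ht).mdifferentiableWithinAt (by simp))).2, map_zero]
  have h1 : derivWithin (fun s => tc (γ t) (γ s) (V s)) (Icc 0 1) t = _ :=
    ((h t ht).hasDerivWithinAt hx).2.2.derivWithin (uniqueDiffWithinAt_unitInterval ht)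
  rw [h1, hvel t ht]
  exact neg_add_cancel _

theorem SmAt.contMDiffAt_vec {Z : Type*} [NormedAddCommGroup Z] [NormedSpace ℝ Z]
    {φ : Z → GState n M} {z : Z} (h : SmAt φ z) :
    ContMDiffAt 𝓘(ℝ, Z) (𝓡 n).tangent ∞
      (fun z => (⟨(φ z).pt, (φ z).vec⟩ : TangentBundle (𝓡 n) M)) z := by
  refine Bundle.contMDiffAt_totalSpace.2 ⟨h.contMDiffAt_pt, ?_⟩
  have hx : (φ z).pt ∈ chartDom n (φ z).pt := mem_chart_source _ _
  refine ContMDiffAt.congr_of_eventuallyEq (h.2 _ hx).snd.snd.contMDiffAt ?_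
  filter_upwards [h.1.eventually ((isOpen_chartDom _).mem_nhds hx)] with z' hz'
  rw [← tc_eq hz']
  rfl

/-- The curve under a smooth solution is a geodesic. -/
theorem isGeodesicIn_of_isSol {cov : Conn n M} {W : ℝ → GState n M} {Ω : Set M}
    (hW : ∀ t ∈ Icc (0 : ℝ) 1, IsSol cov univ W t) (hs : ∀ t ∈ Icc (0 : ℝ) 1, SmAt W t)
    (hΩ : ∀ t ∈ Icc (0 : ℝ) 1, (W t).pt ∈ Ω) :
    IsGeodesicIn cov Ω (W 0).pt (W 1).pt (fun t => (W t).pt) ∧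
    ∀ t ∈ Icc (0 : ℝ) 1, velocity (fun t => (W t).pt) t = (W t).vel := by
  obtain ⟨h1, h2⟩ := isParallel_of_isSol (cov := cov) (A := fun t => (W t).vel)
    (fun t ht => (hs t ht).contMDiffAt_vec.contMDiffWithinAt)
    (fun t ht => (hW t ht).mono (subset_univ _))
  have hsm : ContMDiffOn 𝓘(ℝ, ℝ) (𝓡 n) ∞ (fun t => (W t).pt) (Icc 0 1) :=
    fun t ht => (hs t ht).contMDiffAt_pt.contMDiffWithinAt
  refine ⟨⟨hsm, ?_, hΩ, rfl, rfl⟩, h2⟩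
  have hvs := contMDiffOn_velocity hsm
  refine (isParallel_of_isSol (cov := cov) (A := fun t => (W t).vel) hvs fun t ht => ?_).1.parallel
  have h3 : IsSol cov (Icc 0 1) (fun s => (⟨(W s).pt, (W s).vel, (W s).vel⟩ : GState n M)) t := by
    refine ⟨(hW t ht).1.mono (subset_univ _), fun x₀ hx => ?_⟩
    obtain ⟨h4, h5, -⟩ := ((hW t ht).mono (subset_univ (Icc (0 : ℝ) 1))).hasDerivWithinAt hx
    exact h4.prodMk (h5.prodMk h5)
  refine h3.congr ?_ ?_
  · filter_upwards [self_mem_nhdsWithin] with s hs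
    simp only [h2 s hs]
  · simp only [h2 t ht]

/-- A solution over a geodesic determines the velocity and the transport of its last vector. -/
theorem eq_transport [T2Space M] {cov : Conn n M} (hcov : SmoothConn cov) {Ω : Set M} {p q : M}
    {γ : ℝ → M} (hγ : IsGeodesicIn cov Ω p q γ) {W : ℝ → GState n M}
    (hW : ∀ t ∈ Icc (0 : ℝ) 1, IsSol cov univ W t) (hs : ∀ t ∈ Icc (0 : ℝ) 1, SmAt W t)
    (hpt : ∀ t ∈ Icc (0 : ℝ) 1, (W t).pt = γ t) {u v : TangentSpace (𝓡 n) q}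
    (h1 : W 1 = ⟨q, u, v⟩) :
    (IsParallel cov γ (transport cov γ q v) ∧
      (⟨γ 1, transport cov γ q v 1⟩ : TangentBundle (𝓡 n) M) = ⟨q, v⟩) ∧
    ∀ t ∈ Icc (0 : ℝ) 1, W t = ⟨γ t, velocity γ t, transport cov γ q v t⟩ := by
  classical
  -- The base point of `W t` is only propositionally equal to `γ t`, so its vectors are first moved
  -- into the tangent spaces along `γ`; outside `[0,1]` the value is irrelevant.
  have hex : ∀ t, ∃ a b : TangentSpace (𝓡 n) (γ t), t ∈ Icc (0 : ℝ) 1 → W t = ⟨γ t, a, b⟩ := by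
    intro t
    by_cases ht : t ∈ Icc (0 : ℝ) 1
    · rw [← hpt t ht]
      exact ⟨(W t).vel, (W t).vec, fun _ => rfl⟩
    · exact ⟨0, 0, fun h => absurd h ht⟩
  choose A B hAB using hex
  have hsolAB : ∀ t ∈ Icc (0 : ℝ) 1, IsSol cov (Icc 0 1) (fun s => ⟨γ s, A s, B s⟩) t := by
    intro t ht
    refine ((hW t ht).mono (subset_univ (Icc (0 : ℝ) 1))).congr ?_ (hAB t ht).symm
    filter_upwards [self_mem_nhdsWithin] with s hs
    exact (hAB s hs).symm
  have hsm : ContMDiffOn 𝓘(ℝ, ℝ) (𝓡 n).tangent ∞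
      (fun t => (⟨γ t, B t⟩ : TangentBundle (𝓡 n) M)) (Icc 0 1) := by
    intro t ht
    have hcongr : ∀ s ∈ Icc (0 : ℝ) 1, (⟨γ s, B s⟩ : TangentBundle (𝓡 n) M) =
        ⟨(W s).pt, (W s).vec⟩ := by
      intro s hs
      rw [hAB s hs]
    exact ((hs t ht).contMDiffAt_vec.contMDiffWithinAt).congr hcongr (hcongr t ht)
  obtain ⟨hB, hA⟩ := isParallel_of_isSol hsm hsolAB
  have h11 : (1 : ℝ) ∈ Icc (0 : ℝ) 1 := ⟨zero_le_one, le_rfl⟩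
  have hend : (⟨γ 1, B 1⟩ : TangentBundle (𝓡 n) M) = ⟨q, v⟩ := by
    have h2 := hAB 1 h11
    rw [h1] at h2
    have := congrArg (fun ξ : GState n M => (⟨ξ.pt, ξ.vec⟩ : TangentBundle (𝓡 n) M)) h2
    exact this.symm
  have hexV : ∃ V : ∀ t, TangentSpace (𝓡 n) (γ t), IsParallel cov γ V ∧
      (⟨γ 1, V 1⟩ : TangentBundle (𝓡 n) M) = ⟨q, v⟩ := ⟨B, hB, hend⟩
  have htr : IsParallel cov γ (transport cov γ q v) ∧
      (⟨γ 1, transport cov γ q v 1⟩ : TangentBundle (𝓡 n) M) = ⟨q, v⟩ := by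
    rw [transport, dif_pos hexV]
    exact hexV.choose_spec
  refine ⟨htr, ?_⟩
  -- `transport` is some choice of a parallel field ending in `v`. It shares its state at time 1
  -- with the given solution, hence agrees with it on `[0,1]`.
  have huniq := IsSol.unique hcov ordConnected_Icc hsolAB (fun t ht => hγ.isSol htr.1 ht) h11
    (by
      have h2 := htr.2.trans hend.symm
      have h3 : transport cov γ q v 1 = B 1 := by
        have := (Bundle.TotalSpace.mk.injEq _ _ _ _ ▸ h2 : _ ∧ _).2
        exact eq_of_heq this
      simp only [h3, hA 1 h11])
  intro t ht
  rw [hAB t ht]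
  exact huniq ht

end Conversion
end OscGeom

end

noncomputable section

namespace OscGeom

/-! ### Smooth flows along a whole geodesic. -/

section Flow

variable {n : ℕ} {M : Type*} [TopologicalSpace M] [ChartedSpace (EuclideanSpace ℝ (Fin n)) M]
  [IsManifold (𝓡 n) ∞ M]

local notation "E" => EuclideanSpace ℝ (Fin n)

theorem IsSol.shift {cov : Conn n M} {W : ℝ → GState n M} {c t : ℝ} (h : IsSol cov univ W (t - c)) :
    IsSol cov univ (fun s => W (s - c)) t := by
  have e : ∀ s : ℝ, -c + 1 * s = s - c := fun s => by ring
  have h' : IsSol cov univ W (-c + 1 * t) := by rwa [e]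
  have h2 := h'.affine (mapsTo_univ _ univ)
  refine h2.congr (Eventually.of_forall fun s => ?_) ?_ <;>
    simp only [one_smul]
  · rw [← e s]
  · rw [← e t]

theorem IsSol.smul_vec {cov : Conn n M} {S : Set ℝ} {W : ℝ → GState n M} {t : ℝ} (c : ℝ)
    (h : IsSol cov S W t) : IsSol cov S (fun s => ⟨(W s).pt, (W s).vel, c • (W s).vec⟩) t := by
  have := IsSol.lincomb (γ := fun s => (W s).pt) (V := fun s => (W s).vel)
    (A := fun s => (W s).vec) (B := fun s => (W s).vec) c 0 h h
  simpa using this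

variable {P : Type} [NormedAddCommGroup P] [NormedSpace ℝ P] [FiniteDimensional ℝ P]

theorem exists_flow_near {covF : P → Conn n M} (hcov : SmoothFam covF) (τ₀ : P) {x₀ : M}
    {ξ : GState n M} (hξ : ξ.pt ∈ chartDom n x₀) :
    ∃ ε > 0, ∃ χ : (P × E × E × E) × ℝ → GState n M, ∀ z ∈ Metric.ball (τ₀, rd x₀ ξ) ε,
      z.2.1 ∈ (cc n x₀).target ∧ χ (z, 0) = wr x₀ z.2 ∧ ∀ s ∈ Ioo (-ε) ε, SmAt χ (z, s) ∧
        IsSol (covF z.1) univ (fun s => χ (z, s)) s := by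
  obtain ⟨ε, hε, φ, hφ, h⟩ := exists_local_flow_param
    (isOpen_univ.prod ((isOpen_cc_target x₀).prod isOpen_univ))
    (contDiffOn_geoField (Γ := fun τ => christ (covF τ) x₀) (hcov x₀)) (z₀ := (τ₀, rd x₀ ξ))
    ⟨mem_univ _, cc_mem_target hξ, mem_univ _⟩
  have h0 : (0 : ℝ) ∈ Ioo (-ε) ε := ⟨by linarith, hε⟩
  refine ⟨ε, hε, fun q => wr x₀ (φ q), fun z hz => ?_⟩
  obtain ⟨h1, h2⟩ := h z hz
  have h3 := (h2 0 h0).1.2.1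
  rw [h1] at h3
  refine ⟨h3, by simp only [h1], fun s hs => ⟨?_, ?_⟩⟩
  · exact smAt_wr (hφ.contDiffAt ((Metric.isOpen_ball.prod isOpen_Ioo).mem_nhds ⟨hz, hs⟩))
      (h2 s hs).1.2.1
  · exact isSol_wr (h2 s hs).1.2.1 (h2 s hs).2.hasDerivWithinAt

/-- `φ` assigns to a parameter and final data in the chart at `x₁` a solution on `(a, b)`. -/
def IsFlow (covF : P → Conn n M) (x₁ : M) (O : Set (P × E × E × E)) (a b : ℝ)
    (φ : (P × E × E × E) × ℝ → GState n M) : Prop :=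
  ∀ z ∈ O, z.2.1 ∈ (cc n x₁).target ∧ φ (z, 1) = wr x₁ z.2 ∧ ∀ s ∈ Ioo a b, SmAt φ (z, s) ∧
    IsSol (covF z.1) univ (fun s => φ (z, s)) s

/-- The flow is restarted at time `t₁` with the local flow `χ` and continued backwards. The gained
length `ε` depends only on the ball on which `χ` is defined, not on `t₁`; the propagation down to
time 0 relies on this. -/
theorem IsFlow.extend [T2Space M] {covF : P → Conn n M} (hcov : SmoothFam covF) {x₁ x₂ : M}
    {O : Set (P × E × E × E)} (hO : IsOpen O) {a b t₁ ε : ℝ} (hε : 0 < ε) (ht₁ : t₁ ∈ Ioo a b)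
    (h1 : t₁ ≤ 1)
    {φ : (P × E × E × E) × ℝ → GState n M} (hφ : IsFlow covF x₁ O a b φ)
    {y : P × E × E × E} {χ : (P × E × E × E) × ℝ → GState n M}
    (hχ : ∀ z ∈ Metric.ball y ε, z.2.1 ∈ (cc n x₂).target ∧ χ (z, 0) = wr x₂ z.2 ∧
      ∀ s ∈ Ioo (-ε) ε, SmAt χ (z, s) ∧ IsSol (covF z.1) univ (fun s => χ (z, s)) s)
    {z₀ : P × E × E × E} (hz₀ : z₀ ∈ O) (hpt : (φ (z₀, t₁)).pt ∈ chartDom n x₂)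
    (hball : (z₀.1, rd x₂ (φ (z₀, t₁))) ∈ Metric.ball y ε) :
    ∃ O', IsOpen O' ∧ z₀ ∈ O' ∧ ∃ φ', IsFlow covF x₁ O' (t₁ - ε) b φ' := by
  set κ : P × E × E × E → P × E × E × E := fun z => (z.1, rd x₂ (φ (z, t₁))) with hκ
  have hsm : ∀ z ∈ O, SmAt (fun z => φ (z, t₁)) z := fun z hz =>
    ((hφ z hz).2.2 t₁ ht₁).1.comp (g := fun z => (z, t₁)) (by fun_prop)
  have hκd : ∀ z ∈ O, (φ (z, t₁)).pt ∈ chartDom n x₂ → ContDiffAt ℝ ∞ κ z := fun z hz hp =>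
    contDiffAt_fst.prodMk ((hsm z hz).2 x₂ hp)
  have hnhds : {z | z ∈ O ∧ (φ (z, t₁)).pt ∈ chartDom n x₂ ∧ κ z ∈ Metric.ball y ε} ∈ 𝓝 z₀ := by
    filter_upwards [hO.mem_nhds hz₀, (hsm z₀ hz₀).1.eventually ((isOpen_chartDom x₂).mem_nhds hpt),
      (hκd z₀ hz₀ hpt).continuousAt.eventually (Metric.isOpen_ball.mem_nhds hball)] with z a b c
      using ⟨a, b, c⟩
  obtain ⟨O', hO'sub, hO', hz₀'⟩ := mem_nhds_iff.1 hnhds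
  classical
  -- Half the width of an interval around `t₁` on which both flows are defined; there they agree by
  -- uniqueness.
  set m := min (t₁ - a) (min ε (b - t₁)) with hm
  have hm0 : 0 < m := lt_min (by linarith [ht₁.1]) (lt_min hε (by linarith [ht₁.2]))
  have hma : m ≤ t₁ - a := min_le_left _ _
  have hmε : m ≤ ε := (min_le_right _ _).trans (min_le_left _ _)
  have hmb : m ≤ b - t₁ := (min_le_right _ _).trans (min_le_right _ _)
  have hχs : ∀ z ∈ O', ∀ s ∈ Ioo (t₁ - ε) (t₁ + ε),
      IsSol (covF z.1) univ (fun s => χ (κ z, s - t₁)) s := by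
    intro z hz s hs
    exact (((hχ _ (hO'sub hz).2.2).2.2 (s - t₁) ⟨by linarith [hs.1], by linarith [hs.2]⟩).2).shift
  have hagree : ∀ z ∈ O', EqOn (fun s => φ (z, s)) (fun s => χ (κ z, s - t₁))
      (Ioo (t₁ - m) (t₁ + m)) := by
    intro z hz
    refine IsSol.unique (hcov.smoothConn z.1) ordConnected_Ioo ?_ ?_ (a := t₁)
      ⟨by linarith, by linarith⟩ ?_
    · intro s hs
      exact ((hφ z (hO'sub hz).1).2.2 s ⟨by linarith [hs.1], by linarith [hs.2]⟩).2.mono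
        (subset_univ _)
    · intro s hs
      exact (hχs z hz s ⟨by linarith [hs.1], by linarith [hs.2]⟩).mono (subset_univ _)
    · simp only [sub_self]
      rw [(hχ _ (hO'sub hz).2.2).2.1, wr_rd (hO'sub hz).2.1]
  -- The two flows are glued at `t₁ - m`. Near each time, `φ'` coincides with one of them on a full
  -- neighbourhood, since they agree on the overlap; so smoothness passes through the seam.
  set φ' : (P × E × E × E) × ℝ → GState n M := fun q =>
    if t₁ - m < q.2 then φ q else χ (κ q.1, q.2 - t₁) with hφ'
  refine ⟨O', hO', hz₀', φ', fun z hz => ⟨(hφ z (hO'sub hz).1).1, ?_, fun s hs => ?_⟩⟩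
  · rw [hφ']
    simp only
    rw [if_pos (by linarith)]
    exact (hφ z (hO'sub hz).1).2.1
  by_cases hsm' : t₁ - m < s
  · have hev : φ' =ᶠ[𝓝 (z, s)] φ := by
      filter_upwards [(isOpen_lt continuous_const continuous_snd).mem_nhds
        (show (z, s) ∈ {q : (P × E × E × E) × ℝ | t₁ - m < q.2} from hsm')] with q hq
      exact if_pos hq
    obtain ⟨h2, h3⟩ := (hφ z (hO'sub hz).1).2.2 s ⟨by linarith, hs.2⟩
    refine ⟨h2.congr hev, h3.congr ?_ hev.self_of_nhds⟩
    rw [nhdsWithin_univ]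
    exact (Continuous.prodMk_right z).continuousAt.eventually hev
  · have hst : s < t₁ := by linarith
    have hev : φ' =ᶠ[𝓝 (z, s)] fun q => χ (κ q.1, q.2 - t₁) := by
      filter_upwards [(hO'.prod isOpen_Iio).mem_nhds
        (show (z, s) ∈ O' ×ˢ Iio t₁ from ⟨hz, hst⟩)] with q hq
      by_cases h4 : t₁ - m < q.2
      · rw [hφ']
        simp only
        rw [if_pos h4]
        exact hagree q.1 hq.1 ⟨h4, by linarith [show q.2 < t₁ from hq.2]⟩
      · exact if_neg h4
    have hd : ContDiffAt ℝ ∞ (fun q : (P × E × E × E) × ℝ => (κ q.1, q.2 - t₁)) (z, s) :=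
      ((hκd z (hO'sub hz).1 (hO'sub hz).2.1).comp (f := Prod.fst) (z, s) contDiffAt_fst).prodMk
        (contDiffAt_snd.sub contDiffAt_const)
    have h5 := ((hχ _ (hO'sub hz).2.2).2.2 (s - t₁) ⟨by linarith [hs.1], by linarith⟩).1
    refine ⟨(h5.comp (g := fun q : (P × E × E × E) × ℝ => (κ q.1, q.2 - t₁)) hd).congr hev,
      (hχs z hz s ⟨hs.1, by linarith⟩).congr ?_ hev.self_of_nhds⟩
    rw [nhdsWithin_univ]
    exact (Continuous.prodMk_right z).continuousAt.eventually hev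

/-- Solutions near a solution on `[0,1]`, with prescribed data at time `1`. -/
theorem exists_flow_along [T2Space M] {covF : P → Conn n M} (hcov : SmoothFam covF) (τ₀ : P)
    {W : ℝ → GState n M} (hW : ∀ t ∈ Icc (0 : ℝ) 1, IsSol (covF τ₀) (Icc 0 1) W t) {x₁ : M}
    (hx₁ : (W 1).pt ∈ chartDom n x₁) :
    ∃ δ > 0, ∃ O, IsOpen O ∧ (τ₀, rd x₁ (W 1)) ∈ O ∧ ∃ φ, IsFlow covF x₁ O (-δ) (1 + δ) φ ∧
      ∀ s ∈ Icc (0 : ℝ) 1, φ ((τ₀, rd x₁ (W 1)), s) = W s := by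
  set z₀ : P × E × E × E := (τ₀, rd x₁ (W 1)) with hz₀
  have h11 : (1 : ℝ) ∈ Icc (0 : ℝ) 1 := ⟨zero_le_one, le_rfl⟩
  have hbase : ∀ {O a b φ}, IsFlow covF x₁ O a b φ → z₀ ∈ O → 1 < b → ∀ t ∈ Icc (0 : ℝ) 1, a < t →
      ∀ s ∈ Icc t 1, φ (z₀, s) = W s := by
    intro O a b φ hφ hz hb t ht hat
    refine IsSol.unique (hcov.smoothConn τ₀) ordConnected_Icc ?_ ?_ (a := 1) ⟨ht.2, le_rfl⟩ ?_
    · intro s hs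
      exact ((hφ z₀ hz).2.2 s ⟨by linarith [hs.1], by linarith [hs.2]⟩).2.mono (subset_univ _)
    · intro s hs
      exact (hW s ⟨ht.1.trans hs.1, hs.2⟩).mono (Icc_subset_Icc_left ht.1)
    · rw [(hφ z₀ hz).2.1, wr_rd hx₁]
  suffices hs : ∃ δ > 0, ∃ O, IsOpen O ∧ z₀ ∈ O ∧ ∃ φ, IsFlow covF x₁ O (0 - δ) (1 + δ) φ by
    obtain ⟨δ, hδ, O, hO, hz, φ, hφ⟩ := hs
    rw [zero_sub] at hφ
    exact ⟨δ, hδ, O, hO, hz, φ, hφ, hbase hφ hz (by linarith) 0 ⟨le_rfl, zero_le_one⟩ (by linarith)⟩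
  -- The existence of a flow reaching back past `t` is propagated from `t = 1`, where the data are
  -- prescribed, to `t = 0`.
  refine interval_propagation (C := fun t => ∃ δ > 0, ∃ O, IsOpen O ∧ z₀ ∈ O ∧
    ∃ φ, IsFlow covF x₁ O (t - δ) (1 + δ) φ) (ordConnected_Icc (a := (0 : ℝ)) (b := 1)) h11
    ⟨le_rfl, zero_le_one⟩ ?_ ?_
  · obtain ⟨ε, hε, χ, hχ⟩ := exists_flow_near hcov τ₀ hx₁
    refine ⟨ε, hε, Metric.ball z₀ ε, Metric.isOpen_ball, Metric.mem_ball_self hε,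
      fun q => χ (q.1, q.2 - 1), fun z hz => ?_⟩
    obtain ⟨h1, h2, h3⟩ := hχ z hz
    refine ⟨h1, by simpa using h2, fun s hs => ?_⟩
    have hs' : s - 1 ∈ Ioo (-ε) ε := ⟨by linarith [hs.1], by linarith [hs.2]⟩
    exact ⟨(h3 _ hs').1.comp (g := fun q : (P × E × E × E) × ℝ => (q.1, q.2 - 1)) (by fun_prop),
      (h3 _ hs').2.shift⟩
  · intro t ht
    have hx₂ : (W t).pt ∈ chartDom n (W t).pt := mem_chart_source _ _
    obtain ⟨ε, hε, χ, hχ⟩ := exists_flow_near hcov τ₀ hx₂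
    have hev : ∀ᶠ s in 𝓝[Icc 0 1] t, (W s).pt ∈ chartDom n (W t).pt ∧
        rd (W t).pt (W s) ∈ Metric.ball (rd (W t).pt (W t)) ε :=
      ((hW t ht).1.eventually ((isOpen_chartDom _).mem_nhds hx₂)).and
        (((hW t ht).2 _ hx₂).continuousWithinAt.eventually (Metric.ball_mem_nhds _ hε))
    obtain ⟨ε₁, hε₁, hε₁'⟩ := Metric.mem_nhdsWithin_iff.1 hev
    -- The bound by `ε / 2` gives `|t₁ - t₂| < ε`, so that an extension by `ε` from `t₁` passes
    -- `t₂`. The bound by `ε₁` puts the state at `t₁` into the ball where `χ` is defined.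
    refine ⟨min ε₁ (ε / 2), lt_min hε₁ (by linarith), fun t₁ ht₁ t₂ ht₂ h1 h2 => ?_⟩
    rintro ⟨δ, hδ, O, hO, hz, φ, hφ⟩
    have hlt : |t₁ - t₂| < ε := by
      have h3 := h1.trans_le (min_le_right _ _)
      have h4 := h2.trans_le (min_le_right _ _)
      rw [abs_lt] at *
      constructor <;> linarith
    have hφt : φ (z₀, t₁) = W t₁ :=
      hbase hφ hz (by linarith) t₁ ht₁ (by linarith) t₁ ⟨le_rfl, ht₁.2⟩
    obtain ⟨h5, h6⟩ := hε₁' (show t₁ ∈ Metric.ball t ε₁ ∩ Icc 0 1 from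
      ⟨by rw [Metric.mem_ball, Real.dist_eq]; exact h1.trans_le (min_le_left _ _), ht₁⟩)
    obtain ⟨O', hO', hz', φ', hφ''⟩ := hφ.extend hcov hO hε (t₁ := t₁)
      ⟨by linarith, by linarith [ht₁.2]⟩ ht₁.2 hχ hz (by rw [hφt]; exact h5)
      (by
        rw [hφt, Metric.mem_ball, Prod.dist_eq]
        exact max_lt (by simpa [hz₀] using hε) h6)
    refine ⟨min δ (ε - |t₁ - t₂|), lt_min hδ (by linarith), O', hO', hz', φ', fun z hz => ?_⟩
    obtain ⟨a1, a2, a3⟩ := hφ'' z hz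
    refine ⟨a1, a2, fun s hs => a3 s ⟨?_, hs.2.trans_le (by linarith [min_le_left δ (ε - |t₁ - t₂|)])⟩⟩
    have := hs.1
    have := min_le_right δ (ε - |t₁ - t₂|)
    have := le_abs_self (t₁ - t₂)
    linarith

/-- Geodesics near a geodesic on `[0,1]`, with parallel transports, parametrized by the final
point `y`, the final velocity `u` and the final vector `a`, in coordinates. -/
theorem exists_geodesic_flow [T2Space M] {covF : P → Conn n M} (hcov : SmoothFam covF) (τ₀ : P)
    {Ω : Set M} {p q : M} {γ : ℝ → M} (hγ : IsGeodesicIn (covF τ₀) Ω p q γ) {x₁ : M}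
    (hx₁ : γ 1 ∈ chartDom n x₁) :
    ∃ δ > 0, ∃ O : Set (P × E × E), IsOpen O ∧
      (τ₀, cc n x₁ (γ 1), tc x₁ (γ 1) (velocity γ 1)) ∈ O ∧
      ∃ Ψ : E → (P × E × E) × ℝ → GState n M,
        (∀ a, ∀ z ∈ O, z.2.1 ∈ (cc n x₁).target ∧ Ψ a (z, 1) = wr x₁ (z.2.1, z.2.2, a) ∧
          ∀ s ∈ Ioo (-δ) (1 + δ), SmAt (Ψ a) (z, s) ∧
            IsSol (covF z.1) univ (fun s => Ψ a (z, s)) s ∧ (Ψ a (z, s)).pt = (Ψ 0 (z, s)).pt) ∧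
        ∀ s ∈ Icc (0 : ℝ) 1,
          (Ψ 0 ((τ₀, cc n x₁ (γ 1), tc x₁ (γ 1) (velocity γ 1)), s)).pt = γ s := by
  obtain ⟨δ, hδ, O, hO, hz, φ, hφ, hbase⟩ := exists_flow_along hcov τ₀
    (W := fun s => (⟨γ s, velocity γ s, 0⟩ : GState n M)) (fun t ht => hγ.isSol_zero ht) (x₁ := x₁) hx₁
  set y₀ := cc n x₁ (γ 1) with hy₀
  set u₀ := tc (n := n) x₁ (γ 1) (velocity γ 1) with hu₀
  have hrd : rd x₁ (⟨γ 1, velocity γ 1, 0⟩ : GState n M) = (y₀, u₀, 0) := by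
    simp [rd, hy₀, hu₀]
  rw [hrd] at hz hbase
  obtain ⟨ρ, hρ, hball⟩ := Metric.isOpen_iff.1 hO _ hz
  have hmem : ∀ z ∈ Metric.ball (τ₀, y₀, u₀) ρ, ∀ w : E, ‖w‖ < ρ → (z.1, z.2.1, z.2.2, w) ∈ O := by
    intro z hz w hw
    apply hball
    simp only [Metric.mem_ball, Prod.dist_eq, max_lt_iff, dist_zero_right] at hz ⊢
    exact ⟨hz.1, hz.2.1, hz.2.2, hw⟩
  -- The flow is available for small final vectors only. Since the transported vector enters
  -- linearly, `a` is scaled down by `ε a` and the result scaled up again, which reaches all `a` on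
  -- the same neighbourhood.
  let ε : E → ℝ := fun a => ρ / 2 / (1 + ‖a‖)
  have hε0 : ∀ a, 0 < ε a := fun a => by positivity
  have hεa : ∀ a, ‖ε a • a‖ < ρ := by
    intro a
    rw [norm_smul, Real.norm_of_nonneg (hε0 a).le]
    have h1 : ‖a‖ ≤ 1 + ‖a‖ := by linarith
    calc ε a * ‖a‖ ≤ ε a * (1 + ‖a‖) := mul_le_mul_of_nonneg_left h1 (hε0 a).le
      _ = ρ / 2 := by simp only [ε]; field_simp
      _ < ρ := by linarith
  let sc : ℝ → GState n M → GState n M := fun c ξ => ⟨ξ.pt, ξ.vel, c • ξ.vec⟩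
  let Ψ : E → (P × E × E) × ℝ → GState n M := fun a q =>
    sc (ε a)⁻¹ (φ ((q.1.1, q.1.2.1, q.1.2.2, ε a • a), q.2))
  have hΨ1 : ∀ a, ∀ z ∈ Metric.ball (τ₀, y₀, u₀) ρ, Ψ a (z, 1) = wr x₁ (z.2.1, z.2.2, a) := by
    intro a z hz
    have h1 := (hφ _ (hmem z hz _ (hεa a))).2.1
    change sc (ε a)⁻¹ (φ ((z.1, z.2.1, z.2.2, ε a • a), 1)) = _
    rw [h1]
    simp only [sc, wr, map_smul, inv_smul_smul₀ (hε0 a).ne']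
  have hΨs : ∀ a, ∀ z ∈ Metric.ball (τ₀, y₀, u₀) ρ, ∀ s ∈ Ioo (-δ) (1 + δ), SmAt (Ψ a) (z, s) ∧
      IsSol (covF z.1) univ (fun s => Ψ a (z, s)) s := by
    intro a z hz s hs
    obtain ⟨h1, h2⟩ := (hφ _ (hmem z hz _ (hεa a))).2.2 s hs
    refine ⟨?_, h2.smul_vec _⟩
    have h3 := (h1.comp (g := fun q : (P × E × E) × ℝ =>
      ((q.1.1, q.1.2.1, q.1.2.2, ε a • a), q.2)) (y := (z, s)) (by fun_prop)).scale 1 (ε a)⁻¹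
    simpa only [one_smul] using h3
  refine ⟨δ, hδ, Metric.ball (τ₀, y₀, u₀) ρ, Metric.isOpen_ball, Metric.mem_ball_self hρ, Ψ,
    fun a z hz => ⟨(hφ _ (hmem z hz 0 (by simpa using hρ))).1, hΨ1 a z hz, fun s hs =>
      ⟨(hΨs a z hz s hs).1, (hΨs a z hz s hs).2, ?_⟩⟩, ?_⟩
  -- The base curve does not depend on `a`: after the transported vector is set to zero, both
  -- solutions have the same state at time 1.
  · have huniq : EqOn (fun s => (⟨(Ψ a (z, s)).pt, (Ψ a (z, s)).vel, (0 : ℝ) • (Ψ a (z, s)).vec⟩ :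
        GState n M)) (fun s => ⟨(Ψ 0 (z, s)).pt, (Ψ 0 (z, s)).vel, (0 : ℝ) • (Ψ 0 (z, s)).vec⟩)
        (Ioo (-δ) (1 + δ)) := by
      refine IsSol.unique (hcov.smoothConn z.1) ordConnected_Ioo (fun s hs => ?_) (fun s hs => ?_)
        (a := 1) ⟨by linarith, by linarith⟩ ?_
      · exact ((hΨs a z hz s hs).2.smul_vec 0).mono (subset_univ _)
      · exact ((hΨs 0 z hz s hs).2.smul_vec 0).mono (subset_univ _)
      · change sc 0 (Ψ a (z, 1)) = sc 0 (Ψ 0 (z, 1))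
        rw [hΨ1 a z hz, hΨ1 0 z hz]
        simp only [sc, wr, zero_smul]
    have h1 : sc 0 (Ψ a (z, s)) = sc 0 (Ψ 0 (z, s)) := huniq hs
    change (sc 0 (Ψ a (z, s))).pt = (sc 0 (Ψ 0 (z, s))).pt
    rw [h1]
  · intro s hs
    change (φ ((τ₀, y₀, u₀, ε 0 • (0 : E)), s)).pt = γ s
    rw [smul_zero, hbase s hs]

end Flow
end OscGeom

end

noncomputable section

namespace OscGeom

/-! ### Geodesics parametrized by their two end points. -/

section TwoPoint

variable {n : ℕ} {M : Type*} [TopologicalSpace M] [ChartedSpace (EuclideanSpace ℝ (Fin n)) M]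
  [IsManifold (𝓡 n) ∞ M]

local notation "E" => EuclideanSpace ℝ (Fin n)

theorem isInvertible_of_comp_eq_id {L R : E →L[ℝ] E} (h : L ∘L R = .id ℝ E) : L.IsInvertible := by
  refine ContinuousLinearMap.IsInvertible.of_inverse (g := R) h ?_
  have h1 : (L : E →ₗ[ℝ] E) * (R : E →ₗ[ℝ] E) = 1 := by
    ext1 v
    exact congrArg (fun A : E →L[ℝ] E => A v) h
  have h2 := mul_eq_one_comm.1 h1
  ext1 v
  exact congrArg (fun A : E →ₗ[ℝ] E => A v) h2

variable {P : Type} [NormedAddCommGroup P] [NormedSpace ℝ P]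

/-- Geodesics with parallel transports, parametrized by their final data. -/
def IsGeoFlow (covF : P → Conn n M) (x₁ : M) (O : Set (P × E × E)) (δ : ℝ)
    (Ψ : E → (P × E × E) × ℝ → GState n M) : Prop :=
  ∀ a, ∀ z ∈ O, z.2.1 ∈ (cc n x₁).target ∧ Ψ a (z, 1) = wr x₁ (z.2.1, z.2.2, a) ∧
    ∀ s ∈ Ioo (-δ) (1 + δ), SmAt (Ψ a) (z, s) ∧
      IsSol (covF z.1) univ (fun s => Ψ a (z, s)) s ∧ (Ψ a (z, s)).pt = (Ψ 0 (z, s)).pt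

/-- Geodesics in `Ω` with parallel transports, parametrized by their end points. -/
def IsGeoFamily (covF : P → Conn n M) (Ω : Set M) (x₀ x₁ : M) (O : Set (P × E × E)) (δ : ℝ)
    (Θ : E → (P × E × E) × ℝ → GState n M) : Prop :=
  ∀ a, ∀ z ∈ O, z.2.1 ∈ (cc n x₀).target ∧ z.2.2 ∈ (cc n x₁).target ∧
    (Θ a (z, 0)).pt = (cc n x₀).symm z.2.1 ∧ (∃ u, Θ a (z, 1) = wr x₁ (z.2.2, u, a)) ∧
    ∀ s ∈ Ioo (-δ) (1 + δ), SmAt (Θ a) (z, s) ∧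
      IsSol (covF z.1) univ (fun s => Θ a (z, s)) s ∧ (Θ a (z, s)).pt = (Θ 0 (z, s)).pt ∧
      (s ∈ Icc (0 : ℝ) 1 → (Θ a (z, s)).pt ∈ Ω)

/-- The initial point of a geodesic in terms of its final velocity, in coordinates. -/
def startPt (x₀ : M) (Ψ : E → (P × E × E) × ℝ → GState n M) (τ : P) (y u : E) : E :=
  cc n x₀ (Ψ 0 ((τ, y, u), 0)).pt

theorem IsGeoFlow.contDiffAt_startPt {covF : P → Conn n M} {x₀ x₁ : M} {O : Set (P × E × E)} {δ : ℝ}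
    (hδ : 0 < δ) {Ψ : E → (P × E × E) × ℝ → GState n M} (h : IsGeoFlow covF x₁ O δ Ψ)
    {z : P × E × E} (hz : z ∈ O) (hx : (Ψ 0 (z, 0)).pt ∈ chartDom n x₀) :
    ContDiffAt ℝ ∞ (fun z : P × E × E => startPt x₀ Ψ z.1 z.2.1 z.2.2) z := by
  have h1 := ((h 0 z hz).2.2 0 ⟨by linarith, by linarith⟩).1.comp (g := fun z : P × E × E => (z, (0 : ℝ)))
    (y := z) (by fun_prop)
  exact (h1.2 x₀ hx).fst

/-- The implicit function theorem solves `startPt = x` for the final velocity. The hypothesis `hinv`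
says that the end points are not conjugate along the geodesic. -/
theorem exists_geoFamily [FiniteDimensional ℝ P] {covF : P → Conn n M} {Ω : Set M} (hΩ : IsOpen Ω)
    {x₀ x₁ : M} {O : Set (P × E × E)} (hO : IsOpen O) {δ : ℝ} (hδ : 0 < δ)
    {Ψ : E → (P × E × E) × ℝ → GState n M} (h : IsGeoFlow covF x₁ O δ Ψ)
    {τ₀ : P} {y₀ u₀ : E} (hz₀ : (τ₀, y₀, u₀) ∈ O)
    (hΩΨ : ∀ s ∈ Icc (0 : ℝ) 1, (Ψ 0 ((τ₀, y₀, u₀), s)).pt ∈ Ω)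
    (hx : (Ψ 0 ((τ₀, y₀, u₀), 0)).pt ∈ chartDom n x₀)
    (hinv : (fderiv ℝ (startPt x₀ Ψ τ₀ y₀) u₀).IsInvertible) :
    ∃ O', IsOpen O' ∧ (τ₀, startPt x₀ Ψ τ₀ y₀ u₀, y₀) ∈ O' ∧
      ∃ Θ, IsGeoFamily covF Ω x₀ x₁ O' δ Θ := by
  have h0 : (0 : ℝ) ∈ Ioo (-δ) (1 + δ) := ⟨by linarith, by linarith⟩
  have hcont : ContinuousOn (fun z : P × E × E => (Ψ 0 (z, 0)).pt) O := fun z hz =>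
    ((((h 0 z hz).2.2 0 h0).1.comp (g := fun z : P × E × E => (z, (0 : ℝ)))
      (y := z) (by fun_prop)).1).continuousWithinAt
  have hO₁ : IsOpen (O ∩ (fun z : P × E × E => (Ψ 0 (z, 0)).pt) ⁻¹' chartDom n x₀) :=
    hcont.isOpen_inter_preimage hO (isOpen_chartDom x₀)
  let e : (P × E × E) × E → P × E × E := fun q => (q.1.1, q.1.2.2, q.2)
  have he : ContDiff ℝ ∞ e := by fun_prop
  let f : (P × E × E) × E → E := fun q => startPt x₀ Ψ q.1.1 q.1.2.2 q.2 - q.1.2.1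
  set D : Set ((P × E × E) × E) :=
    e ⁻¹' (O ∩ (fun z : P × E × E => (Ψ 0 (z, 0)).pt) ⁻¹' chartDom n x₀) with hD
  have hDo : IsOpen D := hO₁.preimage he.continuous
  have hfd : ∀ q ∈ D, ContDiffAt ℝ ∞ f q := fun q hq =>
    ((h.contDiffAt_startPt hδ hq.1 hq.2).comp (f := e) q he.contDiffAt).sub (by fun_prop)
  set a₀ : P × E × E := (τ₀, startPt x₀ Ψ τ₀ y₀ u₀, y₀) with ha₀
  have hbase : (a₀, u₀) ∈ D := ⟨hz₀, hx⟩
  have hfz : f (a₀, u₀) = 0 := sub_self _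
  have hinv' : (fderiv ℝ f (a₀, u₀) ∘L .inr ℝ (P × E × E) E).IsInvertible := by
    have h1 : HasFDerivAt (fun u => f (a₀, u)) (fderiv ℝ f (a₀, u₀) ∘L .inr ℝ (P × E × E) E) u₀ :=
      ((hfd _ hbase).differentiableAt (by simp)).hasFDerivAt.comp u₀ (hasFDerivAt_prodMk_right a₀ u₀)
    have h2 : fderiv ℝ (fun u => f (a₀, u)) u₀ = fderiv ℝ (startPt x₀ Ψ τ₀ y₀) u₀ :=
      fderiv_sub_const _
    rwa [← h1.fderiv, h2]
  obtain ⟨A, V, g, hA, hV, hA₀, hu₀V, hg, hg0, hAV, hsol⟩ := exists_implicit_contDiffOn hDo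
    (fun q hq => (hfd q hq).contDiffWithinAt) hbase hinv'
  have hmem : ∀ z ∈ A, (z, g z) ∈ D := fun z hz => hAV ⟨hz, (hsol z hz).1⟩
  have hgd : ∀ z ∈ A, ContDiffAt ℝ ∞ g z := fun z hz => hg.contDiffAt (hA.mem_nhds hz)
  let Θ : E → (P × E × E) × ℝ → GState n M := fun a q => Ψ a ((q.1.1, q.1.2.2, g q.1), q.2)
  have hΘs : ∀ a, ∀ z ∈ A, ∀ s ∈ Ioo (-δ) (1 + δ), SmAt (Θ a) (z, s) := by
    intro a z hz s hs
    have h1 := ((h a _ (hmem z hz).1).2.2 s hs).1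
    refine h1.comp (g := fun q : (P × E × E) × ℝ => ((q.1.1, q.1.2.2, g q.1), q.2)) (y := (z, s)) ?_
    have h2 : ContDiffAt ℝ ∞ (fun q : (P × E × E) × ℝ => g q.1) (z, s) :=
      (hgd z hz).comp (f := Prod.fst) (z, s) contDiffAt_fst
    have h3 : ContDiffAt ℝ ∞ (fun q : (P × E × E) × ℝ => q.1.1) (z, s) := by fun_prop
    have h4 : ContDiffAt ℝ ∞ (fun q : (P × E × E) × ℝ => q.1.2.2) (z, s) := by fun_prop
    exact (h3.prodMk (h4.prodMk h2)).prodMk contDiffAt_snd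
  -- Staying in the open set `Ω` for all times of `[0,1]` is an open condition, by compactness of
  -- the interval.
  have hev : ∀ᶠ z in 𝓝 a₀, ∀ s ∈ Icc (0 : ℝ) 1, (Θ 0 (z, s)).pt ∈ Ω := by
    refine isCompact_Icc.eventually_forall_of_forall_eventually fun s hs => ?_
    refine (hΘs 0 a₀ hA₀ s ⟨by linarith [hs.1], by linarith [hs.2]⟩).1.eventually (hΩ.mem_nhds ?_)
    change (Ψ 0 ((τ₀, y₀, g a₀), s)).pt ∈ Ω
    rw [show g a₀ = u₀ from hg0]
    exact hΩΨ s hs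
  obtain ⟨O', hO'sub, hO', hz'⟩ := mem_nhds_iff.1 (hev.and (hA.mem_nhds hA₀))
  refine ⟨O', hO', hz', Θ, fun a z hz => ?_⟩
  obtain ⟨hzΩ, hzA⟩ := hO'sub hz
  have hD' := hmem z hzA
  have hfz' : f (z, g z) = 0 := by
    rw [← hfz]
    exact ((hsol z hzA).2 _ (hsol z hzA).1).2 rfl
  have hstart : cc n x₀ (Ψ 0 ((z.1, z.2.2, g z), 0)).pt = z.2.1 := sub_eq_zero.1 hfz'
  have hflow := h a _ hD'.1
  refine ⟨hstart ▸ cc_mem_target hD'.2, hflow.1, ?_, ⟨g z, hflow.2.1⟩, fun s hs => ?_⟩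
  · change (Ψ a ((z.1, z.2.2, g z), 0)).pt = _
    rw [← hstart, cc_left_inv hD'.2]
    exact (hflow.2.2 0 h0).2.2
  · refine ⟨hΘs a z hzA s hs, (hflow.2.2 s hs).2.1, (hflow.2.2 s hs).2.2, fun hs' => ?_⟩
    have := hzΩ s hs'
    rwa [show (Θ 0 (z, s)).pt = (Θ a (z, s)).pt from ((hflow.2.2 s hs).2.2).symm] at this

/-- Geodesics with a differentiable dependence on the initial point are nondegenerate. -/
theorem IsGeoFlow.isInvertible_of_differentiableAt [T2Space M] {covF : P → Conn n M}
    (hcov : SmoothFam covF) {x₀ x₁ : M} {O : Set (P × E × E)} (hO : IsOpen O) {δ : ℝ} (hδ : 0 < δ)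
    {Ψ : E → (P × E × E) × ℝ → GState n M} (h : IsGeoFlow covF x₁ O δ Ψ)
    {τ₀ : P} {q : M} {u₀ : E} (hq : q ∈ chartDom n x₁) (hz₀ : (τ₀, cc n x₁ q, u₀) ∈ O)
    (hx : (Ψ 0 ((τ₀, cc n x₁ q, u₀), 0)).pt ∈ chartDom n x₀) {g : E → E} {y : E}
    (hy : y ∈ (cc n x₀).target)
    (hg : DifferentiableAt ℝ g y) (hg0 : g y = u₀)
    (hgeo : ∀ᶠ x in 𝓝 y, ∃ γ Ω, IsGeodesicIn (covF τ₀) Ω ((cc n x₀).symm x) q γ ∧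
      tc x₁ (γ 1) (velocity γ 1) = g x) :
    (fderiv ℝ (startPt x₀ Ψ τ₀ (cc n x₁ q)) u₀).IsInvertible := by
  have hF : DifferentiableAt ℝ (startPt x₀ Ψ τ₀ (cc n x₁ q)) (g y) := by
    rw [hg0]
    exact ((h.contDiffAt_startPt hδ hz₀ hx).comp (f := fun u => (τ₀, cc n x₁ q, u)) u₀
      (by fun_prop)).differentiableAt (by simp)
  refine isInvertible_of_comp_eq_id (R := fderiv ℝ g y) ?_
  have h1 : HasFDerivAt (fun x => startPt x₀ Ψ τ₀ (cc n x₁ q) (g x))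
      (fderiv ℝ (startPt x₀ Ψ τ₀ (cc n x₁ q)) (g y) ∘L fderiv ℝ g y) y :=
    hF.hasFDerivAt.comp y hg.hasFDerivAt
  rw [hg0] at h1
  rw [← h1.fderiv]
  -- The geodesic from `x` to `q` with final velocity `g x` is the one in the flow with these final
  -- data, so `g` is a right inverse of `startPt`. Its derivative at `y` is then a right inverse of
  -- the derivative, which suffices in finite dimension.
  have hev : (fun x => startPt x₀ Ψ τ₀ (cc n x₁ q) (g x)) =ᶠ[𝓝 y] id := by
    have hO' : ∀ᶠ x in 𝓝 y, (τ₀, cc n x₁ q, g x) ∈ O := by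
      have : ContinuousAt (fun x => (τ₀, cc n x₁ q, g x)) y :=
        continuousAt_const.prodMk (continuousAt_const.prodMk hg.continuousAt)
      exact this.eventually (hO.mem_nhds (by simpa only [hg0] using hz₀))
    filter_upwards [hgeo, hO', (isOpen_cc_target x₀).mem_nhds hy] with x ⟨γ, Ω, hγ, hvel⟩ hxO hxt
    have hγ1 : γ 1 ∈ chartDom n x₁ := by rw [hγ.target]; exact hq
    have huniq := IsSol.unique (hcov.smoothConn τ₀) ordConnected_Icc
      (W := fun s => Ψ 0 ((τ₀, cc n x₁ q, g x), s)) (W' := fun s => ⟨γ s, velocity γ s, 0⟩)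
      (S := Icc 0 1)
      (fun s hs => ((h 0 _ hxO).2.2 s ⟨by linarith [hs.1], by linarith [hs.2]⟩).2.1.mono
        (subset_univ _)) (fun s hs => hγ.isSol_zero hs) (a := 1) ⟨zero_le_one, le_rfl⟩
      (by
        rw [(h 0 _ hxO).2.1, ← wr_rd (ξ := ⟨γ 1, velocity γ 1, 0⟩) hγ1]
        congr 1
        simp only [rd, hvel, hγ.target, map_zero])
    have h2 := huniq (⟨le_rfl, zero_le_one⟩ : (0 : ℝ) ∈ Icc (0 : ℝ) 1)
    simp only at h2
    simp only [startPt, h2, hγ.source, id]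
    exact (cc n x₀).right_inv hxt
  rw [hev.fderiv_eq, fderiv_id]

theorem isGeodesicIn_const (cov : Conn n M) {Ω : Set M} {p : M} (hp : p ∈ Ω) :
    IsGeodesicIn cov Ω p p (fun _ => p) ∧
      ∀ t ∈ Icc (0 : ℝ) 1, velocity (n := n) (fun _ : ℝ => p) t = 0 := by
  refine isGeodesicIn_of_isSol (W := fun _ => ⟨p, 0, 0⟩) (fun t _ => ?_) (fun t _ => ?_)
    (fun _ _ => hp)
  · refine ⟨continuousWithinAt_const, fun x₀ hx => ?_⟩
    have : geoField (christ cov x₀) (rd x₀ (⟨p, 0, 0⟩ : GState n M)) = 0 := by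
      simp [geoField, rd]
    rw [this]
    exact hasDerivWithinAt_const _ _ _
  · exact ⟨continuousAt_const, fun x₀ _ => contDiffAt_const⟩

/-- Constant geodesics are nondegenerate. -/
theorem IsGeoFlow.isInvertible_const [T2Space M] {covF : P → Conn n M}
    (hcov : SmoothFam covF) {x₁ : M} {O : Set (P × E × E)} (hO : IsOpen O) {δ : ℝ} (hδ : 0 < δ)
    {Ψ : E → (P × E × E) × ℝ → GState n M} (h : IsGeoFlow covF x₁ O δ Ψ)
    {τ₀ : P} {y : E} (hz₀ : (τ₀, y, 0) ∈ O) (hx : (Ψ 0 ((τ₀, y, 0), 0)).pt ∈ chartDom n x₁) :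
    (fderiv ℝ (startPt x₁ Ψ τ₀ y) 0).IsInvertible := by
  have hF : DifferentiableAt ℝ (startPt x₁ Ψ τ₀ y) 0 :=
    ((h.contDiffAt_startPt hδ hz₀ hx).comp (f := fun u => (τ₀, y, u)) 0
      (by fun_prop)).differentiableAt (by simp)
  obtain ⟨ρ, hρ, hball⟩ := Metric.isOpen_iff.1 hO _ hz₀
  have hmem : ∀ u : E, ‖u‖ < ρ → (τ₀, y, u) ∈ O := by
    intro u hu
    apply hball
    simp only [Metric.mem_ball, Prod.dist_eq, dist_self, dist_zero_right]
    exact max_lt hρ (max_lt hρ hu)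
  have h11 : (1 : ℝ) ∈ Icc (0 : ℝ) 1 := ⟨zero_le_one, le_rfl⟩
  have h01 : (0 : ℝ) ∈ Icc (0 : ℝ) 1 := ⟨le_rfl, zero_le_one⟩
  have key : ∀ u : E, ‖u‖ < ρ → fderiv ℝ (startPt x₁ Ψ τ₀ y) 0 u = -u := by
    intro u hu
    -- The geodesic with final velocity `l • u` is `s ↦ γ (1 - l + l s)`, where `γ` has final
    -- velocity `u`. So `startPt` at `l • u` is the position of `γ` at time `1 - l`, and its
    -- derivative at `l = 0` is `-u`.
    have hscale : ∀ l ∈ Icc (0 : ℝ) 1,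
        (Ψ 0 ((τ₀, y, l • u), 0)).pt = (Ψ 0 ((τ₀, y, u), 1 - l)).pt := by
      intro l hl
      have hlu : ‖l • u‖ < ρ := by
        rw [norm_smul, Real.norm_of_nonneg hl.1]
        nlinarith [norm_nonneg u, hl.2]
      have huniq := IsSol.unique (hcov.smoothConn τ₀) ordConnected_Icc (S := Icc 0 1)
        (W := fun s => Ψ 0 ((τ₀, y, l • u), s))
        (W' := fun s => ⟨(Ψ 0 ((τ₀, y, u), 1 - l + l * s)).pt,
          l • (Ψ 0 ((τ₀, y, u), 1 - l + l * s)).vel, (Ψ 0 ((τ₀, y, u), 1 - l + l * s)).vec⟩)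
        (fun s hs => ((h 0 _ (hmem _ hlu)).2.2 s ⟨by linarith [hs.1], by linarith [hs.2]⟩).2.1.mono
          (subset_univ _))
        (fun s hs => (IsSol.affine (W := fun s => Ψ 0 ((τ₀, y, u), s)) (S := univ)
          ((h 0 _ (hmem _ hu)).2.2 _ ⟨by nlinarith [hs.1, hl.1, hl.2], by
            nlinarith [hs.2, hl.1, hl.2]⟩).2.1 (mapsTo_univ _ univ)).mono (subset_univ _))
        (a := 1) h11 (by
          let sc : ℝ → GState n M → GState n M := fun c ξ => ⟨ξ.pt, c • ξ.vel, ξ.vec⟩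
          change Ψ 0 ((τ₀, y, l • u), 1) = sc l (Ψ 0 ((τ₀, y, u), 1 - l + l * 1))
          rw [show 1 - l + l * 1 = 1 by ring, (h 0 _ (hmem _ hlu)).2.1, (h 0 _ (hmem _ hu)).2.1]
          simp only [sc, wr, map_smul])
      have h2 := huniq h01
      simp only at h2
      rw [h2, mul_zero, add_zero]
    have hpt1 : (Ψ 0 ((τ₀, y, u), 1)).pt ∈ chartDom n x₁ := by
      rw [(h 0 _ (hmem u hu)).2.1]
      exact wr_pt_mem (h 0 _ (hmem u hu)).1
    have hsol1 := (((h 0 _ (hmem u hu)).2.2 1 ⟨by linarith, by linarith⟩).2.1.hasDerivWithinAt hpt1).1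
    have htcu : tc x₁ (Ψ 0 ((τ₀, y, u), 1)).pt (Ψ 0 ((τ₀, y, u), 1)).vel = u := by
      rw [(h 0 _ (hmem u hu)).2.1]
      exact tc_ts (cc_symm_mem (h 0 _ (hmem u hu)).1) u
    rw [htcu, hasDerivWithinAt_univ] at hsol1
    have hd1 : HasDerivAt (fun l : ℝ => cc n x₁ (Ψ 0 ((τ₀, y, u), 1 - l)).pt) (-u) 0 := by
      have h3 : HasDerivAt (fun l : ℝ => 1 - l) (-1) 0 := by
        simpa using (hasDerivAt_id (0 : ℝ)).const_sub 1
      have h4 : HasDerivAt (fun s => cc n x₁ (Ψ 0 ((τ₀, y, u), s)).pt) u (1 - 0) := by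
        rwa [sub_zero]
      have := h4.scomp (h := fun l : ℝ => 1 - l) 0 h3
      rwa [neg_one_smul] at this
    have hd2 : HasDerivAt (fun l : ℝ => startPt x₁ Ψ τ₀ y (l • u))
        (fderiv ℝ (startPt x₁ Ψ τ₀ y) 0 u) 0 := by
      have h3 : HasDerivAt (fun l : ℝ => l • u) u 0 := by
        simpa using (hasDerivAt_id (0 : ℝ)).smul_const u
      have h4 : HasFDerivAt (startPt x₁ Ψ τ₀ y) (fderiv ℝ (startPt x₁ Ψ τ₀ y) 0) ((0 : ℝ) • u) := by
        rw [zero_smul]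
        exact hF.hasFDerivAt
      exact h4.comp_hasDerivAt 0 h3
    have hd3 : HasDerivWithinAt (fun l : ℝ => startPt x₁ Ψ τ₀ y (l • u)) (-u) (Icc 0 1) 0 :=
      hd1.hasDerivWithinAt.congr (fun l hl => by simp only [startPt, hscale l hl])
        (by simp only [startPt, hscale 0 h01])
    exact (uniqueDiffWithinAt_unitInterval h01).eq_deriv _ hd2.hasDerivWithinAt hd3
  refine isInvertible_of_comp_eq_id (R := -.id ℝ E) ?_
  ext1 u
  obtain ⟨c, hc, hcu⟩ : ∃ c : ℝ, 0 < c ∧ ‖c • u‖ < ρ := by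
    refine ⟨ρ / 2 / (1 + ‖u‖), by positivity, ?_⟩
    rw [norm_smul, Real.norm_of_nonneg (by positivity), div_mul_eq_mul_div, div_lt_iff₀ (by positivity)]
    nlinarith [norm_nonneg u]
  have h1 := key _ hcu
  rw [map_smul, ← smul_neg] at h1
  have h2 := smul_right_injective E hc.ne' h1
  simp [h2]

end TwoPoint
end OscGeom

end

noncomputable section

namespace OscGeom

/-! ### The weighted Hessian at one point: bilinearity and the two integral formulas. -/

section Pointwise

variable {n : ℕ} {M : Type*} [TopologicalSpace M] [ChartedSpace (EuclideanSpace ℝ (Fin n)) M]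
  [IsManifold (𝓡 n) ∞ M]

local notation "E" => EuclideanSpace ℝ (Fin n)

theorem two_le_infty : (2 : WithTop ℕ∞) ≤ ∞ := by
  change ((2 : ℕ∞) : WithTop ℕ∞) ≤ ((⊤ : ℕ∞) : WithTop ℕ∞)
  exact WithTop.coe_le_coe.2 le_top

section Hess

variable {F : Type*} [NormedAddCommGroup F] [NormedSpace ℝ F]

/-- The Hessian in the chart at `x₀`. -/
def hessC (cov : Conn n M) (f : M → F) (x₀ : M) (y a b : E) : F :=
  fderiv ℝ (fderiv ℝ (fun y => f ((cc n x₀).symm y))) y b a -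
    fderiv ℝ (fun y => f ((cc n x₀).symm y)) y (christ cov x₀ y a b)

theorem hess_eq_hessC (cov : Conn n M) {f : M → F} {x₀ x : M} (hx : x ∈ chartDom n x₀)
    (hf : ContMDiffAt (𝓡 n) 𝓘(ℝ, F) ∞ f x) (v w : TangentSpace (𝓡 n) x) :
    hess cov f x v w = hessC cov f x₀ (cc n x₀ x) (tc x₀ x v) (tc x₀ x w) :=
  hess_eq cov hx (hf.of_le two_le_infty) v w

theorem hasDerivWithinAt_fderiv_apply {G : E → F} {y a : ℝ → E} {u a' : E} {S : Set ℝ} {s : ℝ}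
    (hG : ContDiffAt ℝ ∞ G (y s)) (hy : HasDerivWithinAt y u S s) (ha : HasDerivWithinAt a a' S s) :
    HasDerivWithinAt (fun s => fderiv ℝ G (y s) (a s))
      (fderiv ℝ (fderiv ℝ G) (y s) u (a s) + fderiv ℝ G (y s) a') S s := by
  have hG1 : HasFDerivAt (fderiv ℝ G) (fderiv ℝ (fderiv ℝ G) (y s)) (y s) :=
    ((hG.fderiv_right (m := 1) two_le_infty).differentiableAt (by simp)).hasFDerivAt
  exact (hG1.comp_hasDerivWithinAt s hy).clm_apply ha

theorem continuousWithinAt_hessC {cov : Conn n M} (hcov : SmoothConn cov) {f : M → F} {x₀ : M}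
    {y a b : ℝ → E} {S : Set ℝ} {s : ℝ} (hyt : y s ∈ (cc n x₀).target)
    (hf : ContDiffAt ℝ ∞ (fun y => f ((cc n x₀).symm y)) (y s)) (hy : ContinuousWithinAt y S s)
    (ha : ContinuousWithinAt a S s) (hb : ContinuousWithinAt b S s) :
    ContinuousWithinAt (fun s => hessC cov f x₀ (y s) (a s) (b s)) S s := by
  have hG1 : ContDiffAt ℝ ∞ (fderiv ℝ (fun y => f ((cc n x₀).symm y))) (y s) :=
    hf.fderiv_right (m := ∞) (by simp)
  have hG2 : ContDiffAt ℝ ∞ (fderiv ℝ (fderiv ℝ (fun y => f ((cc n x₀).symm y)))) (y s) :=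
    hG1.fderiv_right (m := ∞) (by simp)
  have hΓ : ContinuousAt (christ cov x₀) (y s) :=
    ((hcov x₀).contDiffAt ((isOpen_cc_target _).mem_nhds hyt)).continuousAt
  exact (((hG2.continuousAt.comp_continuousWithinAt hy).clm_apply hb).clm_apply ha).sub
    ((hG1.continuousAt.comp_continuousWithinAt hy).clm_apply
      (((hΓ.comp_continuousWithinAt hy).clm_apply ha).clm_apply hb))

theorem hess_lincomb_left (cov : Conn n M) {f : M → F} {x : M}
    (hf : ContMDiffAt (𝓡 n) 𝓘(ℝ, F) ∞ f x) (c d : ℝ) (v v' w : TangentSpace (𝓡 n) x) :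
    hess cov f x (c • v + d • v') w = c • hess cov f x v w + d • hess cov f x v' w := by
  have hx : x ∈ chartDom n x := mem_chart_source _ x
  simp only [hess_eq_hessC cov hx hf, hessC, map_add, map_smul, _root_.add_apply,
    _root_.smul_apply, smul_sub]
  abel

theorem hess_lincomb_right (cov : Conn n M) {f : M → F} {x : M}
    (hf : ContMDiffAt (𝓡 n) 𝓘(ℝ, F) ∞ f x) (c d : ℝ) (v w w' : TangentSpace (𝓡 n) x) :
    hess cov f x v (c • w + d • w') = c • hess cov f x v w + d • hess cov f x v w' := by
  have hx : x ∈ chartDom n x := mem_chart_source _ x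
  simp only [hess_eq_hessC cov hx hf, hessC, map_add, map_smul, _root_.add_apply,
    _root_.smul_apply, smul_sub]
  abel

end Hess

/-- The geodesic from `p` to `q` and the parallel transports along it exist. -/
structure RegPt (cov : Conn n M) (Ω₁ : Set M) (p q : M) : Prop where
  geo : IsGeodesicIn cov Ω₁ p q (geod cov Ω₁ p q)
  par : ∀ v, IsParallel cov (geod cov Ω₁ p q) (transport cov (geod cov Ω₁ p q) q v)
  fin : ∀ v, (⟨geod cov Ω₁ p q 1, transport cov (geod cov Ω₁ p q) q v 1⟩ :
    TangentBundle (𝓡 n) M) = ⟨q, v⟩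

variable {cov : Conn n M} {Ω₁ : Set M} {p q : M}

local notation "γ₁" => geod cov Ω₁ p q
local notation "T₁" => transport cov (geod cov Ω₁ p q) q

theorem RegPt.isSol (h : RegPt cov Ω₁ p q) (v : TangentSpace (𝓡 n) q) {t : ℝ}
    (ht : t ∈ Icc (0 : ℝ) 1) :
    IsSol cov (Icc 0 1) (fun s => ⟨γ₁ s, velocity γ₁ s, T₁ v s⟩) t :=
  h.geo.isSol (h.par v) ht

/-- The end point of the curve is only propositionally `q`; equality in the tangent bundle carries
the final velocity into `T_q M`. -/
theorem RegPt.exists_velocity (h : RegPt cov Ω₁ p q) : ∃ u : TangentSpace (𝓡 n) q,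
    (⟨γ₁ 1, velocity γ₁ 1⟩ : TangentBundle (𝓡 n) M) = ⟨q, u⟩ := by
  have key : ∀ (x : M) (w : TangentSpace (𝓡 n) x), x = q → ∃ u : TangentSpace (𝓡 n) q,
      (⟨x, w⟩ : TangentBundle (𝓡 n) M) = ⟨q, u⟩ := by
    rintro x w rfl
    exact ⟨w, rfl⟩
  exact key _ _ h.geo.target

theorem lincomb_of_mk_eq {x q : M} {a b c : TangentSpace (𝓡 n) x} {v w : TangentSpace (𝓡 n) q}
    {k l : ℝ} (ha : (⟨x, a⟩ : TangentBundle (𝓡 n) M) = ⟨q, v⟩)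
    (hb : (⟨x, b⟩ : TangentBundle (𝓡 n) M) = ⟨q, w⟩)
    (hc : (⟨x, c⟩ : TangentBundle (𝓡 n) M) = ⟨q, k • v + l • w⟩) : c = k • a + l • b := by
  cases ha
  cases hb
  cases hc
  rfl

theorem RegPt.transport_unique [T2Space M] (hcov : SmoothConn cov) (h : RegPt cov Ω₁ p q)
    {V : ∀ t, TangentSpace (𝓡 n) (γ₁ t)} {v : TangentSpace (𝓡 n) q}
    (hV : ∀ t ∈ Icc (0 : ℝ) 1, IsSol cov (Icc 0 1) (fun s => ⟨γ₁ s, velocity γ₁ s, V s⟩) t)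
    (h1 : T₁ v 1 = V 1) {s : ℝ} (hs : s ∈ Icc (0 : ℝ) 1) : T₁ v s = V s := by
  have huniq := IsSol.unique hcov ordConnected_Icc (fun t ht => h.isSol v ht) hV (a := 1)
    ⟨zero_le_one, le_rfl⟩ (by simp only [h1])
  have := huniq hs
  simp only [GState.mk.injEq, true_and] at this
  exact this

theorem RegPt.transport_lincomb [T2Space M] (hcov : SmoothConn cov) (h : RegPt cov Ω₁ p q) (c d : ℝ)
    (v w : TangentSpace (𝓡 n) q) {s : ℝ} (hs : s ∈ Icc (0 : ℝ) 1) :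
    T₁ (c • v + d • w) s = c • T₁ v s + d • T₁ w s :=
  h.transport_unique hcov (fun _ ht => (h.isSol v ht).lincomb c d (h.isSol w ht))
    (lincomb_of_mk_eq (h.fin v) (h.fin w) (h.fin _)) hs

/-- The velocity of a geodesic is parallel, so it is the transport of its own final value. This is
what relates the weighted Hessians to derivatives of `Φ` along the geodesic. -/
theorem RegPt.transport_velocity [T2Space M] (hcov : SmoothConn cov) (h : RegPt cov Ω₁ p q)
    {u : TangentSpace (𝓡 n) q}
    (hu : (⟨γ₁ 1, velocity γ₁ 1⟩ : TangentBundle (𝓡 n) M) = ⟨q, u⟩) {s : ℝ}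
    (hs : s ∈ Icc (0 : ℝ) 1) : T₁ u s = velocity γ₁ s :=
  h.transport_unique hcov (fun _ ht => h.geo.isSol h.geo.isParallel_velocity ht)
    (by
      have h1 := lincomb_of_mk_eq (k := 1) (l := 0) (c := T₁ u 1) hu hu
        (by rw [one_smul, zero_smul, add_zero]; exact h.fin u)
      rwa [one_smul, zero_smul, add_zero] at h1) hs

section

variable {Φ : M → ℝ} (hΦ : ∀ x, x ∈ Ω₁ → ContMDiffAt (𝓡 n) 𝓘(ℝ, ℝ) ∞ Φ x)

include hΦ

/-- In a chart the coordinates of `V` have derivative `-Γ(V, γ')`, and this is exactly the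
connection term of the Hessian. -/
theorem RegPt.hasDerivWithinAt_mvfderiv (h : RegPt cov Ω₁ p q)
    {V : ∀ t, TangentSpace (𝓡 n) (γ₁ t)} {s : ℝ}
    (hs : s ∈ Icc (0 : ℝ) 1)
    (hV : IsSol cov (Icc 0 1) (fun s => ⟨γ₁ s, velocity γ₁ s, V s⟩) s) :
    HasDerivWithinAt (fun s => mvfderiv (𝓡 n) Φ (γ₁ s) (V s))
      (hess cov Φ (γ₁ s) (V s) (velocity γ₁ s)) (Icc 0 1) s := by
  have hx : γ₁ s ∈ chartDom n (γ₁ s) := mem_chart_source _ _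
  obtain ⟨h1, -, h3⟩ := hV.hasDerivWithinAt hx
  have hΦs := hΦ _ (h.geo.mapsTo hs)
  have hG : ContDiffAt ℝ ∞ (fun y => Φ ((cc n (γ₁ s)).symm y)) (cc n (γ₁ s) (γ₁ s)) :=
    contDiffAt_comp_cc_symm (m := ⊤) hx hΦs
  have h4 := hasDerivWithinAt_fderiv_apply (y := fun t => cc n (γ₁ s) (γ₁ t)) hG h1 h3
  rw [map_neg, ← sub_eq_add_neg] at h4
  rw [hess_eq_hessC cov hx hΦs, hessC]
  refine h4.congr_of_eventuallyEq_of_mem ?_ hs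
  filter_upwards [self_mem_nhdsWithin, hV.1.eventually ((isOpen_chartDom (γ₁ s)).mem_nhds hx)]
    with t ht htx
  exact mvfderiv_eq htx ((hΦ _ (h.geo.mapsTo ht)).mdifferentiableAt (by simp)) _

theorem RegPt.continuousOn_hess (hcov : SmoothConn cov) (h : RegPt cov Ω₁ p q)
    (v w : TangentSpace (𝓡 n) q) :
    ContinuousOn (fun s => hess cov Φ (γ₁ s) (T₁ v s) (T₁ w s)) (Icc 0 1) := by
  intro s hs
  have hx : γ₁ s ∈ chartDom n (γ₁ s) := mem_chart_source _ _
  obtain ⟨h1, -, h3⟩ := (h.isSol v hs).hasDerivWithinAt hx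
  obtain ⟨-, -, h4⟩ := (h.isSol w hs).hasDerivWithinAt hx
  have hΦs := hΦ _ (h.geo.mapsTo hs)
  have hG : ContDiffAt ℝ ∞ (fun y => Φ ((cc n (γ₁ s)).symm y)) (cc n (γ₁ s) (γ₁ s)) :=
    contDiffAt_comp_cc_symm (m := ⊤) hx hΦs
  have h5 := continuousWithinAt_hessC hcov (f := Φ) (y := fun t => cc n (γ₁ s) (γ₁ t))
    (cc_mem_target hx) hG h1.continuousWithinAt h3.continuousWithinAt h4.continuousWithinAt
  refine h5.congr_of_eventuallyEq_of_mem ?_ hs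
  filter_upwards [self_mem_nhdsWithin,
    (h.isSol v hs).1.eventually ((isOpen_chartDom (γ₁ s)).mem_nhds hx)] with t ht htx
  exact hess_eq_hessC cov htx (hΦ _ (h.geo.mapsTo ht)) _ _

/-- For `σ ≥ 1` the weight is continuous up to `s = 1`; only `σ = 1` and `σ = 2` occur in the
operator. -/
theorem RegPt.intervalIntegrable (hcov : SmoothConn cov) (h : RegPt cov Ω₁ p q)
    {σ : ℝ} (hσ : 1 ≤ σ) (v w : TangentSpace (𝓡 n) q) :
    IntervalIntegrable (fun s => (1 - s) ^ (σ - 1) * hess cov Φ (γ₁ s) (T₁ v s) (T₁ w s))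
      MeasureTheory.volume 0 1 := by
  refine ContinuousOn.intervalIntegrable ?_
  rw [uIcc_of_le zero_le_one]
  refine ContinuousOn.mul ?_ (h.continuousOn_hess hΦ hcov v w)
  exact (Continuous.rpow_const (by fun_prop) fun _ => Or.inr (by linarith)).continuousOn

theorem RegPt.weightedHess_symm (htor : cov.torsion = 0) (h : RegPt cov Ω₁ p q)
    (σ : ℝ) (v w : TangentSpace (𝓡 n) q) :
    weightedHess cov Ω₁ Φ p σ q v w = weightedHess cov Ω₁ Φ p σ q w v := by
  unfold weightedHess
  congr 1
  refine intervalIntegral.integral_congr fun s hs => ?_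
  rw [uIcc_of_le zero_le_one] at hs
  rw [hess_symm cov htor ((hΦ _ (h.geo.mapsTo hs)).of_le two_le_infty)]

theorem RegPt.weightedHess_lincomb_left [T2Space M] (hcov : SmoothConn cov) (h : RegPt cov Ω₁ p q)
    {σ : ℝ} (hσ : 1 ≤ σ) (c d : ℝ) (v v' w : TangentSpace (𝓡 n) q) :
    weightedHess cov Ω₁ Φ p σ q (c • v + d • v') w =
      c * weightedHess cov Ω₁ Φ p σ q v w + d * weightedHess cov Ω₁ Φ p σ q v' w := by
  unfold weightedHess
  have h1 : ∫ s in (0 : ℝ)..1, (1 - s) ^ (σ - 1) * hess cov Φ (γ₁ s) (T₁ (c • v + d • v') s) (T₁ w s) =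
      ∫ s in (0 : ℝ)..1, (c * ((1 - s) ^ (σ - 1) * hess cov Φ (γ₁ s) (T₁ v s) (T₁ w s)) +
        d * ((1 - s) ^ (σ - 1) * hess cov Φ (γ₁ s) (T₁ v' s) (T₁ w s))) := by
    refine intervalIntegral.integral_congr fun s hs => ?_
    rw [uIcc_of_le zero_le_one] at hs
    rw [h.transport_lincomb hcov c d v v' hs, hess_lincomb_left cov (hΦ _ (h.geo.mapsTo hs))]
    simp only [smul_eq_mul]
    ring
  rw [h1, intervalIntegral.integral_add ((h.intervalIntegrable hΦ hcov hσ v w).const_mul c)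
    ((h.intervalIntegrable hΦ hcov hσ v' w).const_mul d), intervalIntegral.integral_const_mul,
    intervalIntegral.integral_const_mul]
  ring

theorem RegPt.weightedHess_lincomb_right [T2Space M] (hcov : SmoothConn cov)
    (htor : cov.torsion = 0) (h : RegPt cov Ω₁ p q)
    {σ : ℝ} (hσ : 1 ≤ σ) (c d : ℝ) (v w w' : TangentSpace (𝓡 n) q) :
    weightedHess cov Ω₁ Φ p σ q v (c • w + d • w') =
      c * weightedHess cov Ω₁ Φ p σ q v w + d * weightedHess cov Ω₁ Φ p σ q v w' := by
  rw [h.weightedHess_symm hΦ htor, h.weightedHess_lincomb_left hΦ hcov hσ,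
    h.weightedHess_symm hΦ htor σ v w, h.weightedHess_symm hΦ htor σ v w']

/-- The differential of `Φ` at `q` is `∇²₁ Φ` contracted with the velocity. -/
theorem RegPt.mvfderiv_eq_weightedHess [T2Space M] (hcov : SmoothConn cov) (h : RegPt cov Ω₁ p q)
    (hcrit : IsCrit n Φ p) {u : TangentSpace (𝓡 n) q}
    (hu : (⟨γ₁ 1, velocity γ₁ 1⟩ : TangentBundle (𝓡 n) M) = ⟨q, u⟩) (v : TangentSpace (𝓡 n) q) :
    mvfderiv (𝓡 n) Φ q v = weightedHess cov Ω₁ Φ p 1 q v u := by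
  have hd := fun (s : ℝ) (hs : s ∈ Icc (0 : ℝ) 1) => h.hasDerivWithinAt_mvfderiv hΦ (V := T₁ v) hs (h.isSol v hs)
  have hcongr : ∀ s ∈ Icc (0 : ℝ) 1, hess cov Φ (γ₁ s) (T₁ v s) (velocity γ₁ s) =
      hess cov Φ (γ₁ s) (T₁ v s) (T₁ u s) := fun s hs => by
    rw [h.transport_velocity hcov hu hs]
  have hint := intervalIntegral.integral_eq_sub_of_hasDerivAt_of_le
    (f := fun s => mvfderiv (𝓡 n) Φ (γ₁ s) (T₁ v s))
    (f' := fun s => hess cov Φ (γ₁ s) (T₁ v s) (T₁ u s)) zero_le_one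
    (fun s hs => (hd s hs).continuousWithinAt)
    (fun s hs => by
      have := (hd s ⟨hs.1.le, hs.2.le⟩).hasDerivAt (Icc_mem_nhds hs.1 hs.2)
      rwa [hcongr s ⟨hs.1.le, hs.2.le⟩] at this)
    (ContinuousOn.intervalIntegrable (by
      rw [uIcc_of_le zero_le_one]
      exact h.continuousOn_hess hΦ hcov v u))
  have h1 : mvfderiv (𝓡 n) Φ (γ₁ 1) (T₁ v 1) = mvfderiv (𝓡 n) Φ q v := by
    have := congrArg (fun ξ : TangentBundle (𝓡 n) M => mvfderiv (𝓡 n) Φ ξ.1 ξ.2) (h.fin v)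
    exact this
  have h0 : mvfderiv (𝓡 n) Φ (γ₁ 0) (T₁ v 0) = 0 := by
    have : mvfderiv (𝓡 n) Φ (γ₁ 0) = 0 := by
      rw [h.geo.source]
      exact hcrit
    rw [this]
    rfl
  rw [h1, h0, sub_zero] at hint
  rw [weightedHess, ← hint]
  simp

/-- Taylor's formula along the geodesic. -/
theorem RegPt.sub_eq_weightedHess [T2Space M] (hcov : SmoothConn cov) (h : RegPt cov Ω₁ p q)
    (hcrit : IsCrit n Φ p) {u : TangentSpace (𝓡 n) q}
    (hu : (⟨γ₁ 1, velocity γ₁ 1⟩ : TangentBundle (𝓡 n) M) = ⟨q, u⟩) :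
    2 * (Φ q - Φ p) = weightedHess cov Ω₁ Φ p 2 q u u := by
  have hd1 := fun (s : ℝ) (hs : s ∈ Icc (0 : ℝ) 1) => h.hasDerivWithinAt_mvfderiv hΦ hs
    (h.geo.isSol h.geo.isParallel_velocity hs)
  have hd2 : ∀ s ∈ Icc (0 : ℝ) 1, HasDerivWithinAt (fun s => Φ (γ₁ s))
      (mvfderiv (𝓡 n) Φ (γ₁ s) (velocity γ₁ s)) (Icc 0 1) s := fun s hs =>
    hasDerivWithinAt_comp_mvfderiv ((hΦ _ (h.geo.mapsTo hs)).mdifferentiableAt (by simp))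
      ((h.geo.smooth s hs).mdifferentiableWithinAt (by simp))
  -- A primitive of the integrand for `σ = 2`: the two terms with `dΦ(γ')` cancel. It equals `Φ q`
  -- at time 1, and `Φ p` at time 0 because `p` is critical.
  have hd : ∀ s ∈ Icc (0 : ℝ) 1, HasDerivWithinAt
      (fun s => (1 - s) * mvfderiv (𝓡 n) Φ (γ₁ s) (velocity γ₁ s) + Φ (γ₁ s))
      ((1 - s) ^ ((2 : ℝ) - 1) * hess cov Φ (γ₁ s) (T₁ u s) (T₁ u s)) (Icc 0 1) s := by
    intro s hs
    have h3 : HasDerivWithinAt (fun s : ℝ => 1 - s) (-1) (Icc 0 1) s := by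
      simpa using (hasDerivWithinAt_id s (Icc 0 1)).const_sub 1
    refine ((h3.mul (hd1 s hs)).add (hd2 s hs)).congr_deriv ?_
    rw [h.transport_velocity hcov hu hs, show (2 : ℝ) - 1 = 1 by norm_num, Real.rpow_one]
    ring
  have hint := intervalIntegral.integral_eq_sub_of_hasDerivAt_of_le zero_le_one
    (fun s hs => (hd s hs).continuousWithinAt)
    (fun s hs => (hd s ⟨hs.1.le, hs.2.le⟩).hasDerivAt (Icc_mem_nhds hs.1 hs.2))
    (h.intervalIntegrable hΦ hcov (by norm_num) u u)
  have h0 : mvfderiv (𝓡 n) Φ (γ₁ 0) (velocity γ₁ 0) = 0 := by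
    have : mvfderiv (𝓡 n) Φ (γ₁ 0) = 0 := by
      rw [h.geo.source]
      exact hcrit
    rw [this]
    rfl
  rw [weightedHess, hint, h0, h.geo.source, h.geo.target]
  ring

end

end Pointwise
end OscGeom

end

noncomputable section

namespace OscGeom

/-! ### The operator on functions of `Φ`, and the Schrödinger identity. -/

section Algebra

variable {n : ℕ} {M : Type*} [TopologicalSpace M] [ChartedSpace (EuclideanSpace ℝ (Fin n)) M]
  [IsManifold (𝓡 n) ∞ M]

local notation "E" => EuclideanSpace ℝ (Fin n)

/-- The components of a tangent vector in the basis `basisVec`. -/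
def comps {q : M} (v : TangentSpace (𝓡 n) q) : Fin n → ℝ := fun i => (show E from v) i

theorem sum_basisVec {q : M} (v : TangentSpace (𝓡 n) q) : v = ∑ i, comps v i • basisVec q i := by
  have : ∀ a : E, a = ∑ i, a i • EuclideanSpace.single i (1 : ℝ) := by
    intro a
    ext j
    simp [Finset.sum_apply, Pi.single_apply]
  exact this v

section Hess

variable {F : Type*} [NormedAddCommGroup F] [NormedSpace ℝ F]

/-- The Hessian as a bilinear map. -/
theorem exists_bilin_hess (cov : Conn n M) {f : M → F} {x : M}
    (hf : ContMDiffAt (𝓡 n) 𝓘(ℝ, F) ∞ f x) :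
    ∃ B : TangentSpace (𝓡 n) x →ₗ[ℝ] TangentSpace (𝓡 n) x →ₗ[ℝ] F,
      ∀ v w, B v w = hess cov f x v w := by
  refine ⟨LinearMap.mk₂ ℝ (hess cov f x) (fun v v' w => ?_) (fun c v w => ?_) (fun v w w' => ?_)
    (fun c v w => ?_), fun v w => rfl⟩
  · simpa using hess_lincomb_left cov hf 1 1 v v' w
  · simpa using hess_lincomb_left cov hf c 0 v v w
  · simpa using hess_lincomb_right cov hf 1 1 v w w'
  · simpa using hess_lincomb_right cov hf c 0 v w w

theorem mvfderiv_comp_real {Φ : M → ℝ} {x : M} (hΦ : MDifferentiableAt (𝓡 n) 𝓘(ℝ, ℝ) Φ x)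
    {g : ℝ → F} {g' : F} (hg : HasDerivAt g g' (Φ x)) (v : TangentSpace (𝓡 n) x) :
    mvfderiv (𝓡 n) (fun y => g (Φ y)) x v = mvfderiv (𝓡 n) Φ x v • g' := by
  have h := (hg.hasFDerivAt.hasMFDerivAt.comp x hΦ.hasMFDerivAt).mfderiv
  exact congrArg (fun L => L v) h

/-- The Hessian of a function of a function. -/
theorem hess_comp_real (cov : Conn n M) {Φ : M → ℝ} {x : M}
    (hΦ : ContMDiffAt (𝓡 n) 𝓘(ℝ, ℝ) ∞ Φ x) {g g₁ : ℝ → F} {g₂ : F} (hgs : ContDiff ℝ ∞ g)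
    (hg : ∀ r, HasDerivAt g (g₁ r) r) (hg₁ : HasDerivAt g₁ g₂ (Φ x))
    (v w : TangentSpace (𝓡 n) x) :
    hess cov (fun y => g (Φ y)) x v w =
      hess cov Φ x v w • g₁ (Φ x) + (mvfderiv (𝓡 n) Φ x v * mvfderiv (𝓡 n) Φ x w) • g₂ := by
  have hx : x ∈ chartDom n x := mem_chart_source _ x
  have hcomp : ContMDiffAt (𝓡 n) 𝓘(ℝ, F) ∞ (fun y => g (Φ y)) x :=
    (hgs.contMDiff.contMDiffAt (x := Φ x)).comp x hΦ
  rw [hess_eq_hessC cov hx hcomp, hess_eq_hessC cov hx hΦ,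
    mvfderiv_eq hx (hΦ.mdifferentiableAt (by simp)), mvfderiv_eq hx (hΦ.mdifferentiableAt (by simp))]
  unfold hessC
  set G : E → ℝ := fun y => Φ ((cc n x).symm y) with hG
  have hGs : ContDiffAt ℝ ∞ G (cc n x x) := contDiffAt_comp_cc_symm (m := ⊤) hx hΦ
  have hGx : G (cc n x x) = Φ x := by simp only [hG, cc_left_inv hx]
  generalize tc x x v = a
  generalize tc x x w = b
  generalize christ cov x (cc n x x) a b = c
  generalize cc n x x = y at *
  change fderiv ℝ (fderiv ℝ fun y => g (G y)) y b a - fderiv ℝ (fun y => g (G y)) y c = _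
  have hH : ContDiffAt ℝ ∞ (fun y => g (G y)) y := hgs.contDiffAt.comp y hGs
  have h1 : ∀ y' a, DifferentiableAt ℝ G y' →
      fderiv ℝ (fun y => g (G y)) y' a = fderiv ℝ G y' a • g₁ (G y') := by
    intro y' a hd
    have h := ((hg (G y')).hasFDerivAt.comp y' hd.hasFDerivAt).fderiv
    have h' : fderiv ℝ (fun y => g (G y)) y' = _ := h
    rw [h']
    simp
  have hdiff : ∀ᶠ y' in 𝓝 y, DifferentiableAt ℝ G y' :=
    ((hGs.of_le two_le_infty).eventually (by simp)).mono fun y' h => h.differentiableAt (by simp)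
  have hGd : DifferentiableAt ℝ G y := hGs.differentiableAt (by simp)
  have hG1 : DifferentiableAt ℝ (fderiv ℝ G) y :=
    (hGs.fderiv_right (m := 1) two_le_infty).differentiableAt (by simp)
  have hH1 : DifferentiableAt ℝ (fderiv ℝ fun y => g (G y)) y :=
    (hH.fderiv_right (m := 1) two_le_infty).differentiableAt (by simp)
  have e1 : fderiv ℝ (fderiv ℝ fun y => g (G y)) y b a =
      fderiv ℝ (fun y' => fderiv ℝ (fun y => g (G y)) y' a) y b := by
    rw [fderiv_clm_apply hH1 (differentiableAt_const a)]
    simp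
  have e2 : fderiv ℝ (fderiv ℝ G) y b a = fderiv ℝ (fun y' => fderiv ℝ G y' a) y b := by
    rw [fderiv_clm_apply hG1 (differentiableAt_const a)]
    simp
  have hev : (fun y' => fderiv ℝ (fun y => g (G y)) y' a) =ᶠ[𝓝 y]
      fun y' => fderiv ℝ G y' a • g₁ (G y') := hdiff.mono fun y' hy' => h1 y' a hy'
  have hg₁' : HasDerivAt g₁ g₂ (G y) := by rwa [hGx]
  have h3 : HasFDerivAt (fun y' => g₁ (G y')) _ y := hg₁'.hasFDerivAt.comp y hGd.hasFDerivAt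
  have h4 : HasFDerivAt (fun y' => fderiv ℝ G y' a) (fderiv ℝ (fun y' => fderiv ℝ G y' a) y) y :=
    (hG1.clm_apply (differentiableAt_const a)).hasFDerivAt
  have h5 := (h4.smul h3).fderiv
  have h5' : fderiv ℝ (fun y' => fderiv ℝ G y' a • g₁ (G y')) y = _ := h5
  rw [e1, hev.fderiv_eq, h5', h1 y c hGd, e2, hGx]
  simp [mul_smul, sub_smul]
  abel

end Hess

variable {cov : Conn n M} {Ω₁ : Set M} {p q : M} {Φ : M → ℝ}

/-- The weighted Hessian as a bilinear form. -/
theorem RegPt.exists_bilin [T2Space M] (hcov : SmoothConn cov) (htor : cov.torsion = 0)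
    (h : RegPt cov Ω₁ p q) (hΦ : ∀ x, x ∈ Ω₁ → ContMDiffAt (𝓡 n) 𝓘(ℝ, ℝ) ∞ Φ x) {σ : ℝ}
    (hσ : 1 ≤ σ) :
    ∃ B : TangentSpace (𝓡 n) q →ₗ[ℝ] TangentSpace (𝓡 n) q →ₗ[ℝ] ℝ,
      ∀ v w, B v w = weightedHess cov Ω₁ Φ p σ q v w := by
  refine ⟨LinearMap.mk₂ ℝ (weightedHess cov Ω₁ Φ p σ q) (fun v v' w => ?_) (fun c v w => ?_)
    (fun v w w' => ?_) (fun c v w => ?_), fun v w => rfl⟩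
  · simpa using h.weightedHess_lincomb_left hΦ hcov hσ 1 1 v v' w
  · simpa using h.weightedHess_lincomb_left hΦ hcov hσ c 0 v v w
  · simpa using h.weightedHess_lincomb_right hΦ hcov htor hσ 1 1 v w w'
  · simpa using h.weightedHess_lincomb_right hΦ hcov htor hσ c 0 v w w

theorem RegPt.weightedMatrix_mulVec [T2Space M] (hcov : SmoothConn cov) (htor : cov.torsion = 0)
    (h : RegPt cov Ω₁ p q) (hΦ : ∀ x, x ∈ Ω₁ → ContMDiffAt (𝓡 n) 𝓘(ℝ, ℝ) ∞ Φ x) {σ : ℝ}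
    (hσ : 1 ≤ σ) (u : TangentSpace (𝓡 n) q) (i : Fin n) :
    ((weightedMatrix cov Ω₁ Φ p σ q).mulVec (comps u)) i =
      weightedHess cov Ω₁ Φ p σ q (basisVec q i) u := by
  obtain ⟨B, hB⟩ := h.exists_bilin hcov htor hΦ hσ
  conv_rhs => rw [← hB, sum_basisVec u, map_sum]
  simp only [Matrix.mulVec, dotProduct, weightedMatrix, Matrix.of_apply, ← hB, map_smul, smul_eq_mul,
    mul_comm]

theorem RegPt.weightedMatrix_transpose (htor : cov.torsion = 0)
    (h : RegPt cov Ω₁ p q) (hΦ : ∀ x, x ∈ Ω₁ → ContMDiffAt (𝓡 n) 𝓘(ℝ, ℝ) ∞ Φ x) (σ : ℝ) :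
    (weightedMatrix cov Ω₁ Φ p σ q).transpose = weightedMatrix cov Ω₁ Φ p σ q := by
  ext i j
  exact h.weightedHess_symm hΦ htor σ _ _

theorem RegPt.mvfderiv_eq_mulVec [T2Space M] (hcov : SmoothConn cov) (htor : cov.torsion = 0)
    (h : RegPt cov Ω₁ p q) (hΦ : ∀ x, x ∈ Ω₁ → ContMDiffAt (𝓡 n) 𝓘(ℝ, ℝ) ∞ Φ x)
    (hcrit : IsCrit n Φ p) {u : TangentSpace (𝓡 n) q}
    (hu : (⟨geod cov Ω₁ p q 1, velocity (geod cov Ω₁ p q) 1⟩ : TangentBundle (𝓡 n) M) = ⟨q, u⟩) :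
    (fun i => mvfderiv (𝓡 n) Φ q (basisVec q i)) = (weightedMatrix cov Ω₁ Φ p 1 q).mulVec (comps u) := by
  funext i
  rw [h.weightedMatrix_mulVec hcov htor hΦ le_rfl, h.mvfderiv_eq_weightedHess hΦ hcov hcrit hu]

variable {F : Type*} [NormedAddCommGroup F] [NormedSpace ℝ F]

/-- `Z_ψ Φ` is the derivative of `ψ` along the geodesic from `p`. -/
theorem RegPt.zField_eq [T2Space M] (hcov : SmoothConn cov) (htor : cov.torsion = 0)
    (h : RegPt cov Ω₁ p q) (hΦ : ∀ x, x ∈ Ω₁ → ContMDiffAt (𝓡 n) 𝓘(ℝ, ℝ) ∞ Φ x)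
    (hcrit : IsCrit n Φ p) (hdet : (weightedMatrix cov Ω₁ Φ p 1 q).det ≠ 0)
    {u : TangentSpace (𝓡 n) q}
    (hu : (⟨geod cov Ω₁ p q 1, velocity (geod cov Ω₁ p q) 1⟩ : TangentBundle (𝓡 n) M) = ⟨q, u⟩)
    {f : M → F} {c : F} (hf : ∀ v, mvfderiv (𝓡 n) f q v = mvfderiv (𝓡 n) Φ q v • c) (ψ : M → ℝ) :
    zField cov Ω₁ Φ p ψ f q = mvfderiv (𝓡 n) ψ q u • c := by
  have h1 := h.mvfderiv_eq_mulVec hcov htor hΦ hcrit hu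
  set W := weightedMatrix cov Ω₁ Φ p 1 q with hW
  have h2 : W⁻¹.mulVec (fun i => mvfderiv (𝓡 n) Φ q (basisVec q i)) = comps u := by
    rw [h1, Matrix.mulVec_mulVec, Matrix.nonsing_inv_mul _ (isUnit_iff_ne_zero.2 hdet),
      Matrix.one_mulVec]
  have h3 : mvfderiv (𝓡 n) ψ q u = ∑ i, comps u i * mvfderiv (𝓡 n) ψ q (basisVec q i) := by
    conv_lhs => rw [sum_basisVec u, map_sum]
    simp only [map_smul, smul_eq_mul]
  rw [h3, Finset.sum_smul]
  unfold zField
  refine Finset.sum_congr rfl fun i _ => ?_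
  rw [← h2]
  simp only [hf, smul_smul, Matrix.mulVec, dotProduct, Finset.sum_mul, ← Finset.sum_smul]
  congr 1
  exact Finset.sum_congr rfl fun j _ => by ring

/-- `□₀` of a function of `Φ`. -/
theorem RegPt.box₀_eq [T2Space M] (hcov : SmoothConn cov) (htor : cov.torsion = 0)
    (h : RegPt cov Ω₁ p q) (hΦ : ∀ x, x ∈ Ω₁ → ContMDiffAt (𝓡 n) 𝓘(ℝ, ℝ) ∞ Φ x)
    (hcrit : IsCrit n Φ p) (hdet : (weightedMatrix cov Ω₁ Φ p 1 q).det ≠ 0)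
    {f : M → F} {c e : F} (hf : ∀ v w, hess cov f q v w =
      hess cov Φ q v w • c + (mvfderiv (𝓡 n) Φ q v * mvfderiv (𝓡 n) Φ q w) • e) :
    box₀ cov Ω₁ Φ p f q = box₀ cov Ω₁ Φ p Φ q • c + (2 * (Φ q - Φ p)) • e := by
  obtain ⟨u, hu⟩ := h.exists_velocity
  have h1 := h.mvfderiv_eq_mulVec hcov htor hΦ hcrit hu
  have h2 := h.sub_eq_weightedHess hΦ hcov hcrit hu
  have hsym := h.weightedMatrix_transpose htor hΦ 1
  obtain ⟨B, hB⟩ := h.exists_bilin hcov htor hΦ (σ := 2) (by norm_num)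
  have h3 : weightedHess cov Ω₁ Φ p 2 q u u =
      dotProduct (comps u) ((weightedMatrix cov Ω₁ Φ p 2 q).mulVec (comps u)) := by
    simp only [dotProduct, h.weightedMatrix_mulVec hcov htor hΦ (σ := 2) (by norm_num), ← hB]
    have hk : ∀ w, B u w = ∑ i, comps u i * B (basisVec q i) w := by
      intro w
      conv_lhs => rw [sum_basisVec u, map_sum]
      simp only [map_smul, LinearMap.sum_apply, LinearMap.smul_apply, smul_eq_mul]
    exact hk u
  set W := weightedMatrix cov Ω₁ Φ p 1 q with hW
  set W₂ := weightedMatrix cov Ω₁ Φ p 2 q with hW₂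
  have hunit : IsUnit W.det := isUnit_iff_ne_zero.2 hdet
  -- The contribution of `dΦ ⊗ dΦ`. With `dΦ = W u` and `W` symmetric, the quadratic form `dΦᵀ W⁻¹
  -- W₂ W⁻¹ dΦ` reduces to `uᵀ W₂ u`, which Taylor's formula evaluates.
  have h4 : ∑ i, ∑ j, symbolMatrix cov Ω₁ Φ p q i j *
      (mvfderiv (𝓡 n) Φ q (basisVec q j) * mvfderiv (𝓡 n) Φ q (basisVec q i)) =
      2 * (Φ q - Φ p) := by
    rw [h2, h3]
    have h5 : ∀ d : Fin n → ℝ, ∑ i, ∑ j, symbolMatrix cov Ω₁ Φ p q i j * (d j * d i) =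
        dotProduct d ((symbolMatrix cov Ω₁ Φ p q).mulVec d) := by
      intro d
      simp only [dotProduct, Matrix.mulVec, Finset.mul_sum]
      exact Finset.sum_congr rfl fun i _ => Finset.sum_congr rfl fun j _ => by ring
    rw [h5 (fun i => mvfderiv (𝓡 n) Φ q (basisVec q i)), h1, symbolMatrix, ← hW, ← hW₂,
      Matrix.mulVec_mulVec, Matrix.mul_assoc, Matrix.nonsing_inv_mul _ hunit, Matrix.mul_one,
      Matrix.dotProduct_mulVec, Matrix.dotProduct_mulVec, ← Matrix.vecMul_transpose W, hsym,
      Matrix.vecMul_vecMul, ← Matrix.mul_assoc, Matrix.mul_nonsing_inv _ hunit, Matrix.one_mul]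
  rw [← h4]
  unfold box₀
  simp only [hf, smul_add, smul_smul, Finset.sum_add_distrib, Finset.sum_smul, smul_eq_mul]

/-- For `g(r) = t^(-n/2) exp(i (r - Φ(p)) / t)`, `g' = (i/t) g` and `g'' = -g/t²`. The hypothesis on
`η` cancels `□₀Φ`, and `(i/2)(n g' + 2(Φ - Φ(p)) g'')` is the `t`-derivative, whose first part comes
from the factor `t^(-n/2)`. -/
theorem RegPt.hasDerivAt_oscKernel [T2Space M] (hcov : SmoothConn cov) (htor : cov.torsion = 0)
    (h : RegPt cov Ω₁ p q) (hΦ : ∀ x, x ∈ Ω₁ → ContMDiffAt (𝓡 n) 𝓘(ℝ, ℝ) ∞ Φ x)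
    (hcrit : IsCrit n Φ p) (hdet : (weightedMatrix cov Ω₁ Φ p 1 q).det ≠ 0)
    {u : TangentSpace (𝓡 n) q}
    (hu : (⟨geod cov Ω₁ p q 1, velocity (geod cov Ω₁ p q) 1⟩ : TangentBundle (𝓡 n) M) = ⟨q, u⟩)
    (hη : mvfderiv (𝓡 n) (eta cov Ω₁ Φ p) q u = n - box₀ cov Ω₁ Φ p Φ q) {t : ℝ} (ht : 0 < t) :
    HasDerivAt (fun s => oscKernel n Φ p s q)
      (Complex.I / 2 * box cov Ω₁ Φ p (oscKernel n Φ p t) q) t := by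
  have hq : q ∈ Ω₁ := by
    have := h.geo.mapsTo (⟨zero_le_one, le_rfl⟩ : (1 : ℝ) ∈ Icc (0 : ℝ) 1)
    rwa [h.geo.target] at this
  have ht' : (t : ℂ) ≠ 0 := by exact_mod_cast ht.ne'
  set A : ℂ := ((t ^ (-(n : ℝ) / 2) : ℝ) : ℂ) with hA
  set g : ℝ → ℂ := fun r => A * Complex.exp (Complex.I * (((r - Φ p) / t : ℝ) : ℂ)) with hg
  have hexp : ∀ r, HasDerivAt g (Complex.I / t * g r) r := by
    intro r
    have h1 : HasDerivAt (fun r : ℝ => (((r - Φ p) / t : ℝ) : ℂ)) ((1 / t : ℝ) : ℂ) r :=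
      (((hasDerivAt_id r).sub_const (Φ p)).div_const t).ofReal_comp
    have h2 := ((h1.const_mul Complex.I).cexp).const_mul A
    refine h2.congr_deriv ?_
    simp only [hg]
    push_cast
    ring
  have hgs : ContDiff ℝ ∞ g := by
    have h1 : ContDiff ℝ ∞ (fun r : ℝ => (((r - Φ p) / t : ℝ) : ℂ)) :=
      Complex.ofRealCLM.contDiff.comp ((contDiff_id.sub contDiff_const).div_const t)
    exact contDiff_const.mul (contDiff_const.mul h1).cexp
  have hg2 : HasDerivAt (fun r => Complex.I / t * g r)
      (Complex.I / t * (Complex.I / t * g (Φ q))) (Φ q) := (hexp _).const_mul _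
  have hosc : oscKernel n Φ p t = fun x => g (Φ x) := rfl
  have hb := h.box₀_eq hcov htor hΦ hcrit hdet
    (fun v w => hess_comp_real cov (hΦ q hq) hgs hexp hg2 v w)
  have hz := h.zField_eq hcov htor hΦ hcrit hdet hu
    (fun v => mvfderiv_comp_real ((hΦ q hq).mdifferentiableAt (by simp)) (hexp (Φ q)) v)
    (eta cov Ω₁ Φ p)
  rw [box, hosc, hb, hz, hη]
  have hp1 : HasDerivAt (fun s : ℝ => ((s ^ (-(n : ℝ) / 2) : ℝ) : ℂ))
      ((-(n : ℝ) / 2 * t ^ (-(n : ℝ) / 2 - 1) : ℝ) : ℂ) t :=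
    (Real.hasDerivAt_rpow_const (Or.inl ht.ne')).ofReal_comp
  have hp2 : HasDerivAt (fun s : ℝ => (((Φ q - Φ p) / s : ℝ) : ℂ))
      ((-(Φ q - Φ p) / t ^ 2 : ℝ) : ℂ) t := by
    have := ((hasDerivAt_inv ht.ne').const_mul (Φ q - Φ p)).ofReal_comp
    refine (this.congr_deriv ?_)
    congr 1
    field_simp
  have hp3 := hp1.mul ((hp2.const_mul Complex.I).cexp)
  refine hp3.congr_deriv ?_
  have hr : ((t ^ (-(n : ℝ) / 2 - 1) : ℝ) : ℂ) = A / t := by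
    rw [Real.rpow_sub_one ht.ne', hA]
    push_cast
    rfl
  rw [Complex.ofReal_mul, hr]
  simp only [hg, Complex.real_smul]
  rw [← hA]
  generalize Complex.exp (Complex.I * (((Φ q - Φ p) / t : ℝ) : ℂ)) = e
  generalize box₀ cov Ω₁ Φ p Φ q = b
  push_cast
  have hI : Complex.I ^ 2 = -1 := Complex.I_sq
  field_simp
  linear_combination (-A * e * (n * t : ℂ) - 2 * A * e * Complex.I * ((Φ q : ℂ) - Φ p)) * hI

end Algebra
end OscGeom

end

noncomputable section

namespace OscGeom

/-! ### Joint smoothness in parameters: coordinates, Christoffel symbols, and Hessians. -/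

section Families

variable {n : ℕ} {M : Type*} [TopologicalSpace M] [ChartedSpace (EuclideanSpace ℝ (Fin n)) M]
  [IsManifold (𝓡 n) ∞ M]

local notation "E" => EuclideanSpace ℝ (Fin n)

variable {P : Type} [NormedAddCommGroup P] [NormedSpace ℝ P]
variable {F : Type*} [NormedAddCommGroup F] [NormedSpace ℝ F]
variable {Z : Type*} [NormedAddCommGroup Z] [NormedSpace ℝ Z]

theorem contMDiffAt_slice {f : P → M → F} {τ : P} {x : M}
    (hf : ContMDiffAt (𝓘(ℝ, P).prod (𝓡 n)) 𝓘(ℝ, F) ∞ (fun z : P × M => f z.1 z.2) (τ, x)) :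
    ContMDiffAt (𝓡 n) 𝓘(ℝ, F) ∞ (f τ) x :=
  hf.comp (f := fun x => (τ, x)) x (contMDiffAt_const.prodMk contMDiffAt_id)

theorem contDiffAt_coord {f : P → M → F} {τ : P} {x₀ : M} {y : E} (hy : y ∈ (cc n x₀).target)
    (hf : ContMDiffAt (𝓘(ℝ, P).prod (𝓡 n)) 𝓘(ℝ, F) ∞ (fun z : P × M => f z.1 z.2)
      (τ, (cc n x₀).symm y)) :
    ContDiffAt ℝ ∞ (fun z : P × E => f z.1 ((cc n x₀).symm z.2)) (τ, y) := by
  have h5 : ContMDiffAt 𝓘(ℝ, P × E) (𝓘(ℝ, P).prod (𝓡 n)) ∞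
      (fun z : P × E => (z.1, (cc n x₀).symm z.2)) (τ, y) := by
    have h6 : ContMDiffAt 𝓘(ℝ, E) (𝓡 n) ∞ (cc n x₀).symm y :=
      (contMDiffOn_extChartAt_symm x₀).contMDiffAt ((isOpen_cc_target x₀).mem_nhds hy)
    exact (contDiffAt_fst.contMDiffAt).prodMk
      (ContMDiffAt.comp (f := Prod.snd) (τ, y) h6 contDiffAt_snd.contMDiffAt)
  exact (ContMDiffAt.comp (τ, y) (f := fun z : P × E => (z.1, (cc n x₀).symm z.2)) hf h5).contDiffAt

/-- The values of `f` may be defined through choices of geodesics; it suffices that in one chart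
they agree near the point with an explicitly smooth function. -/
theorem contMDiffAt_of_coord {f : P → M → F} {g : P × E → F} {z : P × M} {x₀ : M}
    (hx : z.2 ∈ chartDom n x₀) (hg : ContDiffAt ℝ ∞ g (z.1, cc n x₀ z.2))
    (he : ∀ᶠ w in 𝓝 (z.1, cc n x₀ z.2), f w.1 ((cc n x₀).symm w.2) = g w) :
    ContMDiffAt (𝓘(ℝ, P).prod (𝓡 n)) 𝓘(ℝ, F) ∞ (fun z : P × M => f z.1 z.2) z := by
  have h1 : ContMDiffAt (𝓘(ℝ, P).prod (𝓡 n)) 𝓘(ℝ, P × E) ∞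
      (fun z : P × M => (z.1, cc n x₀ z.2)) z := by
    have h2 : ContMDiffAt (𝓡 n) 𝓘(ℝ, E) ∞ (cc n x₀) z.2 :=
      contMDiffAt_extChartAt' hx
    exact contMDiffAt_fst.prodMk_space (h2.comp (f := Prod.snd) z contMDiffAt_snd)
  have h3 := hg.contMDiffAt.comp z h1
  refine h3.congr_of_eventuallyEq ?_
  have h4 : ∀ᶠ w : P × M in 𝓝 z, w.2 ∈ chartDom n x₀ :=
    continuous_snd.continuousAt.eventually ((isOpen_chartDom x₀).mem_nhds hx)
  filter_upwards [h4, h1.continuousAt.eventually he] with w hw hw'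
  simp only [Function.comp_apply, ← hw', cc_left_inv hw]

theorem contDiffAt_fderiv_snd {G : P × E → F} {τ : Z → P} {y : Z → E} {z₀ : Z}
    (hG : ContDiffAt ℝ ∞ G (τ z₀, y z₀)) (hτ : ContDiffAt ℝ ∞ τ z₀) (hy : ContDiffAt ℝ ∞ y z₀) :
    ContDiffAt ℝ ∞ (fun z => fderiv ℝ (fun y => G (τ z, y)) (y z)) z₀ := by
  refine ContDiffAt.fderiv (n := ∞) (f := fun z y => G (τ z, y)) ?_ hy (by simp)
  exact hG.comp (z₀, y z₀) ((hτ.comp (z₀, y z₀) contDiffAt_fst).prodMk contDiffAt_snd)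

theorem contDiffAt_fderiv_fderiv_snd {G : P × E → F} {τ : Z → P} {y : Z → E} {z₀ : Z}
    (hG : ContDiffAt ℝ ∞ G (τ z₀, y z₀)) (hτ : ContDiffAt ℝ ∞ τ z₀) (hy : ContDiffAt ℝ ∞ y z₀) :
    ContDiffAt ℝ ∞ (fun z => fderiv ℝ (fderiv ℝ (fun y => G (τ z, y))) (y z)) z₀ := by
  have h : ContDiffAt ℝ ∞ (fun w : P × E => fderiv ℝ (fun y => G (w.1, y)) w.2) (τ z₀, y z₀) :=
    contDiffAt_fderiv_snd hG contDiffAt_fst contDiffAt_snd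
  exact contDiffAt_fderiv_snd h hτ hy

theorem contDiffAt_christ {covF : P → Conn n M} (hcov : SmoothFam covF) {x₀ : M}
    {τ : Z → P} {y : Z → E} {z₀ : Z} (hτ : ContDiffAt ℝ ∞ τ z₀) (hy : ContDiffAt ℝ ∞ y z₀)
    (hyt : y z₀ ∈ (cc n x₀).target) :
    ContDiffAt ℝ ∞ (fun z => christ (covF (τ z)) x₀ (y z)) z₀ :=
  ContDiffAt.comp (g := fun z : P × E => christ (covF z.1) x₀ z.2) (f := fun z => (τ z, y z)) z₀
    ((hcov x₀).contDiffAt ((isOpen_univ.prod (isOpen_cc_target _)).mem_nhds ⟨trivial, hyt⟩))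
    (hτ.prodMk hy)

theorem contDiffAt_hessC {covF : P → Conn n M} (hcov : SmoothFam covF) {f : P → M → F} {x₀ : M}
    {τ : Z → P} {y a b : Z → E} {z₀ : Z} (hτ : ContDiffAt ℝ ∞ τ z₀) (hy : ContDiffAt ℝ ∞ y z₀)
    (ha : ContDiffAt ℝ ∞ a z₀) (hb : ContDiffAt ℝ ∞ b z₀) (hyt : y z₀ ∈ (cc n x₀).target)
    (hf : ContDiffAt ℝ ∞ (fun w : P × E => f w.1 ((cc n x₀).symm w.2)) (τ z₀, y z₀)) :
    ContDiffAt ℝ ∞ (fun z => hessC (covF (τ z)) (f (τ z)) x₀ (y z) (a z) (b z)) z₀ := by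
  have h1 := contDiffAt_fderiv_snd hf hτ hy
  have h2 := contDiffAt_fderiv_fderiv_snd hf hτ hy
  have h3 := contDiffAt_christ hcov hτ hy hyt
  unfold hessC
  exact ((h2.clm_apply hb).clm_apply ha).sub (h1.clm_apply ((h3.clm_apply ha).clm_apply hb))

/-- The Hessian of `f` on the vectors carried by two states over the same point. -/
def pairHess (cov : Conn n M) (f : M → F) (ξ η : GState n M) : F :=
  hess cov f ξ.pt ξ.vec (show E from η.vec)

/-- In `pairHess` the vector of `η` is reread over the base point of `ξ`. That is meaningful exactly
when the base points agree, and then the chart formula applies to both vectors. -/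
theorem pairHess_eq (cov : Conn n M) {f : M → F} {x₀ : M} {ξ η : GState n M}
    (hx : ξ.pt ∈ chartDom n x₀) (hf : ContMDiffAt (𝓡 n) 𝓘(ℝ, F) ∞ f ξ.pt) (he : η.pt = ξ.pt) :
    pairHess cov f ξ η = hessC cov f x₀ (rd x₀ ξ).1 (rd x₀ ξ).2.2 (rd x₀ η).2.2 := by
  obtain ⟨x, v, a⟩ := ξ
  obtain ⟨x', v', a'⟩ := η
  obtain rfl : x' = x := he
  exact hess_eq_hessC cov hx hf a a'

theorem contDiffAt_pairHess {covF : P → Conn n M} (hcov : SmoothFam covF) {V : Set (P × M)}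
    (hV : IsOpen V) {f : P → M → F}
    (hf : ContMDiffOn (𝓘(ℝ, P).prod (𝓡 n)) 𝓘(ℝ, F) ∞ (fun z : P × M => f z.1 z.2) V)
    {τ : Z → P} {φ ψ : Z → GState n M} {z₀ : Z} (hτ : ContDiffAt ℝ ∞ τ z₀) (hφ : SmAt φ z₀)
    (hψ : SmAt ψ z₀) (hpt : ∀ᶠ z in 𝓝 z₀, (ψ z).pt = (φ z).pt) (hmem : (τ z₀, (φ z₀).pt) ∈ V) :
    ContDiffAt ℝ ∞ (fun z => pairHess (covF (τ z)) (f (τ z)) (φ z) (ψ z)) z₀ := by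
  set x₀ := (φ z₀).pt with hx₀
  have hx : (φ z₀).pt ∈ chartDom n x₀ := mem_chart_source _ _
  have h1 := hφ.2 x₀ hx
  have h2 := hψ.2 x₀ (by rw [hpt.self_of_nhds]; exact hx)
  have h3 : ContDiffAt ℝ ∞ (fun w : P × E => f w.1 ((cc n x₀).symm w.2)) (τ z₀, (rd x₀ (φ z₀)).1) := by
    refine contDiffAt_coord (cc_mem_target hx) ?_
    change ContMDiffAt _ _ _ _ (τ z₀, (cc n x₀).symm (cc n x₀ (φ z₀).pt))
    rw [cc_left_inv hx]
    exact hf.contMDiffAt (hV.mem_nhds hmem)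
  have h4 := contDiffAt_hessC hcov hτ h1.fst h1.snd.snd h2.snd.snd (cc_mem_target hx) h3
  refine h4.congr_of_eventuallyEq ?_
  filter_upwards [hpt, hφ.1.eventually ((isOpen_chartDom x₀).mem_nhds hx),
    (hτ.continuousAt.prodMk hφ.1).eventually (hV.mem_nhds hmem)] with z hz1 hz2 hz3
  exact pairHess_eq _ hz2 (contMDiffAt_slice (hf.contMDiffAt (hV.mem_nhds hz3))) hz1

end Families
end OscGeom

end

noncomputable section

namespace OscGeom

/-! ### Smoothness of matrix operations and change of basis. -/

section LinearAlgebra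

variable {n : ℕ}

theorem contDiffAt_det {Z : Type*} [NormedAddCommGroup Z] [NormedSpace ℝ Z]
    {A : Z → Matrix (Fin n) (Fin n) ℝ} {z : Z}
    (hA : ∀ i j, ContDiffAt ℝ ∞ (fun z => A z i j) z) : ContDiffAt ℝ ∞ (fun z => (A z).det) z := by
  simp only [Matrix.det_apply]
  exact ContDiffAt.sum fun σ _ => ContDiffAt.const_smul _ (contDiffAt_prod fun i _ => hA _ _)

theorem contDiffAt_matrix_inv {Z : Type*} [NormedAddCommGroup Z] [NormedSpace ℝ Z]
    {A : Z → Matrix (Fin n) (Fin n) ℝ} {z : Z}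
    (hA : ∀ i j, ContDiffAt ℝ ∞ (fun z => A z i j) z) (hdet : (A z).det ≠ 0) (i j : Fin n) :
    ContDiffAt ℝ ∞ (fun z => (A z)⁻¹ i j) z := by
  simp only [Matrix.inv_def, Ring.inverse_eq_inv', Matrix.smul_apply, smul_eq_mul]
  refine ((contDiffAt_det hA).inv hdet).mul ?_
  simp only [Matrix.adjugate_apply]
  refine contDiffAt_det fun k l => ?_
  by_cases hk : k = j
  · subst hk
    simpa using contDiffAt_const
  · simpa [Matrix.updateRow_ne hk] using hA k l

theorem contDiffAt_matrix_mul {Z : Type*} [NormedAddCommGroup Z] [NormedSpace ℝ Z]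
    {A B : Z → Matrix (Fin n) (Fin n) ℝ} {z : Z}
    (hA : ∀ i j, ContDiffAt ℝ ∞ (fun z => A z i j) z)
    (hB : ∀ i j, ContDiffAt ℝ ∞ (fun z => B z i j) z) (i j : Fin n) :
    ContDiffAt ℝ ∞ (fun z => (A z * B z) i j) z := by
  simp only [Matrix.mul_apply]
  exact ContDiffAt.sum fun k _ => (hA i k).mul (hB k j)

variable {V F : Type*} [AddCommGroup V] [Module ℝ V] [AddCommGroup F] [Module ℝ F]

theorem bilin_change (B : V →ₗ[ℝ] V →ₗ[ℝ] F) {b e : Fin n → V} {J : Matrix (Fin n) (Fin n) ℝ}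
    (hb : ∀ i, b i = ∑ k, J k i • e k) (i j : Fin n) :
    B (b i) (b j) = ∑ k, ∑ l, (J k i * J l j) • B (e k) (e l) := by
  rw [hb i, hb j]
  simp only [map_sum, map_smul, LinearMap.sum_apply, LinearMap.smul_apply, Finset.smul_sum,
    smul_smul]
  rw [Finset.sum_comm]
  exact Finset.sum_congr rfl fun k _ => Finset.sum_congr rfl fun l _ => by rw [mul_comm]

/-- The contraction of a contravariant tensor with a bilinear map does not depend on the basis. It
serves both the trace in `□₀` and the pairing in `Z_ψ`. -/
theorem sum_smul_bilin_change (B : V →ₗ[ℝ] V →ₗ[ℝ] F) {b e : Fin n → V}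
    {J S S₀ : Matrix (Fin n) (Fin n) ℝ} (hb : ∀ i, b i = ∑ k, J k i • e k)
    (hS : J * S * J.transpose = S₀) :
    ∑ i, ∑ j, S i j • B (b j) (b i) = ∑ i, ∑ j, S₀ i j • B (e j) (e i) := by
  have h3 : ∀ g : Fin n → Fin n → Fin n → F, ∑ i, ∑ j, ∑ k, g i j k = ∑ k, ∑ j, ∑ i, g i j k := by
    intro g
    rw [Finset.sum_congr rfl fun i _ => Finset.sum_comm, Finset.sum_comm]
    exact Finset.sum_congr rfl fun i _ => Finset.sum_comm
  have h4 : ∀ g : Fin n → Fin n → Fin n → Fin n → F,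
      ∑ i, ∑ j, ∑ k, ∑ l, g i j k l = ∑ l, ∑ k, ∑ j, ∑ i, g i j k l := by
    intro g
    have e1 : ∀ i, ∑ j, ∑ k, ∑ l, g i j k l = ∑ l, ∑ k, ∑ j, g i j k l := fun i => h3 _
    rw [Finset.sum_congr rfl fun i _ => e1 i, Finset.sum_comm]
    refine Finset.sum_congr rfl fun l _ => ?_
    rw [Finset.sum_comm]
    exact Finset.sum_congr rfl fun k _ => Finset.sum_comm
  subst hS
  simp only [bilin_change B hb, Finset.smul_sum, smul_smul, Matrix.mul_apply, Finset.sum_mul,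
    Finset.sum_smul, Matrix.transpose_apply]
  rw [h4]
  refine Finset.sum_congr rfl fun l _ => Finset.sum_congr rfl fun k _ => Finset.sum_congr rfl
    fun j _ => Finset.sum_congr rfl fun i _ => ?_
  congr 1
  ring

end LinearAlgebra

/-! ### From the pointwise basis to the smooth frame of one chart. -/

section Frames

variable {n : ℕ} {M : Type*} [TopologicalSpace M] [ChartedSpace (EuclideanSpace ℝ (Fin n)) M]
  [IsManifold (𝓡 n) ∞ M]

local notation "E" => EuclideanSpace ℝ (Fin n)

/-- The coordinate frame of the chart at `x₁`. -/
def frame (x₁ q : M) (i : Fin n) : TangentSpace (𝓡 n) q :=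
  ts x₁ q (EuclideanSpace.single i (1 : ℝ))

/-- The matrix of `∇²_σ Φ` in the coordinate frame of the chart at `x₁`. -/
def frameMatrix (cov : Conn n M) (Ω₁ : Set M) (Φ : M → ℝ) (p : M) (σ : ℝ) (x₁ q : M) :
    Matrix (Fin n) (Fin n) ℝ :=
  Matrix.of fun i j => weightedHess cov Ω₁ Φ p σ q (frame x₁ q i) (frame x₁ q j)

/-- The matrix of `(∇²_1 Φ)⁻¹ ∇²_2 Φ (∇²_1 Φ)⁻¹` in the coordinate frame. -/
def frameSymbol (cov : Conn n M) (Ω₁ : Set M) (Φ : M → ℝ) (p x₁ q : M) :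
    Matrix (Fin n) (Fin n) ℝ :=
  (frameMatrix cov Ω₁ Φ p 1 x₁ q)⁻¹ * frameMatrix cov Ω₁ Φ p 2 x₁ q *
    (frameMatrix cov Ω₁ Φ p 1 x₁ q)⁻¹

/-- The matrix that relates the basis `basisVec` to the coordinate frame. -/
def frameChange (x₁ q : M) : Matrix (Fin n) (Fin n) ℝ :=
  Matrix.of fun k i => tc x₁ q (basisVec q i) k

theorem euclidean_sum_single (a : E) : a = ∑ i, a i • EuclideanSpace.single i (1 : ℝ) := by
  ext j
  simp [Finset.sum_apply, Pi.single_apply]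

/-- `basisVec` refers to the preferred chart at `q`, which may jump with `q`, so matrices in this
basis need not depend continuously on `q`. Smoothness is proved in the frame of a fixed chart, and
the change of basis cancels in the final formulas. -/
theorem basisVec_eq_frame {x₁ q : M} (hq : q ∈ chartDom n x₁) (i : Fin n) :
    basisVec q i = ∑ k, frameChange x₁ q k i • frame x₁ q k := by
  conv_lhs => rw [← ts_tc hq (basisVec q i), euclidean_sum_single (tc x₁ q (basisVec q i)), map_sum]
  simp only [map_smul]
  rfl

theorem isUnit_frameChange {x₁ q : M} (hq : q ∈ chartDom n x₁) :
    IsUnit (frameChange (n := n) x₁ q).det := by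
  have h : frameChange (n := n) x₁ q *
      (Matrix.of fun i k => comps (frame (n := n) x₁ q k) i) = 1 := by
    ext l k
    have h1 : tc x₁ q (frame x₁ q k) = EuclideanSpace.single k (1 : ℝ) := tc_ts hq _
    have h2 := congrArg (fun a : E => a l) h1
    conv at h2 => lhs; rw [sum_basisVec (frame x₁ q k), map_sum]
    simp only [map_smul] at h2
    simp only [Matrix.mul_apply, frameChange, Matrix.of_apply, Matrix.one_apply]
    have h3 : ∀ v : Fin n → E, (∑ i, v i) l = ∑ i, v i l := fun v => by simp
    rw [h3] at h2
    rw [← Finset.sum_congr rfl fun i _ => mul_comm (comps (frame x₁ q k) i) _]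
    refine h2.trans ?_
    simp
  exact (Matrix.isUnit_iff_isUnit_det _).1 (IsUnit.of_mul_eq_one _ h)

variable {cov : Conn n M} {Ω₁ : Set M} {p q : M} {Φ : M → ℝ}

theorem RegPt.weightedMatrix_eq_frame [T2Space M] (hcov : SmoothConn cov) (htor : cov.torsion = 0)
    (h : RegPt cov Ω₁ p q) (hΦ : ∀ x, x ∈ Ω₁ → ContMDiffAt (𝓡 n) 𝓘(ℝ, ℝ) ∞ Φ x) {σ : ℝ}
    (hσ : 1 ≤ σ) {x₁ : M} (hq : q ∈ chartDom n x₁) :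
    weightedMatrix cov Ω₁ Φ p σ q = (frameChange x₁ q).transpose * frameMatrix cov Ω₁ Φ p σ x₁ q *
      frameChange x₁ q := by
  obtain ⟨B, hB⟩ := h.exists_bilin hcov htor hΦ hσ
  ext i j
  simp only [weightedMatrix, frameMatrix, Matrix.of_apply, ← hB, Matrix.mul_apply,
    Matrix.transpose_apply, bilin_change B (basisVec_eq_frame hq), Finset.sum_mul, smul_eq_mul]
  rw [Finset.sum_comm]
  exact Finset.sum_congr rfl fun k _ => Finset.sum_congr rfl fun l _ => by ring

theorem RegPt.weightedMatrix_det_ne_zero_iff [T2Space M] (hcov : SmoothConn cov)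
    (htor : cov.torsion = 0)
    (h : RegPt cov Ω₁ p q) (hΦ : ∀ x, x ∈ Ω₁ → ContMDiffAt (𝓡 n) 𝓘(ℝ, ℝ) ∞ Φ x) {x₁ : M}
    (hq : q ∈ chartDom n x₁) :
    (weightedMatrix cov Ω₁ Φ p 1 q).det ≠ 0 ↔ (frameMatrix cov Ω₁ Φ p 1 x₁ q).det ≠ 0 := by
  rw [h.weightedMatrix_eq_frame hcov htor hΦ le_rfl hq, Matrix.det_mul, Matrix.det_mul,
    Matrix.det_transpose]
  have := (isUnit_frameChange hq).ne_zero
  simp [this]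

/-- The inverse of a bilinear form transforms contravariantly. The matrix `H` need not be
invertible, as the formula persists for the default inverse. -/
theorem frame_inv {J H : Matrix (Fin n) (Fin n) ℝ} (hJ : IsUnit J.det) :
    J * (J.transpose * H * J)⁻¹ * J.transpose = H⁻¹ := by
  have hJ' : IsUnit J.transpose.det := by rwa [Matrix.det_transpose]
  rw [Matrix.mul_inv_rev, Matrix.mul_inv_rev, ← Matrix.mul_assoc, Matrix.mul_nonsing_inv _ hJ,
    Matrix.one_mul, Matrix.mul_assoc, Matrix.nonsing_inv_mul _ hJ', Matrix.mul_one]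

variable {F : Type*} [NormedAddCommGroup F] [NormedSpace ℝ F]

/-- Inserting `JᵀHJ` for both weighted matrices shows that the symbol is contravariant, so the trace
may be computed in the coordinate frame. -/
theorem RegPt.box₀_eq_frame [T2Space M] (hcov : SmoothConn cov) (htor : cov.torsion = 0)
    (h : RegPt cov Ω₁ p q) (hΦ : ∀ x, x ∈ Ω₁ → ContMDiffAt (𝓡 n) 𝓘(ℝ, ℝ) ∞ Φ x) {x₁ : M}
    (hq : q ∈ chartDom n x₁) {f : M → F} (hf : ContMDiffAt (𝓡 n) 𝓘(ℝ, F) ∞ f q) :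
    box₀ cov Ω₁ Φ p f q =
      ∑ i, ∑ j, frameSymbol cov Ω₁ Φ p x₁ q i j • hess cov f q (frame x₁ q j) (frame x₁ q i) := by
  obtain ⟨B, hB⟩ := exists_bilin_hess cov hf
  simp only [box₀, ← hB]
  refine sum_smul_bilin_change B (basisVec_eq_frame hq) ?_
  have hJ := isUnit_frameChange hq
  rw [symbolMatrix, frameSymbol, h.weightedMatrix_eq_frame hcov htor hΦ le_rfl hq,
    h.weightedMatrix_eq_frame hcov htor hΦ (σ := 2) (by norm_num) hq]
  set J := frameChange (n := n) x₁ q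
  set H := frameMatrix cov Ω₁ Φ p 1 x₁ q
  rw [← frame_inv (H := H) hJ]
  simp only [Matrix.mul_assoc]

theorem RegPt.zField_eq_frame [T2Space M] (hcov : SmoothConn cov) (htor : cov.torsion = 0)
    (h : RegPt cov Ω₁ p q) (hΦ : ∀ x, x ∈ Ω₁ → ContMDiffAt (𝓡 n) 𝓘(ℝ, ℝ) ∞ Φ x) {x₁ : M}
    (hq : q ∈ chartDom n x₁) (ψ : M → ℝ) (f : M → F) :
    zField cov Ω₁ Φ p ψ f q =
      ∑ i, ∑ j, (frameMatrix cov Ω₁ Φ p 1 x₁ q)⁻¹ i j •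
        (mvfderiv (𝓡 n) ψ q (frame x₁ q i) • mvfderiv (𝓡 n) f q (frame x₁ q j)) := by
  set B : TangentSpace (𝓡 n) q →ₗ[ℝ] TangentSpace (𝓡 n) q →ₗ[ℝ] F :=
    LinearMap.mk₂ ℝ (fun v w => mvfderiv (𝓡 n) ψ q w • mvfderiv (𝓡 n) f q v)
      (fun v v' w => by rw [map_add, smul_add]) (fun c v w => by rw [map_smul, smul_comm])
      (fun v w w' => by rw [map_add, add_smul]) (fun c v w => by rw [map_smul, smul_assoc])
  have hB : ∀ v w, mvfderiv (𝓡 n) ψ q w • mvfderiv (𝓡 n) f q v = B v w := fun _ _ => rfl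
  simp only [zField, mul_smul, hB]
  refine sum_smul_bilin_change B (basisVec_eq_frame hq) ?_
  rw [h.weightedMatrix_eq_frame hcov htor hΦ le_rfl hq]
  exact frame_inv (isUnit_frameChange hq)

end Frames
end OscGeom

end

noncomputable section

namespace OscGeom

/-! ### Smoothness of the weighted Hessians, `□₀` and `Z_ψ` over a smooth family of unique
geodesics. -/

section RegularFamilies

variable {n : ℕ} {M : Type*} [TopologicalSpace M] [ChartedSpace (EuclideanSpace ℝ (Fin n)) M]
  [IsManifold (𝓡 n) ∞ M]

local notation "E" => EuclideanSpace ℝ (Fin n)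

theorem isGeodesicIn_geod {cov : Conn n M} {Ω : Set M} {p q : M}
    (h : ∃ γ, IsGeodesicIn cov Ω p q γ) : IsGeodesicIn cov Ω p q (geod cov Ω p q) := by
  rw [geod, dif_pos h]
  exact h.choose_spec

theorem one_mem_unitInterval : (1 : ℝ) ∈ Icc (0 : ℝ) 1 := ⟨zero_le_one, le_rfl⟩

theorem zero_mem_unitInterval : (0 : ℝ) ∈ Icc (0 : ℝ) 1 := ⟨le_rfl, zero_le_one⟩

variable {P : Type} [NormedAddCommGroup P] [NormedSpace ℝ P]

/-- A smooth family of geodesics in `Ω₁`, with parallel transports along them, from the points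
`pF τ` to the points of the chart at `x₁`; they are the only geodesics in `Ω₁` with these end
points. -/
structure IsRegFamily (covF : P → Conn n M) (Ω₁ : Set M) (pF : P → M) (x₁ : M) (W : Set (P × E))
    (δ : ℝ) (Θ : E → (P × E) × ℝ → GState n M) : Prop where
  isOpen : IsOpen W
  pos : 0 < δ
  target : ∀ z ∈ W, z.2 ∈ (cc n x₁).target
  final : ∀ z ∈ W, ∀ a, ∃ u, Θ a (z, 1) = wr x₁ (z.2, u, a)
  smAt : ∀ z ∈ W, ∀ a, ∀ s ∈ Ioo (-δ) (1 + δ), SmAt (Θ a) (z, s)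
  isSol : ∀ z ∈ W, ∀ a, ∀ s ∈ Ioo (-δ) (1 + δ), IsSol (covF z.1) univ (fun s => Θ a (z, s)) s
  pt_eq : ∀ z ∈ W, ∀ a, ∀ s ∈ Ioo (-δ) (1 + δ), (Θ a (z, s)).pt = (Θ 0 (z, s)).pt
  mem : ∀ z ∈ W, ∀ s ∈ Icc (0 : ℝ) 1, (Θ 0 (z, s)).pt ∈ Ω₁
  start : ∀ z ∈ W, (Θ 0 (z, 0)).pt = pF z.1
  uniq : ∀ z ∈ W, ∀ γ, IsGeodesicIn (covF z.1) Ω₁ (pF z.1) ((cc n x₁).symm z.2) γ →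
    EqOn γ (fun s => (Θ 0 (z, s)).pt) (Icc 0 1)

variable {covF : P → Conn n M} {Ω₁ : Set M} {pF : P → M} {x₁ : M}
  {W : Set (P × EuclideanSpace ℝ (Fin n))} {δ : ℝ}
  {Θ : EuclideanSpace ℝ (Fin n) → (P × EuclideanSpace ℝ (Fin n)) × ℝ → GState n M}
  {z : P × EuclideanSpace ℝ (Fin n)}

namespace IsRegFamily

theorem mem_Ioo (h : IsRegFamily covF Ω₁ pF x₁ W δ Θ) {s : ℝ} (hs : s ∈ Icc (0 : ℝ) 1) :
    s ∈ Ioo (-δ) (1 + δ) :=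
  ⟨by linarith [h.pos, hs.1], by linarith [h.pos, hs.2]⟩

theorem smAt_time (h : IsRegFamily covF Ω₁ pF x₁ W δ Θ) (hz : z ∈ W) (a : E) {s : ℝ}
    (hs : s ∈ Icc (0 : ℝ) 1) : SmAt (fun s => Θ a (z, s)) s :=
  (h.smAt z hz a s (h.mem_Ioo hs)).comp (g := fun s => (z, s)) (by fun_prop)

theorem isGeodesicIn (h : IsRegFamily covF Ω₁ pF x₁ W δ Θ) (hz : z ∈ W) :
    IsGeodesicIn (covF z.1) Ω₁ (pF z.1) ((cc n x₁).symm z.2) (fun s => (Θ 0 (z, s)).pt) := by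
  have h1 := (isGeodesicIn_of_isSol (fun t ht => h.isSol z hz 0 t (h.mem_Ioo ht))
    (fun t ht => h.smAt_time hz 0 ht) (h.mem z hz)).1
  obtain ⟨u, hu⟩ := h.final z hz 0
  rwa [h.start z hz, hu] at h1

theorem isGeodesicIn_geod (h : IsRegFamily covF Ω₁ pF x₁ W δ Θ) (hz : z ∈ W) :
    IsGeodesicIn (covF z.1) Ω₁ (pF z.1) ((cc n x₁).symm z.2)
      (geod (covF z.1) Ω₁ (pF z.1) ((cc n x₁).symm z.2)) :=
  OscGeom.isGeodesicIn_geod ⟨_, h.isGeodesicIn hz⟩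

/-- `geod` is an arbitrary choice at each parameter. Uniqueness in `Ω₁` makes it the member of the
smooth family, and so transfers smoothness to everything built from `geod`. -/
theorem pt_eq_geod (h : IsRegFamily covF Ω₁ pF x₁ W δ Θ) (hz : z ∈ W) (a : E) {s : ℝ}
    (hs : s ∈ Icc (0 : ℝ) 1) :
    (Θ a (z, s)).pt = geod (covF z.1) Ω₁ (pF z.1) ((cc n x₁).symm z.2) s := by
  rw [h.pt_eq z hz a s (h.mem_Ioo hs)]
  exact (h.uniq z hz _ (h.isGeodesicIn_geod hz) hs).symm

variable [T2Space M]

theorem transport_spec (hcov : SmoothFam covF) (h : IsRegFamily covF Ω₁ pF x₁ W δ Θ) (hz : z ∈ W)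
    (a : E) :
    (IsParallel (covF z.1) (geod (covF z.1) Ω₁ (pF z.1) ((cc n x₁).symm z.2))
      (transport (covF z.1) (geod (covF z.1) Ω₁ (pF z.1) ((cc n x₁).symm z.2))
        ((cc n x₁).symm z.2) (ts x₁ ((cc n x₁).symm z.2) a)) ∧
      (⟨geod (covF z.1) Ω₁ (pF z.1) ((cc n x₁).symm z.2) 1,
        transport (covF z.1) (geod (covF z.1) Ω₁ (pF z.1) ((cc n x₁).symm z.2))
        ((cc n x₁).symm z.2) (ts x₁ ((cc n x₁).symm z.2) a) 1⟩ :
        TangentBundle (𝓡 n) M) = ⟨(cc n x₁).symm z.2, ts x₁ ((cc n x₁).symm z.2) a⟩) ∧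
    ∀ s ∈ Icc (0 : ℝ) 1, Θ a (z, s) = ⟨geod (covF z.1) Ω₁ (pF z.1) ((cc n x₁).symm z.2) s,
      velocity (geod (covF z.1) Ω₁ (pF z.1) ((cc n x₁).symm z.2)) s,
      transport (covF z.1) (geod (covF z.1) Ω₁ (pF z.1) ((cc n x₁).symm z.2))
        ((cc n x₁).symm z.2) (ts x₁ ((cc n x₁).symm z.2) a) s⟩ := by
  obtain ⟨u, hu⟩ := h.final z hz a
  exact eq_transport (hcov.smoothConn z.1) (h.isGeodesicIn_geod hz)
    (W := fun s => Θ a (z, s)) (fun t ht => h.isSol z hz a t (h.mem_Ioo ht))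
    (fun t ht => h.smAt_time hz a ht) (fun t ht => h.pt_eq_geod hz a ht) hu

theorem regPt (hcov : SmoothFam covF) (h : IsRegFamily covF Ω₁ pF x₁ W δ Θ) (hz : z ∈ W) :
    RegPt (covF z.1) Ω₁ (pF z.1) ((cc n x₁).symm z.2) := by
  have hq := cc_symm_mem (h.target z hz)
  refine ⟨h.isGeodesicIn_geod hz, fun v => ?_, fun v => ?_⟩
  · have := (h.transport_spec hcov hz (tc x₁ _ v)).1.1
    rwa [ts_tc hq] at this
  · have := (h.transport_spec hcov hz (tc x₁ _ v)).1.2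
    rwa [ts_tc hq] at this

theorem weightedHess_eq (hcov : SmoothFam covF) (h : IsRegFamily covF Ω₁ pF x₁ W δ Θ) (hz : z ∈ W)
    (Φ : M → ℝ) (σ : ℝ) (a b : E) :
    weightedHess (covF z.1) Ω₁ Φ (pF z.1) σ ((cc n x₁).symm z.2) (ts x₁ ((cc n x₁).symm z.2) a)
      (ts x₁ ((cc n x₁).symm z.2) b) =
      σ * ∫ s in (0 : ℝ)..1, (1 - s) ^ (σ - 1) * pairHess (covF z.1) Φ (Θ a (z, s)) (Θ b (z, s)) := by
  unfold weightedHess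
  congr 1
  refine intervalIntegral.integral_congr fun s hs => ?_
  rw [uIcc_of_le zero_le_one] at hs
  simp only [(h.transport_spec hcov hz a).2 s hs, (h.transport_spec hcov hz b).2 s hs]
  rfl

variable [FiniteDimensional ℝ P] {U : Set M} {ΦF : P → M → ℝ}

/-- An integral over `[0,1]` of a Hessian on vectors carried by the smooth family `Θ`, hence smooth.
The weight must be smooth up to `s = 1`; for `σ = 1` and `σ = 2` it is a polynomial. -/
theorem contDiffAt_frameMatrix (hcov : SmoothFam covF) (hU : IsOpen U)
    (hΦ : ContMDiffOn (𝓘(ℝ, P).prod (𝓡 n)) 𝓘(ℝ, ℝ) ∞ (fun z : P × M => ΦF z.1 z.2) (univ ×ˢ U))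
    (hΩ : Ω₁ ⊆ U) (h : IsRegFamily covF Ω₁ pF x₁ W δ Θ) (hz : z ∈ W) {σ : ℝ}
    (hσ : ContDiff ℝ ∞ fun s : ℝ => (1 - s) ^ (σ - 1)) (i j : Fin n) :
    ContDiffAt ℝ ∞ (fun w : P × E =>
      frameMatrix (covF w.1) Ω₁ (ΦF w.1) (pF w.1) σ x₁ ((cc n x₁).symm w.2) i j) z := by
  set a : E := EuclideanSpace.single i 1
  set b : E := EuclideanSpace.single j 1
  let k : (P × E) × ℝ → ℝ := fun v => (1 - v.2) ^ (σ - 1) *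
    pairHess (covF v.1.1) (ΦF v.1.1) (Θ a v) (Θ b v)
  have h1 : ContDiffAt ℝ ∞ (fun w : P × E => ∫ s in (0 : ℝ)..1, k (w, s)) z := by
    refine contDiffAt_parametric_intervalIntegral (Z := P × E) (F := ℝ) (h := k) fun s hs => ?_
    refine ContDiffAt.mul ?_ ?_
    · exact hσ.contDiffAt.comp (f := Prod.snd) _ contDiffAt_snd
    · refine contDiffAt_pairHess hcov (isOpen_univ.prod hU) hΦ
        (τ := fun v : (P × E) × ℝ => v.1.1) (contDiffAt_fst.fst) (h.smAt z hz a s (h.mem_Ioo hs))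
        (h.smAt z hz b s (h.mem_Ioo hs)) ?_ ?_
      · have hev : ∀ᶠ v : (P × E) × ℝ in 𝓝 (z, s), v ∈ W ×ˢ Ioo (-δ) (1 + δ) :=
          (h.isOpen.prod isOpen_Ioo).mem_nhds ⟨hz, h.mem_Ioo hs⟩
        filter_upwards [hev] with v hv
        exact (h.pt_eq v.1 hv.1 b v.2 hv.2).trans (h.pt_eq v.1 hv.1 a v.2 hv.2).symm
      · refine ⟨trivial, hΩ ?_⟩
        rw [h.pt_eq z hz a s (h.mem_Ioo hs)]
        exact h.mem z hz s hs
  refine (contDiffAt_const.mul h1 : ContDiffAt ℝ ∞ (fun w : P × E => σ * _) z).congr_of_eventuallyEq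
    ?_
  filter_upwards [h.isOpen.mem_nhds hz] with w hw
  exact h.weightedHess_eq hcov hw (ΦF w.1) σ a b

theorem contDiffAt_frameMatrix_one (hcov : SmoothFam covF) (hU : IsOpen U)
    (hΦ : ContMDiffOn (𝓘(ℝ, P).prod (𝓡 n)) 𝓘(ℝ, ℝ) ∞ (fun z : P × M => ΦF z.1 z.2) (univ ×ˢ U))
    (hΩ : Ω₁ ⊆ U) (h : IsRegFamily covF Ω₁ pF x₁ W δ Θ) (hz : z ∈ W) (i j : Fin n) :
    ContDiffAt ℝ ∞ (fun w : P × E =>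
      frameMatrix (covF w.1) Ω₁ (ΦF w.1) (pF w.1) 1 x₁ ((cc n x₁).symm w.2) i j) z :=
  h.contDiffAt_frameMatrix hcov hU hΦ hΩ hz (by simpa using contDiff_const) i j

theorem contDiffAt_frameSymbol (hcov : SmoothFam covF) (hU : IsOpen U)
    (hΦ : ContMDiffOn (𝓘(ℝ, P).prod (𝓡 n)) 𝓘(ℝ, ℝ) ∞ (fun z : P × M => ΦF z.1 z.2) (univ ×ˢ U))
    (hΩ : Ω₁ ⊆ U) (h : IsRegFamily covF Ω₁ pF x₁ W δ Θ) (hz : z ∈ W)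
    (hdet : (frameMatrix (covF z.1) Ω₁ (ΦF z.1) (pF z.1) 1 x₁ ((cc n x₁).symm z.2)).det ≠ 0)
    (i j : Fin n) :
    ContDiffAt ℝ ∞ (fun w : P × E =>
      frameSymbol (covF w.1) Ω₁ (ΦF w.1) (pF w.1) x₁ ((cc n x₁).symm w.2) i j) z := by
  have h1 := contDiffAt_matrix_inv (h.contDiffAt_frameMatrix_one hcov hU hΦ hΩ hz) hdet
  have h2 := h.contDiffAt_frameMatrix hcov hU hΦ hΩ hz (σ := 2) (by
    have : (fun s : ℝ => (1 - s) ^ ((2 : ℝ) - 1)) = fun s => 1 - s := by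
      funext s
      norm_num
    rw [this]
    fun_prop)
  exact contDiffAt_matrix_mul (contDiffAt_matrix_mul h1 h2) h1 i j

variable {F : Type*} [NormedAddCommGroup F] [NormedSpace ℝ F]

theorem contMDiffAt_phase (hU : IsOpen U)
    (hΦ : ContMDiffOn (𝓘(ℝ, P).prod (𝓡 n)) 𝓘(ℝ, ℝ) ∞ (fun z : P × M => ΦF z.1 z.2) (univ ×ˢ U))
    (hΩ : Ω₁ ⊆ U) (τ : P) (x : M) (hx : x ∈ Ω₁) : ContMDiffAt (𝓡 n) 𝓘(ℝ, ℝ) ∞ (ΦF τ) x :=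
  contMDiffAt_slice (hΦ.contMDiffAt ((isOpen_univ.prod hU).mem_nhds ⟨trivial, hΩ hx⟩))

theorem contDiffAt_box₀ (hcov : SmoothFam covF) (htor : ∀ τ, (covF τ).torsion = 0) (hU : IsOpen U)
    (hΦ : ContMDiffOn (𝓘(ℝ, P).prod (𝓡 n)) 𝓘(ℝ, ℝ) ∞ (fun z : P × M => ΦF z.1 z.2) (univ ×ˢ U))
    (hΩ : Ω₁ ⊆ U) (h : IsRegFamily covF Ω₁ pF x₁ W δ Θ) (hz : z ∈ W)
    (hdet : (frameMatrix (covF z.1) Ω₁ (ΦF z.1) (pF z.1) 1 x₁ ((cc n x₁).symm z.2)).det ≠ 0)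
    {V : Set (P × M)} (hV : IsOpen V) {f : P → M → F}
    (hf : ContMDiffOn (𝓘(ℝ, P).prod (𝓡 n)) 𝓘(ℝ, F) ∞ (fun z : P × M => f z.1 z.2) V)
    (hzV : (z.1, (cc n x₁).symm z.2) ∈ V) :
    ContDiffAt ℝ ∞ (fun w : P × E =>
      box₀ (covF w.1) Ω₁ (ΦF w.1) (pF w.1) (f w.1) ((cc n x₁).symm w.2)) z := by
  have hsum : ContDiffAt ℝ ∞ (fun w : P × E => ∑ i, ∑ j,
      frameSymbol (covF w.1) Ω₁ (ΦF w.1) (pF w.1) x₁ ((cc n x₁).symm w.2) i j •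
        hessC (covF w.1) (f w.1) x₁ w.2 (EuclideanSpace.single j 1)
          (EuclideanSpace.single i 1)) z := by
    refine ContDiffAt.sum fun i _ => ContDiffAt.sum fun j _ => ContDiffAt.smul
      (h.contDiffAt_frameSymbol hcov hU hΦ hΩ hz hdet i j) ?_
    exact contDiffAt_hessC hcov contDiffAt_fst contDiffAt_snd contDiffAt_const contDiffAt_const
      (h.target z hz) (contDiffAt_coord (h.target z hz) (hf.contMDiffAt (hV.mem_nhds hzV)))
  refine hsum.congr_of_eventuallyEq ?_
  have hcont : ContinuousAt (fun w : P × E => (w.1, (cc n x₁).symm w.2)) z :=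
    continuousAt_fst.prodMk (ContinuousAt.comp (f := Prod.snd) (x := z)
      (continuousAt_extChartAt_symm'' (h.target z hz)) continuousAt_snd)
  filter_upwards [h.isOpen.mem_nhds hz, hcont.eventually (hV.mem_nhds hzV)] with w hw hwV
  have hq := cc_symm_mem (h.target w hw)
  have hfw := contMDiffAt_slice (hf.contMDiffAt (hV.mem_nhds hwV))
  rw [(h.regPt hcov hw).box₀_eq_frame (hcov.smoothConn _) (htor _)
    (contMDiffAt_phase hU hΦ hΩ w.1) hq hfw]
  simp only [hess_eq_hessC _ hq hfw, frame, tc_ts hq, (cc n x₁).right_inv (h.target w hw)]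

theorem contDiffAt_zField (hcov : SmoothFam covF) (htor : ∀ τ, (covF τ).torsion = 0) (hU : IsOpen U)
    (hΦ : ContMDiffOn (𝓘(ℝ, P).prod (𝓡 n)) 𝓘(ℝ, ℝ) ∞ (fun z : P × M => ΦF z.1 z.2) (univ ×ˢ U))
    (hΩ : Ω₁ ⊆ U) (h : IsRegFamily covF Ω₁ pF x₁ W δ Θ) (hz : z ∈ W)
    (hdet : (frameMatrix (covF z.1) Ω₁ (ΦF z.1) (pF z.1) 1 x₁ ((cc n x₁).symm z.2)).det ≠ 0)
    {V : Set (P × M)} (hV : IsOpen V) {ψ : P → M → ℝ} {f : P → M → F}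
    (hψ : ContMDiffOn (𝓘(ℝ, P).prod (𝓡 n)) 𝓘(ℝ, ℝ) ∞ (fun z : P × M => ψ z.1 z.2) V)
    (hf : ContMDiffOn (𝓘(ℝ, P).prod (𝓡 n)) 𝓘(ℝ, F) ∞ (fun z : P × M => f z.1 z.2) V)
    (hzV : (z.1, (cc n x₁).symm z.2) ∈ V) :
    ContDiffAt ℝ ∞ (fun w : P × E =>
      zField (covF w.1) Ω₁ (ΦF w.1) (pF w.1) (ψ w.1) (f w.1) ((cc n x₁).symm w.2)) z := by
  have h1 := contDiffAt_matrix_inv (h.contDiffAt_frameMatrix_one hcov hU hΦ hΩ hz) hdet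
  have hsum : ContDiffAt ℝ ∞ (fun w : P × E => ∑ i, ∑ j,
      (frameMatrix (covF w.1) Ω₁ (ΦF w.1) (pF w.1) 1 x₁ ((cc n x₁).symm w.2))⁻¹ i j •
        (fderiv ℝ (fun y => ψ w.1 ((cc n x₁).symm y)) w.2 (EuclideanSpace.single i 1) •
          fderiv ℝ (fun y => f w.1 ((cc n x₁).symm y)) w.2 (EuclideanSpace.single j 1))) z := by
    refine ContDiffAt.sum fun i _ => ContDiffAt.sum fun j _ => (h1 i j).smul ?_
    have h2 := contDiffAt_fderiv_snd (z₀ := z) (contDiffAt_coord (h.target z hz)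
      (hψ.contMDiffAt (hV.mem_nhds hzV))) contDiffAt_fst contDiffAt_snd
    have h3 := contDiffAt_fderiv_snd (z₀ := z) (contDiffAt_coord (h.target z hz)
      (hf.contMDiffAt (hV.mem_nhds hzV))) contDiffAt_fst contDiffAt_snd
    exact (h2.clm_apply contDiffAt_const).smul (h3.clm_apply contDiffAt_const)
  refine hsum.congr_of_eventuallyEq ?_
  have hcont : ContinuousAt (fun w : P × E => (w.1, (cc n x₁).symm w.2)) z :=
    continuousAt_fst.prodMk (ContinuousAt.comp (f := Prod.snd) (x := z)
      (continuousAt_extChartAt_symm'' (h.target z hz)) continuousAt_snd)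
  filter_upwards [h.isOpen.mem_nhds hz, hcont.eventually (hV.mem_nhds hzV)] with w hw hwV
  have hq := cc_symm_mem (h.target w hw)
  have hfw := (contMDiffAt_slice (hf.contMDiffAt (hV.mem_nhds hwV))).mdifferentiableAt (by simp)
  have hψw := (contMDiffAt_slice (hψ.contMDiffAt (hV.mem_nhds hwV))).mdifferentiableAt (by simp)
  rw [(h.regPt hcov hw).zField_eq_frame (hcov.smoothConn _) (htor _)
    (contMDiffAt_phase hU hΦ hΩ w.1) hq]
  simp only [mvfderiv_eq hq hfw, mvfderiv_eq hq hψw, frame, tc_ts hq,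
    (cc n x₁).right_inv (h.target w hw)]

end IsRegFamily

end RegularFamilies
end OscGeom

end

noncomputable section

namespace OscGeom

/-! ### Open conditions on pairs of a parameter and a point. -/

section GoodPoints

variable {n : ℕ} {M : Type*} [TopologicalSpace M] [ChartedSpace (EuclideanSpace ℝ (Fin n)) M]
  [IsManifold (𝓡 n) ∞ M]

local notation "E" => EuclideanSpace ℝ (Fin n)

theorem isSol_const (cov : Conn n M) (S : Set ℝ) (p : M) (v : TangentSpace (𝓡 n) p) (t : ℝ) :
    IsSol cov S (fun _ => ⟨p, 0, v⟩) t := by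
  refine isSol_of_chart (x₀ := p) continuousWithinAt_const (mem_chart_source _ p) ?_
  have h : geoField (christ cov p) (rd p (⟨p, 0, v⟩ : GState n M)) = 0 := by
    simp [geoField, rd]
  rw [h]
  exact hasDerivWithinAt_const ..

/-- The weighted Hessians at the critical point are the Hessian. -/
theorem RegPt.weightedHess_self [T2Space M] {cov : Conn n M} (hcov : SmoothConn cov) {Ω₁ : Set M}
    {p : M} (h : RegPt cov Ω₁ p p) (hp : EqOn (fun _ => p) (geod cov Ω₁ p p) (Icc 0 1)) (Φ : M → ℝ)
    {σ : ℝ} (hσ : 1 ≤ σ) (v w : TangentSpace (𝓡 n) p) :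
    weightedHess cov Ω₁ Φ p σ p v w = hess cov Φ p v w := by
  have key : ∀ v : TangentSpace (𝓡 n) p, ∀ t ∈ Icc (0 : ℝ) 1,
      (⟨p, 0, v⟩ : GState n M) = ⟨geod cov Ω₁ p p t, velocity (geod cov Ω₁ p p) t,
        transport cov (geod cov Ω₁ p p) p v t⟩ := fun v =>
    (eq_transport hcov h.geo (W := fun _ => ⟨p, 0, v⟩) (fun t _ => isSol_const cov univ p v t)
      (fun t _ => smAt_of_chart (x₀ := p) continuousAt_const (mem_chart_source _ p)
        contDiffAt_const) hp rfl).2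
  have h1 : weightedHess cov Ω₁ Φ p σ p v w =
      σ * ∫ s in (0 : ℝ)..1, (1 - s) ^ (σ - 1) * hess cov Φ p v w := by
    unfold weightedHess
    congr 1
    refine intervalIntegral.integral_congr fun s hs => ?_
    rw [uIcc_of_le zero_le_one] at hs
    change _ = (1 - s) ^ (σ - 1) * pairHess cov Φ ⟨p, 0, v⟩ ⟨p, 0, w⟩
    rw [key v s hs, key w s hs]
    rfl
  -- The weight has total mass one: `σ ∫₀¹ (1 - s)^(σ-1) ds = 1`.
  rw [h1, intervalIntegral.integral_mul_const,
    intervalIntegral.integral_comp_sub_left (fun x : ℝ => x ^ (σ - 1)) 1,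
    integral_rpow (Or.inl (by linarith))]
  have : σ ≠ 0 := by linarith
  simp [this]

/-- At `p` both weighted Hessians are the Hessian, and the trace is that of the identity. This makes
the numerator of the integrand of `η` vanish at `s = 0`. -/
theorem RegPt.box₀_self [T2Space M] {cov : Conn n M} (hcov : SmoothConn cov) {Ω₁ : Set M}
    {p : M} (h : RegPt cov Ω₁ p p) (hp : EqOn (fun _ => p) (geod cov Ω₁ p p) (Icc 0 1)) (Φ : M → ℝ)
    (hdet : (weightedMatrix cov Ω₁ Φ p 1 p).det ≠ 0) : box₀ cov Ω₁ Φ p Φ p = n := by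
  have hW : ∀ σ : ℝ, 1 ≤ σ → weightedMatrix cov Ω₁ Φ p σ p = hessMatrix cov Φ p := by
    intro σ hσ
    ext i j
    exact h.weightedHess_self hcov hp Φ hσ _ _
  have hu := isUnit_iff_ne_zero.2 hdet
  rw [box₀_eq_trace]
  rw [hW 1 le_rfl] at hu ⊢
  rw [hW 2 (by norm_num), Matrix.nonsing_inv_mul _ hu, Matrix.one_mul,
    Matrix.nonsing_inv_mul _ hu, Matrix.trace_one, Fintype.card_fin]

variable {P : Type} [NormedAddCommGroup P] [NormedSpace ℝ P]

/-- Smooth families of torsion-free connections and phases. -/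
structure IsPhaseFam (covF : P → Conn n M) (ΦF : P → M → ℝ) (Ω₁ : Set M) : Prop where
  cov : SmoothFam covF
  torsion : ∀ τ, (covF τ).torsion = 0
  phase : ∃ U, IsOpen U ∧ Ω₁ ⊆ U ∧ ContMDiffOn (𝓘(ℝ, P).prod (𝓡 n)) 𝓘(ℝ, ℝ) ∞
    (fun z : P × M => ΦF z.1 z.2) (univ ×ˢ U)

/-- Near `z = (τ, q)` there is a smooth family of unique geodesics from `pF τ`. -/
def RegAt (covF : P → Conn n M) (Ω₁ : Set M) (pF : P → M) (z : P × M) : Prop :=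
  ∃ (x₁ : M) (W : Set (P × E)) (δ : ℝ) (Θ : E → (P × E) × ℝ → GState n M),
    z.2 ∈ chartDom n x₁ ∧ (z.1, cc n x₁ z.2) ∈ W ∧ IsRegFamily covF Ω₁ pF x₁ W δ Θ

/-- The weighted Hessian is smooth and nondegenerate near `z = (τ, q)`. -/
def GoodAt (covF : P → Conn n M) (ΦF : P → M → ℝ) (Ω₀ Ω₁ : Set M) (pF : P → M) (z : P × M) : Prop :=
  z.2 ∈ Ω₀ ∧ RegAt covF Ω₁ pF z ∧ (weightedMatrix (covF z.1) Ω₁ (ΦF z.1) (pF z.1) 1 z.2).det ≠ 0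

/-- The geodesic from `pF τ` to `q` consists of good points. -/
def NiceAt (covF : P → Conn n M) (ΦF : P → M → ℝ) (Ω₀ Ω₁ : Set M) (pF : P → M) (z : P × M) : Prop :=
  RegAt covF Ω₁ pF z ∧
    ∀ s ∈ Icc (0 : ℝ) 1, GoodAt covF ΦF Ω₀ Ω₁ pF (z.1, geod (covF z.1) Ω₁ (pF z.1) z.2 s)

variable {covF : P → Conn n M} {ΦF : P → M → ℝ} {Ω₀ Ω₁ : Set M} {pF : P → M} {z : P × M}

theorem continuousAt_prod_cc {z : P × M} {x₁ : M} (hx : z.2 ∈ chartDom n x₁) :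
    ContinuousAt (fun z : P × M => (z.1, cc n x₁ z.2)) z :=
  continuousAt_fst.prodMk (ContinuousAt.comp (f := Prod.snd) (x := z)
    (continuousAt_extChartAt' (mem_cc_source.2 hx)) continuousAt_snd)

theorem continuousAt_prod_cc_symm {z : P × E} {x₁ : M} (hx : z.2 ∈ (cc n x₁).target) :
    ContinuousAt (fun w : P × E => (w.1, (cc n x₁).symm w.2)) z :=
  continuousAt_fst.prodMk (ContinuousAt.comp (f := Prod.snd) (x := z)
    (continuousAt_extChartAt_symm'' hx) continuousAt_snd)

theorem RegAt.eventually (h : RegAt covF Ω₁ pF z) : ∀ᶠ w in 𝓝 z, RegAt covF Ω₁ pF w := by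
  obtain ⟨x₁, W, δ, Θ, hx, hz, h⟩ := h
  filter_upwards [(continuousAt_prod_cc hx).eventually (h.isOpen.mem_nhds hz),
    continuousAt_snd.eventually ((isOpen_chartDom x₁).mem_nhds hx)] with w hw hwx
  exact ⟨x₁, W, δ, Θ, hwx, hw, h⟩

theorem RegAt.isGeodesicIn_geod (h : RegAt covF Ω₁ pF z) :
    IsGeodesicIn (covF z.1) Ω₁ (pF z.1) z.2 (geod (covF z.1) Ω₁ (pF z.1) z.2) := by
  obtain ⟨x₁, W, δ, Θ, hx, hz, h⟩ := h
  have := h.isGeodesicIn_geod hz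
  simpa only [cc_left_inv hx] using this

theorem RegAt.eqOn_geod (h : RegAt covF Ω₁ pF z) {γ : ℝ → M}
    (hγ : IsGeodesicIn (covF z.1) Ω₁ (pF z.1) z.2 γ) :
    EqOn γ (geod (covF z.1) Ω₁ (pF z.1) z.2) (Icc 0 1) := by
  have h' := h.isGeodesicIn_geod
  obtain ⟨x₁, W, δ, Θ, hx, hz, h⟩ := h
  have key : ∀ γ, IsGeodesicIn (covF z.1) Ω₁ (pF z.1) z.2 γ →
      EqOn γ (fun s => (Θ 0 ((z.1, cc n x₁ z.2), s)).pt) (Icc 0 1) := by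
    intro γ hγ
    refine h.uniq _ hz γ ?_
    simpa only [cc_left_inv hx] using hγ
  exact (key γ hγ).trans (key _ h').symm

theorem RegAt.regPt [T2Space M] (hF : IsPhaseFam covF ΦF Ω₁) (h : RegAt covF Ω₁ pF z) :
    RegPt (covF z.1) Ω₁ (pF z.1) z.2 := by
  obtain ⟨x₁, W, δ, Θ, hx, hz, h⟩ := h
  have := h.regPt hF.cov hz
  simpa only [cc_left_inv hx] using this

theorem IsPhaseFam.contMDiffAt (hF : IsPhaseFam covF ΦF Ω₁) (τ : P) (x : M) (hx : x ∈ Ω₁) :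
    ContMDiffAt (𝓡 n) 𝓘(ℝ, ℝ) ∞ (ΦF τ) x := by
  obtain ⟨U, hU, hΩ, hΦ⟩ := hF.phase
  exact contMDiffAt_slice (hΦ.contMDiffAt ((isOpen_univ.prod hU).mem_nhds ⟨trivial, hΩ hx⟩))

theorem RegAt.mem_range (h : RegAt covF Ω₁ pF z) : z.2 ∈ Ω₁ ∧ pF z.1 ∈ Ω₁ := by
  have h1 := h.isGeodesicIn_geod
  exact ⟨h1.target ▸ h1.mapsTo one_mem_unitInterval, h1.source ▸ h1.mapsTo zero_mem_unitInterval⟩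

theorem RegAt.eqOn_const (h : RegAt covF Ω₁ pF z) (hp : z.2 = pF z.1) :
    EqOn (fun _ => pF z.1) (geod (covF z.1) Ω₁ (pF z.1) (pF z.1)) (Icc 0 1) := by
  have h1 := h.eqOn_geod (γ := fun _ => pF z.1) (by
    rw [hp]
    exact (isGeodesicIn_const _ h.mem_range.2).1)
  rwa [hp] at h1

theorem NiceAt.goodAt (h : NiceAt covF ΦF Ω₀ Ω₁ pF z) : GoodAt covF ΦF Ω₀ Ω₁ pF z := by
  have := h.2 1 one_mem_unitInterval
  rwa [h.1.isGeodesicIn_geod.target] at this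

theorem NiceAt.goodAt_start (h : NiceAt covF ΦF Ω₀ Ω₁ pF z) :
    GoodAt covF ΦF Ω₀ Ω₁ pF (z.1, pF z.1) := by
  have := h.2 0 zero_mem_unitInterval
  rwa [h.1.isGeodesicIn_geod.source] at this

variable [T2Space M] [FiniteDimensional ℝ P]

/-- Nondegeneracy does not depend on the basis, and in the coordinate frame the determinant is
continuous. -/
theorem GoodAt.eventually (hF : IsPhaseFam covF ΦF Ω₁) (hΩ₀ : IsOpen Ω₀)
    (h : GoodAt covF ΦF Ω₀ Ω₁ pF z) : ∀ᶠ w in 𝓝 z, GoodAt covF ΦF Ω₀ Ω₁ pF w := by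
  obtain ⟨hz0, hreg, hdet⟩ := h
  have hreg' := hreg.eventually
  have hregPt := hreg.regPt hF
  obtain ⟨x₁, W, δ, Θ, hx, hz, h⟩ := hreg
  obtain ⟨U, hU, hΩU, hΦ⟩ := hF.phase
  rw [hregPt.weightedMatrix_det_ne_zero_iff (hF.cov.smoothConn _) (hF.torsion _)
    (hF.contMDiffAt _) hx] at hdet
  have hc := (contDiffAt_det (h.contDiffAt_frameMatrix_one hF.cov hU hΦ hΩU hz)).continuousAt
  have hev := hc.eventually_ne (by simpa only [cc_left_inv hx] using hdet)
  filter_upwards [(continuousAt_prod_cc hx).eventually hev, hreg',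
    continuousAt_snd.eventually ((isOpen_chartDom x₁).mem_nhds hx),
    continuousAt_snd.eventually (hΩ₀.mem_nhds hz0)] with w hw hwreg hwx hw0
  refine ⟨hw0, hwreg, ?_⟩
  rw [(hwreg.regPt hF).weightedMatrix_det_ne_zero_iff (hF.cov.smoothConn _) (hF.torsion _)
    (hF.contMDiffAt _) hwx]
  simpa only [cc_left_inv hwx] using hw

/-- The geodesics move continuously with the parameter and the end point, being good is open, and
the time interval is compact. -/
theorem NiceAt.eventually (hF : IsPhaseFam covF ΦF Ω₁) (hΩ₀ : IsOpen Ω₀)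
    (h : NiceAt covF ΦF Ω₀ Ω₁ pF z) : ∀ᶠ w in 𝓝 z, NiceAt covF ΦF Ω₀ Ω₁ pF w := by
  have hreg := h.1.eventually
  obtain ⟨x₁, W, δ, Θ, hx, hz, hW⟩ := h.1
  have hpt : ∀ w : P × M, w.2 ∈ chartDom n x₁ → (w.1, cc n x₁ w.2) ∈ W → ∀ s ∈ Icc (0 : ℝ) 1,
      (Θ 0 ((w.1, cc n x₁ w.2), s)).pt = geod (covF w.1) Ω₁ (pF w.1) w.2 s := by
    intro w hwx hw s hs
    have := hW.pt_eq_geod hw 0 hs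
    simpa only [cc_left_inv hwx] using this
  have hloc : ∀ s ∈ Icc (0 : ℝ) 1, ∀ᶠ v : (P × E) × ℝ in 𝓝 ((z.1, cc n x₁ z.2), s),
      GoodAt covF ΦF Ω₀ Ω₁ pF (v.1.1, (Θ 0 (v.1, v.2)).pt) := by
    intro s hs
    have hc : ContinuousAt (fun v : (P × E) × ℝ => (v.1.1, (Θ 0 v).pt)) ((z.1, cc n x₁ z.2), s) :=
      (continuousAt_fst.fst).prodMk (hW.smAt _ hz 0 s (hW.mem_Ioo hs)).1
    refine hc.eventually (GoodAt.eventually hF hΩ₀ ?_)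
    simp only [hpt z hx hz s hs]
    exact h.2 s hs
  have hall := isCompact_Icc.eventually_forall_of_forall_eventually
    (P := fun (w : P × E) (s : ℝ) => GoodAt covF ΦF Ω₀ Ω₁ pF (w.1, (Θ 0 (w, s)).pt)) hloc
  filter_upwards [hreg, (continuousAt_prod_cc hx).eventually hall,
    (continuousAt_prod_cc hx).eventually (hW.isOpen.mem_nhds hz),
    continuousAt_snd.eventually ((isOpen_chartDom x₁).mem_nhds hx)] with w hw1 hw2 hw3 hw4
  refine ⟨hw1, fun s hs => ?_⟩
  have := hw2 s hs
  simp only [hpt w hw4 hw3 s hs] at this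
  exact this

theorem NiceAt.box₀_start (hF : IsPhaseFam covF ΦF Ω₁) (h : NiceAt covF ΦF Ω₀ Ω₁ pF z) :
    box₀ (covF z.1) Ω₁ (ΦF z.1) (pF z.1) (ΦF z.1) (pF z.1) = n :=
  (h.goodAt_start.2.1.regPt hF).box₀_self (hF.cov.smoothConn _)
    (h.goodAt_start.2.1.eqOn_const rfl) _ h.goodAt_start.2.2

variable {F : Type*} [NormedAddCommGroup F] [NormedSpace ℝ F]

theorem GoodAt.contMDiffAt_box₀ (hF : IsPhaseFam covF ΦF Ω₁) (h : GoodAt covF ΦF Ω₀ Ω₁ pF z)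
    {V : Set (P × M)} (hV : IsOpen V) {f : P → M → F}
    (hf : ContMDiffOn (𝓘(ℝ, P).prod (𝓡 n)) 𝓘(ℝ, F) ∞ (fun z : P × M => f z.1 z.2) V) (hz : z ∈ V) :
    ContMDiffAt (𝓘(ℝ, P).prod (𝓡 n)) 𝓘(ℝ, F) ∞
      (fun z : P × M => box₀ (covF z.1) Ω₁ (ΦF z.1) (pF z.1) (f z.1) z.2) z := by
  obtain ⟨hz0, hreg, hdet⟩ := h
  have hregPt := hreg.regPt hF
  obtain ⟨x₁, W, δ, Θ, hx, hzW, h⟩ := hreg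
  obtain ⟨U, hU, hΩU, hΦ⟩ := hF.phase
  rw [hregPt.weightedMatrix_det_ne_zero_iff (hF.cov.smoothConn _) (hF.torsion _)
    (hF.contMDiffAt _) hx] at hdet
  exact contMDiffAt_of_coord (f := fun τ q => box₀ (covF τ) Ω₁ (ΦF τ) (pF τ) (f τ) q) hx
    (h.contDiffAt_box₀ hF.cov hF.torsion hU hΦ hΩU hzW (by simpa only [cc_left_inv hx] using hdet)
      hV hf (by simpa only [cc_left_inv hx] using hz)) (Eventually.of_forall fun w => rfl)

theorem GoodAt.contMDiffAt_zField (hF : IsPhaseFam covF ΦF Ω₁) (h : GoodAt covF ΦF Ω₀ Ω₁ pF z)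
    {V : Set (P × M)} (hV : IsOpen V) {ψ : P → M → ℝ} {f : P → M → F}
    (hψ : ContMDiffOn (𝓘(ℝ, P).prod (𝓡 n)) 𝓘(ℝ, ℝ) ∞ (fun z : P × M => ψ z.1 z.2) V)
    (hf : ContMDiffOn (𝓘(ℝ, P).prod (𝓡 n)) 𝓘(ℝ, F) ∞ (fun z : P × M => f z.1 z.2) V) (hz : z ∈ V) :
    ContMDiffAt (𝓘(ℝ, P).prod (𝓡 n)) 𝓘(ℝ, F) ∞
      (fun z : P × M => zField (covF z.1) Ω₁ (ΦF z.1) (pF z.1) (ψ z.1) (f z.1) z.2) z := by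
  obtain ⟨hz0, hreg, hdet⟩ := h
  have hregPt := hreg.regPt hF
  obtain ⟨x₁, W, δ, Θ, hx, hzW, h⟩ := hreg
  obtain ⟨U, hU, hΩU, hΦ⟩ := hF.phase
  rw [hregPt.weightedMatrix_det_ne_zero_iff (hF.cov.smoothConn _) (hF.torsion _)
    (hF.contMDiffAt _) hx] at hdet
  exact contMDiffAt_of_coord (f := fun τ q => zField (covF τ) Ω₁ (ΦF τ) (pF τ) (ψ τ) (f τ) q) hx
    (h.contDiffAt_zField hF.cov hF.torsion hU hΦ hΩU hzW (by simpa only [cc_left_inv hx] using hdet)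
      hV hψ hf (by simpa only [cc_left_inv hx] using hz)) (Eventually.of_forall fun w => rfl)

end GoodPoints
end OscGeom

end

noncomputable section

namespace OscGeom

/-! ### The function `η` and the operator `□` at nice points. -/

section Eta

variable {n : ℕ} {M : Type*} [TopologicalSpace M] [ChartedSpace (EuclideanSpace ℝ (Fin n)) M]
  [IsManifold (𝓡 n) ∞ M] [T2Space M]

local notation "E" => EuclideanSpace ℝ (Fin n)

variable {P : Type} [NormedAddCommGroup P] [NormedSpace ℝ P] [FiniteDimensional ℝ P]
variable {covF : P → Conn n M} {ΦF : P → M → ℝ} {Ω₀ Ω₁ : Set M} {pF : P → M}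

theorem contMDiffAt_state_pt {x₁ : M} {W : Set (P × EuclideanSpace ℝ (Fin n))} {δ : ℝ}
    {Θ : EuclideanSpace ℝ (Fin n) → (P × EuclideanSpace ℝ (Fin n)) × ℝ → GState n M}
    (h : IsRegFamily covF Ω₁ pF x₁ W δ Θ) {w : P × E} (hw : w ∈ W) {s : ℝ}
    (hs : s ∈ Icc (0 : ℝ) 1) :
    ContMDiffAt 𝓘(ℝ, (P × E) × ℝ) (𝓘(ℝ, P).prod (𝓡 n)) ∞
      (fun v : (P × E) × ℝ => (v.1.1, (Θ 0 v).pt)) (w, s) :=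
  ContMDiffAt.prodMk (contDiffAt_fst.fst.contMDiffAt)
    (h.smAt w hw 0 s (h.mem_Ioo hs)).contMDiffAt_pt

/-- The geodesic from `p` to `γ r` is a reparametrization of `γ`. -/
theorem IsRegFamily.isGeodesicIn_sub {x₁ : M} {W : Set (P × EuclideanSpace ℝ (Fin n))} {δ : ℝ}
    {Θ : EuclideanSpace ℝ (Fin n) → (P × EuclideanSpace ℝ (Fin n)) × ℝ → GState n M}
    (h : IsRegFamily covF Ω₁ pF x₁ W δ Θ) {w : P × E} (hw : w ∈ W) {r : ℝ}
    (hr : r ∈ Icc (0 : ℝ) 1) :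
    IsGeodesicIn (covF w.1) Ω₁ (pF w.1) (Θ 0 (w, r)).pt (fun s => (Θ 0 (w, r * s)).pt) := by
  have hmem : ∀ s ∈ Icc (0 : ℝ) 1, r * s ∈ Icc (0 : ℝ) 1 := fun s hs =>
    ⟨mul_nonneg hr.1 hs.1, by nlinarith [hr.1, hr.2, hs.1, hs.2]⟩
  have h1 := (isGeodesicIn_of_isSol (cov := covF w.1) (Ω := Ω₁)
    (W := fun s => ⟨(Θ 0 (w, 0 + r * s)).pt, r • (Θ 0 (w, 0 + r * s)).vel,
      (Θ 0 (w, 0 + r * s)).vec⟩)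
    (fun t ht => (h.isSol w hw 0 (0 + r * t) (h.mem_Ioo (by simpa using hmem t ht))).affine
      (fun _ _ => trivial)) (fun t ht => ?_) (fun t ht => ?_)).1
  · simpa only [zero_add, mul_zero, mul_one, h.start w hw] using h1
  · have h2 := ((h.smAt w hw 0 (0 + r * t) (h.mem_Ioo (by simpa using hmem t ht))).comp
      (g := fun s : ℝ => (w, 0 + r * s)) (y := t) (by fun_prop)).scale r 1
    simpa only [one_smul] using h2
  · simpa using h.mem w hw _ (hmem t ht)

/-- The numerator `k` is smooth in parameter, end point and time, and vanishes at time 0. Hence `k =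
s κ` with `κ` smooth, and `η = ∫₀¹ κ`. All three claims follow from this representation. -/
theorem NiceAt.eta_spec (hF : IsPhaseFam covF ΦF Ω₁) (hΩ₀ : IsOpen Ω₀) {z : P × M}
    (hz : NiceAt covF ΦF Ω₀ Ω₁ pF z) :
    IntervalIntegrable (etaIntegrand (covF z.1) Ω₁ (ΦF z.1) (pF z.1) z.2)
      MeasureTheory.volume 0 1 ∧
    ContMDiffAt (𝓘(ℝ, P).prod (𝓡 n)) 𝓘(ℝ, ℝ) ∞
      (fun z : P × M => eta (covF z.1) Ω₁ (ΦF z.1) (pF z.1) z.2) z ∧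
    ∀ u : TangentSpace (𝓡 n) z.2,
      (⟨geod (covF z.1) Ω₁ (pF z.1) z.2 1, velocity (geod (covF z.1) Ω₁ (pF z.1) z.2) 1⟩ :
        TangentBundle (𝓡 n) M) = ⟨z.2, u⟩ →
      mvfderiv (𝓡 n) (eta (covF z.1) Ω₁ (ΦF z.1) (pF z.1)) z.2 u =
        n - box₀ (covF z.1) Ω₁ (ΦF z.1) (pF z.1) (ΦF z.1) z.2 := by
  have hzev := hz.eventually hF hΩ₀
  have hz' := hz
  obtain ⟨⟨x₁, W, δ, Θ, hx, hzW, h⟩, hgood⟩ := hz'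
  obtain ⟨U, hU, hΩU, hΦ⟩ := hF.phase
  set k : (P × E) × ℝ → ℝ := fun v =>
    n - box₀ (covF v.1.1) Ω₁ (ΦF v.1.1) (pF v.1.1) (ΦF v.1.1) (Θ 0 v).pt with hk
  have hpt : ∀ w : P × M, w.2 ∈ chartDom n x₁ → (w.1, cc n x₁ w.2) ∈ W → ∀ s ∈ Icc (0 : ℝ) 1,
      (Θ 0 ((w.1, cc n x₁ w.2), s)).pt = geod (covF w.1) Ω₁ (pF w.1) w.2 s := by
    intro w hwx hw s hs
    have := h.pt_eq_geod hw 0 hs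
    simpa only [cc_left_inv hwx] using this
  have hksm : ∀ w : P × M, w.2 ∈ chartDom n x₁ → (w.1, cc n x₁ w.2) ∈ W →
      NiceAt covF ΦF Ω₀ Ω₁ pF w → ∀ s ∈ Icc (0 : ℝ) 1,
        ContDiffAt ℝ ∞ k ((w.1, cc n x₁ w.2), s) := by
    intro w hwx hw hwn s hs
    have h1 := hwn.2 s hs
    rw [← hpt w hwx hw s hs] at h1
    have h2 := h1.contMDiffAt_box₀ hF (isOpen_univ.prod hU) hΦ ⟨trivial, hΩU h1.2.1.mem_range.1⟩
    have h3 := ContMDiffAt.comp (f := fun v : (P × E) × ℝ => (v.1.1, (Θ 0 v).pt))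
      ((w.1, cc n x₁ w.2), s) h2 (contMDiffAt_state_pt h hw hs)
    exact contDiffAt_const.sub h3.contDiffAt
  have hk0 : ∀ w : P × M, w.2 ∈ chartDom n x₁ → (w.1, cc n x₁ w.2) ∈ W →
      NiceAt covF ΦF Ω₀ Ω₁ pF w → k ((w.1, cc n x₁ w.2), 0) = 0 := by
    intro w hwx hw hwn
    simp only [hk]
    rw [h.start _ hw, hwn.box₀_start hF, sub_self]
  obtain ⟨κ, hκ⟩ := exists_contDiffAt_div (Z := P × E) (F := ℝ) k
  have hint : ∀ w : P × M, w.2 ∈ chartDom n x₁ → (w.1, cc n x₁ w.2) ∈ W →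
      NiceAt covF ΦF Ω₀ Ω₁ pF w → ∀ s ∈ Ioc (0 : ℝ) 1,
        etaIntegrand (covF w.1) Ω₁ (ΦF w.1) (pF w.1) w.2 s = κ ((w.1, cc n x₁ w.2), s) := by
    intro w hwx hw hwn s hs
    have hs' : s ∈ Icc (0 : ℝ) 1 := ⟨hs.1.le, hs.2⟩
    have h1 := (hκ _ (hksm w hwx hw hwn) (hk0 w hwx hw hwn) s hs').2
    rw [etaIntegrand, ← hpt w hwx hw s hs', div_eq_iff hs.1.ne', mul_comm, ← smul_eq_mul, ← h1]
  have hetaκ : ∀ w : P × M, w.2 ∈ chartDom n x₁ → (w.1, cc n x₁ w.2) ∈ W →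
      NiceAt covF ΦF Ω₀ Ω₁ pF w →
        eta (covF w.1) Ω₁ (ΦF w.1) (pF w.1) w.2 = ∫ s in (0 : ℝ)..1, κ ((w.1, cc n x₁ w.2), s) := by
    intro w hwx hw hwn
    refine intervalIntegral.integral_congr_ae (Eventually.of_forall fun s hs => ?_)
    rw [uIoc_of_le zero_le_one] at hs
    exact hint w hwx hw hwn s hs
  set w₀ : P × E := (z.1, cc n x₁ z.2) with hw₀
  have hκsm : ∀ s ∈ Icc (0 : ℝ) 1, ContDiffAt ℝ ∞ κ (w₀, s) := fun s hs =>
    (hκ _ (hksm z hx hzW hz) (hk0 z hx hzW hz) s hs).1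
  have hκc : ContinuousOn (fun s => κ (w₀, s)) (Icc 0 1) := fun s hs =>
    (ContinuousAt.comp (f := fun s : ℝ => (w₀, s)) (hκsm s hs).continuousAt
      (by fun_prop)).continuousWithinAt
  have hκi : IntervalIntegrable (fun s => κ (w₀, s)) MeasureTheory.volume 0 1 :=
    ContinuousOn.intervalIntegrable (by rwa [uIcc_of_le zero_le_one])
  have hsmooth : ContMDiffAt (𝓘(ℝ, P).prod (𝓡 n)) 𝓘(ℝ, ℝ) ∞
      (fun z : P × M => eta (covF z.1) Ω₁ (ΦF z.1) (pF z.1) z.2) z := by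
    refine contMDiffAt_of_coord (f := fun τ q => eta (covF τ) Ω₁ (ΦF τ) (pF τ) q)
      (g := fun w : P × E => ∫ s in (0 : ℝ)..1, κ (w, s)) hx
      (contDiffAt_parametric_intervalIntegral (Z := P × E) (F := ℝ) hκsm) ?_
    have hc : ContinuousAt (fun w : P × E => (w.1, (cc n x₁).symm w.2)) (z.1, cc n x₁ z.2) :=
      continuousAt_prod_cc_symm (cc_mem_target hx)
    have hzev' : ∀ᶠ w in 𝓝 ((fun w : P × E => (w.1, (cc n x₁).symm w.2)) (z.1, cc n x₁ z.2)),
        NiceAt covF ΦF Ω₀ Ω₁ pF w := by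
      simpa only [cc_left_inv hx] using hzev
    filter_upwards [hc.eventually hzev', h.isOpen.mem_nhds hzW] with w hw hwW
    have hwt := h.target w hwW
    have h1 := hetaκ (w.1, (cc n x₁).symm w.2) (cc_symm_mem hwt)
      (by simpa only [(cc n x₁).right_inv hwt] using hwW) hw
    simpa only [(cc n x₁).right_inv hwt] using h1
  refine ⟨?_, hsmooth, ?_⟩
  · refine hκi.congr_ae ?_
    rw [uIoc_of_le zero_le_one]
    filter_upwards [MeasureTheory.ae_restrict_mem measurableSet_Ioc] with s hs
    exact (hint z hx hzW hz s hs).symm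
  · intro u hu
    set γ := geod (covF z.1) Ω₁ (pF z.1) z.2 with hγ
    have hgeo : IsGeodesicIn (covF z.1) Ω₁ (pF z.1) z.2 γ := hz.1.isGeodesicIn_geod
    -- The geodesic from the starting point to `γ r` is `s ↦ γ (r s)`. Since `ds/s` is invariant
    -- under scaling, the integral becomes one of the same `κ` over `[0, r]`.
    have hetaγ : ∀ r ∈ Icc (0 : ℝ) 1,
        eta (covF z.1) Ω₁ (ΦF z.1) (pF z.1) (γ r) = ∫ s in (0 : ℝ)..r, κ (w₀, s) := by
      intro r hr
      have h1 : r * ∫ s in (0 : ℝ)..1, κ (w₀, r * s) = ∫ s in (0 : ℝ)..r, κ (w₀, s) := by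
        rw [intervalIntegral.mul_integral_comp_mul_left (f := fun s => κ (w₀, s)), mul_zero,
          mul_one]
      rw [← h1, ← intervalIntegral.integral_const_mul]
      refine intervalIntegral.integral_congr_ae (Eventually.of_forall fun s hs => ?_)
      rw [uIoc_of_le zero_le_one] at hs
      have hrs : r * s ∈ Icc (0 : ℝ) 1 :=
        ⟨mul_nonneg hr.1 hs.1.le, by nlinarith [hr.1, hr.2, hs.1, hs.2]⟩
      have hs' : s ∈ Icc (0 : ℝ) 1 := ⟨hs.1.le, hs.2⟩
      have hsub := h.isGeodesicIn_sub hzW hr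
      rw [hpt z hx hzW r hr] at hsub
      have h2 := (hgood r hr).2.1.eqOn_geod hsub hs'
      have h3 := (hκ _ (hksm z hx hzW hz) (hk0 z hx hzW hz) (r * s) hrs).2
      rw [etaIntegrand, ← h2, div_eq_iff hs.1.ne']
      refine h3.trans ?_
      rw [smul_eq_mul]
      ring
    -- The derivative at `r = 1` is one-sided, as `γ` is controlled on `[0,1]` only; unique
    -- differentiability still identifies it with `dη(u)`.
    have hd1 : HasDerivWithinAt (fun r => ∫ s in (0 : ℝ)..r, κ (w₀, s)) (κ (w₀, 1)) (Icc 0 1) 1 := by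
      have : Fact ((1 : ℝ) ∈ Icc (0 : ℝ) 1) := ⟨one_mem_unitInterval⟩
      exact intervalIntegral.integral_hasDerivWithinAt_right hκi
        (hκc.stronglyMeasurableAtFilter_nhdsWithin measurableSet_Icc 1) (hκc 1 one_mem_unitInterval)
    have hd2 : HasDerivWithinAt (fun r => eta (covF z.1) Ω₁ (ΦF z.1) (pF z.1) (γ r)) (κ (w₀, 1))
        (Icc 0 1) 1 := hd1.congr hetaγ (hetaγ 1 one_mem_unitInterval)
    have hsl : MDifferentiableAt (𝓡 n) 𝓘(ℝ, ℝ) (eta (covF z.1) Ω₁ (ΦF z.1) (pF z.1)) (γ 1) := by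
      rw [hgeo.target]
      exact (contMDiffAt_slice (f := fun τ q => eta (covF τ) Ω₁ (ΦF τ) (pF τ) q)
        hsmooth).mdifferentiableAt (by simp)
    have hd3 := hasDerivWithinAt_comp_mvfderiv hsl
      ((hgeo.smooth 1 one_mem_unitInterval).mdifferentiableWithinAt (by simp))
    have h4 := (uniqueDiffWithinAt_unitInterval one_mem_unitInterval).eq_deriv _ hd3 hd2
    have h5 := congrArg (fun X : TangentBundle (𝓡 n) M =>
      mvfderiv (𝓡 n) (eta (covF z.1) Ω₁ (ΦF z.1) (pF z.1)) X.1 X.2) hu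
    have h6 := (hκ _ (hksm z hx hzW hz) (hk0 z hx hzW hz) 1 one_mem_unitInterval).2
    rw [one_smul] at h6
    refine (h5.symm.trans h4).trans (h6.symm.trans ?_)
    simp only [hk]
    rw [hpt z hx hzW 1 one_mem_unitInterval, ← hγ, hgeo.target]

theorem NiceAt.schrodinger (hF : IsPhaseFam covF ΦF Ω₁) (hΩ₀ : IsOpen Ω₀) {z : P × M}
    (hz : NiceAt covF ΦF Ω₀ Ω₁ pF z) (hcrit : IsCrit n (ΦF z.1) (pF z.1)) {t : ℝ} (ht : 0 < t) :
    HasDerivAt (fun s => oscKernel n (ΦF z.1) (pF z.1) s z.2)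
      (Complex.I / 2 * box (covF z.1) Ω₁ (ΦF z.1) (pF z.1) (oscKernel n (ΦF z.1) (pF z.1) t) z.2)
      t := by
  have hreg := hz.1.regPt hF
  obtain ⟨u, hu⟩ := hreg.exists_velocity
  exact hreg.hasDerivAt_oscKernel (hF.cov.smoothConn _) (hF.torsion _) (hF.contMDiffAt _) hcrit
    hz.goodAt.2.2 hu ((hz.eta_spec hF hΩ₀).2.2 u hu) ht

variable {F : Type*} [NormedAddCommGroup F] [NormedSpace ℝ F]

theorem NiceAt.contMDiffAt_box (hF : IsPhaseFam covF ΦF Ω₁) (hΩ₀ : IsOpen Ω₀) {z : P × M}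
    (hz : NiceAt covF ΦF Ω₀ Ω₁ pF z) {V : Set (P × M)} (hV : IsOpen V) {f : P → M → F}
    (hf : ContMDiffOn (𝓘(ℝ, P).prod (𝓡 n)) 𝓘(ℝ, F) ∞ (fun z : P × M => f z.1 z.2) V) (hzV : z ∈ V) :
    ContMDiffAt (𝓘(ℝ, P).prod (𝓡 n)) 𝓘(ℝ, F) ∞
      (fun z : P × M => box (covF z.1) Ω₁ (ΦF z.1) (pF z.1) (f z.1) z.2) z := by
  have h1 := hz.goodAt.contMDiffAt_box₀ hF hV hf hzV
  -- `Z_η` differentiates `η`, so `η` must be smooth on a whole neighbourhood; nice points form an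
  -- open set.
  set N : Set (P × M) := {w | NiceAt covF ΦF Ω₀ Ω₁ pF w} with hN
  have hNo : IsOpen N := isOpen_iff_mem_nhds.2 fun w hw => NiceAt.eventually hF hΩ₀ hw
  have h2 := hz.goodAt.contMDiffAt_zField hF (hV.inter hNo)
    (ψ := fun τ q => eta (covF τ) Ω₁ (ΦF τ) (pF τ) q)
    (fun w hw => (NiceAt.eta_spec hF hΩ₀ hw.2).2.1.contMDiffWithinAt)
    (hf.mono inter_subset_left) ⟨hzV, hz⟩
  exact h1.add h2

end Eta
end OscGeom

end

noncomputable section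

namespace OscGeom

/-! ### Continuation of nondegenerate critical points. -/

section CriticalPoints

variable {n : ℕ} {M : Type*} [TopologicalSpace M] [ChartedSpace (EuclideanSpace ℝ (Fin n)) M]
  [IsManifold (𝓡 n) ∞ M]

local notation "E" => EuclideanSpace ℝ (Fin n)

theorem isCrit_iff {Φ : M → ℝ} {x₀ x : M} (hx : x ∈ chartDom n x₀)
    (hΦ : MDifferentiableAt (𝓡 n) 𝓘(ℝ, ℝ) Φ x) :
    IsCrit n Φ x ↔ fderiv ℝ (fun y => Φ ((cc n x₀).symm y)) (cc n x₀ x) = 0 := by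
  constructor
  · intro h
    ext1 a
    have := mvfderiv_eq hx hΦ (ts x₀ x a)
    rw [tc_ts hx, h] at this
    exact this.symm
  · intro h
    ext1 v
    rw [mvfderiv_eq hx hΦ, h]
    rfl

/-- The Hessian matrix in the coordinate frame. -/
def hessFrame (cov : Conn n M) (Φ : M → ℝ) (x₀ : M) (y : E) : Matrix (Fin n) (Fin n) ℝ :=
  Matrix.of fun i j => hessC cov Φ x₀ y (EuclideanSpace.single i 1) (EuclideanSpace.single j 1)

theorem hessMatrix_det_ne_zero_iff (cov : Conn n M) {Φ : M → ℝ} {x₀ x : M}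
    (hx : x ∈ chartDom n x₀) (hΦ : ContMDiffAt (𝓡 n) 𝓘(ℝ, ℝ) ∞ Φ x) :
    (hessMatrix cov Φ x).det ≠ 0 ↔ (hessFrame cov Φ x₀ (cc n x₀ x)).det ≠ 0 := by
  obtain ⟨B, hB⟩ := exists_bilin_hess cov hΦ
  have h : hessMatrix cov Φ x = (frameChange (n := n) x₀ x).transpose *
      hessFrame cov Φ x₀ (cc n x₀ x) * frameChange x₀ x := by
    ext i j
    have h1 : ∀ k l, hessFrame cov Φ x₀ (cc n x₀ x) k l = B (frame x₀ x k) (frame x₀ x l) := by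
      intro k l
      rw [hB, hess_eq_hessC cov hx hΦ]
      simp only [frame, tc_ts hx]
      rfl
    simp only [hessMatrix, Matrix.of_apply, ← hB, Matrix.mul_apply, h1,
      Matrix.transpose_apply, bilin_change B (basisVec_eq_frame hx), Finset.sum_mul, smul_eq_mul]
    rw [Finset.sum_comm]
    exact Finset.sum_congr rfl fun k _ => Finset.sum_congr rfl fun l _ => by ring
  rw [h, Matrix.det_mul, Matrix.det_mul, Matrix.det_transpose]
  have := (isUnit_frameChange hx).ne_zero
  simp [this]

theorem isInvertible_of_det_ne_zero {L : E →L[ℝ] E →L[ℝ] ℝ}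
    (h : (Matrix.of fun i j : Fin n => L (EuclideanSpace.single j 1)
      (EuclideanSpace.single i (1 : ℝ))).det ≠ 0) : L.IsInvertible := by
  have hinj : Function.Injective L := by
    rw [injective_iff_map_eq_zero]
    intro b hb
    set A := Matrix.of fun i j : Fin n => L (EuclideanSpace.single j 1)
      (EuclideanSpace.single i (1 : ℝ)) with hA
    have h1 : A.mulVec (fun j => b j) = 0 := by
      funext i
      have h2 : L b (EuclideanSpace.single i (1 : ℝ)) = 0 := by rw [hb]; rfl
      rw [euclidean_sum_single b, map_sum] at h2
      simp only [map_smul, _root_.sum_apply, _root_.smul_apply, smul_eq_mul] at h2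
      simp only [Matrix.mulVec, dotProduct, hA, Matrix.of_apply, Pi.zero_apply]
      rw [← h2]
      exact Finset.sum_congr rfl fun j _ => mul_comm _ _
    have h3 := Matrix.eq_zero_of_mulVec_eq_zero h h1
    ext j
    exact congrFun h3 j
  have hdim : Module.finrank ℝ E = Module.finrank ℝ (E →L[ℝ] ℝ) := by
    rw [← (LinearMap.toContinuousLinearMap : (E →ₗ[ℝ] ℝ) ≃ₗ[ℝ] E →L[ℝ] ℝ).finrank_eq,
      Module.finrank_linearMap, Module.finrank_self, mul_one]
  let e := LinearMap.linearEquivOfInjective (L : E →ₗ[ℝ] E →L[ℝ] ℝ) hinj hdim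
  exact ⟨e.toContinuousLinearEquiv, by ext1 v; rfl⟩

/-- At a critical point the Christoffel term of the Hessian drops out, so the covariant
nondegeneracy is that of the second derivative in the chart. -/
theorem isInvertible_fderiv_fderiv (cov : Conn n M) {Φ : M → ℝ} {x₀ : M} {y : E}
    (hcrit : fderiv ℝ (fun y => Φ ((cc n x₀).symm y)) y = 0)
    (hdet : (hessFrame cov Φ x₀ y).det ≠ 0) :
    (fderiv ℝ (fderiv ℝ (fun y => Φ ((cc n x₀).symm y))) y).IsInvertible := by
  refine isInvertible_of_det_ne_zero ?_
  convert hdet using 3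
  ext i j
  simp only [hessFrame, hessC, Matrix.of_apply]
  rw [hcrit]
  simp

variable {P : Type} [NormedAddCommGroup P] [NormedSpace ℝ P] [CompleteSpace P]

/-- Near `p` the implicit function theorem for `dΦ = 0` gives exactly one critical point. On the
remaining compact part of `K` the differential does not vanish at `τ₀`, hence not nearby. -/
theorem exists_crit_family {covF : P → Conn n M} (hcov : SmoothFam covF) {ΦF : P → M → ℝ}
    {U : Set M} (hU : IsOpen U)
    (hΦ : ContMDiffOn (𝓘(ℝ, P).prod (𝓡 n)) 𝓘(ℝ, ℝ) ∞ (fun z : P × M => ΦF z.1 z.2) (univ ×ˢ U))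
    {K : Set M} (hK : IsCompact K) (hKU : K ⊆ U) {τ₀ : P} {p : M} (hpK : p ∈ K)
    (hcrit : ∀ x ∈ K, IsCrit n (ΦF τ₀) x ↔ x = p)
    (hnd : (hessMatrix (covF τ₀) (ΦF τ₀) p).det ≠ 0) {D : Set M} (hD : IsOpen D) (hpD : p ∈ D) :
    ∃ N : Set P, IsOpen N ∧ τ₀ ∈ N ∧ ∃ pF : P → M, pF τ₀ = p ∧
      ContMDiffOn 𝓘(ℝ, P) (𝓡 n) ∞ pF N ∧ ∀ τ ∈ N, pF τ ∈ D ∧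
        (∀ x ∈ K, IsCrit n (ΦF τ) x ↔ x = pF τ) ∧
        (hessMatrix (covF τ) (ΦF τ) (pF τ)).det ≠ 0 := by
  have hΦs : ∀ τ x, x ∈ U → ContMDiffAt (𝓡 n) 𝓘(ℝ, ℝ) ∞ (ΦF τ) x := fun τ x hx =>
    contMDiffAt_slice (hΦ.contMDiffAt ((isOpen_univ.prod hU).mem_nhds ⟨trivial, hx⟩))
  have hmd : ∀ τ x, x ∈ U → MDifferentiableAt (𝓡 n) 𝓘(ℝ, ℝ) (ΦF τ) x := fun τ x hx =>
    (hΦs τ x hx).mdifferentiableAt (by simp)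
  let dΦ : M → P × E → E →L[ℝ] ℝ := fun x₀ w =>
    fderiv ℝ (fun y => ΦF w.1 ((cc n x₀).symm y)) w.2
  have hdΦ : ∀ x₀ (w : P × E), w.2 ∈ (cc n x₀).target → (cc n x₀).symm w.2 ∈ U →
      ContDiffAt ℝ ∞ (dΦ x₀) w := fun x₀ w hw hwU =>
    contDiffAt_fderiv_snd (z₀ := w) (contDiffAt_coord hw
      (hΦ.contMDiffAt ((isOpen_univ.prod hU).mem_nhds ⟨trivial, hwU⟩))) contDiffAt_fst contDiffAt_snd
  have hpU := hKU hpK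
  have hp : p ∈ chartDom n p := mem_chart_source _ p
  have hpcrit : dΦ p (τ₀, cc n p p) = 0 := (isCrit_iff hp (hmd τ₀ p hpU)).1 ((hcrit p hpK).2 rfl)
  set T : Set E := (cc n p).target ∩ (cc n p).symm ⁻¹' U with hT
  have hTo : IsOpen T := (continuousOn_extChartAt_symm p).isOpen_inter_preimage
    (isOpen_cc_target p) hU
  have hpT : cc n p p ∈ T := ⟨cc_mem_target hp, by rw [mem_preimage, cc_left_inv hp]; exact hpU⟩
  have hdet := (hessMatrix_det_ne_zero_iff (covF τ₀) hp (hΦs τ₀ p hpU)).1 hnd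
  have hinv : (fderiv ℝ (dΦ p) (τ₀, cc n p p) ∘L .inr ℝ P E).IsInvertible := by
    have h1 : HasFDerivAt (fun y => dΦ p (τ₀, y))
        (fderiv ℝ (dΦ p) (τ₀, cc n p p) ∘L .inr ℝ P E) (cc n p p) :=
      HasFDerivAt.comp (g := dΦ p) (f := fun y => (τ₀, y)) (cc n p p)
        ((hdΦ p (τ₀, cc n p p) hpT.1 hpT.2).differentiableAt (by simp)).hasFDerivAt
        (hasFDerivAt_prodMk_right τ₀ (cc n p p))
    rw [← h1.fderiv]
    exact isInvertible_fderiv_fderiv (covF τ₀) hpcrit hdet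
  obtain ⟨O, V, g, hO, hV, hτO, hpV, hg, hg0, hOV, hgV⟩ := exists_implicit_contDiffOn
    (D := (univ : Set P) ×ˢ T) (isOpen_univ.prod hTo)
    (fun w hw => (hdΦ p w hw.2.1 hw.2.2).contDiffWithinAt) (u := (τ₀, cc n p p)) ⟨trivial, hpT⟩ hinv
  have hgT : ∀ τ ∈ O, g τ ∈ T := fun τ hτ => (hOV (show (τ, g τ) ∈ O ×ˢ V from ⟨hτ, (hgV τ hτ).1⟩)).2
  have hgs : ∀ τ ∈ O, ContMDiffAt 𝓘(ℝ, P) (𝓡 n) ∞ (fun τ => (cc n p).symm (g τ)) τ := by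
    intro τ hτ
    have h6 : ContMDiffAt 𝓘(ℝ, E) (𝓡 n) ∞ (cc n p).symm (g τ) :=
      (contMDiffOn_extChartAt_symm p).contMDiffAt ((isOpen_cc_target p).mem_nhds (hgT τ hτ).1)
    exact h6.comp τ (hg.contDiffAt (hO.mem_nhds hτ)).contMDiffAt
  set B : Set M := chartDom n p ∩ cc n p ⁻¹' V with hB
  have hBo : IsOpen B := by
    have := (continuousOn_extChartAt (I := 𝓡 n) p).isOpen_inter_preimage
      (isOpen_extChartAt_source p) hV
    rwa [extChartAt_source] at this
  -- `B` is the region where the implicit function theorem controls all critical points; its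
  -- complement in `K` is compact.
  have hfar : ∀ᶠ τ in 𝓝 τ₀, ∀ x ∈ K \ B, ¬ IsCrit n (ΦF τ) x := by
    refine (hK.diff hBo).eventually_forall_of_forall_eventually
      (P := fun τ x => ¬ IsCrit n (ΦF τ) x) fun x hx => ?_
    have hxx : x ∈ chartDom n x := mem_chart_source _ x
    have hxp : x ≠ p := fun h => hx.2 (h ▸ ⟨hp, hpV⟩)
    have h1 : dΦ x (τ₀, cc n x x) ≠ 0 := fun h =>
      hxp ((hcrit x hx.1).1 ((isCrit_iff hxx (hmd τ₀ x (hKU hx.1))).2 h))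
    have h2 : ContinuousAt (fun w : P × M => dΦ x (w.1, cc n x w.2)) (τ₀, x) :=
      ContinuousAt.comp (f := fun w : P × M => (w.1, cc n x w.2)) (g := dΦ x)
        (hdΦ x (τ₀, cc n x x) (cc_mem_target hxx)
          (by rw [cc_left_inv hxx]; exact hKU hx.1)).continuousAt (continuousAt_prod_cc hxx)
    filter_upwards [h2.eventually_ne h1, continuousAt_snd.eventually
      ((isOpen_chartDom x).mem_nhds hxx), continuousAt_snd.eventually (hU.mem_nhds (hKU hx.1))]
      with w hw hwx hwU h
    exact hw ((isCrit_iff hwx (hmd w.1 w.2 hwU)).1 h)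
  have hgD : ∀ᶠ τ in 𝓝 τ₀, (cc n p).symm (g τ) ∈ D := by
    have h0 : (cc n p).symm (g τ₀) = p := by rw [hg0, cc_left_inv hp]
    exact (hgs τ₀ hτO).continuousAt.eventually (hD.mem_nhds (by simpa only [h0] using hpD))
  have hgdet : ∀ᶠ τ in 𝓝 τ₀, (hessFrame (covF τ) (ΦF τ) p (g τ)).det ≠ 0 := by
    have hgc : ContDiffAt ℝ ∞ g τ₀ := hg.contDiffAt (hO.mem_nhds hτO)
    have h1 : ContDiffAt ℝ ∞ (fun τ => (hessFrame (covF τ) (ΦF τ) p (g τ)).det) τ₀ := by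
      refine contDiffAt_det fun i j => contDiffAt_hessC hcov contDiffAt_id hgc contDiffAt_const
        contDiffAt_const (hgT τ₀ hτO).1 (contDiffAt_coord (hgT τ₀ hτO).1
          (hΦ.contMDiffAt ((isOpen_univ.prod hU).mem_nhds ⟨trivial, (hgT τ₀ hτO).2⟩)))
    refine h1.continuousAt.eventually_ne ?_
    rw [hg0]
    exact hdet
  obtain ⟨N, hN, hNo, hτN⟩ := mem_nhds_iff.1 (inter_mem hfar (inter_mem hgD hgdet))
  refine ⟨N ∩ O, hNo.inter hO, ⟨hτN, hτO⟩, fun τ => (cc n p).symm (g τ), ?_, fun τ hτ =>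
    (hgs τ hτ.2).contMDiffWithinAt, fun τ hτ => ⟨(hN hτ.1).2.1, fun x hx => ?_, ?_⟩⟩
  · change (cc n p).symm (g τ₀) = p
    rw [hg0, cc_left_inv hp]
  · by_cases hxB : x ∈ B
    · rw [isCrit_iff hxB.1 (hmd τ x (hKU hx))]
      have h1 := (hgV τ hτ.2).2 (cc n p x) hxB.2
      rw [hpcrit] at h1
      refine h1.trans ⟨fun h => ?_, fun h => ?_⟩
      · change x = (cc n p).symm (g τ)
        rw [← h, cc_left_inv hxB.1]
      · rw [h, (cc n p).right_inv (hgT τ hτ.2).1]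
    · refine ⟨fun h => absurd h ((hN hτ.1).1 x ⟨hx, hxB⟩), fun h => absurd ?_ hxB⟩
      rw [h]
      refine ⟨cc_symm_mem (hgT τ hτ.2).1, ?_⟩
      rw [mem_preimage, (cc n p).right_inv (hgT τ hτ.2).1]
      exact (hgV τ hτ.2).1
  · rw [hessMatrix_det_ne_zero_iff (covF τ) (cc_symm_mem (hgT τ hτ.2).1) (hΦs τ _ (hgT τ hτ.2).2),
      (cc n p).right_inv (hgT τ hτ.2).1]
    exact (hN hτ.1).2.2

end CriticalPoints
end OscGeom

end

noncomputable section

namespace OscGeom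

/-! ### Smooth geodesics persist for nearby connections. -/

section SmoothGeodesics

variable {n : ℕ} {M : Type*} [TopologicalSpace M] [ChartedSpace (EuclideanSpace ℝ (Fin n)) M]
  [IsManifold (𝓡 n) ∞ M] [T2Space M]

local notation "E" => EuclideanSpace ℝ (Fin n)

variable {P : Type} [NormedAddCommGroup P] [NormedSpace ℝ P] [FiniteDimensional ℝ P]

theorem isOpen_symm_preimage (x₀ : M) {D : Set M} (hD : IsOpen D) :
    IsOpen ((cc n x₀).target ∩ (cc n x₀).symm ⁻¹' D) :=
  (continuousOn_extChartAt_symm x₀).isOpen_inter_preimage (isOpen_cc_target x₀) hD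

/-- If geodesics depend smoothly on their end points, then they extend to families of geodesics of
nearby connections. -/
theorem exists_geoFamily_of_smooth {covF : P → Conn n M} (hcov : SmoothFam covF) {τ₀ : P}
    {D Ω : Set M} (hD : IsOpen D) (hΩ : IsOpen Ω)
    (hgeo : ∀ p ∈ D, ∀ q ∈ D, ∃ γ, IsGeodesicIn (covF τ₀) Ω p q γ)
    (hsm : ContMDiffOn (((𝓡 n).prod (𝓡 n)).prod 𝓘(ℝ, ℝ)) (𝓡 n) ∞
      (fun z : (M × M) × ℝ => geod (covF τ₀) Ω z.1.1 z.1.2 z.2) ((D ×ˢ D) ×ˢ Icc 0 1))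
    {p q : M} (hp : p ∈ D) (hq : q ∈ D) {x₀ x₁ : M} (hp₀ : p ∈ chartDom n x₀)
    (hq₁ : q ∈ chartDom n x₁) :
    ∃ O, IsOpen O ∧ (τ₀, cc n x₀ p, cc n x₁ q) ∈ O ∧ ∃ δ > 0, ∃ Θ,
      IsGeoFamily covF Ω x₀ x₁ O δ Θ := by
  have hgeo' : ∀ p ∈ D, ∀ q ∈ D, IsGeodesicIn (covF τ₀) Ω p q (geod (covF τ₀) Ω p q) :=
    fun p hp q hq => isGeodesicIn_geod (hgeo p hp q hq)
  have hγ := hgeo' p hp q hq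
  have hx₁ : geod (covF τ₀) Ω p q 1 ∈ chartDom n x₁ := by rw [hγ.target]; exact hq₁
  obtain ⟨δ, hδ, O, hO, hzO, Ψ, hΨ, hΨγ⟩ := exists_geodesic_flow hcov τ₀ hγ hx₁
  set u₀ := tc x₁ (geod (covF τ₀) Ω p q 1) (velocity (n := n) (geod (covF τ₀) Ω p q) 1) with hu₀
  rw [hγ.target] at hzO hΨγ
  have h0 : (Ψ 0 ((τ₀, cc n x₁ q, u₀), 0)).pt = p :=
    (hΨγ 0 zero_mem_unitInterval).trans hγ.source
  set V : Set E := (cc n x₀).target ∩ (cc n x₀).symm ⁻¹' D with hV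
  have hVo : IsOpen V := isOpen_symm_preimage x₀ hD
  have hpV : cc n x₀ p ∈ V := ⟨cc_mem_target hp₀, by rw [mem_preimage, cc_left_inv hp₀]; exact hp⟩
  -- The final velocity at `q` as a function of the starting point. The assumed smoothness up to `s
  -- = 1` makes it differentiable, and it inverts `startPt` from the right; so the end points are
  -- not conjugate.
  set g : E → E := fun x => tc x₁ (geod (covF τ₀) Ω ((cc n x₀).symm x) q 1)
    (velocity (n := n) (geod (covF τ₀) Ω ((cc n x₀).symm x) q) 1) with hg
  have hgd : DifferentiableAt ℝ g (cc n x₀ p) := by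
    set h : E → ℝ → E := fun x s => cc n x₁ (geod (covF τ₀) Ω ((cc n x₀).symm x) q s) with hh
    have h1 : ContMDiffWithinAt 𝓘(ℝ, E × ℝ) 𝓘(ℝ, E) ∞ (Function.uncurry h) (V ×ˢ Icc 0 1)
        (cc n x₀ p, 1) := by
      have h2 := hsm ((p, q), 1) ⟨⟨hp, hq⟩, one_mem_unitInterval⟩
      have h3 : ContMDiffAt 𝓘(ℝ, E × ℝ) (((𝓡 n).prod (𝓡 n)).prod 𝓘(ℝ, ℝ)) ∞
          (fun w : E × ℝ => (((cc n x₀).symm w.1, q), w.2)) (cc n x₀ p, 1) := by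
        have h6 : ContMDiffAt 𝓘(ℝ, E) (𝓡 n) ∞ (cc n x₀).symm (cc n x₀ p) :=
          (contMDiffOn_extChartAt_symm x₀).contMDiffAt
            ((isOpen_cc_target x₀).mem_nhds (cc_mem_target hp₀))
        exact ((ContMDiffAt.comp (f := Prod.fst) (cc n x₀ p, (1 : ℝ)) h6
          contDiffAt_fst.contMDiffAt).prodMk contMDiffAt_const).prodMk contDiffAt_snd.contMDiffAt
      have h4 : ContMDiffWithinAt 𝓘(ℝ, E × ℝ) (𝓡 n) ∞
          (fun w : E × ℝ => geod (covF τ₀) Ω ((cc n x₀).symm w.1) q w.2) (V ×ˢ Icc 0 1)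
          (cc n x₀ p, 1) := by
        refine ContMDiffWithinAt.comp
          (f := fun w : E × ℝ => (((cc n x₀).symm w.1, q), w.2))
          (g := fun z : (M × M) × ℝ => geod (covF τ₀) Ω z.1.1 z.1.2 z.2)
          (t := (D ×ˢ D) ×ˢ Icc 0 1) (cc n x₀ p, 1) ?_ h3.contMDiffWithinAt
          (fun w hw => ⟨⟨hw.1.2, hq⟩, hw.2⟩)
        simpa only [cc_left_inv hp₀] using h2
      have h5 : ContMDiffAt (𝓡 n) 𝓘(ℝ, E) ∞ (cc n x₁)
          (geod (covF τ₀) Ω ((cc n x₀).symm (cc n x₀ p)) q 1) := by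
        refine contMDiffAt_extChartAt' ?_
        rw [cc_left_inv hp₀]
        exact hx₁
      exact h5.comp_contMDiffWithinAt (cc n x₀ p, (1 : ℝ)) h4
    have h2 : ContDiffWithinAt ℝ 1 (fun x => fderivWithin ℝ (h x) (Icc 0 1) 1) V (cc n x₀ p) :=
      ContDiffWithinAt.fderivWithin (n := ∞) (g := fun _ => (1 : ℝ)) h1.contDiffWithinAt
        contDiffWithinAt_const (uniqueDiffOn_Icc one_pos) two_le_infty hpV
        (fun _ _ => one_mem_unitInterval)
    have h3 : DifferentiableAt ℝ (fun x => fderivWithin ℝ (h x) (Icc 0 1) 1 1) (cc n x₀ p) :=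
      ((h2.contDiffAt (hVo.mem_nhds hpV)).differentiableAt (by simp)).clm_apply
        (differentiableAt_const _)
    refine h3.congr_of_eventuallyEq ?_
    filter_upwards [hVo.mem_nhds hpV] with x hx
    have hx' := hgeo' _ hx.2 q hq
    exact tc_velocity one_mem_unitInterval (by rw [hx'.target]; exact hq₁)
      ((hx'.smooth 1 one_mem_unitInterval).mdifferentiableWithinAt (by simp))
  have hgu : ∀ x, x = p → tc x₁ (geod (covF τ₀) Ω x q 1)
      (velocity (n := n) (geod (covF τ₀) Ω x q) 1) = u₀ := fun x hx => by rw [hx]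
  have hinv := IsGeoFlow.isInvertible_of_differentiableAt hcov hO hδ hΨ hq₁ hzO
    (x₀ := x₀) (by rw [h0]; exact hp₀) (cc_mem_target hp₀) hgd
    (hgu _ (cc_left_inv hp₀))
    (by
      filter_upwards [hVo.mem_nhds hpV] with x hx
      exact ⟨_, Ω, hgeo' _ hx.2 q hq, rfl⟩)
  obtain ⟨O', hO', hz', Θ, hΘ⟩ := exists_geoFamily hΩ hO hδ hΨ hzO
    (fun s hs => by rw [hΨγ s hs]; exact hγ.mapsTo hs) (x₀ := x₀) (by rw [h0]; exact hp₀) hinv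
  refine ⟨O', hO', ?_, δ, hδ, Θ, hΘ⟩
  rwa [startPt, h0] at hz'

/-- The family of geodesics from the points `pF τ`. -/
theorem IsGeoFamily.regAt {covF : P → Conn n M} {Ω : Set M} {x₀ x₁ : M}
    {O : Set (P × EuclideanSpace ℝ (Fin n) × EuclideanSpace ℝ (Fin n))} (hO : IsOpen O) {δ : ℝ}
    (hδ : 0 < δ) {Θ : EuclideanSpace ℝ (Fin n) → (P × EuclideanSpace ℝ (Fin n) ×
      EuclideanSpace ℝ (Fin n)) × ℝ → GState n M} (h : IsGeoFamily covF Ω x₀ x₁ O δ Θ)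
    {N : Set P} (hN : IsOpen N) {pF : P → M} (hpF : ContMDiffOn 𝓘(ℝ, P) (𝓡 n) ∞ pF N)
    {D : Set M} (hD : IsOpen D)
    (huniq : ∀ τ ∈ N, ∀ q ∈ D, ∀ γ₁ γ₂, IsGeodesicIn (covF τ) Ω (pF τ) q γ₁ →
      IsGeodesicIn (covF τ) Ω (pF τ) q γ₂ → EqOn γ₁ γ₂ (Icc 0 1))
    {τ₀ : P} {q : M} (hτ₀ : τ₀ ∈ N) (hq : q ∈ D) (hp₀ : pF τ₀ ∈ chartDom n x₀)
    (hq₁ : q ∈ chartDom n x₁) (hz : (τ₀, cc n x₀ (pF τ₀), cc n x₁ q) ∈ O) :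
    RegAt covF Ω pF (τ₀, q) := by
  set N' : Set P := N ∩ pF ⁻¹' chartDom n x₀ with hN'
  have hN'o : IsOpen N' := hpF.continuousOn.isOpen_inter_preimage hN (isOpen_chartDom x₀)
  set y : P → E := fun τ => cc n x₀ (pF τ) with hy
  have hys : ∀ τ ∈ N', ContDiffAt ℝ ∞ y τ := fun τ hτ =>
    (ContMDiffAt.comp (g := cc n x₀) (f := pF) τ
      (contMDiffAt_extChartAt' (I := 𝓡 n) (n := ∞) hτ.2)
      (hpF.contMDiffAt (hN.mem_nhds hτ.1))).contDiffAt
  set V : Set E := (cc n x₁).target ∩ (cc n x₁).symm ⁻¹' D with hV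
  have hVo : IsOpen V := isOpen_symm_preimage x₁ hD
  have hι : ContinuousOn (fun w : P × E => (w.1, y w.1, w.2)) (N' ×ˢ V) := fun w hw =>
    (continuousAt_fst.prodMk ((ContinuousAt.comp (f := Prod.fst) (x := w)
      (hys w.1 hw.1).continuousAt continuousAt_fst).prodMk continuousAt_snd)).continuousWithinAt
  set W : Set (P × E) := (N' ×ˢ V) ∩ (fun w : P × E => (w.1, y w.1, w.2)) ⁻¹' O with hW
  have hqV : cc n x₁ q ∈ V := ⟨cc_mem_target hq₁, by rw [mem_preimage, cc_left_inv hq₁]; exact hq⟩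
  -- On `W` the starting point of the two-point family is specialised to `pF τ`.
  have hsol : ∀ w ∈ W, ∀ a, ∀ s ∈ Ioo (-δ) (1 + δ), _ := fun w hw a => (h a _ hw.2).2.2.2.2
  refine ⟨x₁, W, δ, fun a w => Θ a ((w.1.1, y w.1.1, w.1.2), w.2), hq₁, ⟨⟨⟨hτ₀, hp₀⟩, hqV⟩, hz⟩,
    hι.isOpen_inter_preimage (hN'o.prod hVo) hO, hδ, fun w hw => hw.1.2.1,
    fun w hw a => (h a _ hw.2).2.2.2.1, fun w hw a s hs => ?_,
    fun w hw a s hs => (hsol w hw a s hs).2.1, fun w hw a s hs => (hsol w hw a s hs).2.2.1,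
    fun w hw s hs => (hsol w hw 0 s ⟨by linarith [hs.1], by linarith [hs.2]⟩).2.2.2 hs,
    fun w hw => ?_, fun w hw γ hγ => ?_⟩
  · refine (hsol w hw a s hs).1.comp
      (g := fun v : (P × E) × ℝ => ((v.1.1, y v.1.1, v.1.2), v.2)) (y := (w, s)) ?_
    have h1 : ContDiffAt ℝ ∞ (fun v : (P × E) × ℝ => y v.1.1) (w, s) :=
      ContDiffAt.comp (g := y) (f := fun v : (P × E) × ℝ => v.1.1) (w, s) (hys w.1 hw.1.1)
        contDiffAt_fst.fst
    exact (contDiffAt_fst.fst.prodMk (h1.prodMk contDiffAt_fst.snd)).prodMk contDiffAt_snd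
  · exact ((h 0 _ hw.2).2.2.1).trans (cc_left_inv hw.1.1.2)
  · obtain ⟨u, hu⟩ := (h 0 _ hw.2).2.2.2.1
    have h1 := (isGeodesicIn_of_isSol (cov := covF w.1) (Ω := Ω)
      (W := fun s => Θ 0 ((w.1, y w.1, w.2), s))
      (fun t ht => (hsol w hw 0 t ⟨by linarith [ht.1], by linarith [ht.2]⟩).2.1)
      (fun t ht => ((hsol w hw 0 t ⟨by linarith [ht.1], by linarith [ht.2]⟩).1).comp
        (g := fun s : ℝ => ((w.1, y w.1, w.2), s)) (by fun_prop))
      (fun t ht => (hsol w hw 0 t ⟨by linarith [ht.1], by linarith [ht.2]⟩).2.2.2 ht)).1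
    simp only [(h 0 _ hw.2).2.2.1, hu] at h1
    refine huniq w.1 hw.1.1.1 _ hw.1.2.2 γ _ hγ ?_
    have h2 : (cc n x₀).symm (y w.1) = pF w.1 := cc_left_inv hw.1.1.2
    rw [h2] at h1
    exact h1

end SmoothGeodesics
end OscGeom

end

noncomputable section

namespace OscGeom

/-! ### The operator on admissible neighbourhoods and its perturbations. -/

section Admissible

variable {n : ℕ} {M : Type*} [TopologicalSpace M] [ChartedSpace (EuclideanSpace ℝ (Fin n)) M]
  [IsManifold (𝓡 n) ∞ M] [T2Space M]

local notation "E" => EuclideanSpace ℝ (Fin n)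

variable {cov : Conn n M} {U : Set M} {Φ : M → ℝ} {p : M} {Ω₀ Ω₁ : Set M}

/-- Smooth dependence is assumed at `τ₀` only; `exists_geoFamily_of_smooth` extends it to nearby
parameters. There, connectivity enters just through uniqueness. -/
theorem IsAdmissible.niceAt (hA : IsAdmissible cov U Φ p Ω₀ Ω₁) {P : Type} [NormedAddCommGroup P]
    [NormedSpace ℝ P] [FiniteDimensional ℝ P] {covF : P → Conn n M} (hcov : SmoothFam covF)
    {ΦF : P → M → ℝ} {τ₀ : P} (hcov₀ : covF τ₀ = cov) (hΦ₀ : ΦF τ₀ = Φ) {N : Set P} (hN : IsOpen N)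
    (hτ₀ : τ₀ ∈ N) {pF : P → M} (hp₀ : pF τ₀ = p) (hpF : ContMDiffOn 𝓘(ℝ, P) (𝓡 n) ∞ pF N)
    (hpΩ : ∀ τ ∈ N, pF τ ∈ Ω₀) (hconn : ∀ τ ∈ N, GeodesicallyConnected (covF τ) Ω₀ Ω₁) {q : M}
    (hq : q ∈ Ω₀) : NiceAt covF ΦF Ω₀ Ω₁ pF (τ₀, q) := by
  have hreg : ∀ q ∈ Ω₀, RegAt covF Ω₁ pF (τ₀, q) := by
    intro q hq
    have hp : p ∈ chartDom n p := mem_chart_source _ p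
    have hq₁ : q ∈ chartDom n q := mem_chart_source _ q
    obtain ⟨O, hO, hz, δ, hδ, Θ, hΘ⟩ := exists_geoFamily_of_smooth hcov (τ₀ := τ₀) hA.isOpen₀
      hA.isOpen₁ (fun p hp q hq => by
        rw [hcov₀]
        exact (hA.connected p (subset_closure hp) q (subset_closure hq)).1)
      (by rw [hcov₀]; exact hA.smooth) hA.mem hq hp hq₁
    exact hΘ.regAt hO hδ hN hpF hA.isOpen₀ (fun τ hτ q hq => (hconn τ hτ (pF τ)
      (subset_closure (hpΩ τ hτ)) q (subset_closure hq)).2) hτ₀ hq (by rw [hp₀]; exact hp) hq₁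
      (by rw [hp₀]; exact hz)
  refine ⟨hreg q hq, fun s hs => ?_⟩
  have hs0 : geod (covF τ₀) Ω₁ (pF τ₀) q s ∈ Ω₀ := by
    rw [hcov₀, hp₀]
    exact hA.star q hq s hs
  refine ⟨hs0, hreg _ hs0, ?_⟩
  have := hA.nondegenerate _ (subset_closure hs0)
  simpa only [hcov₀, hp₀, hΦ₀] using this

theorem IsAdmissible.isPhaseFam (hA : IsAdmissible cov U Φ p Ω₀ Ω₁) (hU : IsOpen U) {m : ℕ}
    {covF : EuclideanSpace ℝ (Fin m) → Conn n M} {ΦF : EuclideanSpace ℝ (Fin m) → M → ℝ}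
    (h : IsPerturbation cov U Φ covF ΦF) : IsPhaseFam covF ΦF Ω₁ :=
  ⟨h.smoothFam, h.torsion_free, U, hU, hA.subset, h.phase_smooth⟩

/-- The operator on an admissible pair of neighbourhoods. -/
theorem IsAdmissible.operator (hA : IsAdmissible cov U Φ p Ω₀ Ω₁)
    (hcov : cov.ContMDiffCovariantDerivative ∞) (htor : cov.torsion = 0) (hU : IsOpen U)
    (hΦ : ContMDiffOn (𝓡 n) 𝓘(ℝ, ℝ) ∞ Φ U) :
    (∀ q ∈ Ω₀, IntervalIntegrable (etaIntegrand cov Ω₁ Φ p q) MeasureTheory.volume 0 1) ∧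
    ContMDiffOn (𝓡 n) 𝓘(ℝ, ℝ) ∞ (eta cov Ω₁ Φ p) Ω₀ ∧
    (∀ f : M → ℂ, ContMDiffOn (𝓡 n) 𝓘(ℝ, ℂ) ∞ f Ω₀ →
      ContMDiffOn (𝓡 n) 𝓘(ℝ, ℂ) ∞ (box cov Ω₁ Φ p f) Ω₀) ∧
    SchrodingerOn n (box cov Ω₁ Φ p) Φ p Ω₀ := by
  -- The unperturbed operator is treated as a family over a zero-dimensional parameter space.
  have hpert := isPerturbation_const hcov htor hΦ 0
  have hF := hA.isPhaseFam hU hpert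
  have hnice : ∀ q ∈ Ω₀, NiceAt (fun _ : EuclideanSpace ℝ (Fin 0) => cov) (fun _ => Φ) Ω₀ Ω₁
      (fun _ => p) (0, q) := fun q hq =>
    hA.niceAt hpert.smoothFam (τ₀ := 0) rfl rfl isOpen_univ trivial rfl contMDiffOn_const
      (fun _ _ => hA.mem) (fun _ _ => hA.connected) hq
  have hcrit : IsCrit n Φ p := (hA.crit p (hA.closure_subset (subset_closure hA.mem))).2 rfl
  refine ⟨fun q hq => ((hnice q hq).eta_spec hF hA.isOpen₀).1, fun q hq => ?_,
    fun f hf q hq => ?_, fun q hq t ht => (hnice q hq).schrodinger hF hA.isOpen₀ hcrit ht⟩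
  · exact (contMDiffAt_slice (f := fun _ : EuclideanSpace ℝ (Fin 0) => eta cov Ω₁ Φ p)
      ((hnice q hq).eta_spec hF hA.isOpen₀).2.1).contMDiffWithinAt
  · refine (contMDiffAt_slice (f := fun _ : EuclideanSpace ℝ (Fin 0) => box cov Ω₁ Φ p f)
      ((hnice q hq).contMDiffAt_box hF hA.isOpen₀ (isOpen_univ.prod hA.isOpen₀)
        (f := fun _ => f) ?_ ⟨trivial, hq⟩)).contMDiffWithinAt
    exact hf.comp contMDiffOn_snd fun _ h => h.2

/-- The operator depends smoothly on the connection and the phase. -/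
theorem IsAdmissible.perturbation (hA : IsAdmissible cov U Φ p Ω₀ Ω₁) (hU : IsOpen U)
    (hnondeg : (hessMatrix cov Φ p).det ≠ 0) {m : ℕ}
    {covF : EuclideanSpace ℝ (Fin m) → Conn n M} {ΦF : EuclideanSpace ℝ (Fin m) → M → ℝ}
    (h : IsPerturbation cov U Φ covF ΦF)
    (hconn : ∀ᶠ τ in 𝓝 0, GeodesicallyConnected (covF τ) Ω₀ Ω₁) {Ω : Set M} (hΩ : closure Ω ⊆ Ω₀) :
    ∃ N : Set (EuclideanSpace ℝ (Fin m)), IsOpen N ∧ 0 ∈ N ∧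
      ∃ pF : EuclideanSpace ℝ (Fin m) → M, pF 0 = p ∧ ContMDiffOn (𝓡 m) (𝓡 n) ∞ pF N ∧
        (∀ τ ∈ N,
          pF τ ∈ Ω₀ ∧ (∀ x ∈ Ω₀, IsCrit n (ΦF τ) x ↔ x = pF τ) ∧
          (hessMatrix (covF τ) (ΦF τ) (pF τ)).det ≠ 0 ∧
          ∀ q ∈ Ω, NiceAt covF ΦF Ω₀ Ω₁ pF (τ, q)) := by
  have hF := hA.isPhaseFam hU h
  have hpΩ₁ : p ∈ Ω₁ := hA.closure_subset (subset_closure hA.mem)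
  obtain ⟨N₁, hN₁, h0N₁, pF, hpF0, hpF, hpFN⟩ := exists_crit_family hF.cov hU h.phase_smooth
    hA.isCompact_closure (hA.closure_subset.trans hA.subset) (τ₀ := 0) (subset_closure hA.mem)
    (fun x hx => by rw [h.phase_zero]; exact hA.crit x (hA.closure_subset hx))
    (by rw [h.phase_zero, h.cov_zero]; exact hnondeg) hA.isOpen₀ hA.mem
  obtain ⟨N₂, hN₂, hN₂o, h0N₂⟩ := mem_nhds_iff.1 hconn
  have hnice : ∀ q ∈ closure Ω, NiceAt covF ΦF Ω₀ Ω₁ pF (0, q) := fun q hq =>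
    hA.niceAt hF.cov h.cov_zero h.phase_zero (hN₁.inter hN₂o) ⟨h0N₁, h0N₂⟩ hpF0
      (hpF.mono inter_subset_left) (fun τ hτ => (hpFN τ hτ.1).1) (fun τ hτ => hN₂ hτ.2) (hΩ hq)
  have hcomp : IsCompact (closure Ω) :=
    hA.isCompact_closure.of_isClosed_subset isClosed_closure (hΩ.trans subset_closure)
  -- Niceness at `τ = 0` on all of `Ω₀` is open in `(τ, q)`; the compactness of `closure Ω` makes
  -- the range of `τ` uniform.
  have hall := hcomp.eventually_forall_of_forall_eventually
    (P := fun τ q => NiceAt covF ΦF Ω₀ Ω₁ pF (τ, q)) fun q hq => (hnice q hq).eventually hF hA.isOpen₀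
  obtain ⟨N₃, hN₃, hN₃o, h0N₃⟩ := mem_nhds_iff.1 hall
  refine ⟨N₁ ∩ N₃, hN₁.inter hN₃o, ⟨h0N₁, h0N₃⟩, pF, hpF0, hpF.mono inter_subset_left,
    fun τ hτ => ⟨(hpFN τ hτ.1).1, fun x hx => (hpFN τ hτ.1).2.1 x (subset_closure hx),
      (hpFN τ hτ.1).2.2, fun q hq => hN₃ hτ.2 q (subset_closure hq)⟩⟩

theorem IsAdmissible.perturbed_operator (hA : IsAdmissible cov U Φ p Ω₀ Ω₁) (hU : IsOpen U)
    (hnondeg : (hessMatrix cov Φ p).det ≠ 0) {m : ℕ}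
    {covF : EuclideanSpace ℝ (Fin m) → Conn n M} {ΦF : EuclideanSpace ℝ (Fin m) → M → ℝ}
    (h : IsPerturbation cov U Φ covF ΦF)
    (hconn : ∀ᶠ τ in 𝓝 0, GeodesicallyConnected (covF τ) Ω₀ Ω₁) {Ω : Set M} (hΩo : IsOpen Ω)
    (hΩ : closure Ω ⊆ Ω₀) :
    ∃ N : Set (EuclideanSpace ℝ (Fin m)), IsOpen N ∧ 0 ∈ N ∧
      ∃ pF : EuclideanSpace ℝ (Fin m) → M, pF 0 = p ∧ ContMDiffOn (𝓡 m) (𝓡 n) ∞ pF N ∧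
        (∀ τ ∈ N,
          pF τ ∈ Ω₀ ∧ (∀ x ∈ Ω₀, IsCrit n (ΦF τ) x ↔ x = pF τ) ∧
          (hessMatrix (covF τ) (ΦF τ) (pF τ)).det ≠ 0 ∧
          (∀ q ∈ Ω, ∀ s ∈ Icc (0 : ℝ) 1,
            geod (covF τ) Ω₁ (pF τ) q s ∈ Ω₀ ∧
            (weightedMatrix (covF τ) Ω₁ (ΦF τ) (pF τ) 1
              (geod (covF τ) Ω₁ (pF τ) q s)).det ≠ 0) ∧
          (∀ q ∈ Ω, IntervalIntegrable (etaIntegrand (covF τ) Ω₁ (ΦF τ) (pF τ) q)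
            MeasureTheory.volume 0 1) ∧
          SchrodingerOn n (box (covF τ) Ω₁ (ΦF τ) (pF τ)) (ΦF τ) (pF τ) Ω) ∧
        ContMDiffOn ((𝓡 m).prod (𝓡 n)) 𝓘(ℝ, ℝ) ∞
          (fun z : EuclideanSpace ℝ (Fin m) × M => eta (covF z.1) Ω₁ (ΦF z.1) (pF z.1) z.2)
          (N ×ˢ Ω) ∧
        ∀ f : EuclideanSpace ℝ (Fin m) → M → ℂ,
          ContMDiffOn ((𝓡 m).prod (𝓡 n)) 𝓘(ℝ, ℂ) ∞
            (fun z : EuclideanSpace ℝ (Fin m) × M => f z.1 z.2) (N ×ˢ Ω) →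
          ContMDiffOn ((𝓡 m).prod (𝓡 n)) 𝓘(ℝ, ℂ) ∞
            (fun z : EuclideanSpace ℝ (Fin m) × M =>
              box (covF z.1) Ω₁ (ΦF z.1) (pF z.1) (f z.1) z.2) (N ×ˢ Ω) := by
  have hF := hA.isPhaseFam hU h
  obtain ⟨N, hN, h0N, pF, hpF0, hpF, hpFN⟩ := hA.perturbation hU hnondeg h hconn hΩ
  refine ⟨N, hN, h0N, pF, hpF0, hpF, fun τ hτ => ?_, fun z hz => ?_, fun f hf z hz => ?_⟩
  · obtain ⟨h1, h2, h3, h4⟩ := hpFN τ hτ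
    exact ⟨h1, h2, h3, fun q hq s hs => ⟨((h4 q hq).2 s hs).1, ((h4 q hq).2 s hs).2.2⟩,
      fun q hq => ((h4 q hq).eta_spec hF hA.isOpen₀).1,
      fun q hq t ht => (h4 q hq).schrodinger hF hA.isOpen₀ ((h2 _ h1).2 rfl) ht⟩
  · exact (((hpFN z.1 hz.1).2.2.2 z.2 hz.2).eta_spec hF hA.isOpen₀).2.1.contMDiffWithinAt
  · exact (((hpFN z.1 hz.1).2.2.2 z.2 hz.2).contMDiffAt_box hF hA.isOpen₀ (hN.prod hΩo) hf
      hz).contMDiffWithinAt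

end Admissible
end OscGeom

end

noncomputable section

namespace OscGeom

/-! ### Estimates for geodesics in small coordinate balls. -/

section CoordinateGeodesics

variable {G : Type*} [NormedAddCommGroup G] [NormedSpace ℝ G]

/-- Geodesics in a ball of a normed space, in terms of the Christoffel map `Γ`. -/
structure IsCoordGeodesic (Γ : G → G →L[ℝ] G →L[ℝ] G) (o : G) (R : ℝ) (x v : ℝ → G) : Prop where
  deriv_pos : ∀ t ∈ Icc (0 : ℝ) 1, HasDerivWithinAt x (v t) (Icc 0 1) t
  deriv_vel : ∀ t ∈ Icc (0 : ℝ) 1, HasDerivWithinAt v (-(Γ (x t) (v t) (v t))) (Icc 0 1) t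
  mem : ∀ t ∈ Icc (0 : ℝ) 1, x t ∈ Metric.ball o R

variable {Γ : G → G →L[ℝ] G →L[ℝ] G} {o : G} {R C L : ℝ} {x v y w : ℝ → G}

theorem norm_bilin_le {A : G →L[ℝ] G →L[ℝ] G} (hA : ‖A‖ ≤ C) (a b : G) :
    ‖A a b‖ ≤ C * ‖a‖ * ‖b‖ :=
  (A.le_opNorm₂ a b).trans (by gcongr)

/-- Geodesics in a small ball have small velocity. -/
theorem IsCoordGeodesic.norm_vel_le (h : IsCoordGeodesic Γ o R x v) (hC : 0 < C)
    (hΓ : ∀ y ∈ Metric.ball o R, ‖Γ y‖ ≤ C) (hCR : 8 * C * R < 1) {t : ℝ}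
    (ht : t ∈ Icc (0 : ℝ) 1) : ‖v t‖ ≤ 8 * R := by
  have hvc : ContinuousOn v (Icc 0 1) := fun t ht => (h.deriv_vel t ht).continuousWithinAt
  obtain ⟨t₀, ht₀, hmax⟩ := isCompact_Icc.exists_isMaxOn (nonempty_Icc.2 zero_le_one) hvc.norm
  set S := ‖v t₀‖ with hS
  have hS' : ∀ t ∈ Icc (0 : ℝ) 1, ‖v t‖ ≤ S := fun t ht => hmax ht
  refine (hS' t ht).trans ?_
  have hS0 : 0 ≤ S := norm_nonneg _
  have hacc : ∀ t ∈ Icc (0 : ℝ) 1, ‖-(Γ (x t) (v t) (v t))‖ ≤ C * S * S := by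
    intro t ht
    rw [norm_neg]
    refine (norm_bilin_le (hΓ _ (h.mem t ht)) _ _).trans ?_
    gcongr <;> exact hS' t ht
  -- From the time `t₀` of maximal speed one moves by `l` in a direction that stays in `[0,1]`,
  -- which is possible for `l ≤ 1/2`. The displacement is at most the diameter `2R`, and its
  -- deviation from linear motion is quadratic in `l`.
  have key : ∀ l : ℝ, 0 ≤ l → l ≤ 1 / 2 → l * S ≤ 2 * R + C * S * S * l * l := by
    intro l hl0 hl
    obtain ⟨e, he, hel⟩ : ∃ e ∈ Icc (0 : ℝ) 1, |e - t₀| = l := by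
      rcases le_total t₀ (1 / 2) with h1 | h1
      · exact ⟨t₀ + l, ⟨by linarith [ht₀.1], by linarith⟩, by simp [abs_of_nonneg hl0]⟩
      · exact ⟨t₀ - l, ⟨by linarith, by linarith [ht₀.2]⟩, by simp [abs_of_nonneg hl0]⟩
    have hsub : uIcc t₀ e ⊆ Icc 0 1 := ordConnected_Icc.uIcc_subset ht₀ he
    have hdist : ∀ s ∈ uIcc t₀ e, ‖s - t₀‖ ≤ l := by
      intro s hs
      rw [← hel, Real.norm_eq_abs]
      exact abs_sub_left_of_mem_uIcc hs
    have h1 : ∀ s ∈ uIcc t₀ e, ‖v s - v t₀‖ ≤ C * S * S * l := by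
      intro s hs
      refine ((convex_Icc (0 : ℝ) 1).norm_image_sub_le_of_norm_hasDerivWithin_le h.deriv_vel hacc
        ht₀ (hsub hs)).trans ?_
      gcongr
      exact hdist s hs
    have h2 := (convex_uIcc t₀ e).norm_image_sub_le_of_norm_hasDerivWithin_le
      (f := fun s => x s - s • v t₀) (f' := fun s => v s - v t₀)
      (fun s hs => ((h.deriv_pos s (hsub hs)).mono hsub).sub
        (by simpa using (hasDerivWithinAt_id s (uIcc t₀ e)).smul_const (v t₀)))
      h1 left_mem_uIcc right_mem_uIcc
    rw [Real.norm_eq_abs, hel] at h2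
    have h3 : (e - t₀) • v t₀ = (x e - x t₀) - ((x e - e • v t₀) - (x t₀ - t₀ • v t₀)) := by
      rw [sub_smul]
      abel
    have h4 : l * S = ‖(e - t₀) • v t₀‖ := by rw [norm_smul, Real.norm_eq_abs, hel]
    rw [h4, h3]
    refine (norm_sub_le _ _).trans (add_le_add ?_ h2)
    have h5 := h.mem e he
    have h6 := h.mem t₀ ht₀
    rw [← dist_eq_norm]
    refine (dist_triangle_right _ _ o).trans ?_
    rw [Metric.mem_ball] at h5 h6
    linarith
  -- If `CS < 1`, then `l = 1/2` gives `S/2 ≤ 2R + S/4`. Otherwise `l = 1/(2CS)` is allowed and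
  -- gives `1 ≤ 8CR`, a contradiction.
  rcases lt_or_ge (C * S) 1 with h1 | h1
  · have h2 := key (1 / 2) (by norm_num) le_rfl
    nlinarith
  · exfalso
    have hCS : 0 < C * S := by linarith
    have h2 := key (1 / (2 * (C * S))) (by positivity) (by
      rw [div_le_div_iff₀ (by positivity) (by norm_num)]
      linarith)
    have hSpos : 0 < S := by
      by_contra hneg
      have : S = 0 := by linarith
      rw [this] at hCS
      simp at hCS
    field_simp at h2
    nlinarith

/-- Geodesics in a small ball are determined by their end points. -/
theorem IsCoordGeodesic.eqOn (hx : IsCoordGeodesic Γ o R x v) (hy : IsCoordGeodesic Γ o R y w)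
    (hC : 0 < C) (hL : 0 ≤ L) (hR : 0 ≤ R) (hΓ : ∀ y ∈ Metric.ball o R, ‖Γ y‖ ≤ C)
    (hΓL : ∀ y ∈ Metric.ball o R, ∀ z ∈ Metric.ball o R, ‖Γ y - Γ z‖ ≤ L * ‖y - z‖)
    (hCR : 8 * C * R < 1) (hK : 64 * L * R ^ 2 + 16 * C * R < 1) (h0 : x 0 = y 0)
    (h1 : x 1 = y 1) : EqOn x y (Icc 0 1) := by
  have hvc : ContinuousOn (fun t => v t - w t) (Icc 0 1) := fun t ht =>
    (hx.deriv_vel t ht).continuousWithinAt.sub (hy.deriv_vel t ht).continuousWithinAt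
  obtain ⟨t₀, ht₀, hmax⟩ := isCompact_Icc.exists_isMaxOn (nonempty_Icc.2 zero_le_one) hvc.norm
  set D := ‖v t₀ - w t₀‖ with hD
  have hD' : ∀ t ∈ Icc (0 : ℝ) 1, ‖v t - w t‖ ≤ D := fun t ht => hmax ht
  have hD0 : 0 ≤ D := norm_nonneg _
  have hz' : ∀ t ∈ Icc (0 : ℝ) 1, HasDerivWithinAt (fun t => x t - y t) (v t - w t) (Icc 0 1) t :=
    fun t ht => (hx.deriv_pos t ht).sub (hy.deriv_pos t ht)
  have hz : ∀ t ∈ Icc (0 : ℝ) 1, ‖x t - y t‖ ≤ D * t := by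
    intro t ht
    have := norm_image_sub_le_of_norm_deriv_le_segment' hz'
      (fun s hs => hD' s (Ico_subset_Icc_self hs)) t ht
    simpa [h0] using this
  have hzD : ∀ t ∈ Icc (0 : ℝ) 1, ‖x t - y t‖ ≤ D := fun t ht =>
    (hz t ht).trans (mul_le_of_le_one_right hD0 ht.2)
  set K := 64 * L * R ^ 2 + 16 * C * R with hKdef
  -- The difference of the accelerations is linear in `D`: the change of `Γ` contributes `64 L R²`,
  -- and the two velocity slots contribute `8CR` each, by the velocity bound `8R`.
  have hacc : ∀ t ∈ Icc (0 : ℝ) 1,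
      ‖-(Γ (x t) (v t) (v t)) - -(Γ (y t) (w t) (w t))‖ ≤ K * D := by
    intro t ht
    have hv := hx.norm_vel_le hC hΓ hCR ht
    have hw := hy.norm_vel_le hC hΓ hCR ht
    have e1 : -(Γ (x t) (v t) (v t)) - -(Γ (y t) (w t) (w t)) =
        -((Γ (x t) - Γ (y t)) (v t) (v t)) - (Γ (y t) (v t - w t) (v t) +
          Γ (y t) (w t) (v t - w t)) := by
      simp only [map_sub, _root_.sub_apply]
      abel
    rw [e1]
    have b1 : ‖(Γ (x t) - Γ (y t)) (v t) (v t)‖ ≤ (L * D) * (8 * R) * (8 * R) := by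
      refine (norm_bilin_le ((hΓL _ (hx.mem t ht) _ (hy.mem t ht)).trans
        (mul_le_mul_of_nonneg_left (hzD t ht) hL)) _ _).trans ?_
      gcongr
    have b2 : ‖Γ (y t) (v t - w t) (v t)‖ ≤ C * D * (8 * R) := by
      refine (norm_bilin_le (hΓ _ (hy.mem t ht)) _ _).trans ?_
      gcongr
      exact hD' t ht
    have b3 : ‖Γ (y t) (w t) (v t - w t)‖ ≤ C * (8 * R) * D := by
      refine (norm_bilin_le (hΓ _ (hy.mem t ht)) _ _).trans ?_
      gcongr
      exact hD' t ht
    calc _ ≤ ‖(Γ (x t) - Γ (y t)) (v t) (v t)‖ + (‖Γ (y t) (v t - w t) (v t)‖ +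
          ‖Γ (y t) (w t) (v t - w t)‖) := by
          refine (norm_sub_le _ _).trans ?_
          rw [norm_neg]
          gcongr
          exact norm_add_le _ _
      _ ≤ (L * D) * (8 * R) * (8 * R) + (C * D * (8 * R) + C * (8 * R) * D) := by gcongr
      _ = K * D := by rw [hKdef]; ring
  have hK0 : 0 ≤ K := by positivity
  have hdiff : ∀ s ∈ Icc (0 : ℝ) 1, ‖(v s - w s) - (v t₀ - w t₀)‖ ≤ K * D := by
    intro s hs
    have := (convex_Icc (0 : ℝ) 1).norm_image_sub_le_of_norm_hasDerivWithin_le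
      (f := fun t => v t - w t) (fun t ht => (hx.deriv_vel t ht).sub (hy.deriv_vel t ht)) hacc
      ht₀ hs
    refine this.trans (mul_le_of_le_one_right (mul_nonneg hK0 hD0) ?_)
    rw [Real.norm_eq_abs, abs_le]
    constructor <;> linarith [hs.1, hs.2, ht₀.1, ht₀.2]
  -- The difference of the curves vanishes at both ends, so subtracting the linear motion with its
  -- velocity at `t₀` leaves an increment of norm exactly `D`. Hence `D ≤ K D` with `K < 1`.
  have hfin := norm_image_sub_le_of_norm_deriv_le_segment_01'
    (f := fun s => (x s - y s) - s • (v t₀ - w t₀)) (f' := fun s => (v s - w s) - (v t₀ - w t₀))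
    (fun s hs => (hz' s hs).sub
      (by simpa using (hasDerivWithinAt_id s (Icc (0 : ℝ) 1)).smul_const (v t₀ - w t₀)))
    (fun s hs => hdiff s (Ico_subset_Icc_self hs))
  have hDK : D ≤ K * D := by
    simpa [h0, h1, norm_sub_rev (w t₀), ← hD] using hfin
  have hDz : D = 0 := by nlinarith
  intro t ht
  have := hz t ht
  rw [hDz, zero_mul] at this
  exact sub_eq_zero.1 (norm_le_zero_iff.1 this)

/-- Geodesics in a small ball that start at the center move away from it. -/
theorem IsCoordGeodesic.norm_sub_le {H : Type*} [NormedAddCommGroup H] [InnerProductSpace ℝ H]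
    {Γ : H → H →L[ℝ] H →L[ℝ] H} {o : H} {x v : ℝ → H} (h : IsCoordGeodesic Γ o R x v)
    (hΓ : ∀ y ∈ Metric.ball o R, ‖Γ y‖ ≤ C) (hCR : C * R < 1) (h0 : x 0 = o) {t : ℝ}
    (ht : t ∈ Icc (0 : ℝ) 1) : ‖x t - o‖ ≤ ‖x 1 - o‖ := by
  have hd1 : ∀ t ∈ Icc (0 : ℝ) 1, HasDerivWithinAt (fun t => x t - o) (v t) (Icc 0 1) t :=
    fun t ht => (h.deriv_pos t ht).sub_const o
  have hd2 : ∀ t ∈ Icc (0 : ℝ) 1, HasDerivWithinAt (fun t => inner ℝ (x t - o) (v t))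
      (inner ℝ (x t - o) (-(Γ (x t) (v t) (v t))) + inner ℝ (v t) (v t)) (Icc 0 1) t :=
    fun t ht => (hd1 t ht).inner ℝ (h.deriv_vel t ht)
  have hd3 : ∀ t ∈ Icc (0 : ℝ) 1, HasDerivWithinAt (fun t => inner ℝ (x t - o) (x t - o))
      (2 * inner ℝ (x t - o) (v t)) (Icc 0 1) t := by
    intro t ht
    have := (hd1 t ht).inner ℝ (hd1 t ht)
    rw [real_inner_comm (x t - o) (v t), ← two_mul] at this
    exact this
  -- Half the squared distance from `o` has second derivative at least `(1 - CR)‖v‖²`, so it is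
  -- convex; its first derivative starts at zero.
  have hpos : ∀ t ∈ Icc (0 : ℝ) 1,
      0 ≤ inner ℝ (x t - o) (-(Γ (x t) (v t) (v t))) + inner ℝ (v t) (v t) := by
    intro t ht
    have h1 : |inner ℝ (x t - o) (-(Γ (x t) (v t) (v t)))| ≤ R * (C * ‖v t‖ * ‖v t‖) := by
      refine (abs_real_inner_le_norm _ _).trans ?_
      have hm := h.mem t ht
      rw [Metric.mem_ball, dist_eq_norm] at hm
      rw [norm_neg]
      have := norm_bilin_le (hΓ _ (h.mem t ht)) (v t) (v t)
      have hR : 0 ≤ R := (norm_nonneg _).trans hm.le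
      gcongr
    have h2 := neg_abs_le (inner ℝ (x t - o) (-(Γ (x t) (v t) (v t))))
    rw [real_inner_self_eq_norm_sq]
    nlinarith [sq_nonneg ‖v t‖]
  have hI : interior (Icc (0 : ℝ) 1) ⊆ Icc 0 1 := interior_subset
  have hm1 : MonotoneOn (fun t => inner ℝ (x t - o) (v t)) (Icc 0 1) :=
    monotoneOn_of_hasDerivWithinAt_nonneg (convex_Icc _ _)
      (fun t ht => (hd2 t ht).continuousWithinAt) (fun t ht => (hd2 t (hI ht)).mono hI)
      (fun t ht => hpos t (hI ht))
  have hm2 : MonotoneOn (fun t => inner ℝ (x t - o) (x t - o)) (Icc 0 1) := by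
    refine monotoneOn_of_hasDerivWithinAt_nonneg (convex_Icc _ _)
      (fun t ht => (hd3 t ht).continuousWithinAt) (fun t ht => (hd3 t (hI ht)).mono hI)
      (fun t ht => ?_)
    have := hm1 zero_mem_unitInterval (hI ht) (hI ht).1
    simp only [h0, sub_self, inner_zero_left] at this
    linarith
  have := hm2 ht one_mem_unitInterval ht.2
  simp only [real_inner_self_eq_norm_sq] at this
  exact (sq_le_sq₀ (norm_nonneg _) (norm_nonneg _)).1 this

end CoordinateGeodesics
end OscGeom

end

noncomputable section

namespace OscGeom

/-! ### Small balls in a chart and isolated critical points. -/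

section ChartBalls

set_option maxSynthPendingDepth 3

variable {n : ℕ} {M : Type*} [TopologicalSpace M] [ChartedSpace (EuclideanSpace ℝ (Fin n)) M]

local notation "E" => EuclideanSpace ℝ (Fin n)

/-- Balls around `p` in the chart at `p`. -/
def chartBall (n : ℕ) {M : Type*} [TopologicalSpace M] [ChartedSpace (EuclideanSpace ℝ (Fin n)) M]
    (p : M) (R : ℝ) : Set M := chartDom n p ∩ cc n p ⁻¹' Metric.ball (cc n p p) R

/-- Closed balls around `p` in the chart at `p`. -/
def chartClosedBall (n : ℕ) {M : Type*} [TopologicalSpace M]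
    [ChartedSpace (EuclideanSpace ℝ (Fin n)) M] (p : M) (R : ℝ) : Set M :=
  chartDom n p ∩ cc n p ⁻¹' Metric.closedBall (cc n p p) R

variable {p : M} {r R : ℝ}

theorem isOpen_chartBall : IsOpen (chartBall n p R) := by
  have := (continuousOn_extChartAt (I := 𝓡 n) p).isOpen_inter_preimage
    (isOpen_extChartAt_source p) (Metric.isOpen_ball (x := cc n p p) (ε := R))
  rwa [extChartAt_source] at this

theorem mem_chartBall_self (hR : 0 < R) : p ∈ chartBall n p R :=
  ⟨mem_chart_source _ p, Metric.mem_ball_self hR⟩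

theorem symm_mem_chartClosedBall {y : E} (hy : y ∈ Metric.closedBall (cc n p p) R)
    (ht : y ∈ (cc n p).target) : (cc n p).symm y ∈ chartClosedBall n p R :=
  ⟨cc_symm_mem ht, by rwa [mem_preimage, (cc n p).right_inv ht]⟩

theorem chartClosedBall_eq (hR : Metric.closedBall (cc n p p) R ⊆ (cc n p).target) :
    chartClosedBall n p R = (cc n p).symm '' Metric.closedBall (cc n p p) R := by
  ext x
  constructor
  · exact fun hx => ⟨cc n p x, hx.2, cc_left_inv hx.1⟩
  · rintro ⟨y, hy, rfl⟩
    exact symm_mem_chartClosedBall hy (hR hy)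

theorem isCompact_chartClosedBall (hR : Metric.closedBall (cc n p p) R ⊆ (cc n p).target) :
    IsCompact (chartClosedBall n p R) := by
  rw [chartClosedBall_eq hR]
  exact (isCompact_closedBall _ _).image_of_continuousOn
    ((continuousOn_extChartAt_symm p).mono hR)

theorem chartBall_subset_chartClosedBall : chartBall n p R ⊆ chartClosedBall n p R :=
  fun _ hx => ⟨hx.1, Metric.ball_subset_closedBall hx.2⟩

theorem chartClosedBall_subset_chartBall (h : r < R) : chartClosedBall n p r ⊆ chartBall n p R :=
  fun _ hx => ⟨hx.1, Metric.closedBall_subset_ball h hx.2⟩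

theorem closure_chartBall_subset [T2Space M]
    (hR : Metric.closedBall (cc n p p) R ⊆ (cc n p).target) :
    closure (chartBall n p R) ⊆ chartClosedBall n p R :=
  closure_minimal chartBall_subset_chartClosedBall (isCompact_chartClosedBall hR).isClosed

theorem exists_chartClosedBall_subset {D : Set M} (hD : D ∈ 𝓝 p) :
    ∃ r > 0, chartClosedBall n p r ⊆ D := by
  have hp : p ∈ chartDom n p := mem_chart_source _ p
  have h1 : ContinuousAt (cc n p).symm (cc n p p) := continuousAt_extChartAt_symm p
  have h2 : (cc n p).symm ⁻¹' D ∈ 𝓝 (cc n p p) := h1 (by rwa [cc_left_inv hp])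
  obtain ⟨r, hr, hr'⟩ := Metric.nhds_basis_closedBall.mem_iff.1 h2
  refine ⟨r, hr, fun x hx => ?_⟩
  have := hr' hx.2
  rwa [mem_preimage, cc_left_inv hx.1] at this

theorem exists_closedBall_subset_target (p : M) :
    ∃ r > 0, Metric.closedBall (cc n p p) r ⊆ (cc n p).target :=
  Metric.nhds_basis_closedBall.mem_iff.1
    ((isOpen_cc_target p).mem_nhds (cc_mem_target (mem_chart_source _ p)))

variable [IsManifold (𝓡 n) ∞ M]

/-- A radius for which geodesics in the chart ball are determined by their end points. -/
structure SmallBall (cov : Conn n M) (p : M) (R C L : ℝ) : Prop where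
  target : Metric.closedBall (cc n p p) R ⊆ (cc n p).target
  pos : 0 < R
  pos_C : 0 < C
  pos_L : 0 < L
  speed : 8 * C * R < 1
  contraction : 64 * L * R ^ 2 + 16 * C * R < 1
  bound : ∀ y ∈ Metric.closedBall (cc n p p) R,
    ‖christ cov p y‖ < C ∧ ‖fderiv ℝ (christ cov p) y‖ < L

theorem isCoordGeodesic {cov : Conn n M} {a b : M} {γ : ℝ → M}
    (h : IsGeodesicIn cov (chartBall n p R) a b γ) :
    IsCoordGeodesic (christ cov p) (cc n p p) R (fun t => cc n p (γ t))
      (fun t => tc p (γ t) (velocity γ t)) where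
  deriv_pos _ ht := ((h.isSol_zero ht).hasDerivWithinAt (h.mapsTo ht).1).1
  deriv_vel _ ht := ((h.isSol_zero ht).hasDerivWithinAt (h.mapsTo ht).1).2.1
  mem _ ht := (h.mapsTo ht).2

variable {cov : Conn n M} {C L : ℝ}

theorem SmallBall.eqOn (h : SmallBall cov p R C L) (hcov : SmoothConn cov) {a b : M}
    {γ₁ γ₂ : ℝ → M} (h₁ : IsGeodesicIn cov (chartBall n p R) a b γ₁)
    (h₂ : IsGeodesicIn cov (chartBall n p R) a b γ₂) : EqOn γ₁ γ₂ (Icc 0 1) := by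
  have hb : Metric.ball (cc n p p) R ⊆ Metric.closedBall (cc n p p) R := Metric.ball_subset_closedBall
  have heq := (isCoordGeodesic h₁).eqOn (isCoordGeodesic h₂) h.pos_C h.pos_L.le h.pos.le
    (fun y hy => (h.bound y (hb hy)).1.le)
    (fun y hy z hz => (convex_ball (cc n p p) R).norm_image_sub_le_of_norm_fderiv_le
      (fun w hw => ((hcov p).contDiffAt ((isOpen_cc_target p).mem_nhds
        (h.target (hb hw)))).differentiableAt (by simp))
      (fun w hw => (h.bound w (hb hw)).2.le) hz hy)
    h.speed h.contraction (by simp only [h₁.source, h₂.source])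
    (by simp only [h₁.target, h₂.target])
  intro t ht
  rw [← cc_left_inv (h₁.mapsTo ht).1, ← cc_left_inv (h₂.mapsTo ht).1]
  exact congrArg _ (heq ht)

/-- The distance from the centre never exceeds its final value, so every smaller concentric ball is
star-shaped for geodesics from `p` that stay in the large ball. -/
theorem SmallBall.mem_chartBall (h : SmallBall cov p R C L) {q : M} {γ : ℝ → M}
    (hγ : IsGeodesicIn cov (chartBall n p R) p q γ) (hq : q ∈ chartBall n p r) {s : ℝ}
    (hs : s ∈ Icc (0 : ℝ) 1) : γ s ∈ chartBall n p r := by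
  refine ⟨(hγ.mapsTo hs).1, ?_⟩
  have h1 := (isCoordGeodesic hγ).norm_sub_le
    (fun y hy => (h.bound y (Metric.ball_subset_closedBall hy)).1.le)
    (by nlinarith [h.speed, h.pos, h.pos_C, mul_pos h.pos_C h.pos])
    (by simp only [hγ.source]) hs
  have h2 := hq.2
  simp only [mem_preimage, Metric.mem_ball, dist_eq_norm, hγ.target] at h1 h2 ⊢
  exact h1.trans_lt h2

/-- The bounds in `SmallBall` are strict and imposed on a compact ball, so they hold with the same
constants for nearby connections. -/
theorem SmallBall.eventually {P : Type} [NormedAddCommGroup P] [NormedSpace ℝ P]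
    {covF : P → Conn n M} (hcov : SmoothFam covF) {τ₀ : P} (h : SmallBall (covF τ₀) p R C L) :
    ∀ᶠ τ in 𝓝 τ₀, SmallBall (covF τ) p R C L := by
  have hloc : ∀ y ∈ Metric.closedBall (cc n p p) R, ∀ᶠ w : P × E in 𝓝 (τ₀, y),
      ‖christ (covF w.1) p w.2‖ < C ∧ ‖fderiv ℝ (christ (covF w.1) p) w.2‖ < L := by
    intro y hy
    have h1 : ContDiffAt ℝ ∞ (fun w : P × E => christ (covF w.1) p w.2) (τ₀, y) :=
      contDiffAt_christ hcov contDiffAt_fst contDiffAt_snd (h.target hy)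
    have h2 := contDiffAt_fderiv_snd (z₀ := (τ₀, y)) h1 contDiffAt_fst contDiffAt_snd
    exact (h1.continuousAt.norm.eventually_lt_const (h.bound y hy).1).and
      (h2.continuousAt.norm.eventually_lt_const (h.bound y hy).2)
  have hall := (isCompact_closedBall (cc n p p) R).eventually_forall_of_forall_eventually
    (P := fun τ y => ‖christ (covF τ) p y‖ < C ∧ ‖fderiv ℝ (christ (covF τ) p) y‖ < L) hloc
  filter_upwards [hall] with τ hτ
  exact ⟨h.target, h.pos, h.pos_C, h.pos_L, h.speed, h.contraction, hτ⟩

theorem exists_smallBall (hcov : SmoothConn cov) (p : M) {ε : ℝ} (hε : 0 < ε) :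
    ∃ R ≤ ε, ∃ C L, SmallBall cov p R C L := by
  obtain ⟨R₀, hR₀, hR₀t⟩ := exists_closedBall_subset_target (n := n) p
  have hc : ContinuousOn (fun y => (‖christ cov p y‖, ‖fderiv ℝ (christ cov p) y‖))
      (Metric.closedBall (cc n p p) R₀) := by
    intro y hy
    have h1 := (hcov p).contDiffAt ((isOpen_cc_target p).mem_nhds (hR₀t hy))
    exact (h1.continuousAt.norm.prodMk
      (h1.fderiv_right (m := ∞) (by simp)).continuousAt.norm).continuousWithinAt
  obtain ⟨B, hB⟩ := (isCompact_closedBall (cc n p p) R₀).exists_bound_of_continuousOn hc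
  have hBb : ∀ y ∈ Metric.closedBall (cc n p p) R₀, ‖christ cov p y‖ ≤ B ∧
      ‖fderiv ℝ (christ cov p) y‖ ≤ B := by
    intro y hy
    have := hB y hy
    rw [Prod.norm_def, max_le_iff] at this
    simpa using this
  have hB0 : 0 ≤ B := (norm_nonneg _).trans (hB _ (Metric.mem_closedBall_self hR₀.le))
  set A := B + 1 with hA
  -- With `A ≥ 1` this gives `AR ≤ 1/80` and `R ≤ 1/80`, hence `8AR ≤ 1/10` and `64AR² + 16AR ≤
  -- 1/100 + 1/5`.
  set R := min (min R₀ ε) (1 / (80 * A)) with hRdef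
  have hA1 : 1 ≤ A := by linarith
  have hRpos : 0 < R := lt_min (lt_min hR₀ hε) (by positivity)
  have hR1 : R ≤ R₀ := (min_le_left _ _).trans (min_le_left _ _)
  have hRA : A * R ≤ 1 / 80 := by
    have : R ≤ 1 / (80 * A) := min_le_right _ _
    rw [le_div_iff₀ (by positivity)] at this
    linarith
  have hR80 : R ≤ 1 / 80 := by nlinarith
  refine ⟨R, (min_le_left _ _).trans (min_le_right _ _), A, A,
    (Metric.closedBall_subset_closedBall hR1).trans hR₀t, hRpos, by linarith, by linarith,
    by linarith, by nlinarith, fun y hy => ?_⟩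
  have := hBb y (Metric.closedBall_subset_closedBall hR1 hy)
  exact ⟨by linarith [this.1], by linarith [this.2]⟩

/-- Nondegenerate critical points are isolated. -/
theorem eventually_isCrit_iff {Φ : M → ℝ} (hΦ : ∀ᶠ x in 𝓝 p, ContMDiffAt (𝓡 n) 𝓘(ℝ, ℝ) ∞ Φ x)
    (hcrit : IsCrit n Φ p) (hnd : (hessMatrix cov Φ p).det ≠ 0) :
    ∀ᶠ x in 𝓝 p, IsCrit n Φ x ↔ x = p := by
  have hp : p ∈ chartDom n p := mem_chart_source _ p
  have hΦp := hΦ.self_of_nhds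
  have hG : ContDiffAt ℝ ∞ (fun y => Φ ((cc n p).symm y)) (cc n p p) :=
    contDiffAt_comp_cc_symm (m := ⊤) hp hΦp
  have hG1 : HasFDerivAt (fderiv ℝ (fun y => Φ ((cc n p).symm y)))
      (fderiv ℝ (fderiv ℝ (fun y => Φ ((cc n p).symm y))) (cc n p p)) (cc n p p) :=
    ((hG.fderiv_right (m := 1) two_le_infty).differentiableAt (by simp)).hasFDerivAt
  have hcrit' := (isCrit_iff hp (hΦp.mdifferentiableAt (by simp))).1 hcrit
  obtain ⟨e, he⟩ := isInvertible_fderiv_fderiv cov hcrit'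
    ((hessMatrix_det_ne_zero_iff cov hp hΦp).1 hnd)
  rw [← he] at hG1
  -- The differential of `Φ` has an invertible derivative at `p`, so it cannot vanish again close to
  -- `p`.
  have hne := hG1.eventually_ne (c := 0) ⟨_, e.antilipschitz⟩
  rw [eventually_nhdsWithin_iff] at hne
  have hc : ContinuousAt (cc n p) p := continuousAt_extChartAt p
  filter_upwards [hc.eventually hne, hΦ, (isOpen_chartDom p).mem_nhds hp] with x hx hΦx hxp
  rw [isCrit_iff hxp (hΦx.mdifferentiableAt (by simp))]
  refine ⟨fun h => ?_, fun h => by rw [h]; exact hcrit'⟩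
  by_contra hxne
  refine hx (fun h' => hxne ?_) h
  exact (cc_left_inv hxp).symm.trans ((congrArg _ h').trans (cc_left_inv hp))

end ChartBalls
end OscGeom

end

noncomputable section

namespace OscGeom

/-! ### Construction of admissible neighbourhoods. -/

section SmallNeighbourhoods

variable {n : ℕ} {M : Type*} [TopologicalSpace M] [ChartedSpace (EuclideanSpace ℝ (Fin n)) M]
  [IsManifold (𝓡 n) ∞ M] [T2Space M]

local notation "E" => EuclideanSpace ℝ (Fin n)

variable {P : Type} [NormedAddCommGroup P] [NormedSpace ℝ P] [FiniteDimensional ℝ P]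

/-- Short geodesics near a point form a smooth family. -/
theorem exists_geoFamily_self {covF : P → Conn n M} (hcov : SmoothFam covF) (τ₀ : P) {Ω : Set M}
    (hΩ : IsOpen Ω) {p : M} (hp : p ∈ Ω) :
    ∃ O, IsOpen O ∧ (τ₀, cc n p p, cc n p p) ∈ O ∧ ∃ δ > 0, ∃ Θ, IsGeoFamily covF Ω p p O δ Θ := by
  have hpp : p ∈ chartDom n p := mem_chart_source _ p
  obtain ⟨hγ, hvel⟩ := isGeodesicIn_const (covF τ₀) hp
  obtain ⟨δ, hδ, O, hO, hzO, Ψ, hΨ, hΨγ⟩ := exists_geodesic_flow hcov τ₀ hγ (x₁ := p) hpp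
  simp only [hvel 1 one_mem_unitInterval, map_zero] at hzO hΨγ
  have h0 : (Ψ 0 ((τ₀, cc n p p, 0), 0)).pt = p := hΨγ 0 zero_mem_unitInterval
  have hinv := IsGeoFlow.isInvertible_const hcov hO hδ hΨ hzO (by rw [h0]; exact hpp)
  obtain ⟨O', hO', hz', Θ, hΘ⟩ := exists_geoFamily hΩ hO hδ hΨ hzO
    (fun s hs => by rw [hΨγ s hs]; exact hp) (x₀ := p) (by rw [h0]; exact hpp) hinv
  refine ⟨O', hO', ?_, δ, hδ, Θ, hΘ⟩
  rwa [startPt, h0] at hz'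

variable {covF : P → Conn n M} {Ω : Set M} {x₀ x₁ : M}
  {O : Set (P × EuclideanSpace ℝ (Fin n) × EuclideanSpace ℝ (Fin n))} {δ : ℝ}
  {Θ : EuclideanSpace ℝ (Fin n) → (P × EuclideanSpace ℝ (Fin n) ×
      EuclideanSpace ℝ (Fin n)) × ℝ → GState n M}

theorem IsGeoFamily.isGeodesicIn (h : IsGeoFamily covF Ω x₀ x₁ O δ Θ) (hδ : 0 < δ)
    {z : P × E × E} (hz : z ∈ O) :
    IsGeodesicIn (covF z.1) Ω ((cc n x₀).symm z.2.1) ((cc n x₁).symm z.2.2)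
      (fun s => (Θ 0 (z, s)).pt) := by
  obtain ⟨-, -, h0, ⟨u, hu⟩, hs⟩ := h 0 z hz
  have h1 := (isGeodesicIn_of_isSol (cov := covF z.1) (Ω := Ω) (W := fun s => Θ 0 (z, s))
    (fun t ht => (hs t ⟨by linarith [ht.1], by linarith [ht.2]⟩).2.1)
    (fun t ht => ((hs t ⟨by linarith [ht.1], by linarith [ht.2]⟩).1).comp
      (g := fun s : ℝ => (z, s)) (by fun_prop))
    (fun t ht => (hs t ⟨by linarith [ht.1], by linarith [ht.2]⟩).2.2.2 ht)).1
  simp only [h0, hu] at h1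
  exact h1

/-- Unique geodesics that form a smooth family depend smoothly on their end points. -/
theorem IsGeoFamily.contMDiffOn_geod (h : IsGeoFamily covF Ω x₀ x₁ O δ Θ) (hδ : 0 < δ) {τ₀ : P}
    {D : Set M} (hD₀ : D ⊆ chartDom n x₀) (hD₁ : D ⊆ chartDom n x₁)
    (hDO : ∀ a ∈ D, ∀ b ∈ D, (τ₀, cc n x₀ a, cc n x₁ b) ∈ O)
    (huniq : ∀ a ∈ D, ∀ b ∈ D, ∀ γ₁ γ₂, IsGeodesicIn (covF τ₀) Ω a b γ₁ →
      IsGeodesicIn (covF τ₀) Ω a b γ₂ → EqOn γ₁ γ₂ (Icc 0 1)) :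
    (∀ a ∈ D, ∀ b ∈ D, ∃ γ, IsGeodesicIn (covF τ₀) Ω a b γ) ∧
    ContMDiffOn (((𝓡 n).prod (𝓡 n)).prod 𝓘(ℝ, ℝ)) (𝓡 n) ∞
      (fun z : (M × M) × ℝ => geod (covF τ₀) Ω z.1.1 z.1.2 z.2) ((D ×ˢ D) ×ˢ Icc 0 1) := by
  have hex : ∀ a ∈ D, ∀ b ∈ D, IsGeodesicIn (covF τ₀) Ω a b
      (fun s => (Θ 0 ((τ₀, cc n x₀ a, cc n x₁ b), s)).pt) := by
    intro a ha b hb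
    have := h.isGeodesicIn hδ (hDO a ha b hb)
    simpa only [cc_left_inv (hD₀ ha), cc_left_inv (hD₁ hb)] using this
  refine ⟨fun a ha b hb => ⟨_, hex a ha b hb⟩, ?_⟩
  rintro ⟨⟨a, b⟩, s⟩ ⟨⟨ha, hb⟩, hs⟩
  have h1 := ((h 0 _ (hDO a ha b hb)).2.2.2.2 s ⟨by linarith [hs.1], by linarith [hs.2]⟩).1
  have ha1 : ContMDiffAt (((𝓡 n).prod (𝓡 n)).prod 𝓘(ℝ, ℝ)) 𝓘(ℝ, E) ∞
      (fun z : (M × M) × ℝ => cc n x₀ z.1.1) ((a, b), s) :=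
    ContMDiffAt.comp (g := cc n x₀) (f := fun z : (M × M) × ℝ => z.1.1) ((a, b), s)
      (contMDiffAt_extChartAt' (hD₀ ha)) (contMDiffAt_fst.comp _ contMDiffAt_fst)
  have hb1 : ContMDiffAt (((𝓡 n).prod (𝓡 n)).prod 𝓘(ℝ, ℝ)) 𝓘(ℝ, E) ∞
      (fun z : (M × M) × ℝ => cc n x₁ z.1.2) ((a, b), s) :=
    ContMDiffAt.comp (g := cc n x₁) (f := fun z : (M × M) × ℝ => z.1.2) ((a, b), s)
      (contMDiffAt_extChartAt' (hD₁ hb)) (contMDiffAt_snd.comp _ contMDiffAt_fst)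
  have h2 : ContMDiffAt (((𝓡 n).prod (𝓡 n)).prod 𝓘(ℝ, ℝ)) (𝓡 n) ∞
      (fun z : (M × M) × ℝ => (Θ 0 ((τ₀, cc n x₀ z.1.1, cc n x₁ z.1.2), z.2)).pt) ((a, b), s) :=
    ContMDiffAt.comp (g := fun v => (Θ 0 v).pt)
      (f := fun z : (M × M) × ℝ => ((τ₀, cc n x₀ z.1.1, cc n x₁ z.1.2), z.2)) ((a, b), s)
      h1.contMDiffAt_pt
      ((contMDiffAt_const.prodMk_space (ha1.prodMk_space hb1)).prodMk_space contMDiffAt_snd)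
  refine h2.contMDiffWithinAt.congr_of_mem ?_ ⟨⟨ha, hb⟩, hs⟩
  rintro ⟨⟨c, d⟩, t⟩ ⟨⟨hc, hd⟩, ht⟩
  exact huniq c hc d hd _ _ (isGeodesicIn_geod ⟨_, hex c hc d hd⟩) (hex c hc d hd) ht

variable {cov : Conn n M} {p : M} {R C L r : ℝ}

/-- Existence near `p` comes from the family through the constant geodesic, uniqueness from the
contraction estimate in the ball of radius `R`; together they give smooth dependence. -/
theorem SmallBall.exists_geodesics (h : SmallBall cov p R C L)
    (hcov : SmoothFam (fun _ : EuclideanSpace ℝ (Fin 0) => cov)) :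
    ∃ ρ > 0, ρ < R ∧
      (∀ a ∈ chartBall n p ρ, ∀ b ∈ chartBall n p ρ, ∃ γ, IsGeodesicIn cov (chartBall n p R) a b γ) ∧
      ContMDiffOn (((𝓡 n).prod (𝓡 n)).prod 𝓘(ℝ, ℝ)) (𝓡 n) ∞
        (fun z : (M × M) × ℝ => geod cov (chartBall n p R) z.1.1 z.1.2 z.2)
        ((chartBall n p ρ ×ˢ chartBall n p ρ) ×ˢ Icc 0 1) ∧
      RegAt (fun _ : EuclideanSpace ℝ (Fin 0) => cov) (chartBall n p R) (fun _ => p) (0, p) := by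
  have hpp : p ∈ chartDom n p := mem_chart_source _ p
  have huniq : ∀ a b γ₁ γ₂, IsGeodesicIn cov (chartBall n p R) a b γ₁ →
      IsGeodesicIn cov (chartBall n p R) a b γ₂ → EqOn γ₁ γ₂ (Icc 0 1) :=
    fun a b γ₁ γ₂ h₁ h₂ => h.eqOn (hcov.smoothConn 0) h₁ h₂
  obtain ⟨O, hO, hz, δ, hδ, Θ, hΘ⟩ := exists_geoFamily_self hcov 0
    (isOpen_chartBall (n := n) (p := p) (R := R)) (mem_chartBall_self h.pos)
  obtain ⟨ρ, hρ, hball⟩ := Metric.isOpen_iff.1 hO _ hz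
  have hρ' : 0 < min ρ (R / 2) := lt_min hρ (half_pos h.pos)
  have hDO : ∀ a ∈ chartBall n p (min ρ (R / 2)), ∀ b ∈ chartBall n p (min ρ (R / 2)),
      ((0 : EuclideanSpace ℝ (Fin 0)), cc n p a, cc n p b) ∈ O := by
    intro a ha b hb
    apply hball
    simp only [Metric.mem_ball, Prod.dist_eq, dist_self]
    exact max_lt hρ (max_lt (lt_of_lt_of_le ha.2 (min_le_left _ _))
      (lt_of_lt_of_le hb.2 (min_le_left _ _)))
  obtain ⟨h1, h2⟩ := hΘ.contMDiffOn_geod hδ (τ₀ := 0) (fun _ h => h.1)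
    (fun _ h => h.1) hDO (fun a _ b _ => huniq a b)
  refine ⟨_, hρ', (min_le_right _ _).trans_lt (half_lt_self h.pos), h1, h2, ?_⟩
  exact hΘ.regAt hO hδ isOpen_univ contMDiffOn_const isOpen_univ
    (fun _ _ q _ γ₁ γ₂ => huniq p q γ₁ γ₂) trivial trivial hpp hpp hz

/-- The unperturbed geodesics near `p` persist under perturbations. -/
theorem SmallBall.eventually_connected (h : SmallBall cov p R C L) {covF : P → Conn n M}
    (hcov : SmoothFam covF) {τ₀ : P} (hτ₀ : covF τ₀ = cov) {ρ : ℝ}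
    (hex : ∀ a ∈ chartBall n p ρ, ∀ b ∈ chartBall n p ρ,
      ∃ γ, IsGeodesicIn cov (chartBall n p R) a b γ)
    (hsm : ContMDiffOn (((𝓡 n).prod (𝓡 n)).prod 𝓘(ℝ, ℝ)) (𝓡 n) ∞
        (fun z : (M × M) × ℝ => geod cov (chartBall n p R) z.1.1 z.1.2 z.2)
        ((chartBall n p ρ ×ˢ chartBall n p ρ) ×ˢ Icc 0 1)) (hr : r < ρ) (hrR : r ≤ R) :
    ∀ᶠ τ in 𝓝 τ₀, GeodesicallyConnected (covF τ) (chartBall n p r) (chartBall n p R) := by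
  subst hτ₀
  have hrt := (Metric.closedBall_subset_closedBall hrR).trans h.target
  -- Smooth dependence is known on the open ball of radius `ρ`, so existence persists near each pair
  -- of points of the closed ball of radius `r < ρ`. Compactness of the pairs then makes it uniform.
  have hloc : ∀ w ∈ Metric.closedBall (cc n p p) r ×ˢ Metric.closedBall (cc n p p) r,
      ∀ᶠ v : P × E × E in 𝓝 (τ₀, w), ∃ γ, IsGeodesicIn (covF v.1) (chartBall n p R)
        ((cc n p).symm v.2.1) ((cc n p).symm v.2.2) γ := by
    rintro ⟨y, y'⟩ ⟨hy, hy'⟩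
    have hm := chartClosedBall_subset_chartBall hr (symm_mem_chartClosedBall hy (hrt hy))
    have hm' := chartClosedBall_subset_chartBall hr (symm_mem_chartClosedBall hy' (hrt hy'))
    obtain ⟨O, hO, hz, δ, hδ, Θ, hΘ⟩ := exists_geoFamily_of_smooth hcov isOpen_chartBall
      isOpen_chartBall hex hsm hm hm' hm.1 hm'.1
    rw [(cc n p).right_inv (hrt hy), (cc n p).right_inv (hrt hy')] at hz
    filter_upwards [hO.mem_nhds hz] with v hv
    exact ⟨_, hΘ.isGeodesicIn hδ hv⟩
  have hall := ((isCompact_closedBall (cc n p p) r).prod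
    (isCompact_closedBall (cc n p p) r)).eventually_forall_of_forall_eventually
    (P := fun τ (w : E × E) => ∃ γ, IsGeodesicIn (covF τ) (chartBall n p R)
      ((cc n p).symm w.1) ((cc n p).symm w.2) γ) hloc
  filter_upwards [hall, h.eventually hcov] with τ hτ hτ' a ha b hb
  have ha' := closure_chartBall_subset hrt ha
  have hb' := closure_chartBall_subset hrt hb
  refine ⟨?_, fun γ₁ γ₂ h₁ h₂ => hτ'.eqOn (hcov.smoothConn τ) h₁ h₂⟩
  have := hτ (cc n p a, cc n p b) ⟨ha'.2, hb'.2⟩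
  simpa only [cc_left_inv ha'.1, cc_left_inv hb'.1] using this

/-- Small neighbourhoods of a nondegenerate critical point are admissible, and remain so under
perturbations. -/
theorem exists_isAdmissible (hcov : cov.ContMDiffCovariantDerivative ∞) (htor : cov.torsion = 0)
    {U : Set M} (hU : IsOpen U) {Φ : M → ℝ} (hΦ : ContMDiffOn (𝓡 n) 𝓘(ℝ, ℝ) ∞ Φ U) (hp : p ∈ U)
    (hcrit : IsCrit n Φ p) (hnondeg : (hessMatrix cov Φ p).det ≠ 0) {W : Set M} (hW : W ∈ 𝓝 p) :
    ∃ Ω₀ Ω₁ : Set M, Ω₁ ⊆ W ∧ IsAdmissible cov U Φ p Ω₀ Ω₁ ∧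
      ∀ (m : ℕ) (covF : EuclideanSpace ℝ (Fin m) → Conn n M)
        (ΦF : EuclideanSpace ℝ (Fin m) → M → ℝ), IsPerturbation cov U Φ covF ΦF →
        ∀ᶠ τ in 𝓝 0, GeodesicallyConnected (covF τ) Ω₀ Ω₁ ∧
          ∃ x ∈ Ω₀, ∀ y ∈ Ω₁, IsCrit n (ΦF τ) y ↔ y = x := by
  have hpert := isPerturbation_const hcov htor hΦ 0
  have hΦat : ∀ x ∈ U, ContMDiffAt (𝓡 n) 𝓘(ℝ, ℝ) ∞ Φ x := fun x hx =>
    hΦ.contMDiffAt (hU.mem_nhds hx)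
  have hcritev := eventually_isCrit_iff (cov := cov) (p := p)
    (mem_of_superset (hU.mem_nhds hp) fun x hx => hΦat x hx) hcrit hnondeg
  obtain ⟨ε, hε, hεs⟩ := exists_chartClosedBall_subset (n := n)
    (inter_mem (inter_mem (hU.mem_nhds hp) hW) hcritev)
  obtain ⟨R, hRε, C, L, hR⟩ := exists_smallBall (hpert.smoothFam.smoothConn 0) p hε
  have hsub : chartClosedBall n p R ⊆ U ∩ W ∩ {x | IsCrit n Φ x ↔ x = p} :=
    fun x hx => hεs ⟨hx.1, Metric.closedBall_subset_closedBall hRε hx.2⟩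
  have hbs := chartBall_subset_chartClosedBall (n := n) (p := p) (R := R)
  obtain ⟨ρ, hρ, hρR, hex, hsm, hreg⟩ := hR.exists_geodesics hpert.smoothFam
  have hF : IsPhaseFam (fun _ : EuclideanSpace ℝ (Fin 0) => cov) (fun _ => Φ) (chartBall n p R) :=
    ⟨hpert.smoothFam, fun _ => htor, U, hU, fun x hx => (hsub (hbs hx)).1.1, hpert.phase_smooth⟩
  -- `Ω₀` is not yet chosen, hence `univ` in its place: only the nondegeneracy of `∇²₁Φ` near `p` is
  -- wanted here.
  have hgood : GoodAt (fun _ : EuclideanSpace ℝ (Fin 0) => cov) (fun _ => Φ) univ (chartBall n p R)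
      (fun _ => p) (0, p) := by
    refine ⟨trivial, hreg, ?_⟩
    have heq : weightedMatrix cov (chartBall n p R) Φ p 1 p = hessMatrix cov Φ p := by
      ext i j
      exact (hreg.regPt hF).weightedHess_self (hF.cov.smoothConn 0) (hreg.eqOn_const rfl) Φ le_rfl _ _
    simpa only [heq] using hnondeg
  have hgood' : ∀ᶠ x in 𝓝 p, GoodAt (fun _ : EuclideanSpace ℝ (Fin 0) => cov) (fun _ => Φ) univ
      (chartBall n p R) (fun _ => p) (0, x) :=
    (continuous_const.prodMk continuous_id).continuousAt.eventually
      (hgood.eventually hF isOpen_univ)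
  obtain ⟨r', hr', hr's⟩ := exists_chartClosedBall_subset (n := n) hgood'
  -- The bound `r'` keeps `∇²₁Φ` nondegenerate on the closed ball, which contains the closure of
  -- `Ω₀`; `r < ρ` leaves room for the compactness argument on pairs of end points.
  set r := min r' (ρ / 2) with hr
  have hr0 : 0 < r := lt_min hr' (half_pos hρ)
  have hrρ : r < ρ := (min_le_right _ _).trans_lt (half_lt_self hρ)
  have hrR : r < R := hrρ.trans hρR
  have hcl := closure_chartBall_subset (n := n) (p := p)
    ((Metric.closedBall_subset_closedBall hrR.le).trans hR.target)
  have hsubρ : chartBall n p r ⊆ chartBall n p ρ :=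
    chartBall_subset_chartClosedBall.trans (chartClosedBall_subset_chartBall hrρ)
  have hpr : p ∈ chartBall n p r := mem_chartBall_self hr0
  have hconn := fun (m : ℕ) (covF : EuclideanSpace ℝ (Fin m) → Conn n M)
    (hc : SmoothFam covF) (h0 : covF 0 = cov) => hR.eventually_connected hc h0 hex hsm hrρ hrR.le
  refine ⟨chartBall n p r, chartBall n p R, fun x hx => (hsub (hbs hx)).1.2,
    { isOpen₀ := isOpen_chartBall
      isOpen₁ := isOpen_chartBall
      mem := hpr
      isCompact_closure := (isCompact_chartClosedBall
        ((Metric.closedBall_subset_closedBall hrR.le).trans hR.target)).of_isClosed_subset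
          isClosed_closure hcl
      closure_subset := hcl.trans (chartClosedBall_subset_chartBall hrR)
      subset := fun x hx => (hsub (hbs hx)).1.1
      crit := fun x hx => (hsub (hbs hx)).2
      -- Connectivity on the closure for `cov` itself is the persistence statement for the constant
      -- family, taken at its base parameter.
      connected := (hconn 0 _ hpert.smoothFam rfl).self_of_nhds
      smooth := hsm.mono (prod_mono (prod_mono hsubρ hsubρ) subset_rfl)
      star := fun q hq s hs => hR.mem_chartBall
        (isGeodesicIn_geod (hex p (hsubρ hpr) q (hsubρ hq))) hq hs
      nondegenerate := fun q hq => (hr's ⟨(hcl hq).1,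
        Metric.closedBall_subset_closedBall (min_le_left _ _) (hcl hq).2⟩).2.2 },
    fun m covF ΦF h => ?_⟩
  -- The compact set is the closed ball of radius `R`, which contains `Ω₁`, so uniqueness of the
  -- critical point holds in all of `Ω₁`, while its position is confined to `Ω₀`.
  obtain ⟨N, hN, h0N, pF, -, -, hpN⟩ := exists_crit_family h.smoothFam hU h.phase_smooth
    (isCompact_chartClosedBall hR.target) (fun x hx => (hsub hx).1.1) (τ₀ := 0)
    (hbs (mem_chartBall_self hR.pos))
    (fun x hx => by rw [h.phase_zero]; exact (hsub hx).2)
    (by rw [h.phase_zero, h.cov_zero]; exact hnondeg) isOpen_chartBall hpr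
  filter_upwards [hconn m covF h.smoothFam h.cov_zero, hN.mem_nhds h0N] with τ h1 h2
  exact ⟨h1, pF τ, (hpN τ h2).1, fun y hy => (hpN τ h2).2.1 y (hbs hy)⟩

end SmallNeighbourhoods
end OscGeom

end

/-! ### The operator, its perturbations, and the existence of stable small neighbourhoods. -/

theorem proposition3 {n : ℕ} {M : Type*} [TopologicalSpace M]
    [ChartedSpace (EuclideanSpace ℝ (Fin n)) M] [IsManifold (𝓡 n) ∞ M]
    [T2Space M] [SecondCountableTopology M]
    (cov : OscGeom.Conn n M) (hcov : cov.ContMDiffCovariantDerivative ∞) (htor : cov.torsion = 0)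
    (U : Set M) (hU : IsOpen U) (Φ : M → ℝ) (hΦ : ContMDiffOn (𝓡 n) 𝓘(ℝ, ℝ) ∞ Φ U)
    (p : M) (hp : p ∈ U) (hcrit : OscGeom.IsCrit n Φ p)
    (hnondeg : (OscGeom.hessMatrix cov Φ p).det ≠ 0) :
    -- the operator on any admissible pair of neighbourhoods
    (∀ Ω₀ Ω₁ : Set M, OscGeom.IsAdmissible cov U Φ p Ω₀ Ω₁ →
      (∀ q ∈ Ω₀, IntervalIntegrable (OscGeom.etaIntegrand cov Ω₁ Φ p q)
        MeasureTheory.volume 0 1) ∧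
      ContMDiffOn (𝓡 n) 𝓘(ℝ, ℝ) ∞ (OscGeom.eta cov Ω₁ Φ p) Ω₀ ∧
      (∀ f : M → ℂ, ContMDiffOn (𝓡 n) 𝓘(ℝ, ℂ) ∞ f Ω₀ →
        ContMDiffOn (𝓡 n) 𝓘(ℝ, ℂ) ∞ (OscGeom.box cov Ω₁ Φ p f) Ω₀) ∧
      OscGeom.SchrodingerOn n (OscGeom.box cov Ω₁ Φ p) Φ p Ω₀) ∧
    -- its behaviour under perturbations that preserve the geodesic connectivity
    (∀ Ω₀ Ω₁ : Set M, OscGeom.IsAdmissible cov U Φ p Ω₀ Ω₁ →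
      ∀ (m : ℕ) (covF : EuclideanSpace ℝ (Fin m) → OscGeom.Conn n M)
        (ΦF : EuclideanSpace ℝ (Fin m) → M → ℝ),
        OscGeom.IsPerturbation cov U Φ covF ΦF →
        (∀ᶠ τ in 𝓝 0, OscGeom.GeodesicallyConnected (covF τ) Ω₀ Ω₁) →
        ∀ Ω : Set M, IsOpen Ω → closure Ω ⊆ Ω₀ →
        ∃ N : Set (EuclideanSpace ℝ (Fin m)), IsOpen N ∧ 0 ∈ N ∧
        ∃ pF : EuclideanSpace ℝ (Fin m) → M, pF 0 = p ∧ ContMDiffOn (𝓡 m) (𝓡 n) ∞ pF N ∧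
          (∀ τ ∈ N,
            pF τ ∈ Ω₀ ∧ (∀ x ∈ Ω₀, OscGeom.IsCrit n (ΦF τ) x ↔ x = pF τ) ∧
            (OscGeom.hessMatrix (covF τ) (ΦF τ) (pF τ)).det ≠ 0 ∧
            (∀ q ∈ Ω, ∀ s ∈ Icc (0 : ℝ) 1,
              OscGeom.geod (covF τ) Ω₁ (pF τ) q s ∈ Ω₀ ∧
              (OscGeom.weightedMatrix (covF τ) Ω₁ (ΦF τ) (pF τ) 1
                (OscGeom.geod (covF τ) Ω₁ (pF τ) q s)).det ≠ 0) ∧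
            (∀ q ∈ Ω, IntervalIntegrable (OscGeom.etaIntegrand (covF τ) Ω₁ (ΦF τ) (pF τ) q)
              MeasureTheory.volume 0 1) ∧
            OscGeom.SchrodingerOn n (OscGeom.box (covF τ) Ω₁ (ΦF τ) (pF τ)) (ΦF τ) (pF τ) Ω) ∧
          ContMDiffOn ((𝓡 m).prod (𝓡 n)) 𝓘(ℝ, ℝ) ∞
            (fun z : EuclideanSpace ℝ (Fin m) × M =>
              OscGeom.eta (covF z.1) Ω₁ (ΦF z.1) (pF z.1) z.2) (N ×ˢ Ω) ∧
          ∀ f : EuclideanSpace ℝ (Fin m) → M → ℂ,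
            ContMDiffOn ((𝓡 m).prod (𝓡 n)) 𝓘(ℝ, ℂ) ∞
              (fun z : EuclideanSpace ℝ (Fin m) × M => f z.1 z.2) (N ×ˢ Ω) →
            ContMDiffOn ((𝓡 m).prod (𝓡 n)) 𝓘(ℝ, ℂ) ∞
              (fun z : EuclideanSpace ℝ (Fin m) × M =>
                OscGeom.box (covF z.1) Ω₁ (ΦF z.1) (pF z.1) (f z.1) z.2) (N ×ˢ Ω)) ∧
    -- such pairs of neighbourhoods exist, arbitrarily small and stable under all perturbations
    (∀ W ∈ 𝓝 p, ∃ Ω₀ Ω₁ : Set M, Ω₁ ⊆ W ∧ OscGeom.IsAdmissible cov U Φ p Ω₀ Ω₁ ∧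
      ∀ (m : ℕ) (covF : EuclideanSpace ℝ (Fin m) → OscGeom.Conn n M)
        (ΦF : EuclideanSpace ℝ (Fin m) → M → ℝ),
        OscGeom.IsPerturbation cov U Φ covF ΦF →
        ∀ᶠ τ in 𝓝 0, OscGeom.GeodesicallyConnected (covF τ) Ω₀ Ω₁ ∧
          ∃ x ∈ Ω₀, ∀ y ∈ Ω₁, OscGeom.IsCrit n (ΦF τ) y ↔ y = x) := by
  refine ⟨fun Ω₀ Ω₁ hA => hA.operator hcov htor hU hΦ,
    fun Ω₀ Ω₁ hA m covF ΦF h hconn Ω hΩo hΩ => hA.perturbed_operator hU hnondeg h hconn hΩo hΩ,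
    fun W hW => OscGeom.exists_isAdmissible hcov htor hU hΦ hp hcrit hnondeg hW⟩
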